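/- **Conventions.** Categories denoted $\mathcal C,\mathcal D$ are small; "small" and "cocomplete" refer to one fixed universe. $\Delta$ is the simplex category. A morphism $\alpha:x\to y$ of $\mathcal E$ is *opCartesian* for $p:\mathcal E\to\mathcal C$ if for every $\beta:x\to z$ with $p(\beta)=p(\alpha)$ there is a unique $\gamma:y\to z$ with $p(\gamma)=\mathrm{id}$ and $\gamma\alpha=\beta$; *Cartesian* is the dual notion. $p$ is an *opfibration* if every $f:p(x)\to c'$ has an opCartesian lift with source $x$ and opCartesian morphisms compose. A morphism is *fibrewise* if $p$ sends it to an identity; $\mathcal E(c)$ is the fibre over $c$. The *transpose fibration* $\mathcal E^\top\to\mathcal C^{op}$ has the objects of $\mathcal E$; a morphism $x\to z$ is an isomorphism class of cospans $x\to y\leftarrow z$ with $x\to y$ fibrewise and $z\to y$ opCartesian, composed by pushing forward along opCartesian lifts. One has $\mathcal E^\top(c)=\mathcal E(c)$. **$\Delta$-structures.** A $\Delta$-structure on a category $\mathcal M$ is a functor $\Delta\times\mathcal M\to\mathcal M$, $([n],x)\mapsto\Delta^n\otimes x$, with a natural transformation $\mathrm{diag}:\Delta^n\otimes x\to\Delta^n\otimes(\Delta^n\otimes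 x)$ and a natural isomorphism $\Delta^0\otimes x\cong x$, coassociative and counital. If $\mathcal M$ is cocomplete and each $\Delta^n\otimes-$ preserves small colimits, put $S\otimes x=\operatorname{colim}_{\Delta^n\to S}\Delta^n\otimes x$ for a simplicial set $S$, and let $(S\times T)\otimes x\to S\otimes(T\otimes x)$ be the action map induced by $\mathrm{diag}$; put $|X|=\int^{[n]}\Delta^n\otimes X_n$ for a simplicial object $X$. $\mathcal M$ is a *homotopical $\Delta$-category* if in addition it has a class $\mathcal W$ of weak equivalences, containing the isomorphisms and satisfying two-out-of-three and two-out-of-six, such that: $\mathcal W$ is stable under small coproducts; $S\otimes x$ respects weak equivalences in $S$ (weak homotopy equivalences) and in $x$; the action maps are weak equivalences; $|-|$ sends pointwise weak equivalences to weak equivalences; and for each bisimplicial object $X$ the map $\int^{[n]}\Delta^n\otimes X_{nn}\to\int^{[m],[n]}\Delta^m\otimes(\Delta^n\otimes X_{mn})$ induced by $\mathrm{diag}$ is a weak equivalence. **Homotopical $\Delta$-opfibrations.** A *homotopical $\Delta$-opfibration* is an opfibration $p:\mathcal E\to\mathcal C$ with * a class $\mathcal W$ of fibrewise morphisms, containing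 the fibrewise isomorphisms and satisfying two-out-of-three, such that if $\alpha:A\to B$, $\alpha':A'\to B'$ are opCartesian over the same arrow, $f:A\to A'$ is in $\mathcal W$, $f':B\to B'$ is fibrewise and $f'\alpha=\alpha' f$, then $f'\in\mathcal W$; * a $\Delta$-structure on the transpose fibration, i.e. a $\Delta$-structure on $\mathcal E^\top$ for which $\otimes:\Delta\times\mathcal E^\top\to\mathcal E^\top$ is a functor over $\mathcal C^{op}$ and $\mathrm{diag}$ and the unit isomorphism are fibrewise (their naturality then makes the transition functors into $\Delta$-functors); such that every fibre $\mathcal E(c)$ with the induced structures is a homotopical $\Delta$-category. **Derived sections.** The *simplicial replacement* $\mathbb C$ of $\mathcal C$ is the opposite of the category of simplices of the nerve $N\mathcal C$; its objects are the sequences $c_0\to\dots\to c_n$. Let $t:\mathbb C\to\mathcal C^{op}$ be the functor $(c_0\to\dots\to c_n)\mapsto c_n$, and $\mathbf E=t^*\mathcal E^\top$. A *presection* is a section $\mathbb C\to\mathbf E$; morphisms of presections are fibrewise natural transformations, and the weak equivalences are the pointwise ones. A map of $\mathbb C$ is an *anchor* map if the underlying map $[m]\to[n]$ of $\Delta$ is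 $i\mapsto i$. A morphism of $\mathbf E$ is *weakly Cartesian* if it is a weak equivalence of a fibre followed by a Cartesian morphism. A *derived section* is a presection sending anchor maps to weakly Cartesian morphisms. $\mathbb R\mathrm{Sect}(\mathcal C,\mathcal E)$ is the full subcategory of derived sections and $\mathrm{Ho}\,\mathbb R\mathrm{Sect}(\mathcal C,\mathcal E)$ its localisation at the weak equivalences. For a functor $F:\mathcal D\to\mathcal C$, the pulled back opfibration $F^*\mathcal E\to\mathcal D$ has as weak equivalences the fibrewise morphisms whose image in $\mathcal E$ lies in $\mathcal W$, and composition with $\mathbb F:\mathbb D\to\mathbb C$, $(d_0\to\dots\to d_n)\mapsto(Fd_0\to\dots\to Fd_n)$, induces a functor $\mathbb F^*:\mathbb R\mathrm{Sect}(\mathcal C,\mathcal E)\to\mathbb R\mathrm{Sect}(\mathcal D,F^*\mathcal E)$ which preserves weak equivalences. **Theorem.** Let $\mathcal C,\mathcal D$ be small categories, let $\mathcal E\to\mathcal C$ be a homotopical $\Delta$-opfibration, and let $F:\mathcal D\to\mathcal C$ be a *resolution*, i.e. an opfibration such that the nerve of each fibre $\mathcal D(c)$, $c\in\mathcal C$,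 is contractible. Then the functor induced on localisations $$\mathbb F^*:\mathrm{Ho}\,\mathbb R\mathrm{Sect}(\mathcal C,\mathcal E)\to\mathrm{Ho}\,\mathbb R\mathrm{Sect}(\mathcal D,F^*\mathcal E)$$ is full and faithful. -/

import Mathlib

open CategoryTheory Opposite Simplicial

universe u v w u₁ v₁ u₂ v₂ u₃ v₃

namespace DerivedSections

/-! ### Opfibrations -/

section Opfibrations

variable {C : Type u₁} [Category.{v₁} C] {E : Type u₂} [Category.{v₂} E]

/-- A (Grothendieck) opfibration: every arrow `f : p x ⟶ c'` of the base has an opCartesian lift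
starting at `x`, and opCartesian arrows compose. -/
class IsOpfibration (p : E ⥤ C) : Prop where
  exists_lift (x : E) {c' : C} (f : p.obj x ⟶ c') :
    ∃ (y : E) (φ : x ⟶ y), p.IsCocartesian f φ
  comp {R S T : C} (f : R ⟶ S) (g : S ⟶ T) {a b c : E} (φ : a ⟶ b) (ψ : b ⟶ c)
    (hφ : p.IsCocartesian f φ) (hψ : p.IsCocartesian g ψ) : p.IsCocartesian (f ≫ g) (φ ≫ ψ)

variable {p : E ⥤ C}

theorem isHomLift_of_isHomLift {R S : C} {a b : E} {f : R ⟶ S} {φ : a ⟶ b}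
    (h : p.IsHomLift f φ) {a' b' : E} {ψ : a' ⟶ b'} (h' : p.IsHomLift (p.map φ) ψ) :
    p.IsHomLift f ψ := by
  cases h; exact h'

theorem isHomLift_unique {R S : C} {a b : E} {f f' : R ⟶ S} {φ : a ⟶ b}
    (h : p.IsHomLift f φ) (h' : p.IsHomLift f' φ) : f = f' := by
  rw [IsHomLift.fac p f φ, IsHomLift.fac p f' φ]

theorem isHomLift_domain {R S : C} {a b : E} {f : R ⟶ S} {φ : a ⟶ b}
    (h : p.IsHomLift f φ) : p.obj a = R := IsHomLift.domain_eq p f φ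

theorem isHomLift_codomain {R S : C} {a b : E} {f : R ⟶ S} {φ : a ⟶ b}
    (h : p.IsHomLift f φ) : p.obj b = S := IsHomLift.codomain_eq p f φ

theorem vertical_of_comp {R : C} {a b c : E} {φ : a ⟶ b} {ψ : b ⟶ c}
    (h : p.IsHomLift (𝟙 R) φ) (h' : p.IsHomLift (𝟙 R) (φ ≫ ψ)) : p.IsHomLift (𝟙 R) ψ := by
  have e := IsHomLift.fac' p (𝟙 R) (φ ≫ ψ)
  have e' := IsHomLift.fac' p (𝟙 R) φ
  refine IsHomLift.of_fac' p _ _ (IsHomLift.codomain_eq p (𝟙 R) φ)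
    (IsHomLift.codomain_eq p (𝟙 R) (φ ≫ ψ)) ?_
  rw [p.map_comp, e'] at e
  simp only [Category.id_comp, eqToHom_trans] at e ⊢
  rw [eqToHom_comp_iff] at e
  simpa using e

theorem isCocartesian_of_isHomLift {R S : C} {a b : E} {f : R ⟶ S} {φ : a ⟶ b}
    (h : p.IsHomLift f φ) (h' : p.IsCocartesian (p.map φ) φ) : p.IsCocartesian f φ := by
  cases h; exact h'

theorem isCocartesian_map {R S : C} {a b : E} {f : R ⟶ S} {φ : a ⟶ b}
    (h : p.IsCocartesian f φ) : p.IsCocartesian (p.map φ) φ := by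
  have := h.toIsHomLift
  cases this; exact h

theorem IsOpfibration.exists_lift' (p : E ⥤ C) [IsOpfibration p] {x : E} {R S : C}
    (hx : p.obj x = R) (f : R ⟶ S) : ∃ (y : E) (φ : x ⟶ y), p.IsCocartesian f φ := by
  subst hx; exact IsOpfibration.exists_lift x f

end Opfibrations

/-! ### The transpose fibration -/

section Transpose

variable {C : Type u₁} [Category.{v₁} C] {E : Type u₂} [Category.{v₂} E]

/-- A cospan `x ⟶ y ⟵ z` in the total category whose left arrow is fibrewise and whose right
arrow is opCartesian. -/
structure TransposeCospan (p : E ⥤ C) (x z : E) where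
  mid : E
  left : x ⟶ mid
  right : z ⟶ mid
  left_vertical : p.IsHomLift (𝟙 (p.obj x)) left
  right_cocartesian : p.IsCocartesian (p.map right) right

namespace TransposeCospan

variable {p : E ⥤ C}

theorem obj_mid {x z : E} (c : TransposeCospan p x z) : p.obj c.mid = p.obj x :=
  isHomLift_codomain c.left_vertical

/-- The arrow of the base under the opCartesian leg. -/
def base {x z : E} (c : TransposeCospan p x z) : p.obj z ⟶ p.obj x :=
  p.map c.right ≫ eqToHom c.obj_mid

theorem right_isHomLift {x z : E} (c : TransposeCospan p x z) : p.IsHomLift c.base c.right := by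
  unfold base; infer_instance

theorem right_isCocartesian {x z : E} (c : TransposeCospan p x z) :
    p.IsCocartesian c.base c.right :=
  isCocartesian_of_isHomLift c.right_isHomLift c.right_cocartesian

/-- Isomorphism of cospans. -/
def Rel {x z : E} (c d : TransposeCospan p x z) : Prop :=
  ∃ i : c.mid ≅ d.mid, c.left ≫ i.hom = d.left ∧ c.right ≫ i.hom = d.right

instance setoid (p : E ⥤ C) (x z : E) : Setoid (TransposeCospan p x z) where
  r := Rel
  iseqv :=
    { refl := fun c => ⟨Iso.refl _, by simp, by simp⟩
      symm := fun {c d} ⟨i, h, h'⟩ => ⟨i.symm, by simp [← h], by simp [← h']⟩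
      trans := fun {c d e} ⟨i, h, h'⟩ ⟨j, k, k'⟩ =>
        ⟨i ≪≫ j, by simp [reassoc_of% h, k], by simp [reassoc_of% h', k']⟩ }

theorem vertical_of_rel {x z : E} {c d : TransposeCospan p x z} {f : c.mid ⟶ d.mid}
    (h : c.left ≫ f = d.left) : p.IsHomLift (𝟙 (p.obj x)) f :=
  vertical_of_comp c.left_vertical (h ▸ d.left_vertical)

theorem base_eq_of_rel {x z : E} {c d : TransposeCospan p x z} (h : Rel c d) :
    c.base = d.base := by
  obtain ⟨i, h, h'⟩ := h
  have := vertical_of_rel h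
  have := c.right_isHomLift
  have h₁ : p.IsHomLift c.base (c.right ≫ i.hom) := inferInstance
  rw [h'] at h₁
  exact isHomLift_unique h₁ d.right_isHomLift

/-- `r` is a composite of the cospans `c` and `d`: it is obtained by pushing the middle object
of `d` forward along the base arrow of `c`. -/
structure IsComposite {x y z : E} (c : TransposeCospan p x y) (d : TransposeCospan p y z)
    (r : TransposeCospan p x z) (k : d.mid ⟶ r.mid) (e : c.mid ⟶ r.mid) : Prop where
  cocartesian : p.IsCocartesian c.base k
  vertical : p.IsHomLift (𝟙 (p.obj x)) e
  comm : c.right ≫ e = d.left ≫ k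
  left_eq : r.left = c.left ≫ e
  right_eq : r.right = d.right ≫ k

theorem rel_of_isComposite {x y z : E} {c c' : TransposeCospan p x y}
    {d d' : TransposeCospan p y z} {r r' : TransposeCospan p x z}
    {k : d.mid ⟶ r.mid} {e : c.mid ⟶ r.mid} {k' : d'.mid ⟶ r'.mid} {e' : c'.mid ⟶ r'.mid}
    (h : IsComposite c d r k e) (h' : IsComposite c' d' r' k' e')
    (hc : Rel c c') (hd : Rel d d') : Rel r r' := by
  have hb := base_eq_of_rel hc
  obtain ⟨i, hi, hi'⟩ := hc
  obtain ⟨j, hj, hj'⟩ := hd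
  have := h.cocartesian
  have := h'.cocartesian
  have := h.vertical
  have := h'.vertical
  have := vertical_of_rel hi
  have := vertical_of_rel hj
  have := c.right_isCocartesian
  rw [← hb] at *
  have : p.IsCocartesian c.base (j.hom ≫ k') := inferInstance
  let t := Functor.IsCocartesian.codomainUniqueUpToIso p c.base k (j.hom ≫ k')
  have ht : k ≫ t.hom = j.hom ≫ k' := by
    simp [t, Functor.IsCocartesian.codomainUniqueUpToIso]
  have : p.IsHomLift (𝟙 (p.obj x)) t.hom := by
    simp only [t, Functor.IsCocartesian.codomainUniqueUpToIso]; infer_instance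
  have key : e ≫ t.hom = i.hom ≫ e' := by
    apply Functor.IsCocartesian.ext p c.base c.right
    rw [reassoc_of% h.comm, ht, reassoc_of% hj, reassoc_of% hi', h'.comm]
  refine ⟨t, ?_, ?_⟩
  · rw [h.left_eq, h'.left_eq, Category.assoc, key, reassoc_of% hi]
  · rw [h.right_eq, h'.right_eq, Category.assoc, ht, reassoc_of% hj']

/-- The cospan `x ⟶ z ⟵ z` of a fibrewise arrow. -/
def ofVertical {x z : E} (f : x ⟶ z) (hf : p.IsHomLift (𝟙 (p.obj x)) f) :
    TransposeCospan p x z where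
  mid := z
  left := f
  right := 𝟙 z
  left_vertical := hf
  right_cocartesian := inferInstance

theorem exists_isComposite [IsOpfibration p] {x y z : E} (c : TransposeCospan p x y)
    (d : TransposeCospan p y z) :
    ∃ (r : TransposeCospan p x z) (k : d.mid ⟶ r.mid) (e : c.mid ⟶ r.mid),
      IsComposite c d r k e := by
  obtain ⟨m, k, hk⟩ := IsOpfibration.exists_lift' p d.obj_mid c.base
  have := c.right_isCocartesian
  have := d.left_vertical
  have := c.left_vertical
  refine ⟨⟨m, c.left ≫ Functor.IsCocartesian.map p c.base c.right (d.left ≫ k), d.right ≫ k,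
    inferInstance, isCocartesian_map (IsOpfibration.comp _ _ _ _ d.right_isCocartesian hk)⟩,
    k, Functor.IsCocartesian.map p c.base c.right (d.left ≫ k), hk, inferInstance, by simp,
    rfl, rfl⟩

/-- A chosen composite of two cospans; its isomorphism class does not depend on the choice. -/
noncomputable def comp [IsOpfibration p] {x y z : E} (c : TransposeCospan p x y)
    (d : TransposeCospan p y z) : TransposeCospan p x z :=
  (exists_isComposite c d).choose

theorem isComposite_comp [IsOpfibration p] {x y z : E} (c : TransposeCospan p x y)
    (d : TransposeCospan p y z) :
    ∃ (k : d.mid ⟶ (comp c d).mid) (e : c.mid ⟶ (comp c d).mid), IsComposite c d (comp c d) k e :=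
  (exists_isComposite c d).choose_spec

end TransposeCospan

/-- The total category of the transpose fibration of `p`: it has the same objects as the total
category of `p`. -/
@[ext]
structure Transpose (p : E ⥤ C) where
  obj : E

namespace Transpose

variable {p : E ⥤ C}

theorem comp_rel_of_isComposite [IsOpfibration p] {x y z : E} {c : TransposeCospan p x y}
    {d : TransposeCospan p y z} {r : TransposeCospan p x z}
    {k : d.mid ⟶ r.mid} {e : c.mid ⟶ r.mid} (h : TransposeCospan.IsComposite c d r k e) :
    (TransposeCospan.comp c d) ≈ r := by
  obtain ⟨k', e', h'⟩ := TransposeCospan.isComposite_comp c d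
  exact TransposeCospan.rel_of_isComposite h' h (Setoid.refl c) (Setoid.refl d)

/-- A morphism of the transpose fibration is an isomorphism class of cospans; composition is
induced by `TransposeCospan.comp`. -/
noncomputable instance category [IsOpfibration p] : Category.{max u₂ v₂} (Transpose p) where
  Hom x z := Quotient (TransposeCospan.setoid p x.obj z.obj)
  id x := Quotient.mk _ (TransposeCospan.ofVertical (𝟙 x.obj) inferInstance)
  comp := Quotient.map₂ TransposeCospan.comp (by
    intro c c' hc d d' hd
    obtain ⟨k, e, h⟩ := TransposeCospan.isComposite_comp c d
    obtain ⟨k', e', h'⟩ := TransposeCospan.isComposite_comp c' d'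
    exact TransposeCospan.rel_of_isComposite h h' hc hd)
  id_comp := by
    rintro x y ⟨c⟩
    apply Quotient.sound
    have := c.left_vertical
    refine comp_rel_of_isComposite (k := 𝟙 c.mid) (e := c.left) ⟨?_, ?_, ?_, ?_, ?_⟩
    · have : p.IsHomLift (TransposeCospan.ofVertical (p := p) (𝟙 x.obj) inferInstance).base
          (𝟙 c.mid) := by
        have : (TransposeCospan.ofVertical (p := p) (𝟙 x.obj) inferInstance).base
          = 𝟙 (p.obj x.obj) := by simp [TransposeCospan.ofVertical, TransposeCospan.base]
        rw [this]
        exact IsHomLift.id c.obj_mid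
      infer_instance
    · exact c.left_vertical
    · simp [TransposeCospan.ofVertical]
    · simp [TransposeCospan.ofVertical]
    · simp
  comp_id := by
    rintro x y ⟨c⟩
    apply Quotient.sound
    have := c.right_isCocartesian
    refine comp_rel_of_isComposite (k := c.right) (e := 𝟙 c.mid) ⟨?_, ?_, ?_, ?_, ?_⟩
    · exact c.right_isCocartesian
    · exact IsHomLift.id c.obj_mid
    · simp [TransposeCospan.ofVertical]
    · simp
    · simp [TransposeCospan.ofVertical]
  assoc := by
    rintro x y z t ⟨c⟩ ⟨d⟩ ⟨f⟩
    apply Quotient.sound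
    obtain ⟨k, e, h⟩ := TransposeCospan.isComposite_comp c d
    obtain ⟨k', e', h'⟩ := TransposeCospan.isComposite_comp d f
    obtain ⟨k₂, e₂, h₂⟩ := TransposeCospan.isComposite_comp c (TransposeCospan.comp d f)
    have := h.cocartesian
    have := h.vertical
    have := h'.cocartesian
    have := h'.vertical
    have := h₂.cocartesian
    have := h₂.vertical
    have := c.right_isCocartesian
    have := d.right_isCocartesian
    have h₃ : p.IsHomLift c.base (e' ≫ k₂) := inferInstance
    let m := Functor.IsCocartesian.map p c.base k (e' ≫ k₂)
    have hm : k ≫ m = e' ≫ k₂ := by simp [m]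
    have hme : e ≫ m = e₂ := by
      apply Functor.IsCocartesian.ext p c.base c.right
      rw [reassoc_of% h.comm, hm, h₂.comm, h'.left_eq, Category.assoc]
    have hb : (TransposeCospan.comp c d).base = d.base ≫ c.base := by
      have := IsOpfibration.comp _ _ _ _ d.right_isCocartesian h.cocartesian
      have h₄ := this.toIsHomLift
      rw [← h.right_eq] at h₄
      exact isHomLift_unique (TransposeCospan.right_isHomLift _) h₄
    refine comp_rel_of_isComposite (k := k' ≫ k₂) (e := m) ⟨?_, ?_, ?_, ?_, ?_⟩
    · rw [hb]; exact IsOpfibration.comp _ _ _ _ h'.cocartesian h₂.cocartesian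
    · infer_instance
    · rw [h.right_eq, Category.assoc, hm, reassoc_of% h'.comm]
    · rw [h₂.left_eq, h.left_eq, Category.assoc, hme]
    · rw [h₂.right_eq, h'.right_eq, Category.assoc]

variable [IsOpfibration p]

/-- The morphism of the transpose fibration represented by a cospan. -/
def homMk {x z : Transpose p} (c : TransposeCospan p x.obj z.obj) : x ⟶ z := Quotient.mk _ c

theorem homMk_surj {x z : Transpose p} (φ : x ⟶ z) : ∃ c, homMk c = φ := Quotient.exists_rep φ

theorem homMk_eq_iff {x z : Transpose p} (c d : TransposeCospan p x.obj z.obj) :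
    homMk c = homMk d ↔ TransposeCospan.Rel c d :=
  ⟨fun h => Quotient.exact h, fun h => Quotient.sound h⟩

theorem homMk_comp_homMk {x y z : Transpose p} {c : TransposeCospan p x.obj y.obj}
    {d : TransposeCospan p y.obj z.obj} {r : TransposeCospan p x.obj z.obj}
    {k : d.mid ⟶ r.mid} {e : c.mid ⟶ r.mid} (h : TransposeCospan.IsComposite c d r k e) :
    homMk c ≫ homMk d = homMk r :=
  Quotient.sound (comp_rel_of_isComposite h)

/-- The arrow of the base under a morphism of the transpose fibration. -/
def base {x z : Transpose p} (φ : x ⟶ z) : p.obj z.obj ⟶ p.obj x.obj :=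
  Quotient.lift TransposeCospan.base (fun _ _ h => TransposeCospan.base_eq_of_rel h) φ

theorem base_homMk {x z : Transpose p} (c : TransposeCospan p x.obj z.obj) :
    base (homMk c) = c.base := rfl

theorem base_comp {x y z : Transpose p} (φ : x ⟶ y) (ψ : y ⟶ z) :
    base (φ ≫ ψ) = base ψ ≫ base φ := by
  obtain ⟨c, rfl⟩ := homMk_surj φ
  obtain ⟨d, rfl⟩ := homMk_surj ψ
  obtain ⟨k, e, h⟩ := TransposeCospan.isComposite_comp c d
  have h₁ := (IsOpfibration.comp _ _ _ _ d.right_isCocartesian h.cocartesian).toIsHomLift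
  rw [← h.right_eq] at h₁
  exact isHomLift_unique (TransposeCospan.right_isHomLift _) h₁

theorem base_id (x : Transpose p) : base (𝟙 x) = 𝟙 (p.obj x.obj) := by
  change TransposeCospan.base _ = _
  simp [TransposeCospan.ofVertical, TransposeCospan.base]

/-- The transpose fibration of `p`, as a functor to the opposite of the base. -/
def proj (p : E ⥤ C) [IsOpfibration p] : Transpose p ⥤ Cᵒᵖ where
  obj x := op (p.obj x.obj)
  map φ := (base φ).op
  map_id x := by rw [base_id]; rfl
  map_comp φ ψ := by rw [base_comp]; rfl

theorem proj_isHomLift_iff {R S : C} {f : S ⟶ R} {x z : Transpose p} {φ : x ⟶ z} :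
    (proj p).IsHomLift f.op φ ↔ ∃ (hx : p.obj x.obj = R) (hz : p.obj z.obj = S),
      base φ = eqToHom hz ≫ f ≫ eqToHom hx.symm := by
  constructor
  · intro h
    have hx := isHomLift_domain h
    have hz := isHomLift_codomain h
    refine ⟨congrArg unop hx, congrArg unop hz, ?_⟩
    have := congrArg Quiver.Hom.unop (IsHomLift.fac' (proj p) f.op φ)
    have e : ∀ {a b : C} (h : op a = op b), (eqToHom h).unop = eqToHom (congrArg unop h).symm := by
      intro a b h
      obtain rfl : a = b := congrArg unop h
      rfl
    rw [unop_comp, unop_comp] at this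
    change base φ = ((eqToHom hz.symm).unop ≫ f) ≫ (eqToHom hx).unop at this
    rw [this, Category.assoc]
    exact congrArg₂ (fun s t => s ≫ f ≫ t) (e hz.symm) (e hx)
  · rintro ⟨rfl, rfl, h⟩
    have h : base φ = f := by simpa using h
    subst h
    exact IsHomLift.map (proj p) φ

/-- A fibrewise arrow `x ⟶ z` of the total category, seen in the transpose fibration. -/
def ofVertical {x z : E} (f : x ⟶ z) (hf : p.IsHomLift (𝟙 (p.obj x)) f) :
    (⟨x⟩ : Transpose p) ⟶ ⟨z⟩ :=
  homMk (TransposeCospan.ofVertical f hf)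

/-- The weak equivalences of the transpose fibration: the weak equivalences of the fibres. -/
def weq (W : MorphismProperty E) : MorphismProperty (Transpose p) := fun x z φ =>
  ∃ (f : x.obj ⟶ z.obj) (hf : p.IsHomLift (𝟙 (p.obj x.obj)) f), W f ∧ φ = ofVertical f hf

/-- A weakly Cartesian morphism of the transpose fibration is a weak equivalence followed by a
Cartesian morphism. -/
def IsWeaklyCartesian (W : MorphismProperty E) {x z : Transpose p} (φ : x ⟶ z) : Prop :=
  ∃ (y : Transpose p) (f : x ⟶ y) (κ : y ⟶ z),
    weq W f ∧ (proj p).IsCartesian ((proj p).map κ) κ ∧ f ≫ κ = φ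

end Transpose

end Transpose

/-! ### Pullbacks of opfibrations -/

section Pullback

variable {C : Type u₁} [Category.{v₁} C] {E : Type u₂} [Category.{v₂} E]
  {D : Type u₃} [Category.{v₃} D]

/-- The strict pullback category of `p` along `F`, i.e. the total category of the pulled back
opfibration. -/
@[ext]
structure Pullback (F : D ⥤ C) (p : E ⥤ C) where
  base : D
  fib : E
  w : p.obj fib = F.obj base

namespace Pullback

variable {F : D ⥤ C} {p : E ⥤ C}

/-- A morphism of the pullback category: a pair of arrows with the same image in the base. -/
@[ext]
structure Hom (X Y : Pullback F p) where
  base : X.base ⟶ Y.base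
  fib : X.fib ⟶ Y.fib
  w : p.IsHomLift (F.map base) fib

instance category : Category (Pullback F p) where
  Hom := Hom
  id X := ⟨𝟙 _, 𝟙 _, by rw [F.map_id]; exact IsHomLift.id X.w⟩
  comp f g := ⟨f.base ≫ g.base, f.fib ≫ g.fib, by
    have := f.w
    have := g.w
    rw [F.map_comp]; infer_instance⟩

@[ext]
theorem hom_ext {X Y : Pullback F p} {f g : X ⟶ Y} (h : f.base = g.base) (h' : f.fib = g.fib) :
    f = g := Hom.ext h h'

@[simp] theorem id_base (X : Pullback F p) : (𝟙 X : X ⟶ X).base = 𝟙 _ := rfl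
@[simp] theorem id_fib (X : Pullback F p) : (𝟙 X : X ⟶ X).fib = 𝟙 _ := rfl
@[simp] theorem comp_base {X Y Z : Pullback F p} (f : X ⟶ Y) (g : Y ⟶ Z) :
    (f ≫ g).base = f.base ≫ g.base := rfl
@[simp] theorem comp_fib {X Y Z : Pullback F p} (f : X ⟶ Y) (g : Y ⟶ Z) :
    (f ≫ g).fib = f.fib ≫ g.fib := rfl

variable (F p)

/-- The pullback `F^* p` of `p` along `F`. -/
@[simps]
def proj : Pullback F p ⥤ D where
  obj X := X.base
  map f := f.base

/-- The projection to the original total category. -/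
@[simps]
def toTotal : Pullback F p ⥤ E where
  obj X := X.fib
  map f := f.fib

variable {F p}

theorem fib_isHomLift {X Y : Pullback F p} {R S : D} {f : R ⟶ S} {g : X ⟶ Y}
    (h : (proj F p).IsHomLift f g) : p.IsHomLift (F.map f) g.fib := by
  cases h; exact g.w

theorem hom_base_eq {X Y : Pullback F p} {R S : D} {f : R ⟶ S} {g : X ⟶ Y}
    (h : (proj F p).IsHomLift f g) :
    g.base = eqToHom (show X.base = R from isHomLift_domain h) ≫ f ≫
      eqToHom (show Y.base = S from isHomLift_codomain h).symm :=
  IsHomLift.fac' (proj F p) f g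

theorem isHomLift_of_base {X Y : Pullback F p} {R S : D} {f : R ⟶ S} {g : X ⟶ Y}
    (hX : X.base = R) (hY : Y.base = S) (h : g.base = eqToHom hX ≫ f ≫ eqToHom hY.symm) :
    (proj F p).IsHomLift f g :=
  IsHomLift.of_fac' (proj F p) f g hX hY h

theorem isCocartesian_of_fib {X Y : Pullback F p} (g : X ⟶ Y)
    (h : p.IsCocartesian (F.map g.base) g.fib) : (proj F p).IsCocartesian g.base g where
  toIsHomLift := IsHomLift.map (proj F p) g
  universal_property := by
    intro Z ψ hψ
    have hψ' := fib_isHomLift hψ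
    have hZ : Z.base = Y.base := isHomLift_codomain hψ
    have hb : ψ.base = g.base ≫ eqToHom hZ.symm := by
      rw [hom_base_eq hψ]; simp
    obtain ⟨χ, ⟨hχ, hχ'⟩, huniq⟩ := h.universal_property ψ.fib
    have hχw : p.IsHomLift (F.map (eqToHom hZ.symm)) χ := by
      rw [eqToHom_map]
      have : p.IsHomLift (𝟙 (F.obj Y.base) ≫ eqToHom (congrArg F.obj hZ.symm)) χ := inferInstance
      simpa using this
    refine ⟨⟨eqToHom hZ.symm, χ, hχw⟩, ⟨?_, ?_⟩, ?_⟩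
    · exact isHomLift_of_base rfl hZ (by simp)
    · ext
      · simp [hb]
      · simpa using hχ'
    · rintro θ ⟨hθ, hθ'⟩
      have hθb : θ.base = eqToHom hZ.symm := by
        rw [hom_base_eq hθ]; simp
      ext
      · exact hθb
      · apply huniq
        refine ⟨?_, by rw [← hθ']; rfl⟩
        have := fib_isHomLift hθ
        simpa using this

variable [IsOpfibration p]

theorem exists_lift (X : Pullback F p) {d : D} (u : X.base ⟶ d) :
    ∃ (Y : Pullback F p) (g : X ⟶ Y), (proj F p).IsCocartesian u g ∧
      p.IsCocartesian (F.map u) g.fib := by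
  obtain ⟨y, χ, hχ⟩ := IsOpfibration.exists_lift' p X.w (F.map u)
  exact ⟨⟨d, y, isHomLift_codomain hχ.toIsHomLift⟩, ⟨u, χ, hχ.toIsHomLift⟩,
    isCocartesian_of_fib (Y := ⟨d, y, isHomLift_codomain hχ.toIsHomLift⟩)
      ⟨u, χ, hχ.toIsHomLift⟩ hχ, hχ⟩

theorem fib_isCocartesian {X Y : Pullback F p} {R S : D} {f : R ⟶ S} {g : X ⟶ Y}
    (h : (proj F p).IsCocartesian f g) : p.IsCocartesian (F.map f) g.fib := by
  have hg := h.toIsHomLift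
  cases hg
  obtain ⟨Z, g', hg', hg''⟩ := exists_lift X g.base
  have h₀ : (proj F p).IsCocartesian g.base g := h
  let i := Functor.IsCocartesian.codomainUniqueUpToIso (proj F p) g.base g' g
  have hi : g' ≫ i.hom = g := by simp [i, Functor.IsCocartesian.codomainUniqueUpToIso]
  have hi' : (proj F p).IsHomLift (𝟙 Y.base) i.hom := by
    simp only [i, Functor.IsCocartesian.codomainUniqueUpToIso]
    exact Functor.IsCocartesian.map_isHomLift (proj F p) g.base g' g
  let j : Z.fib ≅ Y.fib := (toTotal F p).mapIso i
  have hv : p.IsHomLift (𝟙 (F.obj Y.base)) j.hom := by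
    have := fib_isHomLift hi'
    rwa [F.map_id] at this
  have h₂ := Functor.IsCocartesian.of_comp_iso p (F.map g.base) g'.fib j
  have h₃ : g'.fib ≫ j.hom = g.fib := congrArg Hom.fib hi
  rwa [h₃] at h₂

instance isOpfibration : IsOpfibration (proj F p) where
  exists_lift X d u := by
    obtain ⟨Y, g, hg, -⟩ := exists_lift X u
    exact ⟨Y, g, hg⟩
  comp f g _ _ _ φ ψ hφ hψ := by
    have h := IsOpfibration.comp _ _ _ _ (fib_isCocartesian hφ) (fib_isCocartesian hψ)
    have hφ' := hφ.toIsHomLift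
    have hψ' := hψ.toIsHomLift
    have h₁ : (proj F p).IsHomLift (f ≫ g) (φ ≫ ψ) := inferInstance
    rw [← F.map_comp] at h
    refine isCocartesian_of_isHomLift h₁ (isCocartesian_of_fib (φ ≫ ψ) ?_)
    exact isCocartesian_of_isHomLift (φ ≫ ψ).w (isCocartesian_map h)

/-- The weak equivalences of the pulled back opfibration: fibrewise arrows which are weak
equivalences of the original one. -/
def weq (F : D ⥤ C) (p : E ⥤ C) (W : MorphismProperty E) : MorphismProperty (Pullback F p) :=
  fun X _ g => (proj F p).IsHomLift (𝟙 X.base) g ∧ W g.fib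

/-! The comparison between the transpose of a pullback and the transpose. -/

/-- The projection of cospans from the pulled back opfibration. -/
def cospanToTotal {X Z : Pullback F p} (c : TransposeCospan (proj F p) X Z) :
    TransposeCospan p X.fib Z.fib where
  mid := c.mid.fib
  left := c.left.fib
  right := c.right.fib
  left_vertical := by
    have := fib_isHomLift c.left_vertical
    rw [F.map_id] at this
    exact isHomLift_of_isHomLift (IsHomLift.id rfl)
      (by rw [p.map_id, X.w]; exact this)
  right_cocartesian := isCocartesian_map (fib_isCocartesian c.right_cocartesian)

theorem cospanToTotal_base {X Z : Pullback F p} (c : TransposeCospan (proj F p) X Z) :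
    (cospanToTotal c).base = eqToHom Z.w ≫ F.map c.base ≫ eqToHom X.w.symm := by
  have h := fib_isHomLift c.right_isHomLift
  have h' := (cospanToTotal c).right_isHomLift
  refine isHomLift_unique h' ?_
  have : p.IsHomLift (F.map c.base) (cospanToTotal c).right := h
  have := IsHomLift.lift_comp_eqToHom p (F.map c.base) (cospanToTotal c).right X.w.symm
  exact IsHomLift.lift_eqToHom_comp p (F.map c.base ≫ eqToHom X.w.symm) (cospanToTotal c).right Z.w

theorem rel_cospanToTotal {X Z : Pullback F p} {c d : TransposeCospan (proj F p) X Z}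
    (h : TransposeCospan.Rel c d) : TransposeCospan.Rel (cospanToTotal c) (cospanToTotal d) := by
  obtain ⟨i, h, h'⟩ := h
  exact ⟨(toTotal F p).mapIso i, congrArg Hom.fib h, congrArg Hom.fib h'⟩

/-- The functor from the transpose of the pulled back opfibration to the transpose. -/
def transposeToTotal (F : D ⥤ C) (p : E ⥤ C) [IsOpfibration p] :
    Transpose (proj F p) ⥤ Transpose p where
  obj X := ⟨X.obj.fib⟩
  map {X Z} φ := Quotient.map (sa := TransposeCospan.setoid _ _ _)
    (sb := TransposeCospan.setoid _ _ _) cospanToTotal (fun _ _ h => rel_cospanToTotal h) φ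
  map_id X := rfl
  map_comp {X Y Z} φ ψ := by
    obtain ⟨c, rfl⟩ := Transpose.homMk_surj φ
    obtain ⟨d, rfl⟩ := Transpose.homMk_surj ψ
    obtain ⟨k, e, h⟩ := TransposeCospan.isComposite_comp c d
    rw [Transpose.homMk_comp_homMk h]
    symm
    refine Transpose.homMk_comp_homMk (p := p) (x := ⟨X.obj.fib⟩) (y := ⟨Y.obj.fib⟩)
      (z := ⟨Z.obj.fib⟩) (c := cospanToTotal c) (d := cospanToTotal d)
      (r := cospanToTotal (TransposeCospan.comp c d)) (k := k.fib) (e := e.fib)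
      ⟨?_, ?_, ?_, ?_, ?_⟩
    · refine isCocartesian_of_isHomLift ?_ (isCocartesian_map (fib_isCocartesian h.cocartesian))
      have := fib_isHomLift h.cocartesian.toIsHomLift
      rw [cospanToTotal_base]
      have := IsHomLift.lift_comp_eqToHom p (F.map c.base) k.fib X.obj.w.symm
      exact IsHomLift.lift_eqToHom_comp p (F.map c.base ≫ eqToHom X.obj.w.symm) k.fib Y.obj.w
    · have := fib_isHomLift h.vertical
      rw [F.map_id] at this
      exact isHomLift_of_isHomLift (IsHomLift.id rfl) (by rw [p.map_id, X.obj.w]; exact this)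
    · exact congrArg Hom.fib h.comm
    · exact congrArg Hom.fib h.left_eq
    · exact congrArg Hom.fib h.right_eq

theorem transpose_hom_ext {X Z : Transpose (proj F p)} {φ ψ : X ⟶ Z}
    (h : Transpose.base φ = Transpose.base ψ)
    (h' : (transposeToTotal F p).map φ = (transposeToTotal F p).map ψ) : φ = ψ := by
  obtain ⟨c, rfl⟩ := Transpose.homMk_surj φ
  obtain ⟨d, rfl⟩ := Transpose.homMk_surj ψ
  obtain ⟨i, hi, hi'⟩ := (Transpose.homMk_eq_iff (p := p) (x := ⟨X.obj.fib⟩)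
    (z := ⟨Z.obj.fib⟩) (cospanToTotal c) (cospanToTotal d)).1 h'
  have hv := TransposeCospan.vertical_of_rel hi
  have hc : c.mid.base = X.obj.base := c.obj_mid
  have hd : d.mid.base = X.obj.base := d.obj_mid
  have hcl : c.left.base = eqToHom hc.symm := by
    rw [hom_base_eq c.left_vertical]; simp
  have hdl : d.left.base = eqToHom hd.symm := by
    rw [hom_base_eq d.left_vertical]; simp
  have hw : p.IsHomLift (F.map (eqToHom (hc.trans hd.symm))) i.hom := by
    refine IsHomLift.of_fac' _ _ _ c.mid.w d.mid.w ?_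
    have := IsHomLift.fac' p (𝟙 (p.obj X.obj.fib)) i.hom
    rw [this, eqToHom_map, Category.id_comp]
    exact (eqToHom_trans _ _).trans (by simp; exact (eqToHom_trans _ _).symm)
  have hw' : p.IsHomLift (F.map (eqToHom (hd.trans hc.symm))) i.inv := by
    refine IsHomLift.of_fac' _ _ _ d.mid.w c.mid.w ?_
    have hv' : p.IsHomLift (𝟙 (p.obj X.obj.fib)) i.inv := inferInstance
    have := IsHomLift.fac' p (𝟙 (p.obj X.obj.fib)) i.inv
    rw [this, eqToHom_map, Category.id_comp]
    exact (eqToHom_trans _ _).trans (by simp; exact (eqToHom_trans _ _).symm)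
  refine (Transpose.homMk_eq_iff _ _).2 ⟨⟨⟨_, i.hom, hw⟩, ⟨_, i.inv, hw'⟩, ?_, ?_⟩, ?_, ?_⟩
  · ext
    · simp
    · exact i.hom_inv_id
  · ext
    · simp
    · exact i.inv_hom_id
  · ext
    · simp [hcl, hdl]
    · exact hi
  · ext
    · have hb : c.right.base ≫ eqToHom hc = d.right.base ≫ eqToHom hd := h
      simp only [comp_base]
      rw [← cancel_mono (eqToHom hd), ← hb]
      simp
    · exact hi'

/-- The lift of a cospan to the pulled back opfibration along an arrow `u` of the new base lying
over the base of the cospan. -/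
def cospanLift {X Z : Pullback F p} (u : Z.base ⟶ X.base) (c : TransposeCospan p X.fib Z.fib)
    (h : c.base = eqToHom Z.w ≫ F.map u ≫ eqToHom X.w.symm) :
    TransposeCospan (proj F p) X Z :=
  have hr : p.IsHomLift (F.map u) c.right := by
    have h' := c.right_isHomLift
    rw [h] at h'
    have := (IsHomLift.lift_eqToHom_comp_iff p _ _ Z.w).1 h'
    exact (IsHomLift.lift_comp_eqToHom_iff p _ _ X.w.symm).1 this
  have hl : p.IsHomLift (F.map (𝟙 X.base)) c.left := by
    have := c.left_vertical
    rwa [X.w, ← F.map_id] at this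
  { mid := ⟨X.base, c.mid, c.obj_mid.trans X.w⟩
    left := ⟨𝟙 _, c.left, hl⟩
    right := ⟨u, c.right, hr⟩
    left_vertical := isHomLift_of_base (X := X) (Y := ⟨X.base, c.mid, c.obj_mid.trans X.w⟩)
      (f := 𝟙 X.base) (g := ⟨𝟙 _, c.left, hl⟩) rfl rfl (by simp)
    right_cocartesian := isCocartesian_of_fib (X := Z) (Y := ⟨X.base, c.mid, c.obj_mid.trans X.w⟩)
      ⟨u, c.right, hr⟩ (isCocartesian_of_isHomLift hr c.right_cocartesian) }

/-- The morphism of the transpose of the pulled back opfibration given by an arrow `u` of the new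
base and a morphism of the transpose of the original opfibration over the image of `u`. -/
noncomputable def transposeLift {X Z : Pullback F p} (u : Z.base ⟶ X.base)
    (φ : (⟨X.fib⟩ : Transpose p) ⟶ ⟨Z.fib⟩)
    (h : Transpose.base φ = eqToHom Z.w ≫ F.map u ≫ eqToHom X.w.symm) :
    (⟨X⟩ : Transpose (proj F p)) ⟶ ⟨Z⟩ :=
  Transpose.homMk (x := ⟨X⟩) (z := ⟨Z⟩) (cospanLift u (Transpose.homMk_surj φ).choose
    ((congrArg Transpose.base (Transpose.homMk_surj φ).choose_spec).trans h))

theorem base_transposeLift {X Z : Pullback F p} (u : Z.base ⟶ X.base)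
    (φ : (⟨X.fib⟩ : Transpose p) ⟶ ⟨Z.fib⟩)
    (h : Transpose.base φ = eqToHom Z.w ≫ F.map u ≫ eqToHom X.w.symm) :
    Transpose.base (transposeLift u φ h) = u :=
  Category.comp_id u

theorem map_transposeLift {X Z : Pullback F p} (u : Z.base ⟶ X.base)
    (φ : (⟨X.fib⟩ : Transpose p) ⟶ ⟨Z.fib⟩)
    (h : Transpose.base φ = eqToHom Z.w ≫ F.map u ≫ eqToHom X.w.symm) :
    (transposeToTotal F p).map (transposeLift u φ h) = φ :=
  (Transpose.homMk_surj φ).choose_spec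

theorem base_map {X Z : Transpose (proj F p)} (φ : X ⟶ Z) :
    Transpose.base ((transposeToTotal F p).map φ) =
      eqToHom Z.obj.w ≫ F.map (Transpose.base φ) ≫ eqToHom X.obj.w.symm := by
  obtain ⟨c, rfl⟩ := Transpose.homMk_surj φ
  exact cospanToTotal_base c

theorem transposeLift_eq {X Z : Pullback F p} {u : Z.base ⟶ X.base}
    {φ : (⟨X.fib⟩ : Transpose p) ⟶ ⟨Z.fib⟩}
    {h : Transpose.base φ = eqToHom Z.w ≫ F.map u ≫ eqToHom X.w.symm}
    {ψ : (⟨X⟩ : Transpose (proj F p)) ⟶ ⟨Z⟩} (h₁ : Transpose.base ψ = u)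
    (h₂ : (transposeToTotal F p).map ψ = φ) : transposeLift u φ h = ψ :=
  transpose_hom_ext ((base_transposeLift u φ h).trans h₁.symm)
    ((map_transposeLift u φ h).trans h₂.symm)

theorem weq_transposeLift (W : MorphismProperty E) {X Z : Pullback F p} (u : Z.base ⟶ X.base)
    (φ : (⟨X.fib⟩ : Transpose p) ⟶ ⟨Z.fib⟩)
    (h : Transpose.base φ = eqToHom Z.w ≫ F.map u ≫ eqToHom X.w.symm)
    (hZ : X.base = Z.base) (hu : u = eqToHom hZ.symm) (hφ : Transpose.weq W φ) :
    Transpose.weq (weq F p W) (transposeLift u φ h) := by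
  obtain ⟨f, hf, hW, rfl⟩ := hφ
  have hf' : p.IsHomLift (F.map (eqToHom hZ)) f := by
    rw [eqToHom_map]
    refine IsHomLift.of_fac' p _ _ X.w Z.w ?_
    have hf₁ : p.IsHomLift (𝟙 (p.obj X.fib)) f := hf
    have := IsHomLift.fac' p (𝟙 (p.obj X.fib)) f
    rw [this, Category.id_comp]
    exact (eqToHom_trans _ _).trans (by simp)
  let g : X ⟶ Z := ⟨eqToHom hZ, f, hf'⟩
  have hg : (proj F p).IsHomLift (𝟙 X.base) g := isHomLift_of_base rfl hZ.symm
    (by simp only [g, eqToHom_refl, Category.id_comp])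
  refine ⟨g, hg, ⟨hg, hW⟩, transposeLift_eq ?_ rfl⟩
  subst hu
  change 𝟙 Z.base ≫ eqToHom _ = _
  rw [Category.id_comp]
  exact rfl

theorem eqToHom_id_eqToHom {a b c : C} (h : a = b) (h' : b = c) :
    eqToHom h ≫ 𝟙 b ≫ eqToHom h' = eqToHom (h.trans h') := by
  subst h; simp

theorem cartesian_aux {x y z : D} {a b c : C} (u : z ⟶ y) (hX : x = y) (ez : c = F.obj z)
    (ey : b = F.obj y) (ex : a = F.obj x) (hab : a = b) :
    eqToHom ez ≫ F.map (u ≫ eqToHom hX.symm) ≫ eqToHom ex.symm =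
      eqToHom rfl ≫ (eqToHom ez ≫ F.map u ≫ eqToHom ey.symm) ≫ eqToHom hab.symm := by
  subst hX hab ez ex
  simp

theorem transposeLift_isCartesian {Y Z : Pullback F p} (u : Z.base ⟶ Y.base)
    (κ : (⟨Y.fib⟩ : Transpose p) ⟶ ⟨Z.fib⟩)
    (h : Transpose.base κ = eqToHom Z.w ≫ F.map u ≫ eqToHom Y.w.symm)
    (hκ : (Transpose.proj p).IsCartesian ((Transpose.proj p).map κ) κ) :
    (Transpose.proj (proj F p)).IsCartesian
      ((Transpose.proj (proj F p)).map (transposeLift u κ h)) (transposeLift u κ h) where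
  universal_property := by
    rintro ⟨X⟩ φ hφ
    obtain ⟨hX, hZ, hφb⟩ := Transpose.proj_isHomLift_iff.1 hφ
    have hX : X.base = Y.base := hX
    have hφb : Transpose.base φ = u ≫ eqToHom hX.symm := by
      rw [hφb, base_transposeLift]; exact Category.id_comp _
    let φ' : (⟨X.fib⟩ : Transpose p) ⟶ ⟨Z.fib⟩ := (transposeToTotal F p).map φ
    have hφ'b : Transpose.base φ' = eqToHom Z.w ≫ F.map (Transpose.base φ) ≫
      eqToHom X.w.symm := base_map φ
    have hXY : p.obj X.fib = p.obj Y.fib := X.w.trans ((congrArg F.obj hX).trans Y.w.symm)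
    have hφ' : (Transpose.proj p).IsHomLift ((Transpose.proj p).map κ) φ' := by
      refine Transpose.proj_isHomLift_iff.2 ⟨hXY, rfl, ?_⟩
      refine (hφ'b.trans (congrArg (fun t => eqToHom Z.w ≫ F.map t ≫ eqToHom X.w.symm) hφb)).trans ((cartesian_aux (F := F) u hX Z.w Y.w X.w hXY).trans (by rw [← h]))
    obtain ⟨χ, ⟨hχ, hχ'⟩, huniq⟩ := hκ.universal_property
      (a' := (⟨X.fib⟩ : Transpose p)) φ'
    have hχb : Transpose.base χ = eqToHom Y.w ≫ F.map (eqToHom hX.symm) ≫ eqToHom X.w.symm := by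
      obtain ⟨_, _, e⟩ := Transpose.proj_isHomLift_iff (f := 𝟙 (p.obj Y.fib)).1 hχ
      rw [e]
      simp [eqToHom_map]
    refine ⟨transposeLift (eqToHom hX.symm) χ hχb, ⟨?_, ?_⟩, ?_⟩
    · refine Transpose.proj_isHomLift_iff (f := 𝟙 Y.base).2 ⟨hX, rfl, ?_⟩
      exact (base_transposeLift _ _ _).trans (eqToHom_id_eqToHom rfl hX.symm).symm
    · refine transpose_hom_ext ?_ ?_
      · rw [Transpose.base_comp, base_transposeLift, base_transposeLift]
        exact hφb.symm
      · rw [Functor.map_comp, map_transposeLift, map_transposeLift]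
        exact hχ'
    · rintro θ ⟨hθ, hθ'⟩
      obtain ⟨_, _, e⟩ := Transpose.proj_isHomLift_iff (f := 𝟙 Y.base).1 hθ
      have e : Transpose.base θ = eqToHom hX.symm := e.trans (eqToHom_id_eqToHom _ _)
      symm
      refine transposeLift_eq e (huniq _ ⟨?_, ?_⟩)
      · refine Transpose.proj_isHomLift_iff (f := 𝟙 (p.obj Y.fib)).2 ⟨hXY, rfl, ?_⟩
        refine (base_map θ).trans ?_
        refine (congrArg (fun t => eqToHom Y.w ≫ F.map t ≫ eqToHom X.w.symm) e).trans ?_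
        simp only [eqToHom_map]
        exact ((congrArg (eqToHom Y.w ≫ ·) (eqToHom_trans _ _)).trans (eqToHom_trans _ _)).trans
          (eqToHom_id_eqToHom _ _).symm
      · refine Eq.trans ?_ (congrArg (transposeToTotal F p).map hθ')
        rw [Functor.map_comp, map_transposeLift]
        rfl

theorem isWeaklyCartesian_transposeLift (W : MorphismProperty E) {X Z : Pullback F p}
    (u : Z.base ⟶ X.base) (φ : (⟨X.fib⟩ : Transpose p) ⟶ ⟨Z.fib⟩)
    (h : Transpose.base φ = eqToHom Z.w ≫ F.map u ≫ eqToHom X.w.symm)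
    (hφ : Transpose.IsWeaklyCartesian W φ) :
    Transpose.IsWeaklyCartesian (weq F p W) (transposeLift u φ h) := by
  obtain ⟨⟨y⟩, g, κ, hg, hκ, rfl⟩ := hφ
  obtain ⟨f, hf, hW, rfl⟩ := id hg
  have hy : p.obj y = p.obj X.fib := isHomLift_codomain hf
  have hb : Transpose.base (Transpose.ofVertical f hf) = eqToHom hy := by
    change p.map (𝟙 y) ≫ eqToHom _ = _
    rw [p.map_id]
    exact Category.id_comp _
  let Y : Pullback F p := ⟨X.base, y, hy.trans X.w⟩
  have h₁ : Transpose.base (Transpose.ofVertical f hf) =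
      eqToHom Y.w ≫ F.map (𝟙 X.base) ≫ eqToHom X.w.symm := by
    rw [hb, F.map_id]
    exact (eqToHom_id_eqToHom _ _).symm
  have h₂ : Transpose.base κ = eqToHom Z.w ≫ F.map u ≫ eqToHom Y.w.symm := by
    rw [Transpose.base_comp, hb] at h
    have h' := congrArg (· ≫ eqToHom hy.symm) h
    simp only [Category.assoc, eqToHom_trans, eqToHom_refl, Category.comp_id] at h'
    exact h'
  refine ⟨⟨Y⟩, transposeLift (X := X) (Z := Y) (𝟙 X.base) _ h₁, transposeLift (X := Y) u κ h₂,
    weq_transposeLift W _ _ _ rfl rfl hg, transposeLift_isCartesian _ _ _ hκ, ?_⟩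
  symm
  refine transposeLift_eq ?_ ?_
  · rw [Transpose.base_comp, base_transposeLift, base_transposeLift]
    exact Category.comp_id u
  · rw [Functor.map_comp, map_transposeLift, map_transposeLift]
    rfl

end Pullback

end Pullback

/-! ### Categories with tensors by simplices -/

section DeltaCategories

open Limits

variable {M : Type u₁} [Category.{v₁} M]

/-- The iterated tensor `(m, n) ↦ (x ↦ m ⊗ (n ⊗ x))`. -/
def iteratedTensor (A : SimplexCategory ⥤ M ⥤ M) : SimplexCategory × SimplexCategory ⥤ M ⥤ M where
  obj a := A.obj a.2 ⋙ A.obj a.1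
  map f := A.map f.2 ◫ A.map f.1

/-- The component at `(n, x)` of a transformation from `x ↦ n ⊗ x` to `x ↦ n ⊗ (n ⊗ x)`. -/
def diagComponent {A : SimplexCategory ⥤ M ⥤ M}
    (δ : A ⟶ Functor.diag SimplexCategory ⋙ iteratedTensor A) (n : SimplexCategory) (x : M) :
    (A.obj n).obj x ⟶ (A.obj n).obj ((A.obj n).obj x) :=
  (δ.app n).app x

/-- A `Δ`-structure on a category: a functor `Δ × M ⥤ M`, a diagonal transformation
`Δⁿ ⊗ x ⟶ Δⁿ ⊗ (Δⁿ ⊗ x)` and an isomorphism `Δ⁰ ⊗ x ≅ x`, coassociative and counital. -/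
structure DeltaStructure (M : Type u₁) [Category.{v₁} M] where
  tensor : SimplexCategory ⥤ M ⥤ M
  diag : tensor ⟶ Functor.diag SimplexCategory ⋙ iteratedTensor tensor
  unit : tensor.obj ⦋0⦌ ≅ 𝟭 M
  coassoc (n : SimplexCategory) (x : M) :
    diagComponent diag n x ≫ (tensor.obj n).map (diagComponent diag n x) =
      diagComponent diag n x ≫ diagComponent diag n ((tensor.obj n).obj x)
  counit_left (n : SimplexCategory) (x : M) (π : n ⟶ ⦋0⦌) :
    diagComponent diag n x ≫ (tensor.map π).app ((tensor.obj n).obj x) ≫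
      unit.hom.app ((tensor.obj n).obj x) = 𝟙 _
  counit_right (n : SimplexCategory) (x : M) (π : n ⟶ ⦋0⦌) :
    diagComponent diag n x ≫ (tensor.obj n).map ((tensor.map π).app x ≫ unit.hom.app x) = 𝟙 _

namespace DeltaStructure

variable (T : DeltaStructure M)

/-- The component `Δⁿ ⊗ x ⟶ Δⁿ ⊗ (Δⁿ ⊗ x)` of the diagonal transformation. -/
def diagApp (n : SimplexCategory) (x : M) :
    (T.tensor.obj n).obj x ⟶ (T.tensor.obj n).obj ((T.tensor.obj n).obj x) :=
  diagComponent T.diag n x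

theorem diagApp_map {n m : SimplexCategory} (θ : n ⟶ m) (x : M) :
    (T.tensor.map θ).app x ≫ T.diagApp m x = T.diagApp n x ≫
      (T.tensor.map θ).app ((T.tensor.obj n).obj x) ≫
        (T.tensor.obj m).map ((T.tensor.map θ).app x) :=
  congrArg (fun α => NatTrans.app α x) (T.diag.naturality θ)

theorem diagApp_natural (n : SimplexCategory) {x y : M} (f : x ⟶ y) :
    (T.tensor.obj n).map f ≫ T.diagApp n y =
      T.diagApp n x ≫ (T.tensor.obj n).map ((T.tensor.obj n).map f) :=
  (T.diag.app n).naturality f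

/-! The action of simplicial sets. -/

section SSetTensor

variable [HasColimitsOfSize.{0, u} M]

/-- The tensor `S ⊗ x` of an object with a simplicial set `S`: the colimit of `Δⁿ ⊗ x` over the
category of simplices of `S`. -/
noncomputable def ssetTensor (S : SSet.{u}) (x : M) : M :=
  colimit ((CategoryOfElements.π S).leftOp ⋙ T.tensor.flip.obj x)

/-- The map `Δⁿ ⊗ x ⟶ S ⊗ x` given by an `n`-simplex of `S`. -/
noncomputable def ssetTensorι (S : SSet.{u}) (x : M) {n : SimplexCategory} (s : S.obj (op n)) :
    (T.tensor.obj n).obj x ⟶ T.ssetTensor S x :=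
  colimit.ι ((CategoryOfElements.π S).leftOp ⋙ T.tensor.flip.obj x)
    (op (⟨op n, s⟩ : S.Elements))

theorem map_ssetTensorι (S : SSet.{u}) (x : M) {n m : SimplexCategory} (θ : n ⟶ m)
    (s : S.obj (op m)) :
    (T.tensor.map θ).app x ≫ T.ssetTensorι S x s = T.ssetTensorι S x (S.map θ.op s) :=
  colimit.w ((CategoryOfElements.π S).leftOp ⋙ T.tensor.flip.obj x)
    (CategoryOfElements.homMk (⟨op m, s⟩ : S.Elements) (⟨op n, S.map θ.op s⟩ : S.Elements)
      θ.op rfl).op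

/-- The universal property of `S ⊗ x`. -/
noncomputable def ssetTensorDesc (S : SSet.{u}) (x : M) {y : M}
    (g : ∀ (n : SimplexCategory), S.obj (op n) → ((T.tensor.obj n).obj x ⟶ y))
    (hg : ∀ {n m : SimplexCategory} (θ : n ⟶ m) (s : S.obj (op m)),
      (T.tensor.map θ).app x ≫ g m s = g n (S.map θ.op s)) : T.ssetTensor S x ⟶ y :=
  colimit.desc ((CategoryOfElements.π S).leftOp ⋙ T.tensor.flip.obj x)
    { pt := y
      ι :=
        { app := fun e => g e.unop.1.unop e.unop.2
          naturality := fun e e' f => by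
            have h := hg f.unop.1.unop e'.unop.2
            have h₂ : S.map f.unop.1 e'.unop.2 = e.unop.2 := f.unop.2
            rw [Quiver.Hom.op_unop] at h
            exact h.trans ((congrArg (g e.unop.1.unop) h₂).trans (Category.comp_id _).symm) } }

theorem ssetTensorι_desc (S : SSet.{u}) (x : M) {y : M}
    (g : ∀ (n : SimplexCategory), S.obj (op n) → ((T.tensor.obj n).obj x ⟶ y))
    (hg : ∀ {n m : SimplexCategory} (θ : n ⟶ m) (s : S.obj (op m)),
      (T.tensor.map θ).app x ≫ g m s = g n (S.map θ.op s)) {n : SimplexCategory}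
    (s : S.obj (op n)) : T.ssetTensorι S x s ≫ T.ssetTensorDesc S x g hg = g n s :=
  colimit.ι_desc _ _

/-- Functoriality of `S ⊗ x` in `S`. -/
noncomputable def ssetTensorMapLeft {S S' : SSet.{u}} (φ : S ⟶ S') (x : M) :
    T.ssetTensor S x ⟶ T.ssetTensor S' x :=
  T.ssetTensorDesc S x (fun n s => T.ssetTensorι S' x (φ.app (op n) s)) (by
    intro n m θ s
    rw [map_ssetTensorι, NatTrans.naturality_apply])

/-- Functoriality of `S ⊗ x` in `x`. -/
noncomputable def ssetTensorMapRight (S : SSet.{u}) {x y : M} (f : x ⟶ y) :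
    T.ssetTensor S x ⟶ T.ssetTensor S y :=
  T.ssetTensorDesc S x (fun n s => (T.tensor.obj n).map f ≫ T.ssetTensorι S y s) (by
    intro n m θ s
    rw [← map_ssetTensorι, NatTrans.naturality_assoc])

/-- The action map `(S × S') ⊗ x ⟶ S ⊗ (S' ⊗ x)`. -/
noncomputable def actionMap (S S' : SSet.{u}) (x : M) :
    T.ssetTensor (FunctorToTypes.prod S S') x ⟶ T.ssetTensor S (T.ssetTensor S' x) :=
  T.ssetTensorDesc _ x
    (fun n s => T.diagApp n x ≫ (T.tensor.obj n).map (T.ssetTensorι S' x s.2) ≫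
      T.ssetTensorι S (T.ssetTensor S' x) s.1) (by
    intro n m θ s
    have h : (FunctorToTypes.prod S S').map θ.op s = (S.map θ.op s.1, S'.map θ.op s.2) := rfl
    rw [h, ← map_ssetTensorι, ← map_ssetTensorι, ← Category.assoc, diagApp_map]
    simp)

end SSetTensor

/-! Realisation of simplicial objects. -/

section Realisation

variable [HasColimitsOfSize.{0, 0} M]

/-- The geometric realisation of simplicial objects: the coend of `Δⁿ ⊗ Xₙ`. -/
noncomputable def realisation : (SimplexCategoryᵒᵖ ⥤ M) ⥤ M :=
  (Functor.whiskeringRight _ _ _).obj T.tensor.flip ⋙ coendFunctor SimplexCategory M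

/-- The double coend of `Δᵐ ⊗ (Δⁿ ⊗ Xₘₙ)`. -/
noncomputable def doubleRealisation (X : SimplexCategoryᵒᵖ × SimplexCategoryᵒᵖ ⥤ M) : M :=
  coend (((prodOpEquiv SimplexCategory).functor ⋙ X) ⋙ (iteratedTensor T.tensor).flip)

/-- The canonical map from `Δⁿ ⊗ (Δⁿ ⊗ Xₙₙ)` to the double realisation. -/
noncomputable def doubleRealisationι (X : SimplexCategoryᵒᵖ × SimplexCategoryᵒᵖ ⥤ M)
    (n : SimplexCategory) :
    (T.tensor.obj n).obj ((T.tensor.obj n).obj (X.obj (op n, op n))) ⟶ T.doubleRealisation X :=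
  coend.ι (((prodOpEquiv SimplexCategory).functor ⋙ X) ⋙ (iteratedTensor T.tensor).flip) (n, n)

theorem doubleRealisation_condition (X : SimplexCategoryᵒᵖ × SimplexCategoryᵒᵖ ⥤ M)
    {n m : SimplexCategory} (θ : n ⟶ m) :
    (T.tensor.obj n).map ((T.tensor.obj n).map
        (X.map ((θ.op, θ.op) : (op m, op m) ⟶ (op n, op n)))) ≫ T.doubleRealisationι X n =
      ((T.tensor.map θ).app ((T.tensor.obj n).obj (X.obj (op m, op m))) ≫
        (T.tensor.obj m).map ((T.tensor.map θ).app (X.obj (op m, op m)))) ≫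
          T.doubleRealisationι X m :=
  coend.condition
    (((prodOpEquiv SimplexCategory).functor ⋙ X) ⋙ (iteratedTensor T.tensor).flip)
    (show (n, n) ⟶ (m, m) from (θ, θ))

/-- The comparison from the realisation of the diagonal of a bisimplicial object to its double
realisation, induced by the diagonal `Δⁿ ⊗ Xₙₙ ⟶ Δⁿ ⊗ (Δⁿ ⊗ Xₙₙ)`. -/
noncomputable def diagonalComparison (X : SimplexCategoryᵒᵖ × SimplexCategoryᵒᵖ ⥤ M) :
    T.realisation.obj (Functor.diag SimplexCategoryᵒᵖ ⋙ X) ⟶ T.doubleRealisation X :=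
  coend.desc (fun n => T.diagApp n (X.obj (op n, op n)) ≫ T.doubleRealisationι X n) (by
    intro n m θ
    have h : (T.tensor.obj n).map (X.map ((θ.op, θ.op) : (op m, op m) ⟶ (op n, op n))) ≫
          T.diagApp n (X.obj (op n, op n)) ≫ T.doubleRealisationι X n =
        (T.tensor.map θ).app (X.obj (op m, op m)) ≫
          T.diagApp m (X.obj (op m, op m)) ≫ T.doubleRealisationι X m := by
      rw [← Category.assoc, diagApp_natural, Category.assoc, doubleRealisation_condition,
        ← Category.assoc, ← diagApp_map, Category.assoc]
    exact h)

end Realisation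

end DeltaStructure

end DeltaCategories

/-! ### Homotopical `Δ`-categories -/

section HomotopicalDelta

open Limits

/-- Weak homotopy equivalences of simplicial sets: the maps whose geometric realisation is a
homotopy equivalence. -/
def IsWeakEquivalence {S S' : SSet.{u}} (φ : S ⟶ S') : Prop :=
  ∃ e : ContinuousMap.HomotopyEquiv (SSet.toTop.obj S) (SSet.toTop.obj S'),
    ∀ x, e.toFun x = SSet.toTop.map φ x

/-- A homotopical structure on a category: a class of arrows containing the isomorphisms and
satisfying two-out-of-three. -/
structure IsHomotopicalStructure {M : Type u₁} [Category.{v₁} M] (W : MorphismProperty M) :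
    Prop where
  of_isIso {x y : M} (f : x ⟶ y) : IsIso f → W f
  comp {x y z : M} (f : x ⟶ y) (g : y ⟶ z) : W f → W g → W (f ≫ g)
  of_postcomp {x y z : M} (f : x ⟶ y) (g : y ⟶ z) : W g → W (f ≫ g) → W f
  of_precomp {x y z : M} (f : x ⟶ y) (g : y ⟶ z) : W f → W (f ≫ g) → W g

/-- The two-out-of-six property. -/
def TwoOutOfSix {M : Type u₁} [Category.{v₁} M] (W : MorphismProperty M) : Prop :=
  ∀ ⦃x y z t : M⦄ (f : x ⟶ y) (g : y ⟶ z) (h : z ⟶ t), W (f ≫ g) → W (g ≫ h) →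
    W f ∧ W g ∧ W h ∧ W (f ≫ g ≫ h)

/-- A homotopical `Δ`-category: a cocomplete category with a `Δ`-structure preserving colimits in
the object variable and with a class of weak equivalences `W`, compatible with each other.
"Small" means small relative to the universe `u`. -/
structure IsHomotopicalDeltaCategory {M : Type u₁} [Category.{v₁} M] (T : DeltaStructure M)
    (W : MorphismProperty M) : Prop where
  [cocomplete : HasColimitsOfSize.{u, u} M]
  tensor_preserves (n : SimplexCategory) : PreservesColimitsOfSize.{u, u} (T.tensor.obj n)
  homotopical : IsHomotopicalStructure W
  twoOutOfSix : TwoOutOfSix W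
  coproducts {J : Type u} (x y : J → M) (f : ∀ j, x j ⟶ y j) :
    (∀ j, W (f j)) → W (Limits.Sigma.map f)
  tensor_left {S S' : SSet.{u}} (φ : S ⟶ S') (x : M) : IsWeakEquivalence φ →
    haveI := hasColimitsOfSizeShrink.{0, u, u, u} M
    W (T.ssetTensorMapLeft φ x)
  tensor_right (S : SSet.{u}) {x y : M} (f : x ⟶ y) : W f →
    haveI := hasColimitsOfSizeShrink.{0, u, u, u} M
    W (T.ssetTensorMapRight S f)
  action (S S' : SSet.{u}) (x : M) :
    haveI := hasColimitsOfSizeShrink.{0, u, u, u} M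
    W (T.actionMap S S' x)
  realisation_map {X Y : SimplexCategoryᵒᵖ ⥤ M} (φ : X ⟶ Y) : (∀ n, W (φ.app n)) →
    haveI := hasColimitsOfSizeShrink.{0, 0, u, u} M
    W (T.realisation.map φ)
  diagonal (X : SimplexCategoryᵒᵖ × SimplexCategoryᵒᵖ ⥤ M) :
    haveI := hasColimitsOfSizeShrink.{0, 0, u, u} M
    W (T.diagonalComparison X)

/-! Fibred structures. -/

/-- A `Δ`-structure on a fibration `q`: a `Δ`-structure on the total category whose tensor lies
over the base and whose structure transformations are fibrewise. Naturality of the diagonal and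
of the unit with respect to Cartesian arrows says that the transition functors are
`Δ`-functors. -/
structure FibredDeltaStructure {B : Type u₁} [Category.{v₁} B] {X : Type u₂} [Category.{v₂} X]
    (q : X ⥤ B) extends DeltaStructure X where
  tensor_isHomLift (n : SimplexCategory) {x y : X} (f : x ⟶ y) :
    q.IsHomLift (q.map f) ((tensor.obj n).map f)
  tensor_vertical {n m : SimplexCategory} (θ : n ⟶ m) (x : X) :
    q.IsHomLift (𝟙 (q.obj x)) ((tensor.map θ).app x)
  diag_vertical (n : SimplexCategory) (x : X) : q.IsHomLift (𝟙 (q.obj x)) ((diag.app n).app x)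
  unit_vertical (x : X) : q.IsHomLift (𝟙 (q.obj x)) (unit.hom.app x)

namespace FibredDeltaStructure

variable {B : Type u₁} [Category.{v₁} B] {X : Type u₂} [Category.{v₂} X] {q : X ⥤ B}
  (T : FibredDeltaStructure q)

theorem obj_eq (n : SimplexCategory) (x : X) : q.obj ((T.tensor.obj n).obj x) = q.obj x :=
  isHomLift_domain (T.tensor_isHomLift n (𝟙 x))

theorem vertical_map (n : SimplexCategory) {b : B} {x y : X} (f : x ⟶ y)
    (hf : q.IsHomLift (𝟙 b) f) : q.IsHomLift (𝟙 b) ((T.tensor.obj n).map f) :=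
  isHomLift_of_isHomLift hf (T.tensor_isHomLift n f)

theorem vertical_of_eq {b : B} {x y z : X} {f : y ⟶ z} (h : q.IsHomLift (𝟙 (q.obj x)) f)
    (hx : q.obj x = b) : q.IsHomLift (𝟙 b) f := by
  subst hx; exact h

/-- The induced `Δ`-structure on a fibre. -/
def fiber (b : B) : DeltaStructure (q.Fiber b) where
  tensor :=
    { obj := fun n =>
        { obj := fun x => ⟨(T.tensor.obj n).obj x.1, (T.obj_eq n x.1).trans x.2⟩
          map := fun f => ⟨(T.tensor.obj n).map f.1, T.vertical_map n f.1 f.2⟩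
          map_id := fun x => Subtype.ext ((T.tensor.obj n).map_id x.1)
          map_comp := fun f g => Subtype.ext ((T.tensor.obj n).map_comp f.1 g.1) }
      map := fun θ =>
        { app := fun x => ⟨(T.tensor.map θ).app x.1, vertical_of_eq (T.tensor_vertical θ x.1) x.2⟩
          naturality := fun x y f => Subtype.ext ((T.tensor.map θ).naturality f.1) }
      map_id := fun n => by
        ext x
        exact congrArg (fun α => NatTrans.app α x.1) (T.tensor.map_id n)
      map_comp := fun θ η => by
        ext x
        exact congrArg (fun α => NatTrans.app α x.1) (T.tensor.map_comp θ η) }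
  diag :=
    { app := fun n =>
        { app := fun x => ⟨(T.diag.app n).app x.1, vertical_of_eq (T.diag_vertical n x.1) x.2⟩
          naturality := fun x y f => Subtype.ext ((T.diag.app n).naturality f.1) }
      naturality := fun n m θ => by
        ext x
        exact congrArg (fun α => NatTrans.app α x.1) (T.diag.naturality θ) }
  unit := NatIso.ofComponents
    (fun x =>
      { hom := ⟨T.unit.hom.app x.1, vertical_of_eq (T.unit_vertical x.1) x.2⟩
        inv := ⟨T.unit.inv.app x.1, by
          have h : q.IsHomLift (𝟙 b) (T.unit.app x.1).hom :=
            vertical_of_eq (T.unit_vertical x.1) x.2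
          exact IsHomLift.lift_id_inv q b (T.unit.app x.1)⟩
        hom_inv_id := Subtype.ext (T.unit.hom_inv_id_app x.1)
        inv_hom_id := Subtype.ext (T.unit.inv_hom_id_app x.1) })
    (fun f => Subtype.ext (T.unit.hom.naturality f.1))
  coassoc n x := Subtype.ext (T.coassoc n x.1)
  counit_left n x π := Subtype.ext (T.counit_left n x.1 π)
  counit_right n x π := Subtype.ext (T.counit_right n x.1 π)

end FibredDeltaStructure

/-- A homotopical structure on an opfibration: a class `W` of fibrewise arrows which contains the
fibrewise isomorphisms, satisfies two-out-of-three, and is preserved by pushforward along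
opCartesian arrows. -/
structure IsHomotopicalOpfibration {C : Type u₁} [Category.{v₁} C] {E : Type u₂} [Category.{v₂} E]
    (p : E ⥤ C) (W : MorphismProperty E) : Prop where
  vertical {x y : E} (f : x ⟶ y) : W f → p.IsHomLift (𝟙 (p.obj x)) f
  of_isIso {x y : E} (f : x ⟶ y) : p.IsHomLift (𝟙 (p.obj x)) f → IsIso f → W f
  comp {x y z : E} (f : x ⟶ y) (g : y ⟶ z) : W f → W g → W (f ≫ g)
  of_postcomp {x y z : E} (f : x ⟶ y) (g : y ⟶ z) : W g → W (f ≫ g) → W f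
  of_precomp {x y z : E} (f : x ⟶ y) (g : y ⟶ z) : W f → W (f ≫ g) → W g
  pushforward {c c' : C} (u : c ⟶ c') {a b a' b' : E} {α : a ⟶ b} {α' : a' ⟶ b'} {f : a ⟶ a'}
    {f' : b ⟶ b'} : p.IsCocartesian u α → p.IsCocartesian u α' → p.IsHomLift (𝟙 c') f' →
    α ≫ f' = f ≫ α' → W f → W f'

/-- The structure of a homotopical `Δ`-opfibration: a homotopical structure on the opfibration and
a `Δ`-structure on its transpose fibration, such that each fibre is a homotopical `Δ`-category. -/
structure HomotopicalDeltaOpfibration {C : Type u₁} [Category.{v₁} C] {E : Type u₂}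
    [Category.{v₂} E] (p : E ⥤ C) [IsOpfibration p] where
  weq : MorphismProperty E
  isHomotopical : IsHomotopicalOpfibration p weq
  delta : FibredDeltaStructure (Transpose.proj p)
  fiber (c : C) : IsHomotopicalDeltaCategory.{u} (delta.fiber (op c))
    ((Transpose.weq weq).inverseImage Functor.Fiber.fiberInclusion)

/-- A resolution: an opfibration all of whose fibres have a contractible nerve. -/
structure IsResolution {C : Type u₁} [Category.{v₁} C] {D : Type u₂} [Category.{v₂} D]
    (F : D ⥤ C) : Prop where
  isOpfibration : IsOpfibration F
  contractible (c : C) : ContractibleSpace (SSet.toTop.obj (nerve (F.Fiber c)))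

end HomotopicalDelta

/-! ### Simplicial replacements -/

section SimplicialReplacement

/-- The simplicial replacement of a category: the opposite of the category of simplices of its
nerve. An object is a sequence `c₀ ⟶ ⋯ ⟶ cₙ`. -/
abbrev SimplicialReplacement (C : Type u₁) [Category.{v₁} C] := (nerve C).Elements

variable {C : Type u₁} [Category.{v₁} C]

/-- The sequence of composable arrows underlying an object of the simplicial replacement. -/
def SimplicialReplacement.arrows (x : SimplicialReplacement C) :
    ComposableArrows C x.1.unop.len := x.2

/-- The last object `cₙ` of `c₀ ⟶ ⋯ ⟶ cₙ`. -/
def SimplicialReplacement.last (x : SimplicialReplacement C) : C :=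
  x.arrows.obj (Fin.last _)

theorem SimplicialReplacement.last_eq {x y : SimplicialReplacement C} (f : x ⟶ y) :
    y.last = x.arrows.obj (f.1.unop.toOrderHom (Fin.last _)) :=
  congrArg (fun G : ComposableArrows C y.1.unop.len => G.obj (Fin.last _)) f.2.symm

theorem SimplicialReplacement.arrows_obj {x y : SimplicialReplacement C} (f : x ⟶ y)
    (i : Fin (y.1.unop.len + 1)) : y.arrows.obj i = x.arrows.obj (f.1.unop.toOrderHom i) :=
  congrArg (fun G : ComposableArrows C y.1.unop.len => G.obj i) f.2.symm

theorem SimplicialReplacement.arrows_map {x y : SimplicialReplacement C} (f : x ⟶ y)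
    {i j : Fin (y.1.unop.len + 1)} (h : i ≤ j) : y.arrows.map (homOfLE h) =
      eqToHom (arrows_obj f i) ≫ x.arrows.map (homOfLE (f.1.unop.toOrderHom.monotone h)) ≫
        eqToHom (arrows_obj f j).symm :=
  Functor.congr_hom (show y.arrows = _ from f.2.symm) (homOfLE h)

theorem SimplicialReplacement.comp_aux {J : Type u₂} [Preorder J] (G : J ⥤ C) {i j k : J}
    (h : i ≤ j) (h' : j ≤ k) (h'' : i ≤ k) {a b c : C} (e₁ : c = a) (e₂ : a = G.obj i)
    (e₃ : b = G.obj j) (e₄ : c = G.obj i) :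
    eqToHom e₄ ≫ G.map (homOfLE h'') =
      (eqToHom e₁ ≫ eqToHom e₂ ≫ G.map (homOfLE h) ≫ eqToHom e₃.symm) ≫
        eqToHom e₃ ≫ G.map (homOfLE h') := by
  subst e₁ e₂ e₃
  simp [← G.map_comp]

/-- The arrow `c'ₘ ⟶ cₙ` induced by `(c₀ ⟶ ⋯ ⟶ cₙ) ⟶ (c'₀ ⟶ ⋯ ⟶ c'ₘ)`. -/
def SimplicialReplacement.lastMap {x y : SimplicialReplacement C} (f : x ⟶ y) :
    y.last ⟶ x.last :=
  eqToHom (last_eq f) ≫ x.arrows.map (homOfLE (Fin.le_last _))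

theorem SimplicialReplacement.lastMap_id (x : SimplicialReplacement C) :
    lastMap (𝟙 x) = 𝟙 x.last :=
  (Category.id_comp _).trans (x.arrows.map_id _)

theorem SimplicialReplacement.lastMap_comp {x y z : SimplicialReplacement C} (f : x ⟶ y)
    (g : y ⟶ z) : lastMap (f ≫ g) = lastMap g ≫ lastMap f := by
  refine (comp_aux x.arrows
    (f.1.unop.toOrderHom.monotone (Fin.le_last (g.1.unop.toOrderHom (Fin.last _))))
    (Fin.le_last (f.1.unop.toOrderHom (Fin.last _))) (Fin.le_last _) (last_eq g)
    (arrows_obj f _) (last_eq f) (last_eq (f ≫ g))).trans ?_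
  have h := arrows_map f (Fin.le_last (g.1.unop.toOrderHom (Fin.last _)))
  exact congrArg (fun t => (eqToHom (last_eq g) ≫ t) ≫ lastMap f) h.symm

/-- The tail functor `(c₀ ⟶ ⋯ ⟶ cₙ) ↦ cₙ`. -/
def tail (C : Type u₁) [Category.{v₁} C] : SimplicialReplacement C ⥤ Cᵒᵖ where
  obj x := op x.last
  map f := (SimplicialReplacement.lastMap f).op
  map_id x := by rw [SimplicialReplacement.lastMap_id]; rfl
  map_comp f g := by rw [SimplicialReplacement.lastMap_comp]; rfl

/-- Anchor maps: those whose underlying map `[m] ⟶ [n]` is the inclusion of the first `m + 1`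
elements. -/
def IsAnchor {x y : SimplicialReplacement C} (f : x ⟶ y) : Prop :=
  ∀ i, (f.1.unop.toOrderHom i : ℕ) = i

/-- The functor between simplicial replacements induced by a functor. -/
def SimplicialReplacement.map {D : Type u₂} [Category.{v₂} D] (F : D ⥤ C) :
    SimplicialReplacement D ⥤ SimplicialReplacement C where
  obj x := ⟨x.1, x.arrows ⋙ F⟩
  map {_ y} f := CategoryOfElements.homMk _ _ f.1
    (congrArg (fun G : ComposableArrows D y.1.unop.len => G ⋙ F) f.2)
  map_id _ := rfl
  map_comp _ _ := rfl

theorem SimplicialReplacement.map_aux {J : Type u₃} [Preorder J] {D : Type u₂} [Category.{v₂} D]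
    (F : D ⥤ C) (G : J ⥤ D) {i j : J} (h : i ≤ j) {a : D} (e : a = G.obj i)
    (e' : F.obj a = F.obj (G.obj i)) :
    eqToHom e' ≫ F.map (G.map (homOfLE h)) = F.map (eqToHom e ≫ G.map (homOfLE h)) := by
  subst e
  simp

theorem tail_map {D : Type u₂} [Category.{v₂} D] (F : D ⥤ C) {x y : SimplicialReplacement D}
    (f : x ⟶ y) : (tail C).map ((SimplicialReplacement.map F).map f) =
      (F.map (SimplicialReplacement.lastMap f)).op :=
  congrArg Quiver.Hom.op (SimplicialReplacement.map_aux F x.arrows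
    (Fin.le_last (f.1.unop.toOrderHom (Fin.last _))) (SimplicialReplacement.last_eq f) _)

end SimplicialReplacement

/-! ### Sections and derived sections -/

section Sections

/-- The category of sections, over `k : K ⥤ B`, of `q : X ⥤ B`; equivalently, of sections of the
pullback of `q` along `k`. -/
structure Sect {K : Type u₁} [Category.{v₁} K] {B : Type u₂} [Category.{v₂} B] {X : Type u₃}
    [Category.{v₃} X] (k : K ⥤ B) (q : X ⥤ B) where
  functor : K ⥤ X
  w : functor ⋙ q = k

namespace Sect

variable {K : Type u₁} [Category.{v₁} K] {B : Type u₂} [Category.{v₂} B] {X : Type u₃}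
    [Category.{v₃} X] {k : K ⥤ B} {q : X ⥤ B}

/-- A morphism of sections: a natural transformation whose components are fibrewise. -/
@[ext]
structure Hom (A A' : Sect k q) where
  natTrans : A.functor ⟶ A'.functor
  vertical (x : K) : q.IsHomLift (𝟙 (k.obj x)) (natTrans.app x)

theorem obj_eq (A : Sect k q) (x : K) : q.obj (A.functor.obj x) = k.obj x :=
  congrArg (fun G => G.obj x) A.w

theorem isHomLift (A : Sect k q) {x y : K} (f : x ⟶ y) :
    q.IsHomLift (k.map f) (A.functor.map f) := by
  obtain ⟨G, rfl⟩ := A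
  exact IsHomLift.map q (G.map f)

instance category : Category (Sect k q) where
  Hom := Hom
  id A := ⟨𝟙 _, fun x => IsHomLift.id (A.obj_eq x)⟩
  comp α β := ⟨α.natTrans ≫ β.natTrans, fun x => by
    have := α.vertical x
    have := β.vertical x
    rw [NatTrans.comp_app]
    infer_instance⟩

@[ext]
theorem hom_ext {A A' : Sect k q} {α β : A ⟶ A'}
    (h : ∀ x, α.natTrans.app x = β.natTrans.app x) : α = β :=
  Hom.ext (NatTrans.ext (funext h))

@[simp] theorem id_natTrans (A : Sect k q) : (𝟙 A : A ⟶ A).natTrans = 𝟙 _ := rfl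
@[simp] theorem comp_natTrans {A A' A'' : Sect k q} (α : A ⟶ A') (β : A' ⟶ A'') :
    (α ≫ β).natTrans = α.natTrans ≫ β.natTrans := rfl

end Sect

variable {C : Type u₁} [Category.{v₁} C] {E : Type u₂} [Category.{v₂} E] {D : Type u₃}
  [Category.{v₃} D]

/-- Presections of the opfibration `p`: sections over the simplicial replacement of the pullback
of the transpose fibration along the tail functor. -/
abbrev PSect (p : E ⥤ C) [IsOpfibration p] := Sect (tail C) (Transpose.proj p)

/-- Derived sections: presections which send anchor maps to weakly Cartesian morphisms. -/
def IsDerivedSection (p : E ⥤ C) [IsOpfibration p] (W : MorphismProperty E) :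
    ObjectProperty (PSect p) := fun A =>
  ∀ ⦃x y : SimplicialReplacement C⦄ (f : x ⟶ y), IsAnchor f →
    Transpose.IsWeaklyCartesian W (A.functor.map f)

/-- The category of derived sections. -/
abbrev RSect (p : E ⥤ C) [IsOpfibration p] (W : MorphismProperty E) :=
  (IsDerivedSection p W).FullSubcategory

/-- The weak equivalences of presections: pointwise weak equivalences. -/
def presectionWeq (p : E ⥤ C) [IsOpfibration p] (W : MorphismProperty E) :
    MorphismProperty (PSect p) := fun _ _ α =>
  ∀ x, Transpose.weq W (α.natTrans.app x)

/-- The weak equivalences of derived sections. -/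
def derivedWeq (p : E ⥤ C) [IsOpfibration p] (W : MorphismProperty E) :
    MorphismProperty (RSect p W) :=
  (presectionWeq p W).inverseImage (IsDerivedSection p W).ι

end Sections

/-! ### Pullback of derived sections -/

section PullbackSections

variable {C : Type u₁} [Category.{v₁} C] {E : Type u₂} [Category.{v₂} E] {D : Type u₃}
  [Category.{v₃} D] (F : D ⥤ C) (p : E ⥤ C) [IsOpfibration p]

namespace PSect

variable {p}

theorem obj_obj_eq (A : PSect p) (x : SimplicialReplacement C) :
    p.obj (A.functor.obj x).obj = x.last :=
  congrArg unop (A.obj_eq x)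

/-- The value of the pullback of a presection: an object of the fibre over `F dₙ`. -/
def pullbackObj (A : PSect p) (d : SimplicialReplacement D) : Pullback F p :=
  ⟨d.last, (A.functor.obj ((SimplicialReplacement.map F).obj d)).obj, A.obj_obj_eq _⟩

theorem pullbackMap_base (A : PSect p) {d d' : SimplicialReplacement D} (f : d ⟶ d') :
    Transpose.base (A.functor.map ((SimplicialReplacement.map F).map f)) =
      eqToHom (A.pullbackObj F d').w ≫ F.map (SimplicialReplacement.lastMap f) ≫
        eqToHom (A.pullbackObj F d).w.symm := by
  have h := A.isHomLift ((SimplicialReplacement.map F).map f)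
  rw [tail_map] at h
  exact (Transpose.proj_isHomLift_iff.1 h).choose_spec.choose_spec

theorem pullbackApp_base {A B : PSect p} (α : A ⟶ B) (d : SimplicialReplacement D) :
    Transpose.base (α.natTrans.app ((SimplicialReplacement.map F).obj d)) =
      eqToHom (B.pullbackObj F d).w ≫ F.map (𝟙 d.last) ≫ eqToHom (A.pullbackObj F d).w.symm := by
  have h := α.vertical ((SimplicialReplacement.map F).obj d)
  refine (Transpose.proj_isHomLift_iff (f := 𝟙 (F.obj d.last)).1 h).choose_spec.choose_spec.trans ?_
  exact congrArg (fun t => eqToHom (B.pullbackObj F d).w ≫ t ≫ eqToHom (A.pullbackObj F d).w.symm)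
    (F.map_id d.last).symm

/-- The action of the pullback of a presection on arrows. -/
noncomputable def pullbackMap (A : PSect p) {d d' : SimplicialReplacement D} (f : d ⟶ d') :
    (⟨A.pullbackObj F d⟩ : Transpose (Pullback.proj F p)) ⟶ ⟨A.pullbackObj F d'⟩ :=
  Pullback.transposeLift (X := A.pullbackObj F d) (Z := A.pullbackObj F d')
    (SimplicialReplacement.lastMap f)
    (A.functor.map ((SimplicialReplacement.map F).map f)) (A.pullbackMap_base F f)

theorem base_pullbackMap (A : PSect p) {d d' : SimplicialReplacement D} (f : d ⟶ d') :
    Transpose.base (A.pullbackMap F f) = SimplicialReplacement.lastMap f :=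
  Pullback.base_transposeLift _ _ _

theorem map_pullbackMap (A : PSect p) {d d' : SimplicialReplacement D} (f : d ⟶ d') :
    (Pullback.transposeToTotal F p).map (A.pullbackMap F f) =
      A.functor.map ((SimplicialReplacement.map F).map f) :=
  Pullback.map_transposeLift _ _ _

/-- The components of the pullback of a morphism of presections. -/
noncomputable def pullbackApp {A B : PSect p} (α : A ⟶ B) (d : SimplicialReplacement D) :
    (⟨A.pullbackObj F d⟩ : Transpose (Pullback.proj F p)) ⟶ ⟨B.pullbackObj F d⟩ :=
  Pullback.transposeLift (X := A.pullbackObj F d) (Z := B.pullbackObj F d) (𝟙 d.last)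
    (α.natTrans.app ((SimplicialReplacement.map F).obj d)) (pullbackApp_base F α d)

theorem base_pullbackApp {A B : PSect p} (α : A ⟶ B) (d : SimplicialReplacement D) :
    Transpose.base (pullbackApp F α d) = 𝟙 d.last :=
  Pullback.base_transposeLift _ _ _

theorem map_pullbackApp {A B : PSect p} (α : A ⟶ B) (d : SimplicialReplacement D) :
    (Pullback.transposeToTotal F p).map (pullbackApp F α d) =
      α.natTrans.app ((SimplicialReplacement.map F).obj d) :=
  Pullback.map_transposeLift _ _ _

/-- The pullback of a presection along `F`. -/
noncomputable def pullback (A : PSect p) : PSect (Pullback.proj F p) where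
  functor :=
    { obj := fun d => ⟨A.pullbackObj F d⟩
      map := fun f => A.pullbackMap F f
      map_id := fun d => by
        refine Pullback.transpose_hom_ext ?_ ?_
        · rw [base_pullbackMap, SimplicialReplacement.lastMap_id, Transpose.base_id]
          rfl
        · refine (A.map_pullbackMap F (𝟙 d)).trans (Eq.trans ?_
            ((Pullback.transposeToTotal F p).map_id (⟨A.pullbackObj F d⟩ : Transpose _)).symm)
          rw [CategoryTheory.Functor.map_id, CategoryTheory.Functor.map_id]
          rfl
      map_comp := fun f g => by
        refine Pullback.transpose_hom_ext ?_ ?_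
        · rw [base_pullbackMap, SimplicialReplacement.lastMap_comp, Transpose.base_comp,
            base_pullbackMap, base_pullbackMap]
          rfl
        · refine (A.map_pullbackMap F (f ≫ g)).trans (Eq.trans ?_
            ((Pullback.transposeToTotal F p).map_comp (A.pullbackMap F f)
              (A.pullbackMap F g)).symm)
          rw [Functor.map_comp, Functor.map_comp, map_pullbackMap, map_pullbackMap]
          rfl }
  w := Functor.hext (fun _ => rfl) (fun _ _ f =>
    heq_of_eq (congrArg Quiver.Hom.op (A.base_pullbackMap F f)))

/-- The pullback of presections along `F`, as a functor. -/
noncomputable def pullbackFunctor : PSect p ⥤ PSect (Pullback.proj F p) where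
  obj A := A.pullback F
  map {A B} α :=
    { natTrans :=
        { app := fun d => pullbackApp F α d
          naturality := fun d d' f => by
            refine Pullback.transpose_hom_ext ?_ ?_
            · refine (Transpose.base_comp (A.pullbackMap F f) (pullbackApp F α d')).trans
                (Eq.trans ?_ (Transpose.base_comp (pullbackApp F α d) (B.pullbackMap F f)).symm)
              rw [base_pullbackMap, base_pullbackApp, base_pullbackMap, base_pullbackApp]
              exact (Category.id_comp _).trans (Category.comp_id _).symm
            · refine ((Pullback.transposeToTotal F p).map_comp (A.pullbackMap F f)
                (pullbackApp F α d')).trans (Eq.trans ?_ ((Pullback.transposeToTotal F p).map_comp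
                  (pullbackApp F α d) (B.pullbackMap F f)).symm)
              rw [map_pullbackMap, map_pullbackApp, map_pullbackMap, map_pullbackApp]
              exact α.natTrans.naturality _ }
      vertical := fun d => by
        refine Transpose.proj_isHomLift_iff (f := 𝟙 d.last).2 ⟨rfl, rfl, ?_⟩
        refine (base_pullbackApp F α d).trans ?_
        exact (Pullback.eqToHom_id_eqToHom (a := d.last) (b := d.last) (c := d.last) rfl rfl).symm }
  map_id A := by
    refine Sect.hom_ext (fun d => Pullback.transpose_hom_ext ?_ ?_)
    · exact (base_pullbackApp F (𝟙 A) d).trans (Transpose.base_id (p := Pullback.proj F p) ⟨A.pullbackObj F d⟩).symm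
    · exact (map_pullbackApp F (𝟙 A) d).trans ((Pullback.transposeToTotal F p).map_id
        (⟨A.pullbackObj F d⟩ : Transpose _)).symm
  map_comp α β := by
    refine Sect.hom_ext (fun d => Pullback.transpose_hom_ext ?_ ?_)
    · refine (base_pullbackApp F (α ≫ β) d).trans (Eq.trans ?_
        (Transpose.base_comp (pullbackApp F α d) (pullbackApp F β d)).symm)
      rw [base_pullbackApp, base_pullbackApp]
      exact (Category.id_comp _).symm
    · refine (map_pullbackApp F (α ≫ β) d).trans (Eq.trans ?_
        ((Pullback.transposeToTotal F p).map_comp (pullbackApp F α d) (pullbackApp F β d)).symm)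
      rw [map_pullbackApp, map_pullbackApp]
      rfl

theorem isDerivedSection_pullback (W : MorphismProperty E) {A : PSect p}
    (hA : IsDerivedSection p W A) :
    IsDerivedSection (Pullback.proj F p) (Pullback.weq F p W) (A.pullback F) := by
  intro d d' f hf
  exact Pullback.isWeaklyCartesian_transposeLift W _ _ (A.pullbackMap_base F f) (hA _ hf)

theorem presectionWeq_pullback (W : MorphismProperty E) {A B : PSect p} (α : A ⟶ B)
    (hα : presectionWeq p W α) :
    presectionWeq (Pullback.proj F p) (Pullback.weq F p W) ((pullbackFunctor F).map α) := by
  intro d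
  exact Pullback.weq_transposeLift W _ _ (pullbackApp_base F α d) rfl rfl (hα _)

end PSect

/-- The pullback of derived sections along `F`. -/
noncomputable def RSect.pullbackFunctor (W : MorphismProperty E) :
    RSect p W ⥤ RSect (Pullback.proj F p) (Pullback.weq F p W) :=
  (IsDerivedSection (Pullback.proj F p) (Pullback.weq F p W)).lift
    ((IsDerivedSection p W).ι ⋙ PSect.pullbackFunctor F)
    (fun A => PSect.isDerivedSection_pullback F W A.property)

/-- The pullback of derived sections preserves weak equivalences. -/
noncomputable def RSect.pullback (W : MorphismProperty E) :
    LocalizerMorphism (derivedWeq p W) (derivedWeq (Pullback.proj F p) (Pullback.weq F p W)) where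
  functor := RSect.pullbackFunctor F p W
  map _ _ _ hα := PSect.presectionWeq_pullback F W _ hα

/-- The homotopy category of derived sections: the localisation at the weak equivalences. -/
abbrev HoRSect (p : E ⥤ C) [IsOpfibration p] (W : MorphismProperty E) :=
  (derivedWeq p W).Localization

/-- The pullback functor between the homotopy categories of derived sections. -/
noncomputable def HoRSect.pullback (W : MorphismProperty E) :
    HoRSect p W ⥤ HoRSect (Pullback.proj F p) (Pullback.weq F p W) :=
  (RSect.pullback F p W).localizedFunctor (derivedWeq p W).Q
    (derivedWeq (Pullback.proj F p) (Pullback.weq F p W)).Q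

end PullbackSections

end DerivedSections

/-!
The transpose `q : Eᵀ ⥤ Cᵒᵖ` of a homotopical `Δ`-opfibration is a Grothendieck fibration whose
fibrewise weak equivalences are stable under reindexing
(`HomotopicalDeltaOpfibration.isHomotopicalFibration`), and derived sections of `F^*E` are the same
as derived sections of `q` over the simplicial replacement of `D` (`PSect.toSect`,
`isLocalizedEquivalence_toDerived`). Everything therefore takes place in categories of sections
of `q`, and the functor in question is restriction `R` along `F`.

*Extension and resolution.* For an object `c = (c₀ → ⋯ → cₙ)` of the simplicial replacement of `C`,
let `joinDiagram F c` be the simplicial set whose simplices are the pairs `(d, y)` of a sequence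
`d` in `D` and a sequence `y = (F d₀ → ⋯ → F d_k → c₀ → ⋯ → cₙ)`. Write `hocolim` for the
realisation of the simplicial object `[k] ↦ ∐ G (s)`, the coproduct being over the `k`-simplices
`s` of a simplicial set; it is taken fibrewise for sections. Set

* `S A (c) = hocolim A (y)`, with an augmentation `S A ⟶ A` induced by the maps `y ⟶ c`;
* `E B (c) = hocolim` of the reindexing of `B (d)` along `F d_k → cₙ`, for `B` a section over the
  simplicial replacement of `D`, with a map `S A ⟶ E (R A)` induced by the maps `y ⟶ F d`.

The map `S A ⟶ A` is a weak equivalence for every section `A` (`Sect.weq_resolutionAug`): pushing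
the objects `dᵢ` forward along `F dᵢ → c₀`, one after the other, contracts `joinDiagram F c` with
these coefficients onto the nerve of the fibre of `F` over `c₀`, which is contractible
(`Sect.middleContraction`). Contractions are detected by realisation because simplicially homotopic
maps are simultaneously weak equivalences (`IsHomotopicalDeltaCategory.of_homotopy`), which is the
axiom on the diagonal of a bisimplicial object, and by two-out-of-six
(`Contraction.weq_realisationAug`). The map `S A ⟶ E (R A)` is a weak equivalence if `A` is derived
(`Sect.weq_resolutionToExtension`): `y ⟶ F d` is an anchor map, and so `A (y)` is weakly equivalent
to the reindexing of `A (F d)`. Finally `E` preserves weak equivalences. The same construction for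
the identity of `D` gives a resolution `S' B ⟶ B` and a map `S' B ⟶ R (E B)`, compatible with the
previous maps if `B = R A`; the latter is not asserted to be a weak equivalence, nor `E B` to be
derived, in general.

*The formal argument.* These data form a `HomotopyExtension`. Restriction is faithful on
localisations since, for derived `A`, the zigzag `A ⟵ S A ⟶ E (R A)` identifies `E R` with the
inclusion of derived sections into all sections, and this inclusion is faithful on localisations.
It is full since an arrow `R A ⟶ R A'` of the localisation is a left fraction
`R A ⟶ B ⟵ R A'`; then `E B` is weakly equivalent to `E (R A')`, hence to `A'`, so is derived, and
applying `E` gives a preimage.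

Both steps use fractions, in the localisation of a full subcategory closed under weak equivalences.
A category of sections has homotopy pushouts, namely homotopy colimits over the interval
(`Sect.homotopyPushouts`), so modulo homotopy the weak equivalences admit a calculus of left
fractions (`HomotopyPushouts.hasLeftCalculusOfFractions`), and equality of fractions in the ambient
localisation is witnessed inside the subcategory (`HomotopyPushouts.map_eq_of_fullSubcategory`).
-/

set_option linter.unusedSectionVars false

namespace DerivedSections

open Limits

/-! ### Left fractions up to homotopy -/

section LeftFractions

variable {M : Type u₁} [Category.{v₁} M]

/-- A functorial cylinder together with homotopy pushouts along weak equivalences: every span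
`Y ⟵ X ⟶ Z` whose left leg is in `W` is completed to a square which commutes up to homotopy, whose
leg out of `Z` is in `W`, and which maps (weakly) to every strictly commutative square. -/
structure HomotopyPushouts (W : MorphismProperty M) where
  cyl : M → M
  i₀ (X : M) : X ⟶ cyl X
  i₁ (X : M) : X ⟶ cyl X
  π (X : M) : cyl X ⟶ X
  i₀_π (X : M) : i₀ X ≫ π X = 𝟙 X
  i₁_π (X : M) : i₁ X ≫ π X = 𝟙 X
  weq_π (X : M) : W (π X)
  exists_cylMap {X Y : M} (f : X ⟶ Y) :
    ∃ f' : cyl X ⟶ cyl Y, i₀ X ≫ f' = f ≫ i₀ Y ∧ i₁ X ≫ f' = f ≫ i₁ Y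
  exists_pushout {X Y Z : M} (f : X ⟶ Y) (g : X ⟶ Z) (hf : W f) :
    ∃ (P : M) (inl : Y ⟶ P) (inr : Z ⟶ P) (h : cyl X ⟶ P), W inr ∧
      i₀ X ≫ h = f ≫ inl ∧ i₁ X ≫ h = g ≫ inr ∧
      ∀ (T : M) (a : Y ⟶ T) (b : Z ⟶ T), f ≫ a = g ≫ b → ∃ d : P ⟶ T, inl ≫ d = a ∧ inr ≫ d = b

namespace HomotopyPushouts

variable {W : MorphismProperty M} (h : HomotopyPushouts W)

/-- Two arrows are homotopic if they extend to the functorial cylinder. -/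
def homotopic : HomRel M := fun X Y f g =>
  ∃ H : h.cyl X ⟶ Y, h.i₀ X ≫ H = f ∧ h.i₁ X ≫ H = g

instance : HomRel.IsStableUnderPrecomp h.homotopic where
  comp_left f g g' := by
    rintro ⟨H, rfl, rfl⟩
    obtain ⟨f', h₀, h₁⟩ := h.exists_cylMap f
    exact ⟨f' ≫ H, by rw [reassoc_of% h₀], by rw [reassoc_of% h₁]⟩

instance : HomRel.IsStableUnderPostcomp h.homotopic where
  comp_right g := by
    rintro ⟨H, rfl, rfl⟩
    exact ⟨H ≫ g, by simp, by simp⟩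

/-- The homotopy category. -/
abbrev HoCat := Quotient h.homotopic

/-- The quotient functor to the homotopy category. -/
abbrev toHoCat : M ⥤ h.HoCat := Quotient.functor h.homotopic

theorem toHoCat_map_eq_iff {X Y : M} (f g : X ⟶ Y) :
    h.toHoCat.map f = h.toHoCat.map g ↔ Relation.EqvGen (h.homotopic (X := X) (Y := Y)) f g := by
  have e : HomRel.CompClosure h.homotopic = h.homotopic := HomRel.compClosure_eq_self _
  refine (Quotient.functor_homRel_eq_compClosure_eqvGen h.homotopic f g).trans ?_
  rw [e]

theorem areEqualized : h.homotopic.FactorsThroughLocalization W := by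
  rintro X Y _ _ ⟨H, rfl, rfl⟩
  change W.Q.map _ = W.Q.map _
  rw [W.Q.map_comp, W.Q.map_comp]
  congr 1
  have : IsIso (W.Q.map (h.π X)) := Localization.inverts W.Q W _ (h.weq_π X)
  rw [← cancel_mono (W.Q.map (h.π X)), ← W.Q.map_comp, ← W.Q.map_comp, h.i₀_π, h.i₁_π]

theorem toHoCat_map_eq_of_homotopy {X Y : M} (H : h.cyl X ⟶ Y) :
    h.toHoCat.map (h.i₀ X ≫ H) = h.toHoCat.map (h.i₁ X ≫ H) :=
  CategoryTheory.Quotient.sound _ ⟨H, rfl, rfl⟩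

variable [W.IsMultiplicative] [W.HasTwoOutOfThreeProperty]

/-- Arrows related by a chain of homotopies are related by a single homotopy, for some not
necessarily functorial cylinder: consecutive cylinders are glued along their ends. -/
theorem exists_cylinder {X Y : M} {f g : X ⟶ Y}
    (hfg : Relation.EqvGen (h.homotopic (X := X) (Y := Y)) f g) :
    ∃ (C : M) (p : C ⟶ X) (j₀ j₁ : X ⟶ C) (H : C ⟶ Y), W p ∧ j₀ ≫ p = 𝟙 X ∧ j₁ ≫ p = 𝟙 X ∧
      j₀ ≫ H = f ∧ j₁ ≫ H = g := by
  induction hfg with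
  | rel f g hfg =>
    obtain ⟨H, rfl, rfl⟩ := hfg
    exact ⟨_, h.π X, h.i₀ X, h.i₁ X, H, h.weq_π X, h.i₀_π X, h.i₁_π X, rfl, rfl⟩
  | refl f =>
    exact ⟨X, 𝟙 X, 𝟙 X, 𝟙 X, f, W.id_mem X, by simp, by simp, by simp, by simp⟩
  | symm f g _ ih =>
    obtain ⟨C, p, j₀, j₁, H, hp, h₀, h₁, h₂, h₃⟩ := ih
    exact ⟨C, p, j₁, j₀, H, hp, h₁, h₀, h₃, h₂⟩
  | trans f g k _ _ ih ih' =>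
    obtain ⟨C, p, j₀, j₁, H, hp, h₀, h₁, h₂, h₃⟩ := ih
    obtain ⟨C', p', j₀', j₁', H', hp', h₀', h₁', h₂', h₃'⟩ := ih'
    have hj₁ : W j₁ := W.of_postcomp _ _ hp (by rw [h₁]; exact W.id_mem X)
    obtain ⟨P, inl, inr, -, hinr, -, -, hP⟩ := h.exists_pushout j₁ j₀' hj₁
    obtain ⟨q, hq, hq'⟩ := hP X p p' (by rw [h₁, h₀'])
    obtain ⟨K, hK, hK'⟩ := hP Y H H' (by rw [h₃, h₂'])
    refine ⟨P, q, j₀ ≫ inl, j₁' ≫ inr, K, W.of_precomp _ _ hinr (by rw [hq']; exact hp'), ?_, ?_,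
      ?_, ?_⟩
    · rw [Category.assoc, hq, h₀]
    · rw [Category.assoc, hq', h₁']
    · rw [Category.assoc, hK, h₂]
    · rw [Category.assoc, hK', h₃']

/-- The classes of weak equivalences in the homotopy category. -/
def weqHoCat : MorphismProperty h.HoCat := fun X Y f =>
  ∃ g : X.as ⟶ Y.as, W g ∧ h.toHoCat.map g = f

theorem weq_of_toHoCat_map_eq {X Y : M} {f g : X ⟶ Y} (hf : W f)
    (hfg : h.toHoCat.map f = h.toHoCat.map g) : W g := by
  obtain ⟨C, p, j₀, j₁, H, hp, h₀, h₁, rfl, rfl⟩ :=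
    h.exists_cylinder ((h.toHoCat_map_eq_iff f g).1 hfg)
  have hj₀ : W j₀ := W.of_postcomp _ _ hp (by rw [h₀]; exact W.id_mem X)
  have hj₁ : W j₁ := W.of_postcomp _ _ hp (by rw [h₁]; exact W.id_mem X)
  exact W.comp_mem _ _ hj₁ (W.of_precomp _ _ hj₀ hf)

theorem weq_eq_inverseImage : W = h.weqHoCat.inverseImage h.toHoCat := by
  ext X Y f
  exact ⟨fun hf => ⟨f, hf, rfl⟩, fun ⟨g, hg, e⟩ => h.weq_of_toHoCat_map_eq hg e⟩

/-- Ore squares are homotopy pushouts. If `f₁` and `f₂` have homotopic composites with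
a weak equivalence `s : X ⟶ Y`, a copy of `Y` is glued along `s` to each end of the cylinder carrying
the homotopy; the result is equivalent to `Y`, and an Ore square for it coequalises `f₁` and `f₂`. -/
instance hasLeftCalculusOfFractions : h.weqHoCat.HasLeftCalculusOfFractions where
  id_mem X := ⟨𝟙 X.as, W.id_mem _, h.toHoCat.map_id _⟩
  comp_mem := by
    rintro X Y Z _ _ ⟨f, hf, rfl⟩ ⟨g, hg, rfl⟩
    exact ⟨f ≫ g, W.comp_mem _ _ hf hg, h.toHoCat.map_comp _ _⟩
  exists_leftFraction := by
    rintro ⟨X⟩ ⟨Y⟩ @⟨⟨X'⟩, _, ⟨t, ht, rfl⟩, f⟩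
    change X' ⟶ X at t
    obtain ⟨g, rfl⟩ := h.toHoCat.map_surjective f
    obtain ⟨P, inl, inr, H, hinr, h₀, h₁, -⟩ := h.exists_pushout t g ht
    refine ⟨⟨h.toHoCat.map inl, h.toHoCat.map inr, ⟨inr, hinr, rfl⟩⟩, ?_⟩
    have := h.toHoCat_map_eq_of_homotopy H
    rw [h₀, h₁, h.toHoCat.map_comp, h.toHoCat.map_comp] at this
    exact this.symm
  ext := by
    rintro ⟨X⟩ ⟨Y⟩ ⟨Z⟩ f₁ f₂ _ ⟨s, hs, rfl⟩ e
    obtain ⟨f₁, rfl⟩ := h.toHoCat.map_surjective f₁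
    obtain ⟨f₂, rfl⟩ := h.toHoCat.map_surjective f₂
    change X ⟶ Y at s
    change Y ⟶ Z at f₁ f₂
    have e : h.toHoCat.map (s ≫ f₁) = h.toHoCat.map (s ≫ f₂) := by
      rw [h.toHoCat.map_comp, h.toHoCat.map_comp]; exact e
    obtain ⟨C, p, j₀, j₁, H, hp, h₀, h₁, h₂, h₃⟩ :=
      h.exists_cylinder ((h.toHoCat_map_eq_iff _ _).1 e)
    -- `K` is the cylinder `C` with a copy of `Y` glued at each end; it maps to `Z` by `f₁`, the
    -- homotopy and `f₂`, and it is weakly equivalent to `Y`.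
    obtain ⟨K₁, l₁, r₁, -, hr₁, -, -, hK₁⟩ := h.exists_pushout s j₀ hs
    obtain ⟨d₁, hd₁, hd₁'⟩ := hK₁ Z f₁ H h₂.symm
    obtain ⟨e₁, he₁, he₁'⟩ := hK₁ Y (𝟙 Y) (p ≫ s) (by rw [reassoc_of% h₀, Category.comp_id])
    obtain ⟨K, l₂, r₂, -, hr₂, -, -, hK⟩ := h.exists_pushout s (j₁ ≫ r₁) hs
    obtain ⟨d₂, hd₂, hd₂'⟩ := hK Z f₂ d₁ (by rw [Category.assoc, hd₁', h₃])
    obtain ⟨e₂, he₂, he₂'⟩ := hK Y (𝟙 Y) e₁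
      (by rw [Category.assoc, he₁', reassoc_of% h₁, Category.comp_id])
    have hwe₁ : W e₁ := W.of_precomp _ _ hr₁ (by rw [he₁']; exact W.comp_mem _ _ hp hs)
    have hwe₂ : W e₂ := W.of_precomp _ _ hr₂ (by rw [he₂']; exact hwe₁)
    obtain ⟨Z', l₃, r₃, G, hr₃, g₀, g₁, -⟩ := h.exists_pushout e₂ d₂ hwe₂
    have key : h.toHoCat.map (e₂ ≫ l₃) = h.toHoCat.map (d₂ ≫ r₃) := by
      rw [← g₀, ← g₁]; exact h.toHoCat_map_eq_of_homotopy G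
    refine ⟨⟨Z'⟩, h.toHoCat.map r₃, ⟨r₃, hr₃, rfl⟩, ?_⟩
    have a₁ : h.toHoCat.map (f₁ ≫ r₃) = h.toHoCat.map l₃ := by
      have : f₁ ≫ r₃ = (l₁ ≫ r₂) ≫ (d₂ ≫ r₃) := by simp [reassoc_of% hd₂', reassoc_of% hd₁]
      rw [this, h.toHoCat.map_comp, ← key, ← h.toHoCat.map_comp, Category.assoc, reassoc_of% he₂',
        reassoc_of% he₁]
    have a₂ : h.toHoCat.map (f₂ ≫ r₃) = h.toHoCat.map l₃ := by
      have : f₂ ≫ r₃ = l₂ ≫ (d₂ ≫ r₃) := by simp [reassoc_of% hd₂]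
      rw [this, h.toHoCat.map_comp, ← key, ← h.toHoCat.map_comp, reassoc_of% he₂]
    rw [← h.toHoCat.map_comp, ← h.toHoCat.map_comp, a₁, a₂]

instance isLocalization : (h.toHoCat ⋙ h.weqHoCat.Q).IsLocalization W :=
  Functor.IsLocalization.mk' _ _
    (h.areEqualized.strictUniversalPropertyFixedTarget' h.weq_eq_inverseImage _)
    (h.areEqualized.strictUniversalPropertyFixedTarget' h.weq_eq_inverseImage _)

include h in
/-- Every arrow of the localisation is a left fraction. -/
theorem exists_fraction {X Y : M} (φ : W.Q.obj X ⟶ W.Q.obj Y) :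
    ∃ (P : M) (f : X ⟶ P) (s : Y ⟶ P), W s ∧ φ ≫ W.Q.map s = W.Q.map f := by
  let L := h.toHoCat ⋙ h.weqHoCat.Q
  let E := Localization.uniq W.Q L W
  let e : W.Q ⋙ E.functor ≅ L := Localization.compUniqFunctor _ _ _
  obtain ⟨@⟨⟨P⟩, f, _, ⟨s, hs, rfl⟩⟩, e₂⟩ :=
    Localization.exists_leftFraction h.weqHoCat.Q h.weqHoCat
      (X := h.toHoCat.obj X) (Y := h.toHoCat.obj Y) (e.inv.app X ≫ E.functor.map φ ≫ e.hom.app Y)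
  obtain ⟨f, rfl⟩ := h.toHoCat.map_surjective f
  change X ⟶ P at f
  change Y ⟶ P at s
  refine ⟨P, f, s, hs, E.functor.map_injective ?_⟩
  have e₃ := congrArg (· ≫ L.map s) e₂
  dsimp only at e₃
  rw [show L.map s = h.weqHoCat.Q.map (h.toHoCat.map s) from rfl] at e₃
  erw [MorphismProperty.LeftFraction.map_comp_map_s] at e₃
  have n₁ := e.hom.naturality s
  have n₂ := e.hom.naturality f
  rw [← cancel_mono (e.hom.app P), ← cancel_epi (e.inv.app X), E.functor.map_comp]
  have n₁' : E.functor.map (W.Q.map s) ≫ e.hom.app P = e.hom.app Y ≫ L.map s := n₁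
  have n₂' : E.functor.map (W.Q.map f) ≫ e.hom.app P = e.hom.app X ≫ L.map f := n₂
  rw [n₂', e.inv_hom_id_app_assoc, Category.assoc, n₁']
  rw [Category.assoc, Category.assoc] at e₃
  exact e₃

/-- Two left fractions which agree in the localisation become homotopic after a common
extension. -/
theorem exists_extension_of_fraction_eq {X Y P P' : M} {f : X ⟶ P} {s : Y ⟶ P} {f' : X ⟶ P'}
    {s' : Y ⟶ P'} (hs : W s) (hs' : W s') (φ : W.Q.obj X ⟶ W.Q.obj Y)
    (e : φ ≫ W.Q.map s = W.Q.map f) (e' : φ ≫ W.Q.map s' = W.Q.map f') :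
    ∃ (R : M) (t : P ⟶ R) (t' : P' ⟶ R), W (s ≫ t) ∧
      Relation.EqvGen (h.homotopic (X := Y) (Y := R)) (s ≫ t) (s' ≫ t') ∧
      Relation.EqvGen (h.homotopic (X := X) (Y := R)) (f ≫ t) (f' ≫ t') := by
  let L := h.toHoCat ⋙ h.weqHoCat.Q
  let K : W.Localization ⥤ h.weqHoCat.Localization :=
    Localization.lift L (Localization.inverts L W) W.Q
  let κ : W.Q ⋙ K ≅ L := Localization.fac _ _ _
  let z : h.weqHoCat.LeftFraction (h.toHoCat.obj X) (h.toHoCat.obj Y) :=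
    ⟨h.toHoCat.map f, h.toHoCat.map s, ⟨s, hs, rfl⟩⟩
  let z' : h.weqHoCat.LeftFraction (h.toHoCat.obj X) (h.toHoCat.obj Y) :=
    ⟨h.toHoCat.map f', h.toHoCat.map s', ⟨s', hs', rfl⟩⟩
  have key : ∀ {P : M} (f : X ⟶ P) (s : Y ⟶ P) (hs : W s), φ ≫ W.Q.map s = W.Q.map f →
      κ.inv.app X ≫ K.map φ ≫ κ.hom.app Y = MorphismProperty.LeftFraction.map
        (⟨h.toHoCat.map f, h.toHoCat.map s, ⟨s, hs, rfl⟩⟩ :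
          h.weqHoCat.LeftFraction (h.toHoCat.obj X) (h.toHoCat.obj Y))
        h.weqHoCat.Q (Localization.inverts _ _) := by
    intro P f s hs e
    have : IsIso (L.map s) := Localization.inverts L W _ hs
    rw [← cancel_mono (L.map s)]
    refine Eq.trans ?_ (MorphismProperty.LeftFraction.map_comp_map_s
      (⟨h.toHoCat.map f, h.toHoCat.map s, ⟨s, hs, rfl⟩⟩ :
          h.weqHoCat.LeftFraction (h.toHoCat.obj X) (h.toHoCat.obj Y)) h.weqHoCat.Q
        (Localization.inverts _ _)).symm
    have n₁ : K.map (W.Q.map s) ≫ κ.hom.app P = κ.hom.app Y ≫ L.map s := κ.hom.naturality s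
    have n₂ : K.map (W.Q.map f) ≫ κ.hom.app P = κ.hom.app X ≫ L.map f := κ.hom.naturality f
    rw [Category.assoc, Category.assoc, ← n₁, ← K.map_comp_assoc, e, n₂,
      κ.inv_hom_id_app_assoc]
    rfl
  have hz := (MorphismProperty.LeftFraction.map_eq_iff h.weqHoCat.Q h.weqHoCat z z').1
    ((key f s hs e).symm.trans (key f' s' hs' e'))
  obtain ⟨⟨R⟩, t, t', h₁, h₂, ⟨g, hg, h₃⟩⟩ := hz
  obtain ⟨t, rfl⟩ := h.toHoCat.map_surjective t
  obtain ⟨t', rfl⟩ := h.toHoCat.map_surjective t'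
  change P ⟶ R at t
  change P' ⟶ R at t'
  refine ⟨R, t, t', ?_, ?_, ?_⟩
  · refine h.weq_of_toHoCat_map_eq hg ?_
    rw [h.toHoCat.map_comp]
    exact h₃
  · rw [← toHoCat_map_eq_iff, h.toHoCat.map_comp, h.toHoCat.map_comp]
    exact h₁
  · rw [← toHoCat_map_eq_iff, h.toHoCat.map_comp, h.toHoCat.map_comp]
    exact h₂

/-! ### Full subcategories closed under weak equivalences -/

variable {P : ObjectProperty M} (hP : ∀ {X Y : M} (f : X ⟶ Y), W f → (P X ↔ P Y))

/-- The restriction to a full subcategory which is closed under weak equivalences. -/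
def fullSubcategory : HomotopyPushouts (W.inverseImage P.ι) where
  cyl X := ⟨h.cyl X.obj, (hP _ (h.weq_π X.obj)).2 X.property⟩
  i₀ X := ObjectProperty.homMk (h.i₀ X.obj)
  i₁ X := ObjectProperty.homMk (h.i₁ X.obj)
  π X := ObjectProperty.homMk (h.π X.obj)
  i₀_π X := by ext; exact h.i₀_π X.obj
  i₁_π X := by ext; exact h.i₁_π X.obj
  weq_π X := h.weq_π X.obj
  exists_cylMap f := by
    obtain ⟨f', h₀, h₁⟩ := h.exists_cylMap f.hom
    exact ⟨ObjectProperty.homMk f', by ext; exact h₀, by ext; exact h₁⟩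
  exists_pushout {X Y Z} f g hf := by
    obtain ⟨Q, inl, inr, H, hinr, h₀, h₁, hQ⟩ := h.exists_pushout f.hom g.hom hf
    refine ⟨⟨Q, (hP _ hinr).1 Z.property⟩, ObjectProperty.homMk inl, ObjectProperty.homMk inr,
      ObjectProperty.homMk H, hinr, by ext; exact h₀, by ext; exact h₁, ?_⟩
    intro T a b e
    obtain ⟨d, hd, hd'⟩ := hQ T.obj a.hom b.hom (congrArg InducedCategory.Hom.hom e)
    exact ⟨ObjectProperty.homMk d, by ext; exact hd, by ext; exact hd'⟩

include h hP in
/-- The localisation of a full subcategory closed under weak equivalences embeds faithfully in the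
localisation of the ambient category, stated for left fractions. -/
theorem map_eq_of_fullSubcategory {X Y : P.FullSubcategory}
    (φ ψ : (W.inverseImage P.ι).Q.obj X ⟶ (W.inverseImage P.ι).Q.obj Y)
    (K : (W.inverseImage P.ι).Localization ⥤ W.Localization)
    (κ : (W.inverseImage P.ι).Q ⋙ K ≅ P.ι ⋙ W.Q) (e : K.map φ = K.map ψ) : φ = ψ := by
  have : (W.inverseImage P.ι).IsMultiplicative := inferInstance
  have : (W.inverseImage P.ι).HasTwoOutOfThreeProperty := inferInstance
  let h' := h.fullSubcategory hP
  obtain ⟨R, f, s, hs, e₁⟩ := h'.exists_fraction φ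
  obtain ⟨R', f', s', hs', e₂⟩ := h'.exists_fraction ψ
  have key : ∀ {R : P.FullSubcategory} (f : X ⟶ R) (s : Y ⟶ R)
      (φ : (W.inverseImage P.ι).Q.obj X ⟶ (W.inverseImage P.ι).Q.obj Y),
      φ ≫ (W.inverseImage P.ι).Q.map s = (W.inverseImage P.ι).Q.map f →
      (κ.inv.app X ≫ K.map φ ≫ κ.hom.app Y) ≫ W.Q.map s.hom = W.Q.map f.hom := by
    intro R f s φ e
    have n₁ : K.map ((W.inverseImage P.ι).Q.map s) ≫ κ.hom.app R = κ.hom.app Y ≫ W.Q.map s.hom :=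
      κ.hom.naturality s
    have n₂ : K.map ((W.inverseImage P.ι).Q.map f) ≫ κ.hom.app R = κ.hom.app X ≫ W.Q.map f.hom :=
      κ.hom.naturality f
    rw [Category.assoc, Category.assoc, ← n₁, ← K.map_comp_assoc, e, n₂, κ.inv_hom_id_app_assoc]
  obtain ⟨T, t, t', hT, h₁, h₂⟩ := h.exists_extension_of_fraction_eq (f := f.hom) (s := s.hom)
    (f' := f'.hom) (s' := s'.hom) hs hs' _ (key f s φ e₁) (by rw [e]; exact key f' s' ψ e₂)
  -- `T` is weakly equivalent to `Y`, so it has property `P` and the homotopies with target `T` exist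
  -- in the full subcategory.
  let T' : P.FullSubcategory := ⟨T, (hP _ hT).1 Y.property⟩
  let τ : R ⟶ T' := ObjectProperty.homMk t
  let τ' : R' ⟶ T' := ObjectProperty.homMk t'
  have lift : ∀ {Z : P.FullSubcategory} (a b : Z.obj ⟶ T),
      Relation.EqvGen (h.homotopic (X := Z.obj) (Y := T)) a b →
      (W.inverseImage P.ι).Q.map (ObjectProperty.homMk a : Z ⟶ T') =
        (W.inverseImage P.ι).Q.map (ObjectProperty.homMk b : Z ⟶ T') := by
    intro Z a b hab
    induction hab with
    | rel a b hab =>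
      obtain ⟨H, rfl, rfl⟩ := hab
      exact h'.areEqualized ⟨ObjectProperty.homMk H, rfl, rfl⟩
    | refl a => rfl
    | symm a b _ ih => exact ih.symm
    | trans a b c _ _ ih ih' => exact ih.trans ih'
  have h₁' : (W.inverseImage P.ι).Q.map (s ≫ τ) = (W.inverseImage P.ι).Q.map (s' ≫ τ') :=
    lift _ _ h₁
  have h₂' : (W.inverseImage P.ι).Q.map (f ≫ τ) = (W.inverseImage P.ι).Q.map (f' ≫ τ') :=
    lift _ _ h₂
  have : IsIso ((W.inverseImage P.ι).Q.map (s ≫ τ)) :=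
    Localization.inverts (W.inverseImage P.ι).Q (W.inverseImage P.ι) _ hT
  rw [← cancel_mono ((W.inverseImage P.ι).Q.map (s ≫ τ))]
  conv_rhs => rw [h₁']
  rw [Functor.map_comp, Functor.map_comp, reassoc_of% e₁, reassoc_of% e₂, ← Functor.map_comp, h₂',
    Functor.map_comp]

end HomotopyPushouts

end LeftFractions

/-! ### Realisations of simplicial objects -/

section RealisationApi

variable {N : Type u₁} [Category.{v₁} N] (T : DeltaStructure N)

namespace DeltaStructure

/-- The collapse `Δⁿ ⊗ x ⟶ x`. -/
def collapse (n : SimplexCategory) (x : N) : (T.tensor.obj n).obj x ⟶ x :=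
  (T.tensor.map (SimplexCategory.isTerminalZero.from n)).app x ≫ T.unit.hom.app x

theorem collapse_natural (n : SimplexCategory) {x y : N} (f : x ⟶ y) :
    (T.tensor.obj n).map f ≫ T.collapse n y = T.collapse n x ≫ f := by
  simp [collapse]

theorem map_collapse {n m : SimplexCategory} (θ : n ⟶ m) (x : N) :
    (T.tensor.map θ).app x ≫ T.collapse m x = T.collapse n x := by
  rw [collapse, collapse, ← Category.assoc, ← NatTrans.comp_app, ← T.tensor.map_comp]
  congr 3

variable [HasColimitsOfSize.{0, 0} N]

/-- The canonical map `Δⁿ ⊗ Xₙ ⟶ |X|`. -/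
noncomputable def realisationι (X : SimplexCategoryᵒᵖ ⥤ N) (n : SimplexCategory) :
    (T.tensor.obj n).obj (X.obj (op n)) ⟶ T.realisation.obj X :=
  coend.ι (X ⋙ T.tensor.flip) n

theorem realisation_condition (X : SimplexCategoryᵒᵖ ⥤ N) {n m : SimplexCategory} (θ : n ⟶ m) :
    (T.tensor.obj n).map (X.map θ.op) ≫ T.realisationι X n =
      (T.tensor.map θ).app (X.obj (op m)) ≫ T.realisationι X m :=
  coend.condition (X ⋙ T.tensor.flip) θ

/-- The universal property of the realisation. -/
noncomputable def realisationDesc (X : SimplexCategoryᵒᵖ ⥤ N) {z : N}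
    (g : ∀ n, (T.tensor.obj n).obj (X.obj (op n)) ⟶ z)
    (hg : ∀ ⦃n m : SimplexCategory⦄ (θ : n ⟶ m), (T.tensor.obj n).map (X.map θ.op) ≫ g n =
      (T.tensor.map θ).app (X.obj (op m)) ≫ g m) : T.realisation.obj X ⟶ z :=
  coend.desc (F := X ⋙ T.tensor.flip) g (fun _ _ θ => hg θ)

@[simp]
theorem realisationι_desc (X : SimplexCategoryᵒᵖ ⥤ N) {z : N}
    (g : ∀ n, (T.tensor.obj n).obj (X.obj (op n)) ⟶ z)
    (hg : ∀ ⦃n m : SimplexCategory⦄ (θ : n ⟶ m), (T.tensor.obj n).map (X.map θ.op) ≫ g n =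
      (T.tensor.map θ).app (X.obj (op m)) ≫ g m) (n : SimplexCategory) :
    T.realisationι X n ≫ T.realisationDesc X g hg = g n :=
  coend.ι_desc (F := X ⋙ T.tensor.flip) _ _ _

theorem realisation_hom_ext {X : SimplexCategoryᵒᵖ ⥤ N} {z : N} {f g : T.realisation.obj X ⟶ z}
    (h : ∀ n, T.realisationι X n ≫ f = T.realisationι X n ≫ g) : f = g :=
  coend.hom_ext (F := X ⋙ T.tensor.flip) h

@[simp]
theorem realisationι_map {X Y : SimplexCategoryᵒᵖ ⥤ N} (φ : X ⟶ Y) (n : SimplexCategory) :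
    T.realisationι X n ≫ T.realisation.map φ =
      (T.tensor.obj n).map (φ.app (op n)) ≫ T.realisationι Y n :=
  coend.ι_map (F := X ⋙ T.tensor.flip) (F' := Y ⋙ T.tensor.flip)
    (Functor.whiskerRight φ T.tensor.flip) n

theorem realisationAug_condition {X : SimplexCategoryᵒᵖ ⥤ N} {x : N}
    (a : X ⟶ (Functor.const _).obj x) ⦃n m : SimplexCategory⦄ (θ : n ⟶ m) :
    (T.tensor.obj n).map (X.map θ.op) ≫ (T.tensor.obj n).map (a.app (op n)) ≫ T.collapse n x =
      (T.tensor.map θ).app (X.obj (op m)) ≫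
        (T.tensor.obj m).map (a.app (op m)) ≫ T.collapse m x := by
  have h : X.map θ.op ≫ a.app (op n) = a.app (op m) :=
    (a.naturality θ.op).trans (Category.comp_id _)
  rw [← Functor.map_comp_assoc, h, ← NatTrans.naturality_assoc]
  exact congrArg _ (T.map_collapse θ x).symm

/-- The map from the realisation of an augmented simplicial object to the augmentation. -/
noncomputable def realisationAug {X : SimplexCategoryᵒᵖ ⥤ N} {x : N}
    (a : X ⟶ (Functor.const _).obj x) : T.realisation.obj X ⟶ x :=
  T.realisationDesc X (fun n => (T.tensor.obj n).map (a.app (op n)) ≫ T.collapse n x)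
    (T.realisationAug_condition a)

@[simp]
theorem realisationι_aug {X : SimplexCategoryᵒᵖ ⥤ N} {x : N}
    (a : X ⟶ (Functor.const _).obj x) (n : SimplexCategory) :
    T.realisationι X n ≫ T.realisationAug a =
      (T.tensor.obj n).map (a.app (op n)) ≫ T.collapse n x :=
  T.realisationι_desc _ _ (T.realisationAug_condition a) _

theorem realisation_map_aug {X Y : SimplexCategoryᵒᵖ ⥤ N} {x : N} (φ : X ⟶ Y)
    (a : Y ⟶ (Functor.const _).obj x) :
    T.realisation.map φ ≫ T.realisationAug a = T.realisationAug (φ ≫ a) := by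
  refine T.realisation_hom_ext (fun n => ?_)
  rw [← Category.assoc, realisationι_map, Category.assoc, realisationι_aug, realisationι_aug]
  simp

variable [HasColimitsOfSize.{0, u} N] [HasCoproducts.{u} N]

theorem ssetTensor_hom_ext {S : SSet.{u}} {x y : N} {f g : T.ssetTensor S x ⟶ y}
    (h : ∀ (n : SimplexCategory) (s : S.obj (op n)),
      T.ssetTensorι S x s ≫ f = T.ssetTensorι S x s ≫ g) : f = g :=
  colimit.hom_ext (fun e => h e.unop.1.unop e.unop.2)

/-! ### Coproducts and tensors -/

section Preserves

variable [∀ n, PreservesColimitsOfSize.{u, u} (T.tensor.obj n)]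

/-- Maps out of `Δⁿ ⊗ ∐ A`. -/
noncomputable def tensorSigmaDesc (n : SimplexCategory) {J : Type u} (A : J → N) {z : N}
    (g : ∀ j, (T.tensor.obj n).obj (A j) ⟶ z) : (T.tensor.obj n).obj (∐ A) ⟶ z :=
  Cofan.IsColimit.desc (isColimitOfHasCoproductOfPreservesColimit (T.tensor.obj n) A) g

@[simp]
theorem tensorSigmaι_desc (n : SimplexCategory) {J : Type u} (A : J → N) {z : N}
    (g : ∀ j, (T.tensor.obj n).obj (A j) ⟶ z) (j : J) :
    (T.tensor.obj n).map (Sigma.ι A j) ≫ T.tensorSigmaDesc n A g = g j :=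
  Cofan.IsColimit.fac (isColimitOfHasCoproductOfPreservesColimit (T.tensor.obj n) A) g j

theorem tensorSigma_hom_ext {n : SimplexCategory} {J : Type u} {A : J → N} {z : N}
    {f g : (T.tensor.obj n).obj (∐ A) ⟶ z}
    (h : ∀ j, (T.tensor.obj n).map (Sigma.ι A j) ≫ f = (T.tensor.obj n).map (Sigma.ι A j) ≫ g) :
    f = g :=
  Cofan.IsColimit.hom_ext (isColimitOfHasCoproductOfPreservesColimit (T.tensor.obj n) A) _ _ h

end Preserves

end DeltaStructure

/-! ### Copowers by simplicial sets -/

section Copower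

variable [HasCoproducts.{u} N]

/-- The simplicial object `n ↦ ∐_{s ∈ Sₙ} z`. -/
noncomputable abbrev constCopower (S : SSet.{u}) (z : N) : SimplexCategoryᵒᵖ ⥤ N :=
  S ⋙ sigmaConst.obj z

/-- The codiagonal `∐_{s ∈ Sₙ} z ⟶ z`. -/
noncomputable def constCopowerAug (S : SSet.{u}) (z : N) :
    constCopower S z ⟶ (Functor.const _).obj z where
  app n := Sigma.desc (fun _ => 𝟙 z)
  naturality n m α := by
    apply Sigma.hom_ext
    intro s
    simp

/-- The bisimplicial object `(n, m) ↦ ∐_{s ∈ Sₘ} Yₙ`. -/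
noncomputable def bisimplicialCopower (S : SSet.{u}) (Y : SimplexCategoryᵒᵖ ⥤ N) :
    SimplexCategoryᵒᵖ × SimplexCategoryᵒᵖ ⥤ N :=
  (Y.prod S) ⋙ Functor.uncurry.obj sigmaConst

/-- The simplicial object `n ↦ ∐_{s ∈ Sₙ} Yₙ`. -/
noncomputable def copower (S : SSet.{u}) (Y : SimplexCategoryᵒᵖ ⥤ N) : SimplexCategoryᵒᵖ ⥤ N :=
  Functor.diag _ ⋙ bisimplicialCopower S Y

/-- The inclusion of a summand. -/
noncomputable def bisimplicialCopowerι (S : SSet.{u}) (Y : SimplexCategoryᵒᵖ ⥤ N)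
    (n m : SimplexCategoryᵒᵖ) (s : S.obj m) :
    Y.obj n ⟶ (bisimplicialCopower S Y).obj (n, m) :=
  Sigma.ι (fun _ : S.obj m => Y.obj n) s

theorem bisimplicialCopowerι_map (S : SSet.{u}) (Y : SimplexCategoryᵒᵖ ⥤ N)
    {n m n' m' : SimplexCategoryᵒᵖ} (α : n ⟶ n') (β : m ⟶ m') (s : S.obj m) :
    bisimplicialCopowerι S Y n m s ≫
      (bisimplicialCopower S Y).map ((α, β) : (n, m) ⟶ (n', m')) =
      Y.map α ≫ bisimplicialCopowerι S Y n' m' (S.map β s) := by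
  simp [bisimplicialCopowerι, bisimplicialCopower]

theorem bisimplicialCopower_hom_ext {S : SSet.{u}} {Y : SimplexCategoryᵒᵖ ⥤ N}
    {n m : SimplexCategoryᵒᵖ} {z : N} {f g : (bisimplicialCopower S Y).obj (n, m) ⟶ z}
    (h : ∀ s, bisimplicialCopowerι S Y n m s ≫ f = bisimplicialCopowerι S Y n m s ≫ g) : f = g :=
  Sigma.hom_ext _ _ h

/-- The codiagonal `∐_{s ∈ Sₘ} Yₙ ⟶ Yₙ`. -/
noncomputable def bisimplicialCopowerProj (S : SSet.{u}) (Y : SimplexCategoryᵒᵖ ⥤ N)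
    (n m : SimplexCategoryᵒᵖ) : (bisimplicialCopower S Y).obj (n, m) ⟶ Y.obj n :=
  Sigma.desc (fun _ => 𝟙 (Y.obj n))

@[simp]
theorem bisimplicialCopowerι_proj (S : SSet.{u}) (Y : SimplexCategoryᵒᵖ ⥤ N)
    (n m : SimplexCategoryᵒᵖ) (s : S.obj m) :
    bisimplicialCopowerι S Y n m s ≫ bisimplicialCopowerProj S Y n m = 𝟙 _ :=
  Sigma.ι_desc _ _

theorem bisimplicialCopower_map_proj (S : SSet.{u}) (Y : SimplexCategoryᵒᵖ ⥤ N)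
    {n m n' m' : SimplexCategoryᵒᵖ} (α : n ⟶ n') (β : m ⟶ m') :
    (bisimplicialCopower S Y).map ((α, β) : (n, m) ⟶ (n', m')) ≫
      bisimplicialCopowerProj S Y n' m' = bisimplicialCopowerProj S Y n m ≫ Y.map α := by
  refine bisimplicialCopower_hom_ext (fun s => ?_)
  rw [← Category.assoc, bisimplicialCopowerι_map, Category.assoc, bisimplicialCopowerι_proj,
    ← Category.assoc, bisimplicialCopowerι_proj, Category.comp_id, Category.id_comp]

/-- The projection of the copower. -/
noncomputable def copowerProj (S : SSet.{u}) (Y : SimplexCategoryᵒᵖ ⥤ N) : copower S Y ⟶ Y where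
  app n := bisimplicialCopowerProj S Y n n
  naturality _ _ α := bisimplicialCopower_map_proj S Y α α

/-- The inclusion of `Y` in its copower given by a vertex. -/
noncomputable def copowerVertex (S : SSet.{u}) (Y : SimplexCategoryᵒᵖ ⥤ N) (v : S.obj (op ⦋0⦌)) :
    Y ⟶ copower S Y where
  app n := bisimplicialCopowerι S Y n n
    (S.map (SimplexCategory.isTerminalZero.from n.unop).op v)
  naturality n m α := by
    change _ = _ ≫ (bisimplicialCopower S Y).map ((α, α) : (n, n) ⟶ (m, m))
    rw [bisimplicialCopowerι_map]
    congr 2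
    rw [← ConcreteCategory.comp_apply, ← S.map_comp]
    congr 2

theorem copowerVertex_proj (S : SSet.{u}) (Y : SimplexCategoryᵒᵖ ⥤ N) (v : S.obj (op ⦋0⦌)) :
    copowerVertex S Y v ≫ copowerProj S Y = 𝟙 Y := by
  ext n
  exact bisimplicialCopowerι_proj _ _ _ _ _

end Copower

/-! ### Simplicial objects with coefficients -/

section SigmaObj

variable [HasCoproducts.{u} N]

/-- The arrow `s ⟶ α^* s` in the category of simplices. -/
def simplexArrow (S : SSet.{u}) {n m : SimplexCategoryᵒᵖ} (α : n ⟶ m) (s : S.obj n) :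
    S.elementsMk n s ⟶ S.elementsMk m (S.map α s) :=
  CategoryOfElements.homMk (S.elementsMk n s) (S.elementsMk m (S.map α s)) α rfl

theorem sigma_ι_congr {S : SSet.{u}} (G : S.Elements ⥤ N) {σ : S.Elements}
    {m : SimplexCategoryᵒᵖ} {t t' : S.obj m} (e : σ ⟶ S.elementsMk m t) (e' : σ ⟶ S.elementsMk m t')
    (h : e.1 = e'.1) :
    G.map e ≫ Sigma.ι (fun s : S.obj m => G.obj (S.elementsMk m s)) t =
      G.map e' ≫ Sigma.ι (fun s : S.obj m => G.obj (S.elementsMk m s)) t' := by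
  obtain rfl : t = t' := by
    have h₁ : S.map e.1 σ.2 = t := e.2
    have h₂ : S.map e'.1 σ.2 = t' := e'.2
    rw [← h₁, ← h₂, h]
  obtain rfl : e = e' := CategoryOfElements.ext _ _ _ h
  rfl

/-- The simplicial object `n ↦ ∐_{s ∈ Sₙ} G(s)`. -/
noncomputable def sigmaObj (S : SSet.{u}) (G : S.Elements ⥤ N) : SimplexCategoryᵒᵖ ⥤ N where
  obj n := ∐ fun s : S.obj n => G.obj (S.elementsMk n s)
  map {n m} α := Sigma.desc fun s => G.map (simplexArrow S α s) ≫
    Sigma.ι (fun s : S.obj m => G.obj (S.elementsMk m s)) (S.map α s)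
  map_id n := by
    apply Sigma.hom_ext
    intro s
    rw [Sigma.ι_desc, Category.comp_id]
    refine (sigma_ι_congr G (simplexArrow S (𝟙 n) s) (𝟙 (S.elementsMk n s)) rfl).trans ?_
    rw [G.map_id, Category.id_comp]
  map_comp {n m k} α β := by
    apply Sigma.hom_ext
    intro s
    rw [Sigma.ι_desc, Sigma.ι_desc_assoc, Category.assoc, Sigma.ι_desc, ← G.map_comp_assoc]
    exact sigma_ι_congr G _ _ rfl

/-- The inclusion of a summand. -/
noncomputable def sigmaObjι {S : SSet.{u}} (G : S.Elements ⥤ N) (n : SimplexCategoryᵒᵖ)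
    (s : S.obj n) : G.obj (S.elementsMk n s) ⟶ (sigmaObj S G).obj n :=
  Sigma.ι (fun s : S.obj n => G.obj (S.elementsMk n s)) s

theorem sigmaObj_hom_ext {S : SSet.{u}} {G : S.Elements ⥤ N} {n : SimplexCategoryᵒᵖ} {z : N}
    {f g : (sigmaObj S G).obj n ⟶ z} (h : ∀ s, sigmaObjι G n s ≫ f = sigmaObjι G n s ≫ g) :
    f = g :=
  Sigma.hom_ext _ _ h

theorem sigmaObjι_map {S : SSet.{u}} (G : S.Elements ⥤ N) {n m : SimplexCategoryᵒᵖ} {s : S.obj n}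
    {t : S.obj m} (e : (S.elementsMk n s) ⟶ S.elementsMk m t) :
    sigmaObjι G n s ≫ (sigmaObj S G).map e.1 = G.map e ≫ sigmaObjι G m t := by
  refine (Sigma.ι_desc _ _).trans ?_
  exact sigma_ι_congr G _ _ rfl

/-- Maps out of `∐_{s ∈ Sₙ} G(s)`. -/
noncomputable def sigmaObjDesc {S : SSet.{u}} (G : S.Elements ⥤ N) (n : SimplexCategoryᵒᵖ) {z : N}
    (g : ∀ s : S.obj n, G.obj (S.elementsMk n s) ⟶ z) : (sigmaObj S G).obj n ⟶ z :=
  Sigma.desc g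

@[simp]
theorem sigmaObjι_desc {S : SSet.{u}} (G : S.Elements ⥤ N) (n : SimplexCategoryᵒᵖ) {z : N}
    (g : ∀ s : S.obj n, G.obj (S.elementsMk n s) ⟶ z) (s : S.obj n) :
    sigmaObjι G n s ≫ sigmaObjDesc G n g = g s :=
  Sigma.ι_desc _ _

/-- The universal property of the simplicial object `n ↦ ∐_{s ∈ Sₙ} G(s)`. -/
noncomputable def sigmaObjLift {S : SSet.{u}} (G : S.Elements ⥤ N) {Y : SimplexCategoryᵒᵖ ⥤ N}
    (g : ∀ (n : SimplexCategoryᵒᵖ) (s : S.obj n), G.obj (S.elementsMk n s) ⟶ Y.obj n)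
    (hg : ∀ ⦃n m : SimplexCategoryᵒᵖ⦄ (α : n ⟶ m) (s : S.obj n),
      G.map (simplexArrow S α s) ≫ g m (S.map α s) = g n s ≫ Y.map α) : sigmaObj S G ⟶ Y where
  app n := sigmaObjDesc G n (g n)
  naturality n m α := by
    refine sigmaObj_hom_ext (fun s => ?_)
    rw [← Category.assoc]
    refine (congrArg (· ≫ sigmaObjDesc G m (g m)) (sigmaObjι_map G (simplexArrow S α s))).trans ?_
    rw [Category.assoc, sigmaObjι_desc, ← Category.assoc, sigmaObjι_desc]
    exact hg α s

@[simp]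
theorem sigmaObjι_lift {S : SSet.{u}} (G : S.Elements ⥤ N) {Y : SimplexCategoryᵒᵖ ⥤ N}
    (g : ∀ (n : SimplexCategoryᵒᵖ) (s : S.obj n), G.obj (S.elementsMk n s) ⟶ Y.obj n)
    (hg : ∀ ⦃n m : SimplexCategoryᵒᵖ⦄ (α : n ⟶ m) (s : S.obj n),
      G.map (simplexArrow S α s) ≫ g m (S.map α s) = g n s ≫ Y.map α)
    (n : SimplexCategoryᵒᵖ) (s : S.obj n) :
    sigmaObjι G n s ≫ (sigmaObjLift G g hg).app n = g n s :=
  sigmaObjι_desc _ _ _ _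

/-- Functoriality of `n ↦ ∐_{s ∈ Sₙ} G(s)` in the coefficients. -/
noncomputable def sigmaObjMap {S : SSet.{u}} {G G' : S.Elements ⥤ N} (φ : G ⟶ G') :
    sigmaObj S G ⟶ sigmaObj S G' :=
  sigmaObjLift G (fun n s => φ.app (S.elementsMk n s) ≫ sigmaObjι G' n s) (by
    intro n m α s
    refine (φ.naturality_assoc (simplexArrow S α s) _).trans ?_
    rw [Category.assoc]
    exact congrArg _ (sigmaObjι_map G' (simplexArrow S α s)).symm)

@[simp]
theorem sigmaObjι_sigmaObjMap {S : SSet.{u}} {G G' : S.Elements ⥤ N} (φ : G ⟶ G')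
    (n : SimplexCategoryᵒᵖ) (s : S.obj n) :
    sigmaObjι G n s ≫ (sigmaObjMap φ).app n =
      φ.app (S.elementsMk n s) ≫ sigmaObjι G' n s :=
  sigmaObjι_desc _ _ _ _

theorem sigmaObjMap_app_eq {S : SSet.{u}} {G G' : S.Elements ⥤ N} (φ : G ⟶ G')
    (n : SimplexCategoryᵒᵖ) :
    (sigmaObjMap φ).app n = Limits.Sigma.map (fun s => φ.app (S.elementsMk n s)) := by
  refine sigmaObj_hom_ext (fun s => ?_)
  rw [sigmaObjι_sigmaObjMap]
  exact (Sigma.ι_map (fun s => φ.app (S.elementsMk n s)) s).symm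

end SigmaObj

end RealisationApi

/-! ### Simplicial homotopies in a homotopical `Δ`-category -/

section Homotopy

variable {N : Type u₁} [Category.{v₁} N] (T : DeltaStructure N)

namespace DeltaStructure

section ConstCopower

variable [HasColimitsOfSize.{0, 0} N] [HasColimitsOfSize.{0, u} N] [HasCoproducts.{u} N]

/-- The inclusion of a summand of `∐_{s ∈ Sₙ} z`. -/
noncomputable def constCopowerι (S : SSet.{u}) (z : N) (n : SimplexCategoryᵒᵖ) (s : S.obj n) :
    z ⟶ (constCopower S z).obj n :=
  Sigma.ι (fun _ : S.obj n => z) s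

theorem constCopowerι_map (S : SSet.{u}) (z : N) {n m : SimplexCategoryᵒᵖ} (α : n ⟶ m)
    (s : S.obj n) :
    constCopowerι S z n s ≫ (constCopower S z).map α = constCopowerι S z m (S.map α s) := by
  simp [constCopowerι]

@[simp]
theorem constCopowerι_aug (S : SSet.{u}) (z : N) (n : SimplexCategoryᵒᵖ) (s : S.obj n) :
    constCopowerι S z n s ≫ (constCopowerAug S z).app n = 𝟙 z :=
  Sigma.ι_desc _ _

theorem constCopower_hom_ext {S : SSet.{u}} {z : N} {n : SimplexCategoryᵒᵖ} {w : N}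
    {f g : (constCopower S z).obj n ⟶ w}
    (h : ∀ s, constCopowerι S z n s ≫ f = constCopowerι S z n s ≫ g) : f = g :=
  Sigma.hom_ext _ _ h

variable [∀ n, PreservesColimitsOfSize.{u, u} (T.tensor.obj n)]

/-- The comparison `|n ↦ ∐_{s ∈ Sₙ} z| ⟶ S ⊗ z`. -/
noncomputable def copowerToTensor (S : SSet.{u}) (z : N) :
    T.realisation.obj (constCopower S z) ⟶ T.ssetTensor S z :=
  T.realisationDesc _ (fun n => T.tensorSigmaDesc n (fun _ : S.obj (op n) => z)
    (fun s => T.ssetTensorι S z s)) (by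
    intro n m θ
    refine T.tensorSigma_hom_ext (fun s => ?_)
    have e : (T.tensor.obj n).map (Sigma.ι (fun _ : S.obj (op m) => z) s) ≫
        (T.tensor.obj n).map ((constCopower S z).map θ.op) =
        (T.tensor.obj n).map (Sigma.ι (fun _ : S.obj (op n) => z) (S.map θ.op s)) := by
      rw [← Functor.map_comp]
      exact congrArg _ (constCopowerι_map S z θ.op s)
    refine (Category.assoc _ _ _).symm.trans ((congrArg (· ≫ _) e).trans ?_)
    rw [tensorSigmaι_desc]
    refine Eq.trans ?_ ((T.tensor.map θ).naturality_assoc _ _).symm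
    refine (T.map_ssetTensorι S z θ s).symm.trans (congrArg _ ?_)
    exact (T.tensorSigmaι_desc m (fun _ : S.obj (op m) => z) _ s).symm)

theorem copowerToTensor_fac (S : SSet.{u}) (z : N) {n : SimplexCategory} (s : S.obj (op n)) :
    (T.tensor.obj n).map (constCopowerι S z (op n) s) ≫ T.realisationι _ n ≫
      T.copowerToTensor S z = T.ssetTensorι S z s := by
  rw [copowerToTensor, realisationι_desc]
  exact T.tensorSigmaι_desc n (fun _ : S.obj (op n) => z) _ s

/-- The comparison `S ⊗ z ⟶ |n ↦ ∐_{s ∈ Sₙ} z|`. -/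
noncomputable def tensorToCopower (S : SSet.{u}) (z : N) :
    T.ssetTensor S z ⟶ T.realisation.obj (constCopower S z) :=
  T.ssetTensorDesc S z
    (fun n s => (T.tensor.obj n).map (constCopowerι S z (op n) s) ≫ T.realisationι _ n) (by
    intro n m θ s
    rw [← constCopowerι_map, Functor.map_comp_assoc, realisation_condition,
      NatTrans.naturality_assoc])

theorem ssetTensorι_tensorToCopower (S : SSet.{u}) (z : N) {n : SimplexCategory}
    (s : S.obj (op n)) : T.ssetTensorι S z s ≫ T.tensorToCopower S z =
      (T.tensor.obj n).map (constCopowerι S z (op n) s) ≫ T.realisationι _ n :=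
  colimit.ι_desc _ _

instance isIso_copowerToTensor (S : SSet.{u}) (z : N) : IsIso (T.copowerToTensor S z) := by
  refine ⟨T.tensorToCopower S z, ?_, ?_⟩
  · refine T.realisation_hom_ext (fun n => ?_)
    refine T.tensorSigma_hom_ext (J := S.obj (op n)) (A := fun _ => z) (fun s => ?_)
    have h := T.copowerToTensor_fac S z s
    have h' := T.ssetTensorι_tensorToCopower S z s
    rw [Category.comp_id]
    refine Eq.trans ?_ h'
    rw [← h]
    simp only [Category.assoc]
    rfl
  · refine T.ssetTensor_hom_ext (fun n s => ?_)
    rw [Category.comp_id, ← Category.assoc, ssetTensorι_tensorToCopower, Category.assoc,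
      copowerToTensor_fac]

/-- The collapse `S ⊗ z ⟶ z`. -/
noncomputable def ssetTensorCollapse (S : SSet.{u}) (z : N) : T.ssetTensor S z ⟶ z :=
  T.ssetTensorDesc S z (fun n _ => T.collapse n z) (fun θ _ => T.map_collapse θ z)

theorem ssetTensorι_collapse (S : SSet.{u}) (z : N) {n : SimplexCategory} (s : S.obj (op n)) :
    T.ssetTensorι S z s ≫ T.ssetTensorCollapse S z = T.collapse n z :=
  T.ssetTensorι_desc _ _ _ _ _

theorem ssetTensorι_mapLeft {S S' : SSet.{u}} (φ : S ⟶ S') (z : N) {n : SimplexCategory}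
    (s : S.obj (op n)) :
    T.ssetTensorι S z s ≫ T.ssetTensorMapLeft φ z = T.ssetTensorι S' z (φ.app (op n) s) :=
  colimit.ι_desc _ _

theorem copowerToTensor_collapse (S : SSet.{u}) (z : N) :
    T.copowerToTensor S z ≫ T.ssetTensorCollapse S z =
      T.realisationAug (constCopowerAug S z) := by
  refine T.realisation_hom_ext (fun n => ?_)
  refine T.tensorSigma_hom_ext (J := S.obj (op n)) (A := fun _ => z) (fun s => ?_)
  rw [realisationι_aug]
  have h := T.copowerToTensor_fac S z s
  have e : (T.tensor.obj n).map (constCopowerι S z (op n) s) ≫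
      (T.tensor.obj n).map ((constCopowerAug S z).app (op n)) = 𝟙 _ := by
    rw [← Functor.map_comp, constCopowerι_aug, CategoryTheory.Functor.map_id]
  refine Eq.trans (b := T.collapse n z) ?_ ?_
  · refine Eq.trans (b := T.ssetTensorι S z s ≫ T.ssetTensorCollapse S z) ?_
      (T.ssetTensorι_collapse S z s)
    rw [← h]
    simp only [Category.assoc]
    rfl
  · refine Eq.trans ?_ (Category.assoc _ _ _)
    refine Eq.trans ?_ (congrArg (· ≫ T.collapse n z) e).symm
    exact (Category.id_comp _).symm

theorem ssetTensorMapLeft_collapse {S S' : SSet.{u}} (φ : S ⟶ S') (z : N) :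
    T.ssetTensorMapLeft φ z ≫ T.ssetTensorCollapse S' z = T.ssetTensorCollapse S z := by
  refine T.ssetTensor_hom_ext (fun n s => ?_)
  rw [← Category.assoc, ssetTensorι_mapLeft, ssetTensorι_collapse, ssetTensorι_collapse]

theorem isIso_ssetTensorCollapse_point (z : N) :
    IsIso (T.ssetTensorCollapse (Δ[0] : SSet.{u}) z) := by
  have hs : ∀ (n : SimplexCategoryᵒᵖ) (s t : (Δ[0] : SSet.{u}).obj n), s = t := fun n s t =>
    SSet.stdSimplex.objEquiv.injective (Subsingleton.elim _ _)
  let v : (Δ[0] : SSet.{u}).obj (op ⦋0⦌) := SSet.stdSimplex.objEquiv.symm (𝟙 _)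
  refine ⟨T.unit.inv.app z ≫ T.ssetTensorι _ z v, ?_, ?_⟩
  · refine T.ssetTensor_hom_ext (fun n s => ?_)
    rw [← Category.assoc, ssetTensorι_collapse, collapse, Category.assoc,
      Category.comp_id]
    refine (congrArg _ (T.unit.hom_inv_id_app_assoc z _)).trans ?_
    rw [map_ssetTensorι]
    exact congrArg _ (hs _ _ _)
  · rw [Category.assoc, ssetTensorι_collapse, collapse]
    have : SimplexCategory.isTerminalZero.from ⦋0⦌ = 𝟙 _ := Subsingleton.elim _ _
    rw [this, T.tensor.map_id, NatTrans.id_app, Category.id_comp]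
    exact T.unit.inv_hom_id_app z

end ConstCopower

end DeltaStructure

theorem homotopic_of_contractible {X Y : Type*} [TopologicalSpace X] [TopologicalSpace Y]
    [ContractibleSpace Y] (f g : C(X, Y)) : f.Homotopic g := by
  obtain ⟨y, hy⟩ := id_nullhomotopic Y
  have h : ∀ k : C(X, Y), k.Homotopic (ContinuousMap.const X y) := fun k =>
    ContinuousMap.Homotopic.comp hy (ContinuousMap.Homotopic.refl k)
  exact (h f).trans (h g).symm

/-- A map between simplicial sets with contractible realisations is a weak homotopy
equivalence. -/
theorem isWeakEquivalence_of_contractible {S S' : SSet.{u}} (φ : S ⟶ S')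
    [ContractibleSpace (SSet.toTop.obj S)] [ContractibleSpace (SSet.toTop.obj S')] :
    IsWeakEquivalence φ := by
  let f : C(SSet.toTop.obj S, SSet.toTop.obj S') := (SSet.toTop.map φ).hom
  let y : SSet.toTop.obj S := Classical.arbitrary _
  let g : C(SSet.toTop.obj S', SSet.toTop.obj S) := ContinuousMap.const _ y
  refine ⟨⟨f, g, ?_, ?_⟩, fun x => rfl⟩
  · exact homotopic_of_contractible _ _
  · exact homotopic_of_contractible _ _

/-- The realisation of the point is a point. -/
instance contractibleSpace_point : ContractibleSpace (SSet.toTop.obj (Δ[0] : SSet.{u})) :=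
  inferInstance

/-- The realisation of the interval is an interval. -/
instance contractibleSpace_interval : ContractibleSpace (SSet.toTop.obj (Δ[1] : SSet.{u})) := by
  have := (convex_stdSimplex ℝ (Fin 2)).contractibleSpace ⟨_, ite_eq_mem_stdSimplex ℝ 0⟩
  exact (SimplexCategory.toTopHomeo ⦋1⦌).contractibleSpace

end Homotopy

section Homotopy

variable {N : Type u₁} [Category.{v₁} N] (T : DeltaStructure N)

namespace DeltaStructure

section Double

variable [HasColimitsOfSize.{0, 0} N]

/-- The canonical map `Δⁿ ⊗ (Δᵐ ⊗ Xₙₘ) ⟶ ∫ Δⁿ ⊗ (Δᵐ ⊗ Xₙₘ)`. -/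
noncomputable def doubleι (X : SimplexCategoryᵒᵖ × SimplexCategoryᵒᵖ ⥤ N) (n m : SimplexCategory) :
    (T.tensor.obj n).obj ((T.tensor.obj m).obj (X.obj (op n, op m))) ⟶ T.doubleRealisation X :=
  coend.ι (((prodOpEquiv SimplexCategory).functor ⋙ X) ⋙ (iteratedTensor T.tensor).flip) (n, m)

theorem double_condition (X : SimplexCategoryᵒᵖ × SimplexCategoryᵒᵖ ⥤ N)
    {n m n' m' : SimplexCategory} (θ : n ⟶ n') (η : m ⟶ m') :
    (T.tensor.obj n).map ((T.tensor.obj m).map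
        (X.map ((θ.op, η.op) : (op n', op m') ⟶ (op n, op m)))) ≫ T.doubleι X n m =
      ((T.tensor.map θ).app ((T.tensor.obj m).obj (X.obj (op n', op m'))) ≫
        (T.tensor.obj n').map ((T.tensor.map η).app (X.obj (op n', op m')))) ≫
          T.doubleι X n' m' :=
  coend.condition
    (((prodOpEquiv SimplexCategory).functor ⋙ X) ⋙ (iteratedTensor T.tensor).flip)
    (show (n, m) ⟶ (n', m') from (θ, η))

/-- The universal property of the double realisation. -/
noncomputable def doubleDesc (X : SimplexCategoryᵒᵖ × SimplexCategoryᵒᵖ ⥤ N) {z : N}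
    (g : ∀ n m, (T.tensor.obj n).obj ((T.tensor.obj m).obj (X.obj (op n, op m))) ⟶ z)
    (hg : ∀ ⦃n m n' m' : SimplexCategory⦄ (θ : n ⟶ n') (η : m ⟶ m'),
      (T.tensor.obj n).map ((T.tensor.obj m).map
        (X.map ((θ.op, η.op) : (op n', op m') ⟶ (op n, op m)))) ≫ g n m =
      ((T.tensor.map θ).app ((T.tensor.obj m).obj (X.obj (op n', op m'))) ≫
        (T.tensor.obj n').map ((T.tensor.map η).app (X.obj (op n', op m')))) ≫ g n' m') :
    T.doubleRealisation X ⟶ z :=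
  coend.desc
    (F := ((prodOpEquiv SimplexCategory).functor ⋙ X) ⋙ (iteratedTensor T.tensor).flip)
    (fun a => g a.1 a.2) (fun _ _ f => hg f.1 f.2)

theorem doubleι_desc (X : SimplexCategoryᵒᵖ × SimplexCategoryᵒᵖ ⥤ N) {z : N}
    (g : ∀ n m, (T.tensor.obj n).obj ((T.tensor.obj m).obj (X.obj (op n, op m))) ⟶ z)
    (hg : ∀ ⦃n m n' m' : SimplexCategory⦄ (θ : n ⟶ n') (η : m ⟶ m'),
      (T.tensor.obj n).map ((T.tensor.obj m).map
        (X.map ((θ.op, η.op) : (op n', op m') ⟶ (op n, op m)))) ≫ g n m =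
      ((T.tensor.map θ).app ((T.tensor.obj m).obj (X.obj (op n', op m'))) ≫
        (T.tensor.obj n').map ((T.tensor.map η).app (X.obj (op n', op m')))) ≫ g n' m')
    (n m : SimplexCategory) : T.doubleι X n m ≫ T.doubleDesc X g hg = g n m :=
  coend.ι_desc
    (F := ((prodOpEquiv SimplexCategory).functor ⋙ X) ⋙ (iteratedTensor T.tensor).flip) _ _ _

theorem double_hom_ext {X : SimplexCategoryᵒᵖ × SimplexCategoryᵒᵖ ⥤ N} {z : N}
    {f g : T.doubleRealisation X ⟶ z}
    (h : ∀ n m, T.doubleι X n m ≫ f = T.doubleι X n m ≫ g) : f = g :=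
  coend.hom_ext
    (F := ((prodOpEquiv SimplexCategory).functor ⋙ X) ⋙ (iteratedTensor T.tensor).flip)
    (fun a => h a.1 a.2)

theorem realisationι_diagonalComparison (X : SimplexCategoryᵒᵖ × SimplexCategoryᵒᵖ ⥤ N)
    (n : SimplexCategory) :
    T.realisationι (Functor.diag SimplexCategoryᵒᵖ ⋙ X) n ≫ T.diagonalComparison X =
      T.diagApp n (X.obj (op n, op n)) ≫ T.doubleι X n n :=
  coend.ι_desc (F := (Functor.diag SimplexCategoryᵒᵖ ⋙ X) ⋙ T.tensor.flip) _ _ _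

/-- Maps out of `Δⁿ ⊗ |Z|`, when `Δⁿ ⊗ -` preserves colimits. -/
theorem exists_tensorRealisationDesc (n : SimplexCategory)
    [PreservesColimitsOfSize.{0, 0} (T.tensor.obj n)] (Z : SimplexCategoryᵒᵖ ⥤ N) {w : N}
    (g : ∀ m, (T.tensor.obj n).obj ((T.tensor.obj m).obj (Z.obj (op m))) ⟶ w)
    (hg : ∀ ⦃m m' : SimplexCategory⦄ (η : m ⟶ m'),
      (T.tensor.obj n).map ((T.tensor.obj m).map (Z.map η.op)) ≫ g m =
        (T.tensor.obj n).map ((T.tensor.map η).app (Z.obj (op m'))) ≫ g m') :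
    ∃ d : (T.tensor.obj n).obj (T.realisation.obj Z) ⟶ w,
      ∀ m, (T.tensor.obj n).map (T.realisationι Z m) ≫ d = g m := by
  let I := Multicofork.isColimitMapOfPreserves
    (Multicoequalizer.multicofork (multispanIndexCoend (Z ⋙ T.tensor.flip))) (T.tensor.obj n)
    (colimit.isColimit _)
  exact ⟨I.desc (Multicofork.ofπ ((multispanIndexCoend (Z ⋙ T.tensor.flip)).map (T.tensor.obj n))
    w g (fun f => hg f.hom)), fun m => I.fac _ (WalkingMultispan.right m)⟩

theorem tensorRealisation_hom_ext {n : SimplexCategory}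
    [PreservesColimitsOfSize.{0, 0} (T.tensor.obj n)] {Z : SimplexCategoryᵒᵖ ⥤ N} {w : N}
    {f g : (T.tensor.obj n).obj (T.realisation.obj Z) ⟶ w}
    (h : ∀ m, (T.tensor.obj n).map (T.realisationι Z m) ≫ f =
      (T.tensor.obj n).map (T.realisationι Z m) ≫ g) : f = g :=
  Multicofork.IsColimit.hom_ext (Multicofork.isColimitMapOfPreserves
    (Multicoequalizer.multicofork (multispanIndexCoend (Z ⋙ T.tensor.flip))) (T.tensor.obj n)
    (colimit.isColimit _)) h

end Double

section Cylinder

variable [HasColimitsOfSize.{0, 0} N] [HasColimitsOfSize.{0, u} N] [HasCoproducts.{u} N]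

/-- The simplicial object `n ↦ |m ↦ ∐_{s ∈ Sₘ} Yₙ|`. -/
noncomputable def innerRealisation (S : SSet.{u}) (Y : SimplexCategoryᵒᵖ ⥤ N) :
    SimplexCategoryᵒᵖ ⥤ N :=
  Y ⋙ sigmaConst ⋙ (Functor.whiskeringLeft _ _ _).obj S ⋙ T.realisation

/-- The canonical map `Δᵐ ⊗ ∐_{s ∈ Sₘ} Yₙ ⟶ |m ↦ ∐_{s ∈ Sₘ} Yₙ|`. -/
noncomputable def innerRealisationι (S : SSet.{u}) (Y : SimplexCategoryᵒᵖ ⥤ N)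
    (n : SimplexCategoryᵒᵖ) (m : SimplexCategory) :
    (T.tensor.obj m).obj ((bisimplicialCopower S Y).obj (n, op m)) ⟶
      (T.innerRealisation S Y).obj n :=
  T.realisationι (constCopower S (Y.obj n)) m

theorem bisimplicialCopower_map_fst (S : SSet.{u}) (Y : SimplexCategoryᵒᵖ ⥤ N)
    {n n' : SimplexCategoryᵒᵖ} (α : n ⟶ n') (m : SimplexCategoryᵒᵖ) :
    (bisimplicialCopower S Y).map ((α, 𝟙 m) : (n, m) ⟶ (n', m)) =
      (sigmaConst.map (Y.map α)).app (S.obj m) := by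
  refine bisimplicialCopower_hom_ext (fun s => ?_)
  rw [bisimplicialCopowerι_map, S.map_id]
  exact (Sigma.ι_map (fun _ : S.obj m => Y.map α) s).symm

theorem bisimplicialCopower_map_snd (S : SSet.{u}) (Y : SimplexCategoryᵒᵖ ⥤ N)
    (n : SimplexCategoryᵒᵖ) {m m' : SimplexCategoryᵒᵖ} (β : m ⟶ m') :
    (bisimplicialCopower S Y).map ((𝟙 n, β) : (n, m) ⟶ (n, m')) =
      (constCopower S (Y.obj n)).map β := by
  refine bisimplicialCopower_hom_ext (fun s => ?_)
  rw [bisimplicialCopowerι_map, Y.map_id, Category.id_comp]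
  exact (constCopowerι_map S (Y.obj n) β s).symm

theorem innerRealisation_condition (S : SSet.{u}) (Y : SimplexCategoryᵒᵖ ⥤ N)
    (n : SimplexCategoryᵒᵖ) {m m' : SimplexCategory} (η : m ⟶ m') :
    (T.tensor.obj m).map ((bisimplicialCopower S Y).map ((𝟙 n, η.op) : (n, op m') ⟶ (n, op m))) ≫
      T.innerRealisationι S Y n m =
    (T.tensor.map η).app ((bisimplicialCopower S Y).obj (n, op m')) ≫
      T.innerRealisationι S Y n m' := by
  rw [bisimplicialCopower_map_snd]
  exact T.realisation_condition (constCopower S (Y.obj n)) η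

theorem innerRealisationι_map (S : SSet.{u}) (Y : SimplexCategoryᵒᵖ ⥤ N)
    {n n' : SimplexCategoryᵒᵖ} (α : n ⟶ n') (m : SimplexCategory) :
    T.innerRealisationι S Y n m ≫ (T.innerRealisation S Y).map α =
      (T.tensor.obj m).map ((bisimplicialCopower S Y).map ((α, 𝟙 _) : (n, op m) ⟶ (n', op m))) ≫
        T.innerRealisationι S Y n' m := by
  rw [bisimplicialCopower_map_fst]
  exact T.realisationι_map (Functor.whiskerLeft S (sigmaConst.map (Y.map α))) m

/-- The augmentations `|m ↦ ∐_{s ∈ Sₘ} Yₙ| ⟶ Yₙ`. -/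
noncomputable def innerRealisationAugApp (S : SSet.{u}) (Y : SimplexCategoryᵒᵖ ⥤ N)
    (n : SimplexCategoryᵒᵖ) : (T.innerRealisation S Y).obj n ⟶ Y.obj n :=
  T.realisationAug (constCopowerAug S (Y.obj n))

theorem innerRealisationι_aug (S : SSet.{u}) (Y : SimplexCategoryᵒᵖ ⥤ N)
    (n : SimplexCategoryᵒᵖ) (m : SimplexCategory) :
    T.innerRealisationι S Y n m ≫ T.innerRealisationAugApp S Y n =
      (T.tensor.obj m).map (bisimplicialCopowerProj S Y n (op m)) ≫ T.collapse m (Y.obj n) :=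
  T.realisationι_aug (constCopowerAug S (Y.obj n)) m

theorem innerRealisation_hom_ext {S : SSet.{u}} {Y : SimplexCategoryᵒᵖ ⥤ N}
    {n : SimplexCategoryᵒᵖ} {z : N} {f g : (T.innerRealisation S Y).obj n ⟶ z}
    (h : ∀ m, T.innerRealisationι S Y n m ≫ f = T.innerRealisationι S Y n m ≫ g) : f = g :=
  T.realisation_hom_ext h

/-- The augmentation of `innerRealisation`. -/
noncomputable def innerRealisationAug (S : SSet.{u}) (Y : SimplexCategoryᵒᵖ ⥤ N) :
    T.innerRealisation S Y ⟶ Y where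
  app n := T.innerRealisationAugApp S Y n
  naturality n n' α := by
    refine T.innerRealisation_hom_ext (fun m => ?_)
    rw [← Category.assoc, innerRealisationι_map, Category.assoc, innerRealisationι_aug,
      ← Functor.map_comp_assoc, bisimplicialCopower_map_proj, ← Category.assoc,
      innerRealisationι_aug, Functor.map_comp_assoc, collapse_natural, Category.assoc]

variable [∀ n, PreservesColimitsOfSize.{0, 0} (T.tensor.obj n)]

/-- The double realisation of `(n, m) ↦ ∐_{s ∈ Sₘ} Yₙ` is the iterated one. -/
noncomputable def doubleToIterated (S : SSet.{u}) (Y : SimplexCategoryᵒᵖ ⥤ N) :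
    T.doubleRealisation (bisimplicialCopower S Y) ⟶ T.realisation.obj (T.innerRealisation S Y) :=
  T.doubleDesc _ (fun n m => (T.tensor.obj n).map (T.innerRealisationι S Y (op n) m) ≫
    T.realisationι (T.innerRealisation S Y) n) (by
    intro n m n' m' θ η
    have e : (bisimplicialCopower S Y).map ((θ.op, η.op) : (op n', op m') ⟶ (op n, op m)) =
        (bisimplicialCopower S Y).map ((θ.op, 𝟙 (op m')) : (op n', op m') ⟶ (op n, op m')) ≫
          (bisimplicialCopower S Y).map ((𝟙 (op n), η.op) : (op n, op m') ⟶ (op n, op m)) :=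
      (congrArg (bisimplicialCopower S Y).map
        (Prod.ext (Category.comp_id _).symm (Category.id_comp _).symm)).trans
          (Functor.map_comp _ _ _)
    rw [e, Functor.map_comp, ← Functor.map_comp_assoc, Category.assoc,
      innerRealisation_condition, NatTrans.naturality_assoc, ← innerRealisationι_map,
      Functor.map_comp_assoc, Functor.map_comp_assoc, realisation_condition, Category.assoc,
      NatTrans.naturality_assoc, NatTrans.naturality_assoc])

theorem doubleι_doubleToIterated (S : SSet.{u}) (Y : SimplexCategoryᵒᵖ ⥤ N)
    (n m : SimplexCategory) : T.doubleι _ n m ≫ T.doubleToIterated S Y =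
      (T.tensor.obj n).map (T.innerRealisationι S Y (op n) m) ≫
        T.realisationι (T.innerRealisation S Y) n :=
  T.doubleι_desc _ _ _ _ _

instance isIso_doubleToIterated (S : SSet.{u}) (Y : SimplexCategoryᵒᵖ ⥤ N) :
    IsIso (T.doubleToIterated S Y) := by
  have h := fun n => T.exists_tensorRealisationDesc n (constCopower S (Y.obj (op n)))
    (fun m => T.doubleι (bisimplicialCopower S Y) n m) (by
      intro m m' η
      have := T.double_condition (bisimplicialCopower S Y) (𝟙 n) η
      rw [T.tensor.map_id, NatTrans.id_app, Category.id_comp] at this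
      refine Eq.trans ?_ this
      refine congrArg (fun t => (T.tensor.obj n).map ((T.tensor.obj m).map t) ≫ _) ?_
      exact (bisimplicialCopower_map_snd S Y (op n) η.op).symm)
  choose d hd using h
  let d' : ∀ n, (T.tensor.obj n).obj ((T.innerRealisation S Y).obj (op n)) ⟶
    T.doubleRealisation (bisimplicialCopower S Y) := d
  have hd' : ∀ n m, (T.tensor.obj n).map (T.innerRealisationι S Y (op n) m) ≫ d' n =
    T.doubleι (bisimplicialCopower S Y) n m := hd
  have ext : ∀ {n k : SimplexCategory} {z : N} {f g : (T.tensor.obj n).obj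
      ((T.innerRealisation S Y).obj (op k)) ⟶ z},
      (∀ m, (T.tensor.obj n).map (T.innerRealisationι S Y (op k) m) ≫ f =
        (T.tensor.obj n).map (T.innerRealisationι S Y (op k) m) ≫ g) → f = g :=
    fun h => T.tensorRealisation_hom_ext h
  let e : T.realisation.obj (T.innerRealisation S Y) ⟶
      T.doubleRealisation (bisimplicialCopower S Y) :=
    T.realisationDesc _ d' (by
      intro n n' θ
      refine ext (fun m => ?_)
      rw [← Functor.map_comp_assoc, innerRealisationι_map, Functor.map_comp_assoc, hd',
        NatTrans.naturality_assoc, hd']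
      have := T.double_condition (bisimplicialCopower S Y) θ (𝟙 m)
      rw [T.tensor.map_id, NatTrans.id_app] at this
      refine this.trans ?_
      rw [CategoryTheory.Functor.map_id, Category.comp_id])
  have he : ∀ n, T.realisationι (T.innerRealisation S Y) n ≫ e = d' n := fun n =>
    T.realisationι_desc _ _ _ n
  refine ⟨e, ?_, ?_⟩
  · refine T.double_hom_ext (fun n m => ?_)
    rw [← Category.assoc, doubleι_doubleToIterated, Category.assoc, he, hd', Category.comp_id]
  · refine T.realisation_hom_ext (fun n => ext (fun m => ?_))
    rw [← Category.assoc (T.realisationι _ n), he, ← Category.assoc, hd',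
      doubleι_doubleToIterated, Category.comp_id]

/-- By the counit law, the projection of a copower factors through the comparison of the diagonal
with the iterated realisation; this is what makes it accessible to the axiom on diagonals. -/
theorem realisation_map_copowerProj (S : SSet.{u}) (Y : SimplexCategoryᵒᵖ ⥤ N) :
    T.diagonalComparison (bisimplicialCopower S Y) ≫ T.doubleToIterated S Y ≫
      T.realisation.map (T.innerRealisationAug S Y) = T.realisation.map (copowerProj S Y) := by
  refine T.realisation_hom_ext (fun n => ?_)
  refine (Category.assoc _ _ _).symm.trans ((congrArg (· ≫ _)
    (T.realisationι_diagonalComparison (bisimplicialCopower S Y) n)).trans ?_)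
  have h₂ : (T.tensor.obj n).map (T.innerRealisationι S Y (op n) n) ≫
      (T.tensor.obj n).map ((T.innerRealisationAug S Y).app (op n)) =
      (T.tensor.obj n).map (T.collapse n _) ≫
        (T.tensor.obj n).map (bisimplicialCopowerProj S Y (op n) (op n)) := by
    rw [← Functor.map_comp, ← Functor.map_comp]
    exact congrArg _ ((T.innerRealisationι_aug S Y (op n) n).trans (T.collapse_natural n _))
  rw [Category.assoc, ← Category.assoc (T.doubleι _ n n), doubleι_doubleToIterated,
    Category.assoc, realisationι_map, reassoc_of% h₂]
  have h₃ := T.counit_right n ((bisimplicialCopower S Y).obj (op n, op n))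
    (SimplexCategory.isTerminalZero.from n)
  refine (Category.assoc _ _ _).symm.trans ((congrArg (· ≫ _) h₃).trans ?_)
  rw [Category.id_comp]
  exact (T.realisationι_map (copowerProj S Y) n).symm

end Cylinder

end DeltaStructure

/-! ### Consequences of the axioms of a homotopical `Δ`-category -/

namespace IsHomotopicalDeltaCategory

variable {T} {W : MorphismProperty N} (hT : IsHomotopicalDeltaCategory.{u} T W)
  [HasColimitsOfSize.{0, 0} N] [HasColimitsOfSize.{0, u} N] [HasCoproducts.{u} N]

include hT

/-- The realisation of the constant copower is `S ⊗ z`, and `S` is weakly equivalent to a point. -/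
theorem realisationAug_constCopower (S : SSet.{u}) [ContractibleSpace (SSet.toTop.obj S)] (z : N) :
    W (T.realisationAug (constCopowerAug S z)) := by
  have := hT.tensor_preserves
  rw [← T.copowerToTensor_collapse]
  refine hT.homotopical.comp _ _ (hT.homotopical.of_isIso _ inferInstance) ?_
  let φ : S ⟶ Δ[0] := SSet.stdSimplex.isTerminalObj₀.from S
  rw [← T.ssetTensorMapLeft_collapse φ]
  exact hT.homotopical.comp _ _ (hT.tensor_left φ z (isWeakEquivalence_of_contractible φ))
    (hT.homotopical.of_isIso _ (T.isIso_ssetTensorCollapse_point z))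

/-- The copower of a simplicial object by a contractible simplicial set is realised by an
equivalent object, by the axiom on diagonals. -/
theorem realisation_map_copowerProj (S : SSet.{u}) [ContractibleSpace (SSet.toTop.obj S)]
    (Y : SimplexCategoryᵒᵖ ⥤ N) : W (T.realisation.map (copowerProj S Y)) := by
  have := hT.tensor_preserves
  have : ∀ n, PreservesColimitsOfSize.{0, 0} (T.tensor.obj n) := fun n =>
    preservesColimitsOfSize_shrink.{0, u, 0, u} (T.tensor.obj n)
  rw [← T.realisation_map_copowerProj]
  refine hT.homotopical.comp _ _ (hT.diagonal _) (hT.homotopical.comp _ _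
    (hT.homotopical.of_isIso _ inferInstance) (hT.realisation_map _ (fun n => ?_)))
  exact hT.realisationAug_constCopower S (Y.obj n)

/-- Simplicially homotopic maps are simultaneously weak equivalences. -/
theorem of_homotopy (S : SSet.{u}) [ContractibleSpace (SSet.toTop.obj S)]
    {Y Y' : SimplexCategoryᵒᵖ ⥤ N} (H : copower S Y ⟶ Y') (s t : S.obj (op ⦋0⦌))
    (hs : W (T.realisation.map (copowerVertex S Y s ≫ H))) :
    W (T.realisation.map (copowerVertex S Y t ≫ H)) := by
  have h : ∀ v, W (T.realisation.map (copowerVertex S Y v)) := fun v => by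
    refine hT.homotopical.of_postcomp _ _ (hT.realisation_map_copowerProj S Y) ?_
    rw [← Functor.map_comp, copowerVertex_proj, CategoryTheory.Functor.map_id]
    exact hT.homotopical.of_isIso _ inferInstance
  rw [Functor.map_comp] at hs ⊢
  exact hT.homotopical.comp _ _ (h t) (hT.homotopical.of_precomp _ _ (h s) hs)

/-- An augmentation with an extra homotopy: if the augmented simplicial object `Y ⟶ z` is, up to
simplicial homotopy, a retract of the copower of `z` by a contractible simplicial set, then its
realisation is weakly equivalent to `z`. -/
theorem realisationAug_of_homotopy (S : SSet.{u}) [ContractibleSpace (SSet.toTop.obj S)]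
    (I : SSet.{u}) [ContractibleSpace (SSet.toTop.obj I)]
    {Y : SimplexCategoryᵒᵖ ⥤ N} {z : N} (a : Y ⟶ (Functor.const _).obj z)
    (i : constCopower S z ⟶ Y) (hi : i ≫ a = constCopowerAug S z) (r : Y ⟶ constCopower S z)
    (H : copower I Y ⟶ Y) (s t : I.obj (op ⦋0⦌)) (hs : copowerVertex I Y s ≫ H = 𝟙 Y)
    (ht : copowerVertex I Y t ≫ H = r ≫ i) : W (T.realisationAug a) := by
  have h₁ : W (T.realisation.map r ≫ T.realisation.map i) := by
    rw [← Functor.map_comp, ← ht]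
    refine hT.of_homotopy I H s t ?_
    rw [hs, CategoryTheory.Functor.map_id]
    exact hT.homotopical.of_isIso _ inferInstance
  have h₂ : W (T.realisation.map i ≫ T.realisationAug a) := by
    rw [T.realisation_map_aug, hi]
    exact hT.realisationAug_constCopower S z
  exact (hT.twoOutOfSix _ _ _ h₁ h₂).2.2.1

theorem realisation_sigmaObjMap {S : SSet.{u}} {G G' : S.Elements ⥤ N} (φ : G ⟶ G')
    (h : ∀ s, W (φ.app s)) : W (T.realisation.map (sigmaObjMap φ)) := by
  refine hT.realisation_map _ (fun n => ?_)
  rw [sigmaObjMap_app_eq]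
  exact hT.coproducts _ _ _ (fun s => h _)

end IsHomotopicalDeltaCategory

end Homotopy

/-! ### Homotopy colimits in the fibres of a fibration -/

section Hocolim

variable {N : Type u₁} [Category.{v₁} N] (T : DeltaStructure N)
  [HasColimitsOfSize.{0, 0} N] [HasColimitsOfSize.{0, u} N] [HasCoproducts.{u} N]

namespace DeltaStructure

/-- The canonical map from `Δⁿ ⊗ G(s)` to the realisation of `n ↦ ∐_{s ∈ Sₙ} G(s)`. -/
noncomputable def hocolimι {S : SSet.{u}} (G : S.Elements ⥤ N) (n : SimplexCategory)
    (s : S.obj (op n)) : (T.tensor.obj n).obj (G.obj (S.elementsMk (op n) s)) ⟶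
      T.realisation.obj (sigmaObj S G) :=
  (T.tensor.obj n).map (sigmaObjι G (op n) s) ≫ T.realisationι _ n

theorem hocolim_condition {S : SSet.{u}} (G : S.Elements ⥤ N) {n m : SimplexCategory} (θ : n ⟶ m)
    (s : S.obj (op m)) :
    (T.tensor.obj n).map (G.map (simplexArrow S θ.op s)) ≫ T.hocolimι G n (S.map θ.op s) =
      (T.tensor.map θ).app _ ≫ T.hocolimι G m s := by
  rw [hocolimι, hocolimι, ← Functor.map_comp_assoc]
  refine (congrArg (fun t => (T.tensor.obj n).map t ≫ _)
    (sigmaObjι_map G (simplexArrow S θ.op s)).symm).trans ?_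
  refine (Functor.map_comp_assoc _ _ _ _).trans ?_
  refine (congrArg (_ ≫ ·) (T.realisation_condition (sigmaObj S G) θ)).trans ?_
  exact (T.tensor.map θ).naturality_assoc _ _

@[simp]
theorem hocolimι_map {S : SSet.{u}} {G G' : S.Elements ⥤ N} (φ : G ⟶ G') (n : SimplexCategory)
    (s : S.obj (op n)) : T.hocolimι G n s ≫ T.realisation.map (sigmaObjMap φ) =
      (T.tensor.obj n).map (φ.app _) ≫ T.hocolimι G' n s := by
  rw [hocolimι, Category.assoc, realisationι_map, ← Functor.map_comp_assoc,
    sigmaObjι_sigmaObjMap, Functor.map_comp_assoc, hocolimι]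

theorem hocolimι_aug {S : SSet.{u}} {G : S.Elements ⥤ N} {z : N}
    (a : sigmaObj S G ⟶ (Functor.const _).obj z) (n : SimplexCategory) (s : S.obj (op n)) :
    T.hocolimι G n s ≫ T.realisationAug a =
      (T.tensor.obj n).map (sigmaObjι G (op n) s ≫ a.app (op n)) ≫ T.collapse n z := by
  rw [hocolimι, Category.assoc, realisationι_aug]
  exact (Functor.map_comp_assoc _ _ _ _).symm

variable [∀ n, PreservesColimitsOfSize.{u, u} (T.tensor.obj n)]

theorem hocolim_hom_ext {S : SSet.{u}} {G : S.Elements ⥤ N} {z : N}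
    {f g : T.realisation.obj (sigmaObj S G) ⟶ z}
    (h : ∀ n s, T.hocolimι G n s ≫ f = T.hocolimι G n s ≫ g) : f = g := by
  refine T.realisation_hom_ext (fun n => T.tensorSigma_hom_ext (J := S.obj (op n))
    (A := fun s => G.obj (S.elementsMk (op n) s)) (fun s => ?_))
  have := h n s
  rwa [hocolimι, Category.assoc, Category.assoc] at this

theorem exists_hocolimDesc {S : SSet.{u}} (G : S.Elements ⥤ N) {z : N}
    (g : ∀ (n : SimplexCategory) (s : S.obj (op n)),
      (T.tensor.obj n).obj (G.obj (S.elementsMk (op n) s)) ⟶ z)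
    (hg : ∀ ⦃n m : SimplexCategory⦄ (θ : n ⟶ m) (s : S.obj (op m)),
      (T.tensor.obj n).map (G.map (simplexArrow S θ.op s)) ≫ g n (S.map θ.op s) =
        (T.tensor.map θ).app _ ≫ g m s) :
    ∃ d : T.realisation.obj (sigmaObj S G) ⟶ z, ∀ n s, T.hocolimι G n s ≫ d = g n s := by
  have fac : ∀ n s, (T.tensor.obj n).map (sigmaObjι G (op n) s) ≫
      T.tensorSigmaDesc n (fun s => G.obj (S.elementsMk (op n) s)) (g n) = g n s :=
    fun n s => T.tensorSigmaι_desc n _ (g n) s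
  refine ⟨T.realisationDesc _ (fun n => T.tensorSigmaDesc n _ (g n)) ?_, fun n s => ?_⟩
  · intro n m θ
    refine T.tensorSigma_hom_ext (J := S.obj (op m))
      (A := fun s => G.obj (S.elementsMk (op m) s)) (fun s => ?_)
    refine Eq.trans (b := (T.tensor.obj n).map (G.map (simplexArrow S θ.op s)) ≫
      g n (S.map θ.op s)) ?_ ((hg θ s).trans ?_)
    · rw [← fac]
      refine (Functor.map_comp_assoc _ _ _ _).symm.trans ?_
      refine (congrArg (fun t => (T.tensor.obj n).map t ≫ _)
        (sigmaObjι_map G (simplexArrow S θ.op s))).trans ?_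
      exact Functor.map_comp_assoc _ _ _ _
    · rw [← fac m s]
      exact ((T.tensor.map θ).naturality_assoc _ _).symm
  · rw [hocolimι, Category.assoc]
    exact (congrArg (_ ≫ ·) (T.realisationι_desc _ _ _ n)).trans (fac n s)

end DeltaStructure

end Hocolim

section Relative

variable {B : Type u₂} [Category.{v₂} B] {X : Type u₃} [Category.{v₃} X] {q : X ⥤ B}
  (T : FibredDeltaStructure q)
  [∀ b, HasColimitsOfSize.{0, 0} (q.Fiber b)] [∀ b, HasColimitsOfSize.{0, u} (q.Fiber b)]
  [∀ b, HasCoproducts.{u} (q.Fiber b)]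
  [∀ b n, PreservesColimitsOfSize.{u, u} ((T.fiber b).tensor.obj n)]

namespace FibredDeltaStructure

/-- The realisation of `n ↦ ∐_{s ∈ Sₙ} G(s)` in a fibre. -/
noncomputable def fiberHocolim {b : B} {S : SSet.{u}} (G : S.Elements ⥤ q.Fiber b) : q.Fiber b :=
  (T.fiber b).realisation.obj (sigmaObj S G)

/-- The canonical map from `Δⁿ ⊗ G(s)` to the fibrewise homotopy colimit. -/
noncomputable def fiberHocolimι {b : B} {S : SSet.{u}} (G : S.Elements ⥤ q.Fiber b)
    (n : SimplexCategory) (s : S.obj (op n)) :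
    (T.tensor.obj n).obj (G.obj (S.elementsMk (op n) s)).1 ⟶ (T.fiberHocolim G).1 :=
  ((T.fiber b).hocolimι G n s).1

instance fiberHocolimι_isHomLift {b : B} {S : SSet.{u}} (G : S.Elements ⥤ q.Fiber b)
    (n : SimplexCategory) (s : S.obj (op n)) :
    q.IsHomLift (𝟙 b) (T.fiberHocolimι G n s) :=
  ((T.fiber b).hocolimι G n s).2

theorem fiberHocolim_condition {b : B} {S : SSet.{u}} (G : S.Elements ⥤ q.Fiber b)
    {n m : SimplexCategory} (θ : n ⟶ m) (s : S.obj (op m)) :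
    (T.tensor.obj n).map (G.map (simplexArrow S θ.op s)).1 ≫
        T.fiberHocolimι G n (S.map θ.op s) =
      (T.tensor.map θ).app _ ≫ T.fiberHocolimι G m s :=
  congrArg Subtype.val ((T.fiber b).hocolim_condition G θ s)

variable [q.IsFibered]

/-- Every arrow over `u` factors through any Cartesian lift of `u`. -/
theorem exists_fiber_factorisation {b c : B} (u : b ⟶ c) {y x : X} (κ : y ⟶ x)
    [q.IsCartesian u κ] {w : X} (g : w ⟶ x) [hg : q.IsHomLift u g] :
    ∃ g' : w ⟶ y, q.IsHomLift (𝟙 b) g' ∧ g' ≫ κ = g :=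
  ⟨Functor.IsCartesian.map q u κ g, inferInstance, by simp⟩

/-- The homotopy colimit in a fibre has the universal property of a colimit also for maps to
objects of other fibres. -/
theorem exists_fiberHocolimDesc {b c : B} (u : b ⟶ c) {S : SSet.{u}} (G : S.Elements ⥤ q.Fiber b)
    {z : X} (hz : q.obj z = c)
    (g : ∀ (n : SimplexCategory) (s : S.obj (op n)),
      (T.tensor.obj n).obj (G.obj (S.elementsMk (op n) s)).1 ⟶ z)
    (hg : ∀ n s, q.IsHomLift u (g n s))
    (hg' : ∀ ⦃n m : SimplexCategory⦄ (θ : n ⟶ m) (s : S.obj (op m)),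
      (T.tensor.obj n).map (G.map (simplexArrow S θ.op s)).1 ≫ g n (S.map θ.op s) =
        (T.tensor.map θ).app _ ≫ g m s) :
    ∃ d : (T.fiberHocolim G).1 ⟶ z, q.IsHomLift u d ∧
      ∀ n s, T.fiberHocolimι G n s ≫ d = g n s := by
  obtain ⟨y, κ, hκ⟩ := IsPreFibered.exists_isCartesian q hz u
  have hy : q.obj y = b := isHomLift_domain hκ.toIsHomLift
  have h : ∀ n s, ∃ g' : (T.tensor.obj n).obj (G.obj (S.elementsMk (op n) s)).1 ⟶ y,
      q.IsHomLift (𝟙 b) g' ∧ g' ≫ κ = g n s := fun n s => by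
    have := hg n s
    exact exists_fiber_factorisation u κ (g n s)
  choose g' hg₁ hg₂ using h
  obtain ⟨d, hd⟩ := (T.fiber b).exists_hocolimDesc G (z := ⟨y, hy⟩)
    (fun n s => ⟨g' n s, hg₁ n s⟩) (by
      intro n m θ s
      refine Subtype.ext ?_
      change (T.tensor.obj n).map (G.map (simplexArrow S θ.op s)).1 ≫ g' n (S.map θ.op s) =
        (T.tensor.map θ).app _ ≫ g' m s
      have h₁ := hg₁ n (S.map θ.op s)
      have h₂ := hg₁ m s
      have h₃ := ((T.fiber b).tensor.obj n).map (G.map (simplexArrow S θ.op s)) |>.2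
      have h₄ := (((T.fiber b).tensor.map θ).app (G.obj (S.elementsMk (op m) s))).2
      have h₅ : q.IsHomLift (𝟙 b) ((T.tensor.obj n).map (G.map (simplexArrow S θ.op s)).1) := h₃
      have h₆ : q.IsHomLift (𝟙 b)
        ((T.tensor.map θ).app (G.obj (S.elementsMk (op m) s)).1) := h₄
      refine Functor.IsCartesian.ext q u κ _ _ ?_
      rw [Category.assoc, Category.assoc, hg₂, hg₂]
      exact hg' θ s)
  obtain ⟨d₁, hd₁, hd₂⟩ : ∃ d₁ : (T.fiberHocolim G).1 ⟶ y, q.IsHomLift (𝟙 b) d₁ ∧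
      ∀ n s, T.fiberHocolimι G n s ≫ d₁ = g' n s :=
    ⟨d.1, d.2, fun n s => congrArg Subtype.val (hd n s)⟩
  refine ⟨d₁ ≫ κ, ?_, fun n s => ?_⟩
  · have := hκ.toIsHomLift
    have e : q.IsHomLift (𝟙 b ≫ u) (d₁ ≫ κ) := inferInstance
    simpa using e
  · rw [← hg₂, ← Category.assoc, hd₂]

theorem fiberHocolim_hom_ext {b c : B} (u : b ⟶ c) {S : SSet.{u}} {G : S.Elements ⥤ q.Fiber b}
    {z : X} {f g : (T.fiberHocolim G).1 ⟶ z} (hf : q.IsHomLift u f) (hg : q.IsHomLift u g)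
    (h : ∀ n s, T.fiberHocolimι G n s ≫ f = T.fiberHocolimι G n s ≫ g) : f = g := by
  obtain ⟨y, κ, hκ⟩ := IsPreFibered.exists_isCartesian q (isHomLift_codomain hf) u
  have hy : q.obj y = b := isHomLift_domain hκ.toIsHomLift
  obtain ⟨f', hf', rfl⟩ := exists_fiber_factorisation (hg := hf) u κ f
  obtain ⟨g', hg', rfl⟩ := exists_fiber_factorisation (hg := hg) u κ g
  congr 1
  let f'' : T.fiberHocolim G ⟶ ⟨y, hy⟩ := ⟨f', hf'⟩
  let g'' : T.fiberHocolim G ⟶ ⟨y, hy⟩ := ⟨g', hg'⟩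
  suffices f'' = g'' from congrArg Subtype.val this
  refine (T.fiber b).hocolim_hom_ext (fun n s => Subtype.ext ?_)
  change T.fiberHocolimι G n s ≫ f' = T.fiberHocolimι G n s ≫ g'
  refine Functor.IsCartesian.ext q u κ _ _ ?_
  rw [Category.assoc, Category.assoc]
  exact h n s

end FibredDeltaStructure

end Relative

/-! ### Fibrewise homotopy colimits of sections -/

section SectionHocolim

variable {B : Type u₂} [Category.{v₂} B] {X : Type u₃} [Category.{v₃} X] {q : X ⥤ B}

theorem isHomLift_vertical_comp {b c : B} {u : b ⟶ c} {x y z : X} {f : x ⟶ y} {g : y ⟶ z}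
    (hf : q.IsHomLift (𝟙 b) f) (hg : q.IsHomLift u g) : q.IsHomLift u (f ≫ g) := by
  have e : q.IsHomLift (𝟙 b ≫ u) (f ≫ g) := inferInstance
  rwa [Category.id_comp] at e

theorem isHomLift_comp_vertical {b c : B} {u : b ⟶ c} {x y z : X} {f : x ⟶ y} {g : y ⟶ z}
    (hf : q.IsHomLift u f) (hg : q.IsHomLift (𝟙 c) g) : q.IsHomLift u (f ≫ g) := by
  have e : q.IsHomLift (u ≫ 𝟙 c) (f ≫ g) := inferInstance
  rwa [Category.comp_id] at e

theorem isHomLift_comp {b c d : B} {u : b ⟶ c} {v : c ⟶ d} {x y z : X} {f : x ⟶ y} {g : y ⟶ z}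
    (hf : q.IsHomLift u f) (hg : q.IsHomLift v g) : q.IsHomLift (u ≫ v) (f ≫ g) :=
  inferInstance

namespace FibredDeltaStructure

variable (T : FibredDeltaStructure q)

theorem isHomLift_tensor_map (n : SimplexCategory) {b c : B} {u : b ⟶ c} {x y : X} {f : x ⟶ y}
    (hf : q.IsHomLift u f) : q.IsHomLift u ((T.tensor.obj n).map f) :=
  isHomLift_of_isHomLift hf (T.tensor_isHomLift n f)

theorem isHomLift_collapse (n : SimplexCategory) {b : B} {x : X} (hx : q.obj x = b) :
    q.IsHomLift (𝟙 b) (T.collapse n x) :=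
  isHomLift_vertical_comp (vertical_of_eq (T.tensor_vertical _ x) hx)
    (vertical_of_eq (T.unit_vertical x) hx)

end FibredDeltaStructure

variable {K : Type u₁} [Category.{v₁} K]

namespace Sect

variable {k : K ⥤ B}

/-- A section given by its values on objects and arrows. -/
@[simps functor_obj functor_map]
def ofLifts (obj : K → X) (hobj : ∀ x, q.obj (obj x) = k.obj x)
    (map : ∀ {x y : K}, (x ⟶ y) → (obj x ⟶ obj y))
    (hmap : ∀ {x y : K} (f : x ⟶ y), q.IsHomLift (k.map f) (map f))
    (map_id : ∀ x, map (𝟙 x) = 𝟙 (obj x))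
    (map_comp : ∀ {x y z : K} (f : x ⟶ y) (g : y ⟶ z), map (f ≫ g) = map f ≫ map g) :
    Sect k q where
  functor := { obj := obj, map := map, map_id := map_id, map_comp := map_comp }
  w := CategoryTheory.Functor.ext hobj (fun x y f => by
    have := hmap f
    exact IsHomLift.fac' q (k.map f) (map f))

/-- Restriction of sections along a functor `Φ` compatible with the functors to the base. -/
def precomp {K' : Type*} [Category* K'] {k' : K' ⥤ B} (Φ : K' ⥤ K) (h : Φ ⋙ k = k')
    (A : Sect k q) : Sect k' q where
  functor := Φ ⋙ A.functor
  w := by rw [Functor.assoc, A.w, h]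

end Sect

/-! ### Categories of simplices -/

/-- The category of simplices of a diagram of simplicial sets: an object is a simplex `s` of one of
the simplicial sets `P c`, and an arrow `s ⟶ t` identifies `t` with the image of `s` under an
arrow of the base and a simplicial operator. -/
structure Simplices (P : K ⥤ SSet.{u}) where
  base : K
  dim : SimplexCategory
  simplex : (P.obj base).obj (op dim)

namespace Simplices

variable {P : K ⥤ SSet.{u}}

/-- An arrow in the category of simplices. -/
@[ext]
structure Hom (x y : Simplices P) where
  base : x.base ⟶ y.base
  dim : y.dim ⟶ x.dim
  w : (P.map base).app _ ((P.obj x.base).map dim.op x.simplex) = y.simplex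

instance category : Category (Simplices P) where
  Hom := Hom
  id x := ⟨𝟙 _, 𝟙 _, by simp⟩
  comp {x y z} f g := ⟨f.base ≫ g.base, g.dim ≫ f.dim, by
    rw [← g.w, ← f.w]
    simp [NatTrans.naturality_apply]⟩

@[ext]
theorem hom_ext {x y : Simplices P} {f g : x ⟶ y} (h : f.base = g.base) (h' : f.dim = g.dim) :
    f = g := Hom.ext h h'

@[simp] theorem id_base (x : Simplices P) : (𝟙 x : x ⟶ x).base = 𝟙 _ := rfl
@[simp] theorem id_dim (x : Simplices P) : (𝟙 x : x ⟶ x).dim = 𝟙 _ := rfl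
@[simp] theorem comp_base {x y z : Simplices P} (f : x ⟶ y) (g : y ⟶ z) :
    (f ≫ g).base = f.base ≫ g.base := rfl
@[simp] theorem comp_dim {x y z : Simplices P} (f : x ⟶ y) (g : y ⟶ z) :
    (f ≫ g).dim = g.dim ≫ f.dim := rfl

variable (P) in
/-- The projection to the base. -/
@[simps]
def proj : Simplices P ⥤ K where
  obj x := x.base
  map f := f.base

/-- The image of a simplex under an arrow of the base. -/
abbrev push (x : Simplices P) {c : K} (f : x.base ⟶ c) : Simplices P :=
  ⟨c, x.dim, (P.map f).app _ x.simplex⟩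

/-- The arrow to the image of a simplex. -/
abbrev toPush (x : Simplices P) {c : K} (f : x.base ⟶ c) : x ⟶ x.push f :=
  ⟨f, 𝟙 x.dim, by simp⟩

/-- The restriction of a simplex along a simplicial operator. -/
abbrev restrict (x : Simplices P) {n : SimplexCategory} (θ : n ⟶ x.dim) : Simplices P :=
  ⟨x.base, n, (P.obj x.base).map θ.op x.simplex⟩

/-- The arrow to the restriction of a simplex. -/
abbrev toRestrict (x : Simplices P) {n : SimplexCategory} (θ : n ⟶ x.dim) : x ⟶ x.restrict θ :=
  ⟨𝟙 x.base, θ, by simp⟩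

variable (P) in
/-- The inclusion of the category of simplices of one of the simplicial sets. -/
@[simps]
def incl (c : K) : (P.obj c).Elements ⥤ Simplices P where
  obj e := ⟨c, e.1.unop, e.2⟩
  map {e e'} f := ⟨𝟙 c, f.1.unop, by
    have h : (P.obj c).map f.1 e.2 = e'.2 := f.2
    simp [h]⟩

end Simplices

variable {P : K ⥤ SSet.{u}}

namespace Sect

variable {k : K ⥤ B}

theorem isHomLift_of_base (A : Sect (Simplices.proj P ⋙ k) q) {x y : Simplices P} (e : x ⟶ y) :
    q.IsHomLift (k.map e.base) (A.functor.map e) :=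
  A.isHomLift e

/-- The restriction to a fibre of a section over a category of simplices. -/
def fiberFunctor (A : Sect (Simplices.proj P ⋙ k) q) (c : K) :
    (P.obj c).Elements ⥤ q.Fiber (k.obj c) where
  obj e := ⟨A.functor.obj ((Simplices.incl P c).obj e), A.obj_eq _⟩
  map f := ⟨A.functor.map ((Simplices.incl P c).map f), by
    have h := A.isHomLift ((Simplices.incl P c).map f)
    have e : (Simplices.proj P ⋙ k).map ((Simplices.incl P c).map f) = 𝟙 (k.obj c) := k.map_id c
    rwa [e] at h⟩
  map_id e := Subtype.ext (by
    refine (congrArg A.functor.map ((Simplices.incl P c).map_id e)).trans ?_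
    exact A.functor.map_id _)
  map_comp f g := Subtype.ext (by
    refine (congrArg A.functor.map ((Simplices.incl P c).map_comp f g)).trans ?_
    exact A.functor.map_comp _ _)

variable (T : FibredDeltaStructure q)
  [∀ b, HasColimitsOfSize.{0, 0} (q.Fiber b)] [∀ b, HasColimitsOfSize.{0, u} (q.Fiber b)]
  [∀ b, HasCoproducts.{u} (q.Fiber b)]
  [∀ b n, PreservesColimitsOfSize.{u, u} ((T.fiber b).tensor.obj n)]

/-- The values of the fibrewise homotopy colimit. -/
noncomputable def hocolimObj (A : Sect (Simplices.proj P ⋙ k) q) (c : K) : X :=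
  (T.fiberHocolim (A.fiberFunctor c)).1

theorem obj_hocolimObj (A : Sect (Simplices.proj P ⋙ k) q) (c : K) :
    q.obj (A.hocolimObj T c) = k.obj c := (T.fiberHocolim (A.fiberFunctor c)).2

/-- The canonical maps to the fibrewise homotopy colimit. -/
noncomputable def hocolimObjι (A : Sect (Simplices.proj P ⋙ k) q) (x : Simplices P) :
    (T.tensor.obj x.dim).obj (A.functor.obj x) ⟶ A.hocolimObj T x.base :=
  T.fiberHocolimι (A.fiberFunctor x.base) x.dim x.simplex

theorem hocolimObjι_isHomLift (A : Sect (Simplices.proj P ⋙ k) q) (x : Simplices P) :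
    q.IsHomLift (𝟙 (k.obj x.base)) (A.hocolimObjι T x) :=
  T.fiberHocolimι_isHomLift (A.fiberFunctor x.base) x.dim x.simplex

theorem hocolimObjι_congr (A : Sect (Simplices.proj P ⋙ k) q) {x : Simplices P} {c : K}
    {n : SimplexCategory} {t t' : (P.obj c).obj (op n)} (e : x ⟶ ⟨c, n, t⟩)
    (e' : x ⟶ ⟨c, n, t'⟩) (h : e.base = e'.base) (h' : e.dim = e'.dim) :
    (T.tensor.obj n).map (A.functor.map e) ≫ A.hocolimObjι T ⟨c, n, t⟩ =
      (T.tensor.obj n).map (A.functor.map e') ≫ A.hocolimObjι T ⟨c, n, t'⟩ := by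
  obtain rfl : t = t' := e.w.symm.trans (Eq.trans (by rw [h, h']) e'.w)
  rw [Simplices.hom_ext h h']

theorem hocolimObjι_condition (A : Sect (Simplices.proj P ⋙ k) q) (x : Simplices P)
    {n : SimplexCategory} (θ : n ⟶ x.dim) :
    (T.tensor.obj n).map (A.functor.map (x.toRestrict θ)) ≫ A.hocolimObjι T (x.restrict θ) =
      (T.tensor.map θ).app _ ≫ A.hocolimObjι T x :=
  T.fiberHocolim_condition (A.fiberFunctor x.base) θ x.simplex

variable [q.IsFibered]

theorem exists_hocolimObjDesc (A : Sect (Simplices.proj P ⋙ k) q) (c : K) {z : X} {b : B}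
    (u : k.obj c ⟶ b) (hz : q.obj z = b)
    (g : ∀ (n : SimplexCategory) (s : (P.obj c).obj (op n)),
      (T.tensor.obj n).obj (A.functor.obj ⟨c, n, s⟩) ⟶ z)
    (hg : ∀ n s, q.IsHomLift u (g n s))
    (hg' : ∀ ⦃n m : SimplexCategory⦄ (θ : n ⟶ m) (s : (P.obj c).obj (op m)),
      (T.tensor.obj n).map (A.functor.map (Simplices.toRestrict (P := P) ⟨c, m, s⟩ θ)) ≫
        g n ((P.obj c).map θ.op s) = (T.tensor.map θ).app _ ≫ g m s) :
    ∃ d : A.hocolimObj T c ⟶ z, q.IsHomLift u d ∧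
      ∀ n s, A.hocolimObjι T ⟨c, n, s⟩ ≫ d = g n s :=
  T.exists_fiberHocolimDesc u (A.fiberFunctor c) hz g hg hg'

theorem hocolimObj_hom_ext {A : Sect (Simplices.proj P ⋙ k) q} {c : K} {z : X} {b : B}
    (u : k.obj c ⟶ b) {f g : A.hocolimObj T c ⟶ z} (hf : q.IsHomLift u f)
    (hg : q.IsHomLift u g)
    (h : ∀ n s, A.hocolimObjι T ⟨c, n, s⟩ ≫ f = A.hocolimObjι T ⟨c, n, s⟩ ≫ g) : f = g :=
  T.fiberHocolim_hom_ext u hf hg h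

theorem exists_hocolimMap (A : Sect (Simplices.proj P ⋙ k) q) {c c' : K} (f : c ⟶ c') :
    ∃ d : A.hocolimObj T c ⟶ A.hocolimObj T c', q.IsHomLift (k.map f) d ∧
      ∀ n s, A.hocolimObjι T ⟨c, n, s⟩ ≫ d =
        (T.tensor.obj n).map (A.functor.map (Simplices.toPush (P := P) ⟨c, n, s⟩ f)) ≫
          A.hocolimObjι T (Simplices.push (P := P) ⟨c, n, s⟩ f) := by
  refine A.exists_hocolimObjDesc T c (k.map f) (A.obj_hocolimObj T c') _ (fun n s =>
    isHomLift_comp_vertical (T.isHomLift_tensor_map n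
      (A.isHomLift_of_base (Simplices.toPush (P := P) ⟨c, n, s⟩ f)))
      (A.hocolimObjι_isHomLift T (Simplices.push (P := P) ⟨c, n, s⟩ f))) (fun n m θ s => ?_)
  rw [← Functor.map_comp_assoc, ← A.functor.map_comp, ← NatTrans.naturality_assoc]
  refine Eq.trans ?_ (congrArg (_ ≫ ·)
    (A.hocolimObjι_condition T (Simplices.push (P := P) ⟨c, m, s⟩ f) θ))
  rw [← Functor.map_comp_assoc, ← A.functor.map_comp]
  refine A.hocolimObjι_congr T _ _ ?_ ?_
  · exact (Category.id_comp f).trans (Category.comp_id f).symm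
  · exact (Category.id_comp θ).trans (Category.comp_id θ).symm

/-- The fibrewise homotopy colimit of a section over a category of simplices. -/
noncomputable def hocolim (A : Sect (Simplices.proj P ⋙ k) q) : Sect k q :=
  ofLifts (fun c => A.hocolimObj T c) (A.obj_hocolimObj T)
    (fun f => (A.exists_hocolimMap T f).choose)
    (fun f => (A.exists_hocolimMap T f).choose_spec.1)
    (fun c => by
      have h := (A.exists_hocolimMap T (𝟙 c)).choose_spec
      refine hocolimObj_hom_ext T (𝟙 (k.obj c)) (by simpa using h.1)
        (IsHomLift.id (A.obj_hocolimObj T c)) (fun n s => ?_)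
      rw [h.2 n s, Category.comp_id]
      refine (A.hocolimObjι_congr T (Simplices.toPush (P := P) ⟨c, n, s⟩ (𝟙 c))
        (𝟙 (⟨c, n, s⟩ : Simplices P)) rfl rfl).trans ?_
      exact (congrArg (· ≫ _) (((T.tensor.obj n).congr_map (A.functor.map_id _)).trans
        ((T.tensor.obj n).map_id _))).trans (Category.id_comp _))
    (fun {c c' c''} f g => by
      have h := (A.exists_hocolimMap T f).choose_spec
      have h' := (A.exists_hocolimMap T g).choose_spec
      have h'' := (A.exists_hocolimMap T (f ≫ g)).choose_spec
      refine hocolimObj_hom_ext T (k.map f ≫ k.map g) (by simpa using h''.1)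
        (isHomLift_comp h.1 h'.1) (fun n s => ?_)
      rw [h''.2 n s, reassoc_of% (h.2 n s)]
      refine Eq.trans ?_ (congrArg (_ ≫ ·) (h'.2 n _).symm)
      rw [← Functor.map_comp_assoc, ← A.functor.map_comp]
      exact A.hocolimObjι_congr T _ _ rfl (Category.comp_id (𝟙 n)).symm)

/-- The canonical maps to the fibrewise homotopy colimit. -/
noncomputable def hocolimι (A : Sect (Simplices.proj P ⋙ k) q) (x : Simplices P) :
    (T.tensor.obj x.dim).obj (A.functor.obj x) ⟶ (A.hocolim T).functor.obj x.base :=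
  A.hocolimObjι T x

theorem hocolimι_isHomLift (A : Sect (Simplices.proj P ⋙ k) q) (x : Simplices P) :
    q.IsHomLift (𝟙 (k.obj x.base)) (A.hocolimι T x) :=
  A.hocolimObjι_isHomLift T x

theorem hocolimι_condition (A : Sect (Simplices.proj P ⋙ k) q) {x y : Simplices P} (e : x ⟶ y) :
    (T.tensor.obj y.dim).map (A.functor.map e) ≫ A.hocolimι T y =
      (T.tensor.map e.dim).app _ ≫ A.hocolimι T x ≫ (A.hocolim T).functor.map e.base := by
  have h : A.hocolimObjι T x ≫ (A.exists_hocolimMap T e.base).choose =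
      (T.tensor.obj x.dim).map (A.functor.map (x.toPush e.base)) ≫
        A.hocolimObjι T (x.push e.base) :=
    (A.exists_hocolimMap T e.base).choose_spec.2 x.dim x.simplex
  refine Eq.trans ?_ (congrArg (_ ≫ ·) h.symm)
  have h' := A.hocolimObjι_condition T (x.push e.base) e.dim
  refine Eq.trans ?_ ((T.tensor.map e.dim).naturality_assoc _ _)
  refine Eq.trans ?_ (congrArg ((T.tensor.obj y.dim).map
    (A.functor.map (x.toPush e.base)) ≫ ·) h')
  refine Eq.trans ?_ (Functor.map_comp_assoc _ _ _ _)
  rw [← A.functor.map_comp]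
  exact A.hocolimObjι_congr T _ _ (Category.comp_id _).symm (Category.comp_id _).symm

theorem hocolim_hom_ext {A : Sect (Simplices.proj P ⋙ k) q} {A' : Sect k q}
    {φ ψ : A.hocolim T ⟶ A'}
    (h : ∀ x : Simplices P, A.hocolimι T x ≫ φ.natTrans.app x.base =
      A.hocolimι T x ≫ ψ.natTrans.app x.base) : φ = ψ :=
  Sect.hom_ext (fun c => hocolimObj_hom_ext T (𝟙 (k.obj c)) (φ.vertical c) (ψ.vertical c)
    (fun n s => h ⟨c, n, s⟩))

theorem exists_hocolimDesc (A : Sect (Simplices.proj P ⋙ k) q) (A' : Sect k q)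
    (g : ∀ x : Simplices P, (T.tensor.obj x.dim).obj (A.functor.obj x) ⟶ A'.functor.obj x.base)
    (hg : ∀ x, q.IsHomLift (𝟙 (k.obj x.base)) (g x))
    (hg' : ∀ ⦃x y : Simplices P⦄ (e : x ⟶ y), (T.tensor.obj y.dim).map (A.functor.map e) ≫ g y =
      (T.tensor.map e.dim).app _ ≫ g x ≫ A'.functor.map e.base) :
    ∃ d : A.hocolim T ⟶ A', ∀ x, A.hocolimι T x ≫ d.natTrans.app x.base = g x := by
  have h := fun c => A.exists_hocolimObjDesc T c (𝟙 (k.obj c)) (A'.obj_eq c)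
    (fun n s => g ⟨c, n, s⟩) (fun n s => hg ⟨c, n, s⟩) (fun n m θ s => by
      refine (hg' (Simplices.toRestrict (P := P) ⟨c, m, s⟩ θ)).trans ?_
      refine congrArg (_ ≫ ·) ?_
      refine (congrArg (_ ≫ ·) (A'.functor.map_id c)).trans (Category.comp_id _))
  choose d hd hd' using h
  refine ⟨⟨{ app := d, naturality := fun c c' f => ?_ }, hd⟩, fun x => hd' _ _ _⟩
  refine hocolimObj_hom_ext T (k.map f) (isHomLift_comp_vertical ((A.hocolim T).isHomLift f)
    (hd c')) (isHomLift_vertical_comp (hd c) (A'.isHomLift f)) (fun n s => ?_)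
  let x : Simplices P := ⟨c, n, s⟩
  have h₁ := A.hocolimι_condition T (x.toPush f)
  have h₂ := hg' (x.toPush f)
  have e : ∀ z, (T.tensor.map (x.toPush f).dim).app z = 𝟙 _ := fun z =>
    congrArg (fun t => NatTrans.app t z) (T.tensor.map_id x.dim)
  rw [e, Category.id_comp] at h₁ h₂
  refine (Category.assoc _ _ _).symm.trans ?_
  refine (congrArg (· ≫ d c') h₁.symm).trans ?_
  refine (Category.assoc _ _ _).trans ?_
  refine (congrArg (_ ≫ ·) (hd' c' n _)).trans (h₂.trans ?_)
  exact (congrArg (· ≫ A'.functor.map f) (hd' c n s).symm).trans (Category.assoc _ _ _)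

theorem exists_hocolim_map {A A' : Sect (Simplices.proj P ⋙ k) q} (φ : A ⟶ A') :
    ∃ d : A.hocolim T ⟶ A'.hocolim T, ∀ x, A.hocolimι T x ≫ d.natTrans.app x.base =
      (T.tensor.obj x.dim).map (φ.natTrans.app x) ≫ A'.hocolimι T x :=
  A.exists_hocolimDesc T (A'.hocolim T)
    (fun x => (T.tensor.obj x.dim).map (φ.natTrans.app x) ≫ A'.hocolimι T x)
    (fun x => isHomLift_vertical_comp (T.isHomLift_tensor_map _ (φ.vertical x))
      (A'.hocolimι_isHomLift T x))
    (fun x y e => by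
      rw [← Functor.map_comp_assoc, φ.natTrans.naturality, Functor.map_comp_assoc,
        hocolimι_condition, NatTrans.naturality_assoc, Category.assoc])

/-- The map between fibrewise homotopy colimits given by a map of sections. -/
noncomputable def hocolimMap {A A' : Sect (Simplices.proj P ⋙ k) q} (φ : A ⟶ A') :
    A.hocolim T ⟶ A'.hocolim T :=
  (exists_hocolim_map T φ).choose

theorem hocolimι_map {A A' : Sect (Simplices.proj P ⋙ k) q} (φ : A ⟶ A') (x : Simplices P) :
    A.hocolimι T x ≫ (hocolimMap T φ).natTrans.app x.base =
      (T.tensor.obj x.dim).map (φ.natTrans.app x) ≫ A'.hocolimι T x :=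
  (exists_hocolim_map T φ).choose_spec x

/-- The components of a map to a section pulled back from the base. -/
def augApp {A : Sect (Simplices.proj P ⋙ k) q} {A' : Sect k q}
    (a : A ⟶ A'.precomp (Simplices.proj P) rfl) (x : Simplices P) :
    A.functor.obj x ⟶ A'.functor.obj x.base :=
  a.natTrans.app x

theorem augApp_isHomLift {A : Sect (Simplices.proj P ⋙ k) q} {A' : Sect k q}
    (a : A ⟶ A'.precomp (Simplices.proj P) rfl) (x : Simplices P) :
    q.IsHomLift (𝟙 (k.obj x.base)) (augApp a x) :=
  a.vertical x

theorem augApp_naturality {A : Sect (Simplices.proj P ⋙ k) q} {A' : Sect k q}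
    (a : A ⟶ A'.precomp (Simplices.proj P) rfl) {x y : Simplices P} (e : x ⟶ y) :
    A.functor.map e ≫ augApp a y = augApp a x ≫ A'.functor.map e.base :=
  a.natTrans.naturality e

theorem exists_hocolimAug {A : Sect (Simplices.proj P ⋙ k) q} {A' : Sect k q}
    (a : A ⟶ A'.precomp (Simplices.proj P) rfl) :
    ∃ d : A.hocolim T ⟶ A', ∀ x, A.hocolimι T x ≫ d.natTrans.app x.base =
      (T.tensor.obj x.dim).map (augApp a x) ≫ T.collapse x.dim _ :=
  A.exists_hocolimDesc T A'
    (fun x => (T.tensor.obj x.dim).map (augApp a x) ≫ T.collapse x.dim _)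
    (fun x => isHomLift_vertical_comp (T.isHomLift_tensor_map _ (augApp_isHomLift a x))
      (T.isHomLift_collapse _ (A'.obj_eq x.base)))
    (fun x y e => by
      rw [← Functor.map_comp_assoc, augApp_naturality, Functor.map_comp_assoc,
        T.collapse_natural, ← T.map_collapse e.dim (A'.functor.obj x.base), Category.assoc,
        NatTrans.naturality_assoc, Category.assoc])

/-- The augmentation of a fibrewise homotopy colimit given by a map to a section pulled back from
the base. -/
noncomputable def hocolimAug {A : Sect (Simplices.proj P ⋙ k) q} {A' : Sect k q}
    (a : A ⟶ A'.precomp (Simplices.proj P) rfl) : A.hocolim T ⟶ A' :=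
  (exists_hocolimAug T a).choose

theorem hocolimι_aug {A : Sect (Simplices.proj P ⋙ k) q} {A' : Sect k q}
    (a : A ⟶ A'.precomp (Simplices.proj P) rfl) (x : Simplices P) :
    A.hocolimι T x ≫ (hocolimAug T a).natTrans.app x.base =
      (T.tensor.obj x.dim).map (augApp a x) ≫ T.collapse x.dim _ :=
  (exists_hocolimAug T a).choose_spec x

end Sect

end SectionHocolim

/-! ### Weak equivalences between fibrewise homotopy colimits -/

section Contraction

variable {N : Type u₁} [Category.{v₁} N] {T : DeltaStructure N} {W : MorphismProperty N}
  (hT : IsHomotopicalDeltaCategory.{u} T W)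
  [HasColimitsOfSize.{0, 0} N] [HasColimitsOfSize.{0, u} N] [HasCoproducts.{u} N]

/-- Maps out of `n ↦ ∐_{s ∈ Sₙ} z`. -/
noncomputable def constCopowerLift (S : SSet.{u}) (z : N) {Y : SimplexCategoryᵒᵖ ⥤ N}
    (g : ∀ n, S.obj n → (z ⟶ Y.obj n))
    (hg : ∀ ⦃n m : SimplexCategoryᵒᵖ⦄ (α : n ⟶ m) (s : S.obj n),
      g n s ≫ Y.map α = g m (S.map α s)) : constCopower S z ⟶ Y where
  app n := Sigma.desc (g n)
  naturality n m α := by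
    refine DeltaStructure.constCopower_hom_ext (fun s => ?_)
    rw [← Category.assoc, DeltaStructure.constCopowerι_map, ← Category.assoc]
    refine (Sigma.ι_desc (g m) _).trans ((hg α s).symm.trans ?_)
    exact congrArg (· ≫ Y.map α) (Sigma.ι_desc (g n) s).symm

theorem constCopowerι_lift (S : SSet.{u}) (z : N) {Y : SimplexCategoryᵒᵖ ⥤ N}
    (g : ∀ n, S.obj n → (z ⟶ Y.obj n))
    (hg : ∀ ⦃n m : SimplexCategoryᵒᵖ⦄ (α : n ⟶ m) (s : S.obj n),
      g n s ≫ Y.map α = g m (S.map α s)) (n : SimplexCategoryᵒᵖ) (s : S.obj n) :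
    DeltaStructure.constCopowerι S z n s ≫ (constCopowerLift S z g hg).app n = g n s :=
  Sigma.ι_desc _ _

/-- The inclusion of a summand of the copower of `n ↦ ∐_{s ∈ Sₙ} G(s)` by a simplicial set. -/
noncomputable def copowerSigmaι (I : SSet.{u}) {S : SSet.{u}} (G : S.Elements ⥤ N)
    (n : SimplexCategoryᵒᵖ) (v : I.obj n) (s : S.obj n) :
    G.obj (S.elementsMk n s) ⟶ (copower I (sigmaObj S G)).obj n :=
  sigmaObjι G n s ≫ bisimplicialCopowerι I (sigmaObj S G) n n v

theorem copowerSigma_hom_ext {I S : SSet.{u}} {G : S.Elements ⥤ N} {n : SimplexCategoryᵒᵖ} {w : N}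
    {f g : (copower I (sigmaObj S G)).obj n ⟶ w}
    (h : ∀ v s, copowerSigmaι I G n v s ≫ f = copowerSigmaι I G n v s ≫ g) : f = g := by
  refine bisimplicialCopower_hom_ext (fun v => sigmaObj_hom_ext (fun s => ?_))
  exact (Category.assoc _ _ _).symm.trans ((h v s).trans (Category.assoc _ _ _))

theorem copowerSigmaι_map (I : SSet.{u}) {S : SSet.{u}} (G : S.Elements ⥤ N)
    {n m : SimplexCategoryᵒᵖ} (α : n ⟶ m) (v : I.obj n) (s : S.obj n) :
    copowerSigmaι I G n v s ≫ (copower I (sigmaObj S G)).map α =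
      G.map (simplexArrow S α s) ≫ copowerSigmaι I G m (I.map α v) (S.map α s) := by
  refine (Category.assoc _ _ _).trans ?_
  refine (congrArg (sigmaObjι G n s ≫ ·)
    (bisimplicialCopowerι_map I (sigmaObj S G) α α v)).trans ?_
  refine (Category.assoc _ _ _).symm.trans ?_
  refine (congrArg (· ≫ bisimplicialCopowerι I (sigmaObj S G) m m (I.map α v))
    (sigmaObjι_map G (simplexArrow S α s))).trans ?_
  exact Category.assoc _ _ _

/-- Maps out of the copower of `n ↦ ∐_{s ∈ Sₙ} G(s)` by a simplicial set. -/
noncomputable def copowerSigmaLift (I : SSet.{u}) {S : SSet.{u}} (G : S.Elements ⥤ N)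
    {Y : SimplexCategoryᵒᵖ ⥤ N}
    (g : ∀ n, I.obj n → ∀ s : S.obj n, (G.obj (S.elementsMk n s) ⟶ Y.obj n))
    (hg : ∀ ⦃n m : SimplexCategoryᵒᵖ⦄ (α : n ⟶ m) (v : I.obj n) (s : S.obj n),
      G.map (simplexArrow S α s) ≫ g m (I.map α v) (S.map α s) = g n v s ≫ Y.map α) :
    copower I (sigmaObj S G) ⟶ Y where
  app n := Sigma.desc (fun v => sigmaObjDesc G n (g n v))
  naturality n m α := by
    have h : ∀ n v s, copowerSigmaι I G n v s ≫
        Sigma.desc (fun v => sigmaObjDesc G n (g n v)) = g n v s := fun n v s =>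
      (Category.assoc _ _ _).trans ((congrArg (sigmaObjι G n s ≫ ·)
        (Sigma.ι_desc (fun v => sigmaObjDesc G n (g n v)) v)).trans
        (sigmaObjι_desc G n (g n v) s))
    refine copowerSigma_hom_ext (fun v s => ?_)
    refine (Category.assoc _ _ _).symm.trans ((congrArg
      (· ≫ Sigma.desc (fun v => sigmaObjDesc G m (g m v))) (copowerSigmaι_map I G α v s)).trans ?_)
    refine (Category.assoc _ _ _).trans ((congrArg (G.map (simplexArrow S α s) ≫ ·)
      (h m _ _)).trans ((hg α v s).trans ?_))
    exact (congrArg (· ≫ _) (h n v s).symm).trans (Category.assoc _ _ _)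

theorem copowerSigmaι_lift (I : SSet.{u}) {S : SSet.{u}} (G : S.Elements ⥤ N)
    {Y : SimplexCategoryᵒᵖ ⥤ N}
    (g : ∀ n, I.obj n → ∀ s : S.obj n, (G.obj (S.elementsMk n s) ⟶ Y.obj n))
    (hg : ∀ ⦃n m : SimplexCategoryᵒᵖ⦄ (α : n ⟶ m) (v : I.obj n) (s : S.obj n),
      G.map (simplexArrow S α s) ≫ g m (I.map α v) (S.map α s) = g n v s ≫ Y.map α)
    (n : SimplexCategoryᵒᵖ) (v : I.obj n) (s : S.obj n) :
    copowerSigmaι I G n v s ≫ (copowerSigmaLift I G g hg).app n = g n v s :=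
  (Category.assoc _ _ _).trans ((congrArg (sigmaObjι G n s ≫ ·)
        (Sigma.ι_desc (fun v => sigmaObjDesc G n (g n v)) v)).trans
    (sigmaObjι_desc G n (g n v) s))

/-- An augmentation `G ⟶ z` of a diagram on the category of simplices of `S` is contractible if,
up to a simplicial homotopy parametrised by a contractible simplicial set, it is a retract of the
constant diagram with value `z` on the category of simplices of a contractible simplicial set.
Compatibilities are required for arrows of the category of simplices with a prescribed underlying
simplicial operator. -/
structure Contraction {S : SSet.{u}} (G : S.Elements ⥤ N) {z : N}
    (a : ∀ e : S.Elements, G.obj e ⟶ z) where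
  dom : SSet.{u}
  dom_contractible : ContractibleSpace (SSet.toTop.obj dom)
  i : dom ⟶ S
  γ (n : SimplexCategoryᵒᵖ) (j : dom.obj n) : z ⟶ G.obj (S.elementsMk n (i.app n j))
  γ_map {n m : SimplexCategoryᵒᵖ} (α : n ⟶ m) (j : dom.obj n)
    (e : S.elementsMk n (i.app n j) ⟶ S.elementsMk m (i.app m (dom.map α j))) :
    e.1 = α → γ n j ≫ G.map e = γ m (dom.map α j)
  γ_a (n : SimplexCategoryᵒᵖ) (j : dom.obj n) : γ n j ≫ a _ = 𝟙 z
  r : S ⟶ dom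
  par : SSet.{u}
  par_contractible : ContractibleSpace (SSet.toTop.obj par)
  h (n : SimplexCategoryᵒᵖ) : S.obj n → par.obj n → S.obj n
  h_map {n m : SimplexCategoryᵒᵖ} (α : n ⟶ m) (s : S.obj n) (v : par.obj n) :
    S.map α (h n s v) = h m (S.map α s) (par.map α v)
  η (n : SimplexCategoryᵒᵖ) (s : S.obj n) (v : par.obj n) :
    G.obj (S.elementsMk n s) ⟶ G.obj (S.elementsMk n (h n s v))
  η_map {n m : SimplexCategoryᵒᵖ} (α : n ⟶ m) (s : S.obj n) (v : par.obj n)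
    (e : S.elementsMk n s ⟶ S.elementsMk m (S.map α s))
    (e' : S.elementsMk n (h n s v) ⟶ S.elementsMk m (h m (S.map α s) (par.map α v))) :
    e.1 = α → e'.1 = α → G.map e ≫ η m (S.map α s) (par.map α v) = η n s v ≫ G.map e'
  start : par.obj (op ⦋0⦌)
  finish : par.obj (op ⦋0⦌)
  h_start (n : SimplexCategoryᵒᵖ) (s : S.obj n) :
    h n s (par.map (SimplexCategory.isTerminalZero.from n.unop).op start) = s
  h_finish (n : SimplexCategoryᵒᵖ) (s : S.obj n) :
    h n s (par.map (SimplexCategory.isTerminalZero.from n.unop).op finish) =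
      i.app n (r.app n s)
  η_start (n : SimplexCategoryᵒᵖ) (s : S.obj n)
    (e : S.elementsMk n (h n s (par.map (SimplexCategory.isTerminalZero.from n.unop).op start)) ⟶
      S.elementsMk n s) : e.1 = 𝟙 n → η n s _ ≫ G.map e = 𝟙 _
  η_finish (n : SimplexCategoryᵒᵖ) (s : S.obj n)
    (e : S.elementsMk n (h n s (par.map (SimplexCategory.isTerminalZero.from n.unop).op finish)) ⟶
      S.elementsMk n (i.app n (r.app n s))) :
    e.1 = 𝟙 n → η n s _ ≫ G.map e = a _ ≫ γ n (r.app n s)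

/-- The augmentation of a simplicial object given by compatible maps. -/
noncomputable def sigmaObjAug {S : SSet.{u}} (G : S.Elements ⥤ N) {z : N}
    (a : ∀ e : S.Elements, G.obj e ⟶ z)
    (ha : ∀ {e e' : S.Elements} (f : e ⟶ e'), G.map f ≫ a e' = a e) :
    sigmaObj S G ⟶ (Functor.const _).obj z :=
  sigmaObjLift G (fun n s => a (S.elementsMk n s))
    (fun _ _ _ _ => (ha _).trans (Category.comp_id _).symm)

include hT in
/-- The data of a contraction are a simplicial retraction up to homotopy of the realisations, onto
the realisation of a constant diagram over a contractible simplicial set. -/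
theorem Contraction.weq_realisationAug {S : SSet.{u}} {G : S.Elements ⥤ N} {z : N}
    {a : ∀ e : S.Elements, G.obj e ⟶ z} (c : Contraction G a)
    (ha : ∀ {e e' : S.Elements} (f : e ⟶ e'), G.map f ≫ a e' = a e) :
    W (T.realisationAug (sigmaObjAug G a ha)) := by
  have := c.dom_contractible
  have := c.par_contractible
  let a' := sigmaObjAug G a ha
  have hι : ∀ {n m : SimplexCategoryᵒᵖ} (α : n ⟶ m) (s : S.obj n) (t : S.obj m)
      (h : S.map α s = t), ∃ e : S.elementsMk n s ⟶ S.elementsMk m t, e.1 = α := fun α s t h =>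
    ⟨CategoryOfElements.homMk (S.elementsMk _ s) (S.elementsMk _ t) α h, rfl⟩
  have ha' : ∀ n s, sigmaObjι G n s ≫ a'.app n = a (S.elementsMk n s) := fun n s =>
    sigmaObjι_desc G n _ s
  have hmap : ∀ {n m : SimplexCategoryᵒᵖ} {s : S.obj n} {t : S.obj m}
      (e : S.elementsMk n s ⟶ S.elementsMk m t) (α : n ⟶ m), e.1 = α →
      sigmaObjι G n s ≫ (sigmaObj S G).map α = G.map e ≫ sigmaObjι G m t := by
    rintro n m s t e _ rfl
    exact sigmaObjι_map G e
  let i : constCopower c.dom z ⟶ sigmaObj S G :=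
    constCopowerLift c.dom z (fun n j => c.γ n j ≫ sigmaObjι G n (c.i.app n j)) (by
      intro n m α j
      obtain ⟨e, he⟩ := hι α (c.i.app n j) (c.i.app m (c.dom.map α j))
        (NatTrans.naturality_apply c.i α j).symm
      rw [Category.assoc, hmap e α he, ← Category.assoc, c.γ_map α j e he])
  have hi : i ≫ a' = constCopowerAug c.dom z := by
    ext n
    refine DeltaStructure.constCopower_hom_ext (fun j => ?_)
    refine Eq.trans ?_ (DeltaStructure.constCopowerι_aug c.dom z n j).symm
    refine (Category.assoc _ _ _).symm.trans ((congrArg (· ≫ a'.app n)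
      (constCopowerι_lift _ _ _ _ n j)).trans ?_)
    rw [Category.assoc]
    exact (congrArg (_ ≫ ·) (ha' _ _)).trans (c.γ_a n j)
  let r : sigmaObj S G ⟶ constCopower c.dom z :=
    sigmaObjLift G (fun n s => a (S.elementsMk n s) ≫
      DeltaStructure.constCopowerι c.dom z n (c.r.app n s)) (by
      intro n m α s
      rw [Category.assoc, DeltaStructure.constCopowerι_map, ← Category.assoc]
      have h₁ := ha (simplexArrow S α s)
      have h₂ : c.r.app m (S.map α s) = c.dom.map α (c.r.app n s) :=
        NatTrans.naturality_apply c.r α s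
      rw [← h₂]
      exact congrArg (· ≫ _) h₁)
  let H : copower c.par (sigmaObj S G) ⟶ sigmaObj S G :=
    copowerSigmaLift c.par G (fun n v s => c.η n s v ≫ sigmaObjι G n (c.h n s v)) (by
      intro n m α v s
      obtain ⟨e, he⟩ := hι α (c.h n s v) _ (c.h_map α s v)
      rw [Category.assoc, hmap e α he, ← Category.assoc, ← Category.assoc]
      exact congrArg (· ≫ _) (c.η_map α s v _ e rfl he))
  refine hT.realisationAug_of_homotopy c.dom c.par a' i hi r H c.start c.finish ?_ ?_
  · ext n
    refine sigmaObj_hom_ext (fun s => ?_)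
    refine (Category.assoc _ _ _).symm.trans ((copowerSigmaι_lift _ _ _ _ n _ s).trans ?_)
    obtain ⟨e, he⟩ := hι (𝟙 n) _ s (by simpa using c.h_start n s)
    have h₁ := hmap e (𝟙 n) he
    rw [CategoryTheory.Functor.map_id, Category.comp_id] at h₁
    rw [h₁, ← Category.assoc, c.η_start n s e he]
    exact (Category.id_comp _).trans (Category.comp_id _).symm
  · ext n
    refine sigmaObj_hom_ext (fun s => ?_)
    refine (Category.assoc _ _ _).symm.trans ((copowerSigmaι_lift _ _ _ _ n _ s).trans ?_)
    obtain ⟨e, he⟩ := hι (𝟙 n) _ (c.i.app n (c.r.app n s)) (by simpa using c.h_finish n s)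
    have h₁ := hmap e (𝟙 n) he
    rw [CategoryTheory.Functor.map_id, Category.comp_id] at h₁
    rw [h₁, ← Category.assoc, c.η_finish n s e he]
    symm
    refine (Category.assoc _ _ _).symm.trans ((congrArg (· ≫ i.app n)
      (sigmaObjι_lift _ _ _ n s)).trans ?_)
    rw [Category.assoc, Category.assoc]
    exact congrArg (_ ≫ ·) (constCopowerι_lift _ _ _ _ n _)

end Contraction

section Weq

variable {B : Type u₂} [Category.{v₂} B] {X : Type u₃} [Category.{v₃} X] {q : X ⥤ B}
  {K : Type u₁} [Category.{v₁} K] {k : K ⥤ B} {P : K ⥤ SSet.{u}}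

/-- The pointwise weak equivalences of sections. -/
def Sect.weq (k : K ⥤ B) (q : X ⥤ B) (W : MorphismProperty X) : MorphismProperty (Sect k q) :=
  fun _ _ φ => ∀ x, W (φ.natTrans.app x)

variable (T : FibredDeltaStructure q) {W : MorphismProperty X}
  (hT : ∀ b, IsHomotopicalDeltaCategory.{u} (T.fiber b)
    (W.inverseImage Functor.Fiber.fiberInclusion))
  [∀ b, HasColimitsOfSize.{0, 0} (q.Fiber b)] [∀ b, HasColimitsOfSize.{0, u} (q.Fiber b)]
  [∀ b, HasCoproducts.{u} (q.Fiber b)]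
  [∀ b n, PreservesColimitsOfSize.{u, u} ((T.fiber b).tensor.obj n)] [q.IsFibered]

namespace Sect

include hT in
theorem weq_hocolimMap {A A' : Sect (Simplices.proj P ⋙ k) q} (φ : A ⟶ A')
    (hφ : Sect.weq _ q W φ) : Sect.weq k q W (hocolimMap T φ) := by
  intro c
  let φ' : A.fiberFunctor c ⟶ A'.fiberFunctor c :=
    { app := fun e => ⟨φ.natTrans.app ((Simplices.incl P c).obj e), φ.vertical ((Simplices.incl P c).obj e)⟩
      naturality := fun e e' f => Subtype.ext (φ.natTrans.naturality _) }
  have h := (hT (k.obj c)).realisation_sigmaObjMap φ' (fun s => hφ _)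
  let d : A.hocolimObj T c ⟶ A'.hocolimObj T c :=
    ((T.fiber (k.obj c)).realisation.map (sigmaObjMap φ')).1
  have hd : (hocolimMap T φ).natTrans.app c = d := by
    refine hocolimObj_hom_ext T (𝟙 (k.obj c)) ((hocolimMap T φ).vertical c)
      ((T.fiber (k.obj c)).realisation.map (sigmaObjMap φ')).2 (fun n s => ?_)
    refine (hocolimι_map T φ ⟨c, n, s⟩).trans ?_
    exact (congrArg Subtype.val ((T.fiber (k.obj c)).hocolimι_map φ' n s)).symm
  rw [hd]
  exact h

include hT in
/-- The augmentation of a fibrewise homotopy colimit is a weak equivalence at `c` if the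
augmented diagram over `c` is contractible. -/
theorem weq_hocolimAug {A : Sect (Simplices.proj P ⋙ k) q} {A' : Sect k q}
    (a : A ⟶ A'.precomp (Simplices.proj P) rfl) (c : K)
    (C : Contraction (A.fiberFunctor c) (z := ⟨A'.functor.obj c, A'.obj_eq c⟩)
      (fun e => ⟨augApp a ((Simplices.incl P c).obj e), augApp_isHomLift a ((Simplices.incl P c).obj e)⟩)) :
    W ((hocolimAug T a).natTrans.app c) := by
  have h := C.weq_realisationAug (hT (k.obj c)) (fun {e e'} f => Subtype.ext (by
    refine (augApp_naturality a ((Simplices.incl P c).map f)).trans ?_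
    exact (congrArg (_ ≫ ·) (A'.functor.map_id c)).trans (Category.comp_id _)))
  let b := sigmaObjAug (A.fiberFunctor c) (z := ⟨A'.functor.obj c, A'.obj_eq c⟩)
    (fun e => ⟨augApp a ((Simplices.incl P c).obj e), augApp_isHomLift a ((Simplices.incl P c).obj e)⟩)
    (fun {e e'} f => Subtype.ext (by
      refine (augApp_naturality a ((Simplices.incl P c).map f)).trans ?_
      exact (congrArg (_ ≫ ·) (A'.functor.map_id c)).trans (Category.comp_id _)))
  let d : A.hocolimObj T c ⟶ A'.functor.obj c := ((T.fiber (k.obj c)).realisationAug b).1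
  have hd : (hocolimAug T a).natTrans.app c = d := by
    refine hocolimObj_hom_ext T (𝟙 (k.obj c)) ((hocolimAug T a).vertical c)
      ((T.fiber (k.obj c)).realisationAug b).2 (fun n s => ?_)
    refine (hocolimι_aug T a ⟨c, n, s⟩).trans ?_
    refine Eq.trans ?_ (congrArg Subtype.val
      ((T.fiber (k.obj c)).hocolimι_aug b n s)).symm
    have h : sigmaObjι (A.fiberFunctor c) (op n) s ≫ b.app (op n) =
      ⟨augApp a ⟨c, n, s⟩, augApp_isHomLift a ⟨c, n, s⟩⟩ := sigmaObjι_lift _ _ _ _ _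
    rw [h]
    rfl
  rw [hd]
  exact h

end Sect

end Weq

/-! ### Cylinders and homotopy pushouts -/

section Interval

variable {N : Type u₁} [Category.{v₁} N]

open SSet.stdSimplex in
theorem stdSimplex_ext {d : ℕ} {n : SimplexCategoryᵒᵖ} {x y : (Δ[d] : SSet.{u}).obj n}
    (h : ∀ i, asOrderHom x i = asOrderHom y i) : x = y :=
  objEquiv.injective (SimplexCategory.Hom.ext _ _ (OrderHom.ext _ _ (funext h)))

theorem asOrderHom_elements {d : ℕ} {e e' : (Δ[d] : SSet.{u}).Elements} (f : e ⟶ e')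
    (i : Fin (e'.1.unop.len + 1)) :
    SSet.stdSimplex.asOrderHom e'.2 i = SSet.stdSimplex.asOrderHom e.2 (f.1.unop.toOrderHom i) := by
  have h : (Δ[d] : SSet.{u}).map f.1 e.2 = e'.2 := f.2
  exact congrArg (fun t => SSet.stdSimplex.asOrderHom t i) h.symm

/-- A constant augmented diagram on the category of simplices of a contractible simplicial set is
contractible. -/
noncomputable def Contraction.const (S : SSet.{u}) (hS : ContractibleSpace (SSet.toTop.obj S))
    (z : N) : Contraction (S := S) ((Functor.const _).obj z) (fun _ => 𝟙 z) where
  dom := S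
  dom_contractible := hS
  i := 𝟙 S
  γ _ _ := 𝟙 z
  γ_map _ _ _ _ := Category.comp_id _
  γ_a _ _ := Category.comp_id _
  r := 𝟙 S
  par := Δ[0]
  par_contractible := inferInstance
  h _ s _ := s
  h_map _ _ _ := rfl
  η _ _ _ := 𝟙 z
  η_map _ _ _ _ _ _ _ := rfl
  start := SSet.stdSimplex.const 0 0 _
  finish := SSet.stdSimplex.const 0 0 _
  h_start _ _ := rfl
  h_finish _ _ := rfl
  η_start _ _ _ _ := Category.comp_id _
  η_finish _ _ _ _ := rfl

/-- The diagram `θ ↦ Φ(θ(0))` on the category of simplices of the interval, augmented to `Φ(1)`, is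
contractible: the homotopy `(θ, θ') ↦ max(θ, θ')` only increases the first vertex. -/
noncomputable def Contraction.interval (R : (Δ[1] : SSet.{u}).Elements ⥤ Fin 2)
    (hR : ∀ e, R.obj e = SSet.stdSimplex.asOrderHom e.2 0) (Φ : Fin 2 ⥤ N) :
    Contraction (S := Δ[1]) (R ⋙ Φ) (z := Φ.obj 1)
      (fun e => Φ.map (homOfLE (Fin.le_last (R.obj e)))) where
  dom := Δ[0]
  dom_contractible := inferInstance
  i := SSet.stdSimplex.map (SimplexCategory.δ 0)
  γ n j := Φ.map (homOfLE (by
    rw [hR]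
    exact le_of_eq (congrArg Fin.succ (Subsingleton.elim (0 : Fin 1) _))))
  γ_map _ _ _ _ := (Φ.map_comp _ _).symm.trans (congrArg Φ.map (Subsingleton.elim _ _))
  γ_a _ _ := (Φ.map_comp _ _).symm.trans (Φ.map_id _)
  r := SSet.stdSimplex.map (SimplexCategory.σ 0)
  par := Δ[1]
  par_contractible := inferInstance
  h n s v := SSet.stdSimplex.objMk
    (SSet.stdSimplex.asOrderHom s ⊔ SSet.stdSimplex.asOrderHom v)
  h_map α s v := rfl
  η n s v := Φ.map (homOfLE (by
    rw [hR, hR]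
    exact le_sup_left))
  η_map _ _ _ _ _ _ _ := (Φ.map_comp _ _).symm.trans
    ((congrArg Φ.map (Subsingleton.elim _ _)).trans (Φ.map_comp _ _))
  start := SSet.stdSimplex.const 1 0 _
  finish := SSet.stdSimplex.const 1 1 _
  h_start n s := stdSimplex_ext (fun i => sup_eq_left.2 (Fin.zero_le _))
  h_finish n s := stdSimplex_ext (fun i => by
    refine (sup_eq_right.2 (Fin.le_last _)).trans ?_
    exact (congrArg Fin.succ (Subsingleton.elim (0 : Fin 1) _)))
  η_start _ _ _ _ := (Φ.map_comp _ _).symm.trans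
    ((congrArg Φ.map (Subsingleton.elim _ (𝟙 _))).trans (Φ.map_id _))
  η_finish _ _ _ _ := (Φ.map_comp _ _).symm.trans
    ((congrArg Φ.map (Subsingleton.elim _ _)).trans (Φ.map_comp _ _))

/-- The object of the span `left ⟵ zero ⟶ right` attached to a simplex of the interval with first
vertex `a` and last vertex `b`: the simplex is constant at `0`, or constant at `1`, or mixed. -/
def intervalShapeObj (a b : Fin 2) : WalkingSpan :=
  if b = 0 then WalkingSpan.left else if a = 1 then WalkingSpan.right else WalkingSpan.zero

theorem intervalShapeObj_eq : ∀ {a b a' b' : Fin 2}, a ≤ b → a ≤ a' → a' ≤ b' → b' ≤ b →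
    intervalShapeObj a b = intervalShapeObj a' b' ∨ intervalShapeObj a b = WalkingSpan.zero := by
  intro a b a' b' h₁ h₂ h₃ h₄
  fin_cases a <;> fin_cases b <;> fin_cases a' <;> fin_cases b' <;> first
    | exact Or.inl rfl
    | exact Or.inr rfl
    | exact absurd h₁ (by decide)
    | exact absurd h₂ (by decide)
    | exact absurd h₃ (by decide)
    | exact absurd h₄ (by decide)

theorem nonempty_hom_of_zero (j : WalkingSpan) : Nonempty (WalkingSpan.zero ⟶ j) := by
  cases j with
  | none => exact ⟨𝟙 _⟩
  | some j => exact ⟨WidePushoutShape.Hom.init j⟩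

theorem intervalShape_nonempty {e e' : (Δ[1] : SSet.{u}).Elements} (f : e ⟶ e') :
    Nonempty (intervalShapeObj (SSet.stdSimplex.asOrderHom e.2 0)
        (SSet.stdSimplex.asOrderHom e.2 (Fin.last _)) ⟶
      intervalShapeObj (SSet.stdSimplex.asOrderHom e'.2 0)
        (SSet.stdSimplex.asOrderHom e'.2 (Fin.last _))) := by
  have m := (SSet.stdSimplex.asOrderHom e.2).monotone
  have h := intervalShapeObj_eq (m (Fin.zero_le (Fin.last _)))
    ((m (Fin.zero_le (f.1.unop.toOrderHom 0))).trans_eq (asOrderHom_elements f 0).symm)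
    ((SSet.stdSimplex.asOrderHom e'.2).monotone (Fin.zero_le (Fin.last _)))
    ((asOrderHom_elements f (Fin.last _)).trans_le
      (m (Fin.le_last (f.1.unop.toOrderHom (Fin.last _)))))
  rcases h with h | h
  · exact ⟨eqToHom h⟩
  · rw [h]
    exact nonempty_hom_of_zero _

/-- The functor from the category of simplices of the interval to the span
`left ⟵ zero ⟶ right`. -/
noncomputable def intervalShape : (Δ[1] : SSet.{u}).Elements ⥤ WalkingSpan where
  obj e := intervalShapeObj (SSet.stdSimplex.asOrderHom e.2 0)
    (SSet.stdSimplex.asOrderHom e.2 (Fin.last _))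
  map f := (intervalShape_nonempty f).some
  map_id _ := Subsingleton.elim _ _
  map_comp _ _ := Subsingleton.elim _ _

/-- The first vertex of the span `left ⟵ zero ⟶ right`. -/
def spanEvalObj (j : WalkingSpan) : Fin 2 :=
  match j with
  | some WalkingPair.right => 1
  | some WalkingPair.left => 0
  | none => 0

theorem spanEval_le {j j' : WalkingSpan} (f : j ⟶ j') : spanEvalObj j ≤ spanEvalObj j' := by
  cases j with
  | none => exact Fin.zero_le _
  | some j =>
    cases j' with
    | none => nomatch f
    | some j' =>
      obtain rfl : j = j' := by
        cases j <;> cases j' <;> first | rfl | nomatch f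
      exact le_rfl

/-- The functor from the span `left ⟵ zero ⟶ right` to the arrow `0 ⟶ 1` which inverts
`zero ⟶ left`. -/
def spanEval : WalkingSpan ⥤ Fin 2 where
  obj := spanEvalObj
  map f := homOfLE (spanEval_le f)

theorem spanEvalObj_intervalShapeObj :
    ∀ {a b : Fin 2}, a ≤ b → spanEvalObj (intervalShapeObj a b) = a := by
  intro a b h
  fin_cases a <;> fin_cases b <;> first
    | rfl
    | exact absurd h (by decide)

theorem spanEval_intervalShape (e : (Δ[1] : SSet.{u}).Elements) :
    (intervalShape ⋙ spanEval).obj e = SSet.stdSimplex.asOrderHom e.2 0 :=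
  spanEvalObj_intervalShapeObj
    ((SSet.stdSimplex.asOrderHom e.2).monotone (Fin.zero_le (Fin.last _)))

/-- The components of the comparison from the arrow `g : X ⟶ Z` to the span `Y ⟵ X ⟶ Z`. -/
def spanComparisonApp {X Y Z : N} (f : X ⟶ Y) (g : X ⟶ Z) (j : WalkingSpan) :
    (spanEval ⋙ ComposableArrows.mk₁ g).obj j ⟶ (span f g).obj j :=
  match j with
  | some WalkingPair.right => 𝟙 Z
  | some WalkingPair.left => f
  | none => 𝟙 X

/-- The comparison from the arrow `g : X ⟶ Z` to the span `Y ⟵ X ⟶ Z`. -/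
def spanComparison {X Y Z : N} (f : X ⟶ Y) (g : X ⟶ Z) :
    spanEval ⋙ ComposableArrows.mk₁ g ⟶ span f g where
  app := spanComparisonApp f g
  naturality j j' t := by
    match j, j', t with
    | _, _, WidePushoutShape.Hom.id j =>
      have h : WidePushoutShape.Hom.id j = 𝟙 j := rfl
      rw [h, CategoryTheory.Functor.map_id, CategoryTheory.Functor.map_id, Category.id_comp,
        Category.comp_id]
    | _, _, WidePushoutShape.Hom.init j =>
      cases j with
      | left => exact rfl
      | right => exact (Category.comp_id g).trans (Category.id_comp g).symm

end Interval

section OfElements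

variable {B : Type u₂} [Category.{v₂} B] {X : Type u₃} [Category.{v₃} X] {q : X ⥤ B}
  {K : Type u₁} [Category.{v₁} K] {k : K ⥤ B} {S : SSet.{u}}

/-- The projection from the category of simplices of a constant diagram. -/
def Simplices.toElements (K : Type u₁) [Category.{v₁} K] (S : SSet.{u}) :
    Simplices ((Functor.const K).obj S) ⥤ S.Elements where
  obj x := ⟨op x.dim, x.simplex⟩
  map f := CategoryOfElements.homMk _ _ f.dim.op f.w
  map_id _ := rfl
  map_comp _ _ := rfl

namespace Sect

/-- The section over a category of simplices given by a diagram of sections. -/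
def ofElements (G : S.Elements ⥤ Sect k q) :
    Sect (Simplices.proj ((Functor.const K).obj S) ⋙ k) q :=
  ofLifts (fun x => (G.obj ((Simplices.toElements K S).obj x)).functor.obj x.base)
    (fun x => (G.obj _).obj_eq x.base)
    (fun {x y} f => (G.map ((Simplices.toElements K S).map f)).natTrans.app x.base ≫
      (G.obj _).functor.map f.base)
    (fun f => isHomLift_vertical_comp ((G.map _).vertical _) ((G.obj _).isHomLift f.base))
    (fun x => by
      rw [CategoryTheory.Functor.map_id, CategoryTheory.Functor.map_id]
      exact (congrArg (_ ≫ ·) ((G.obj _).functor.map_id x.base)).trans (Category.comp_id _))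
    (fun f g => by
      simp only [Functor.map_comp, Simplices.comp_base, comp_natTrans, NatTrans.comp_app,
        Category.assoc, NatTrans.naturality_assoc])

/-- The map of sections over a category of simplices given by a map of diagrams of sections. -/
def ofElementsMap {G G' : S.Elements ⥤ Sect k q} (φ : G ⟶ G') : ofElements G ⟶ ofElements G' where
  natTrans :=
    { app := fun x => (φ.app ((Simplices.toElements K S).obj x)).natTrans.app x.base
      naturality := fun x y f => by
        have h := congrArg (fun t => t.natTrans.app x.base)
          (φ.naturality ((Simplices.toElements K S).map f))
        have h : (G.map ((Simplices.toElements K S).map f)).natTrans.app x.base ≫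
          (φ.app _).natTrans.app x.base = (φ.app _).natTrans.app x.base ≫
            (G'.map ((Simplices.toElements K S).map f)).natTrans.app x.base := h
        refine (Category.assoc _ _ _).trans ((congrArg ((G.map _).natTrans.app x.base ≫ ·)
          ((φ.app _).natTrans.naturality f.base)).trans ?_)
        refine (Category.assoc _ _ _).symm.trans ?_
        exact (congrArg (· ≫ _) h).trans (Category.assoc _ _ _) }
  vertical x := (φ.app _).vertical x.base

/-- The augmentation of the section given by an augmented diagram of sections. -/
def ofElementsAug {G : S.Elements ⥤ Sect k q} {z : Sect k q}
    (φ : G ⟶ (Functor.const _).obj z) :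
    ofElements G ⟶ z.precomp (Simplices.proj ((Functor.const K).obj S)) rfl where
  natTrans :=
    { app := fun x => (φ.app ((Simplices.toElements K S).obj x)).natTrans.app x.base
      naturality := fun x y f => by
        have h := congrArg (fun t => t.natTrans.app x.base)
          (φ.naturality ((Simplices.toElements K S).map f))
        have h : (G.map ((Simplices.toElements K S).map f)).natTrans.app x.base ≫
          (φ.app _).natTrans.app x.base = (φ.app _).natTrans.app x.base ≫ 𝟙 _ := h
        refine (Category.assoc _ _ _).trans ((congrArg ((G.map _).natTrans.app x.base ≫ ·)
          ((φ.app _).natTrans.naturality f.base)).trans ?_)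
        refine (Category.assoc _ _ _).symm.trans ?_
        exact (congrArg (· ≫ _) h).trans (congrArg (· ≫ _) (Category.comp_id _)) }
  vertical x := (φ.app _).vertical x.base

variable (T : FibredDeltaStructure q)
  [∀ b, HasColimitsOfSize.{0, 0} (q.Fiber b)] [∀ b, HasColimitsOfSize.{0, u} (q.Fiber b)]
  [∀ b, HasCoproducts.{u} (q.Fiber b)]
  [∀ b n, PreservesColimitsOfSize.{u, u} ((T.fiber b).tensor.obj n)] [q.IsFibered]

/-- A contraction of an augmented diagram of sections contracts its values. -/
def contractionOfElements {G : S.Elements ⥤ Sect k q} {z : Sect k q}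
    (φ : G ⟶ (Functor.const _).obj z) (C : Contraction G φ.app) (c : K) :
    Contraction ((ofElements G).fiberFunctor c) (z := ⟨z.functor.obj c, z.obj_eq c⟩)
      (fun e => ⟨augApp (ofElementsAug φ) ((Simplices.incl _ c).obj e),
        augApp_isHomLift (ofElementsAug φ) ((Simplices.incl _ c).obj e)⟩) :=
  have hG : ∀ {e e' : S.Elements} (f : e ⟶ e'), (((ofElements G).fiberFunctor c).map f).1 =
      (G.map f).natTrans.app c := fun {e e'} f =>
    (congrArg ((G.map f).natTrans.app c ≫ ·) ((G.obj e').functor.map_id c)).trans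
      (Category.comp_id _)
  { dom := C.dom
    dom_contractible := C.dom_contractible
    i := C.i
    γ := fun n j => ⟨(C.γ n j).natTrans.app c, (C.γ n j).vertical c⟩
    γ_map := fun α j e he => Subtype.ext ((congrArg ((C.γ _ j).natTrans.app c ≫ ·) (hG e)).trans
      (congrArg (fun t => t.natTrans.app c) (C.γ_map α j e he)))
    γ_a := fun n j => Subtype.ext (congrArg (fun t => t.natTrans.app c) (C.γ_a n j))
    r := C.r
    par := C.par
    par_contractible := C.par_contractible
    h := C.h
    h_map := C.h_map
    η := fun n s v => ⟨(C.η n s v).natTrans.app c, (C.η n s v).vertical c⟩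
    η_map := fun α s v e e' he he' => Subtype.ext ((congrArg (· ≫ (C.η _ _ _).natTrans.app c)
      (hG e)).trans ((congrArg (fun t => t.natTrans.app c) (C.η_map α s v e e' he he')).trans
      (congrArg ((C.η _ s v).natTrans.app c ≫ ·) (hG e').symm)))
    start := C.start
    finish := C.finish
    h_start := C.h_start
    h_finish := C.h_finish
    η_start := fun n s e he => Subtype.ext ((congrArg ((C.η _ s _).natTrans.app c ≫ ·)
      (hG e)).trans (congrArg (fun t => t.natTrans.app c) (C.η_start n s e he)))
    η_finish := fun n s e he => Subtype.ext ((congrArg ((C.η _ s _).natTrans.app c ≫ ·)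
      (hG e)).trans (congrArg (fun t => t.natTrans.app c) (C.η_finish n s e he))) }

/-- The inclusion of the value at a vertex. -/
noncomputable def vertexι (G : S.Elements ⥤ Sect k q) (s : S.obj (op ⦋0⦌)) :
    G.obj (S.elementsMk _ s) ⟶ (ofElements G).hocolim T where
  natTrans :=
    { app := fun c => T.unit.inv.app _ ≫ (ofElements G).hocolimι T ⟨c, ⦋0⦌, s⟩
      naturality := fun c c' f => by
        let x : Simplices ((Functor.const K).obj S) := ⟨c, ⦋0⦌, s⟩
        have h := (ofElements G).hocolimι_condition T (x.toPush f)
        have e : ∀ z, (T.tensor.map (x.toPush f).dim).app z = 𝟙 _ := fun z =>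
          congrArg (fun t => NatTrans.app t z) (T.tensor.map_id x.dim)
        rw [e, Category.id_comp] at h
        have e' : (ofElements G).functor.map (x.toPush f) =
            (G.obj (S.elementsMk _ s)).functor.map f := by
          have : (Simplices.toElements K S).map (x.toPush f) = 𝟙 (S.elementsMk _ s) := rfl
          refine (congrArg (fun t => NatTrans.app (Sect.Hom.natTrans (G.map t)) c ≫
            (G.obj (S.elementsMk _ s)).functor.map f) this).trans ?_
          exact (congrArg (fun t => NatTrans.app (Sect.Hom.natTrans t) c ≫
            (G.obj (S.elementsMk _ s)).functor.map f) (G.map_id _)).trans (Category.id_comp _)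
        rw [e'] at h
        refine (Category.assoc _ _ _).symm.trans ?_
        refine (congrArg (· ≫ _) (T.unit.inv.naturality _)).trans ?_
        refine (Category.assoc _ _ _).trans ((congrArg (_ ≫ ·) h).trans ?_)
        exact (Category.assoc _ _ _).symm }
  vertical c := by
    refine isHomLift_vertical_comp ?_ ((ofElements G).hocolimι_isHomLift T ⟨c, ⦋0⦌, s⟩)
    have h : q.IsHomLift (𝟙 (k.obj c)) (T.unit.app ((G.obj (S.elementsMk _ s)).functor.obj c)).hom :=
      FibredDeltaStructure.vertical_of_eq (T.unit_vertical _) ((G.obj _).obj_eq c)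
    exact IsHomLift.lift_id_inv q (k.obj c) (T.unit.app _)

theorem vertexι_map {G G' : S.Elements ⥤ Sect k q} (φ : G ⟶ G') (s : S.obj (op ⦋0⦌)) :
    vertexι T G s ≫ hocolimMap T (ofElementsMap φ) = φ.app (S.elementsMk _ s) ≫ vertexι T G' s := by
  refine Sect.hom_ext (fun c => ?_)
  have h := hocolimι_map T (ofElementsMap φ) ⟨c, ⦋0⦌, s⟩
  refine (Category.assoc _ _ _).trans ((congrArg (_ ≫ ·) h).trans ?_)
  refine (Category.assoc _ _ _).symm.trans ?_
  refine (congrArg (· ≫ _) (T.unit.inv.naturality _).symm).trans ?_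
  exact Category.assoc _ _ _

theorem vertexι_aug {G : S.Elements ⥤ Sect k q} {z : Sect k q}
    (φ : G ⟶ (Functor.const _).obj z) (s : S.obj (op ⦋0⦌)) :
    vertexι T G s ≫ hocolimAug T (ofElementsAug φ) = φ.app (S.elementsMk _ s) := by
  refine Sect.hom_ext (fun c => ?_)
  have h := hocolimι_aug T (ofElementsAug φ) ⟨c, ⦋0⦌, s⟩
  refine (Category.assoc _ _ _).trans ((congrArg (_ ≫ ·) h).trans ?_)
  refine (Category.assoc _ _ _).symm.trans ?_
  refine (congrArg (· ≫ _) (T.unit.inv.naturality _).symm).trans ?_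
  refine (Category.assoc _ _ _).trans ?_
  refine (congrArg (_ ≫ ·) ?_).trans (Category.comp_id _)
  have e : T.collapse ⦋0⦌ (z.functor.obj c) = T.unit.hom.app _ := by
    have : SimplexCategory.isTerminalZero.from ⦋0⦌ = 𝟙 _ := Subsingleton.elim _ _
    unfold DeltaStructure.collapse
    rw [this, T.tensor.map_id]
    exact Category.id_comp _
  refine (congrArg (T.unit.inv.app (z.functor.obj c) ≫ ·) e).trans ?_
  exact T.unit.inv_hom_id_app _

end Sect

end OfElements

section HomotopyPushouts

variable {B : Type u₂} [Category.{v₂} B] {X : Type u₃} [Category.{v₃} X] {q : X ⥤ B}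
  {K : Type u₁} [Category.{v₁} K] {k : K ⥤ B}
  {T : FibredDeltaStructure q} {W : MorphismProperty X}
  (hT : ∀ b, IsHomotopicalDeltaCategory.{u} (T.fiber b)
    (W.inverseImage Functor.Fiber.fiberInclusion))

namespace Sect

include hT in
theorem weq_id (A : Sect k q) : Sect.weq k q W (𝟙 A) := fun c =>
  let z : q.Fiber (k.obj c) := ⟨A.functor.obj c, A.obj_eq c⟩
  (hT (k.obj c)).homotopical.of_isIso (𝟙 z) inferInstance

include hT in
theorem weq_isMultiplicative : (Sect.weq k q W).IsMultiplicative where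
  id_mem := weq_id hT
  comp_mem {A A' A''} f g hf hg c := (hT (k.obj c)).homotopical.comp
    (x := ⟨A.functor.obj c, A.obj_eq c⟩) (y := ⟨A'.functor.obj c, A'.obj_eq c⟩)
    (z := ⟨A''.functor.obj c, A''.obj_eq c⟩)
    ⟨f.natTrans.app c, f.vertical c⟩ ⟨g.natTrans.app c, g.vertical c⟩ (hf c) (hg c)

include hT in
theorem weq_hasTwoOutOfThree : (Sect.weq k q W).HasTwoOutOfThreeProperty where
  comp_mem := (weq_isMultiplicative hT).comp_mem
  of_postcomp {A A' A''} f g hf hg c := (hT (k.obj c)).homotopical.of_postcomp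
    (x := ⟨A.functor.obj c, A.obj_eq c⟩) (y := ⟨A'.functor.obj c, A'.obj_eq c⟩)
    (z := ⟨A''.functor.obj c, A''.obj_eq c⟩)
    ⟨f.natTrans.app c, f.vertical c⟩ ⟨g.natTrans.app c, g.vertical c⟩ (hf c) (hg c)
  of_precomp {A A' A''} f g hf hg c := (hT (k.obj c)).homotopical.of_precomp
    (x := ⟨A.functor.obj c, A.obj_eq c⟩) (y := ⟨A'.functor.obj c, A'.obj_eq c⟩)
    (z := ⟨A''.functor.obj c, A''.obj_eq c⟩)
    ⟨f.natTrans.app c, f.vertical c⟩ ⟨g.natTrans.app c, g.vertical c⟩ (hf c) (hg c)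

variable [∀ b, HasColimitsOfSize.{0, 0} (q.Fiber b)] [∀ b, HasColimitsOfSize.{0, u} (q.Fiber b)]
  [∀ b, HasCoproducts.{u} (q.Fiber b)]
  [∀ b n, PreservesColimitsOfSize.{u, u} ((T.fiber b).tensor.obj n)] [q.IsFibered]

include hT in
theorem weq_hocolimAug_ofElements {S : SSet.{u}} {G : S.Elements ⥤ Sect k q} {z : Sect k q}
    (φ : G ⟶ (Functor.const _).obj z) (C : Contraction G φ.app) :
    Sect.weq k q W (hocolimAug T (ofElementsAug φ)) := fun c =>
  weq_hocolimAug T hT (ofElementsAug φ) c (contractionOfElements φ C c)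

/-- The transformation from a constant diagram to the span `f, g` over the interval. -/
noncomputable def toIntervalSpan {M : Type*} [Category* M] {A A' A'' : M} (f : A ⟶ A')
    (g : A ⟶ A'') : (Functor.const (Δ[1] : SSet.{u}).Elements).obj A ⟶ intervalShape ⋙ span f g where
  app e := (span f g).map (nonempty_hom_of_zero (intervalShape.obj e)).some
  naturality _ _ _ := (Category.id_comp _).trans ((congrArg (span f g).map
    (Subsingleton.elim _ _)).trans ((span f g).map_comp _ _))

/-- The augmentation of the diagram over the interval given by the arrow `g`. -/
noncomputable def arrowAug {M : Type*} [Category* M] {A A'' : M} (g : A ⟶ A'') :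
    (intervalShape.{u} ⋙ spanEval) ⋙ ComposableArrows.mk₁ g ⟶ (Functor.const _).obj A'' where
  app _ := (ComposableArrows.mk₁ g).map (homOfLE (Fin.le_last _))
  naturality _ _ t := ((ComposableArrows.mk₁ g).map_comp ((intervalShape ⋙ spanEval).map t)
    (homOfLE (Fin.le_last _))).symm.trans
    ((congrArg (ComposableArrows.mk₁ g).map (Subsingleton.elim _ _)).trans
      (Category.comp_id _).symm)

include hT in
/-- The homotopy pushout is the homotopy colimit over the interval of the diagram which is `A'` on
the simplices constant at `0`, `A''` on those constant at `1`, and `A` on all others. The homotopy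
comes from the natural map from the constant diagram `A`. -/
theorem exists_homotopyPushout {A A' A'' : Sect k q} (f : A ⟶ A') (g : A ⟶ A'')
    (hf : Sect.weq k q W f) :
    ∃ (P : Sect k q) (inl : A' ⟶ P) (inr : A'' ⟶ P)
      (h : (ofElements ((Functor.const (Δ[1] : SSet.{u}).Elements).obj A)).hocolim T ⟶ P),
      Sect.weq k q W inr ∧
      vertexι T ((Functor.const (Δ[1] : SSet.{u}).Elements).obj A)
        (SSet.stdSimplex.const 1 0 _) ≫ h = f ≫ inl ∧
      vertexι T ((Functor.const (Δ[1] : SSet.{u}).Elements).obj A)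
        (SSet.stdSimplex.const 1 1 _) ≫ h = g ≫ inr ∧
      ∀ (Z : Sect k q) (a : A' ⟶ Z) (b : A'' ⟶ Z), f ≫ a = g ≫ b →
        ∃ d : P ⟶ Z, inl ≫ d = a ∧ inr ≫ d = b := by
  have := weq_isMultiplicative (k := k) hT
  have := weq_hasTwoOutOfThree (k := k) hT
  let v₀ : (Δ[1] : SSet.{u}).obj (op ⦋0⦌) := SSet.stdSimplex.const 1 0 _
  let v₁ : (Δ[1] : SSet.{u}).obj (op ⦋0⦌) := SSet.stdSimplex.const 1 1 _
  let x₀ := (Δ[1] : SSet.{u}).elementsMk _ v₀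
  let x₁ := (Δ[1] : SSet.{u}).elementsMk _ v₁
  have e₀ : WalkingSpan.left ⟶ intervalShape.obj x₀ := 𝟙 WalkingSpan.left
  have e₁ : WalkingSpan.right ⟶ intervalShape.obj x₁ := 𝟙 WalkingSpan.right
  let G := intervalShape.{u} ⋙ span f g
  let inl : A' ⟶ (ofElements G).hocolim T := (span f g).map e₀ ≫ vertexι T G v₀
  let inr : A'' ⟶ (ofElements G).hocolim T := (span f g).map e₁ ≫ vertexι T G v₁
  refine ⟨(ofElements G).hocolim T, inl, inr, hocolimMap T (ofElementsMap (toIntervalSpan f g)),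
    ?_, ?_, ?_, ?_⟩
  · -- As `f` is a weak equivalence, `A'` may be replaced by `A`; the resulting diagram, induced by
    -- the arrow `g`, contracts to its value `A''` at `1`.
    let G' := (intervalShape.{u} ⋙ spanEval) ⋙ ComposableArrows.mk₁ g
    let ψ : G' ⟶ G := Functor.whiskerLeft intervalShape (spanComparison f g)
    have hψ : Sect.weq k q W (hocolimMap T (ofElementsMap ψ)) := by
      refine weq_hocolimMap T hT (ofElementsMap ψ) (fun x => ?_)
      have : ∀ j, Sect.weq k q W ((spanComparison f g).app j) := by
        rintro (_ | _ | _)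
        · exact weq_id hT _
        · exact hf
        · exact weq_id hT _
      exact this _ _
    have ha : Sect.weq k q W (hocolimAug T (ofElementsAug (arrowAug g))) :=
      weq_hocolimAug_ofElements hT _ (Contraction.interval _ spanEval_intervalShape _)
    let t : A'' ⟶ (ofElements G').hocolim T :=
      (spanEval ⋙ ComposableArrows.mk₁ g).map e₁ ≫ vertexι T G' v₁
    have ht : t ≫ hocolimAug T (ofElementsAug (arrowAug g)) = 𝟙 A'' := by
      refine (Category.assoc _ _ _).trans ?_
      rw [vertexι_aug]
      refine ((ComposableArrows.mk₁ g).map_comp (spanEval.map e₁)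
        (homOfLE (Fin.le_last _))).symm.trans ?_
      exact (congrArg (ComposableArrows.mk₁ g).map (Subsingleton.elim _
        (𝟙 (1 : Fin 2)))).trans ((ComposableArrows.mk₁ g).map_id 1)
    have ht' : Sect.weq k q W t := by
      refine (Sect.weq k q W).of_postcomp _ _ ha ?_
      rw [ht]
      exact weq_id hT _
    have h : inr = t ≫ hocolimMap T (ofElementsMap ψ) := by
      refine Eq.trans ?_ (Category.assoc _ _ _).symm
      rw [vertexι_map]
      refine Eq.trans ?_ (Category.assoc _ _ _)
      refine (congrArg (· ≫ vertexι T G v₁) ?_)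
      exact (Category.id_comp _).symm.trans ((spanComparison f g).naturality e₁).symm
    rw [h]
    exact (Sect.weq k q W).comp_mem _ _ ht' hψ
  · rw [vertexι_map]
    refine Eq.trans ?_ (Category.assoc _ _ _)
    refine congrArg (· ≫ vertexι T G v₀) ?_
    exact (congrArg (span f g).map (Subsingleton.elim _ _)).trans
      ((span f g).map_comp WalkingSpan.Hom.fst e₀)
  · rw [vertexι_map]
    refine Eq.trans ?_ (Category.assoc _ _ _)
    refine congrArg (· ≫ vertexι T G v₁) ?_
    exact (congrArg (span f g).map (Subsingleton.elim _ _)).trans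
      ((span f g).map_comp WalkingSpan.Hom.snd e₁)
  · intro Z a b hab
    let s := (PushoutCocone.mk a b hab).ι
    let φ : G ⟶ (Functor.const _).obj Z :=
      { app := fun e => s.app (intervalShape.obj e)
        naturality := fun _ _ t => s.naturality (intervalShape.map t) }
    have hs : ∀ {j j' : WalkingSpan} (t : j ⟶ j'), (span f g).map t ≫ s.app j' = s.app j :=
      fun t => (s.naturality t).trans (Category.comp_id _)
    refine ⟨hocolimAug T (ofElementsAug φ), ?_, ?_⟩
    · refine (Category.assoc _ _ _).trans ?_
      rw [vertexι_aug]
      exact hs e₀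
    · refine (Category.assoc _ _ _).trans ?_
      rw [vertexι_aug]
      exact hs e₁

variable (k) in
/-- The cylinders and homotopy pushouts of sections, obtained as fibrewise homotopy colimits over
the interval. -/
noncomputable def homotopyPushouts : HomotopyPushouts (Sect.weq k q W) where
  cyl A := (ofElements ((Functor.const (Δ[1] : SSet.{u}).Elements).obj A)).hocolim T
  i₀ A := vertexι T ((Functor.const (Δ[1] : SSet.{u}).Elements).obj A)
    (SSet.stdSimplex.const 1 0 _)
  i₁ A := vertexι T ((Functor.const (Δ[1] : SSet.{u}).Elements).obj A)
    (SSet.stdSimplex.const 1 1 _)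
  π A := hocolimAug T (ofElementsAug (𝟙 _))
  i₀_π A := vertexι_aug T _ _
  i₁_π A := vertexι_aug T _ _
  weq_π A := weq_hocolimAug_ofElements hT _ (Contraction.const _ inferInstance A)
  exists_cylMap f := ⟨hocolimMap T (ofElementsMap ((Functor.const _).map f)),
    vertexι_map T _ _, vertexι_map T _ _⟩
  exists_pushout f g hf := exists_homotopyPushout hT f g hf

end Sect

end HomotopyPushouts

/-! ### Reindexing of sections along Cartesian arrows -/

section Reindex

variable {B : Type u₂} [Category.{v₂} B] {X : Type u₃} [Category.{v₃} X] {q : X ⥤ B}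
  {K : Type u₁} [Category.{v₁} K] {k k' : K ⥤ B} [q.IsFibered]

namespace Sect

/-- The Cartesian arrow to a value of a section along a transformation `τ : k' ⟶ k`. -/
noncomputable def cartesianLift (τ : k' ⟶ k) (A : Sect k q) (x : K) :
    Functor.IsPreFibered.pullbackObj (A.obj_eq x) (τ.app x) ⟶ A.functor.obj x :=
  Functor.IsPreFibered.pullbackMap (A.obj_eq x) (τ.app x)

instance (τ : k' ⟶ k) (A : Sect k q) (x : K) :
    q.IsCartesian (τ.app x) (A.cartesianLift τ x) :=
  Functor.IsPreFibered.pullbackMap.IsCartesian _ _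

theorem exists_reindexMap (τ : k' ⟶ k) {A A' : Sect k q} {x y : K} (f : x ⟶ y)
    (t : A.functor.obj x ⟶ A'.functor.obj y) (ht : q.IsHomLift (k.map f) t) :
    ∃ d : Functor.IsPreFibered.pullbackObj (A.obj_eq x) (τ.app x) ⟶
      Functor.IsPreFibered.pullbackObj (A'.obj_eq y) (τ.app y),
      q.IsHomLift (k'.map f) d ∧ d ≫ A'.cartesianLift τ y = A.cartesianLift τ x ≫ t :=
  ⟨Functor.IsStronglyCartesian.map q (τ.app y) (A'.cartesianLift τ y) (g := k'.map f)
    (τ.naturality f).symm (A.cartesianLift τ x ≫ t), inferInstance, by simp⟩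

theorem cartesianLift_ext (τ : k' ⟶ k) {A : Sect k q} {x : K} {b : B} {z : X} (u : b ⟶ k'.obj x)
    {f g : z ⟶ Functor.IsPreFibered.pullbackObj (A.obj_eq x) (τ.app x)}
    (hf : q.IsHomLift u f) (hg : q.IsHomLift u g)
    (h : f ≫ A.cartesianLift τ x = g ≫ A.cartesianLift τ x) : f = g :=
  Functor.IsStronglyCartesian.ext q (τ.app x) (A.cartesianLift τ x) u h

/-- The reindexing of a section along a transformation `τ : k' ⟶ k`. -/
noncomputable def reindex (τ : k' ⟶ k) (A : Sect k q) : Sect k' q :=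
  ofLifts (fun x => Functor.IsPreFibered.pullbackObj (A.obj_eq x) (τ.app x))
    (fun x => Functor.IsPreFibered.pullbackObj_proj (A.obj_eq x) (τ.app x))
    (fun f => (exists_reindexMap τ f (A.functor.map f) (A.isHomLift f)).choose)
    (fun f => (exists_reindexMap τ f (A.functor.map f) (A.isHomLift f)).choose_spec.1)
    (fun x => by
      have h := (exists_reindexMap τ (𝟙 x) (A.functor.map (𝟙 x)) (A.isHomLift _)).choose_spec
      refine cartesianLift_ext τ (k'.map (𝟙 x)) h.1 ?_ ?_
      · rw [k'.map_id]
        exact IsHomLift.id (Functor.IsPreFibered.pullbackObj_proj (A.obj_eq x) (τ.app x))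
      · rw [h.2]
        simp)
    (fun {x y z} f g => by
      have h := (exists_reindexMap τ f (A.functor.map f) (A.isHomLift f)).choose_spec
      have h' := (exists_reindexMap τ g (A.functor.map g) (A.isHomLift g)).choose_spec
      have h'' := (exists_reindexMap τ (f ≫ g) (A.functor.map (f ≫ g))
        (A.isHomLift (f ≫ g))).choose_spec
      refine cartesianLift_ext τ (k'.map (f ≫ g)) h''.1 ?_ ?_
      · rw [k'.map_comp]
        exact isHomLift_comp h.1 h'.1
      · rw [h''.2, Category.assoc, h'.2, reassoc_of% h.2, A.functor.map_comp])

/-- The Cartesian arrow from the reindexing of a section. -/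
noncomputable def reindexπ (τ : k' ⟶ k) (A : Sect k q) (x : K) :
    (A.reindex τ).functor.obj x ⟶ A.functor.obj x :=
  A.cartesianLift τ x

instance reindexπ_isCartesian (τ : k' ⟶ k) (A : Sect k q) (x : K) :
    q.IsCartesian (τ.app x) (A.reindexπ τ x) :=
  inferInstanceAs (q.IsCartesian (τ.app x) (A.cartesianLift τ x))

theorem reindexπ_naturality (τ : k' ⟶ k) (A : Sect k q) {x y : K} (f : x ⟶ y) :
    (A.reindex τ).functor.map f ≫ A.reindexπ τ y = A.reindexπ τ x ≫ A.functor.map f :=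
  (exists_reindexMap τ f (A.functor.map f) (A.isHomLift f)).choose_spec.2

theorem reindexπ_ext (τ : k' ⟶ k) {A : Sect k q} {x : K} {b : B} {z : X} (u : b ⟶ k'.obj x)
    {f g : z ⟶ (A.reindex τ).functor.obj x}
    (hf : q.IsHomLift u f) (hg : q.IsHomLift u g)
    (h : f ≫ A.reindexπ τ x = g ≫ A.reindexπ τ x) : f = g :=
  cartesianLift_ext τ u hf hg h

theorem exists_reindexLift (τ : k' ⟶ k) {A : Sect k q} {Z : Sect k' q}
    (g : ∀ x, Z.functor.obj x ⟶ A.functor.obj x) (hg : ∀ x, q.IsHomLift (τ.app x) (g x))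
    (hg' : ∀ ⦃x y : K⦄ (f : x ⟶ y), Z.functor.map f ≫ g y = g x ≫ A.functor.map f) :
    ∃ d : Z ⟶ A.reindex τ, ∀ x, d.natTrans.app x ≫ A.reindexπ τ x = g x := by
  have h := fun x => Functor.IsCartesian.universal_property (p := q) (f := τ.app x)
    (φ := A.reindexπ τ x) (g x)
  choose d hd _ using h
  refine ⟨⟨{ app := d, naturality := fun x y f => ?_ }, fun x => ?_⟩, fun x => (hd x).2⟩
  · refine reindexπ_ext τ (k'.map f) (isHomLift_comp_vertical (Z.isHomLift f) ?_)
      (isHomLift_vertical_comp ?_ ((A.reindex τ).isHomLift f)) ?_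
    · exact (hd y).1
    · exact (hd x).1
    · rw [Category.assoc, Category.assoc, reindexπ_naturality, (hd y).2, reassoc_of% (hd x).2, hg']
  · exact (hd x).1

/-- The map to a reindexed section given by arrows over `τ`. -/
noncomputable def reindexLift (τ : k' ⟶ k) {A : Sect k q} {Z : Sect k' q}
    (g : ∀ x, Z.functor.obj x ⟶ A.functor.obj x) (hg : ∀ x, q.IsHomLift (τ.app x) (g x))
    (hg' : ∀ ⦃x y : K⦄ (f : x ⟶ y), Z.functor.map f ≫ g y = g x ≫ A.functor.map f) :
    Z ⟶ A.reindex τ :=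
  (exists_reindexLift τ g hg hg').choose

theorem reindexLift_π (τ : k' ⟶ k) {A : Sect k q} {Z : Sect k' q}
    (g : ∀ x, Z.functor.obj x ⟶ A.functor.obj x) (hg : ∀ x, q.IsHomLift (τ.app x) (g x))
    (hg' : ∀ ⦃x y : K⦄ (f : x ⟶ y), Z.functor.map f ≫ g y = g x ≫ A.functor.map f) (x : K) :
    (reindexLift τ g hg hg').natTrans.app x ≫ A.reindexπ τ x = g x :=
  (exists_reindexLift τ g hg hg').choose_spec x

/-- The functoriality of reindexing. -/
noncomputable def reindexMap (τ : k' ⟶ k) {A A' : Sect k q} (φ : A ⟶ A') :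
    A.reindex τ ⟶ A'.reindex τ :=
  reindexLift τ (fun x => A.reindexπ τ x ≫ φ.natTrans.app x)
    (fun x => isHomLift_comp_vertical inferInstance (φ.vertical x))
    (fun x y f => by
      rw [← Category.assoc, reindexπ_naturality, Category.assoc, Category.assoc,
        φ.natTrans.naturality])

theorem reindexMap_π (τ : k' ⟶ k) {A A' : Sect k q} (φ : A ⟶ A') (x : K) :
    (reindexMap τ φ).natTrans.app x ≫ A'.reindexπ τ x = A.reindexπ τ x ≫ φ.natTrans.app x :=
  reindexLift_π _ _ _ _ x

theorem reindex_hom_ext {τ : k' ⟶ k} {A : Sect k q} {Z : Sect k' q} {f g : Z ⟶ A.reindex τ}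
    (h : ∀ x, f.natTrans.app x ≫ A.reindexπ τ x = g.natTrans.app x ≫ A.reindexπ τ x) : f = g :=
  Sect.hom_ext (fun x => reindexπ_ext τ (𝟙 _) (f.vertical x) (g.vertical x) (h x))

end Sect

/-- A class of arrows is stable under reindexing if the arrow induced between Cartesian lifts by
an arrow of the class is in the class. -/
def IsStableUnderReindexing (q : X ⥤ B) (W : MorphismProperty X) : Prop :=
  ∀ ⦃b b' : B⦄ (u : b' ⟶ b) ⦃x y x' y' : X⦄ (κ : x' ⟶ x) (κ' : y' ⟶ y) (f : x ⟶ y) (f' : x' ⟶ y'),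
    q.IsCartesian u κ → q.IsCartesian u κ' → q.IsHomLift (𝟙 b') f' → f' ≫ κ' = κ ≫ f → W f → W f'

/-- An arrow is weakly Cartesian over `u` if it is the composite of a fibrewise arrow in `W` and of
a Cartesian arrow over `u`. -/
def IsWeaklyCartesianOver (q : X ⥤ B) (W : MorphismProperty X) {b b' : B} (u : b' ⟶ b) {x y : X}
    (f : x ⟶ y) : Prop :=
  ∃ (z : X) (w : x ⟶ z) (κ : z ⟶ y), W w ∧ q.IsHomLift (𝟙 b') w ∧ q.IsCartesian u κ ∧ w ≫ κ = f

/-- A fibration with a fibred `Δ`-structure and a class of arrows which makes its fibres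
homotopical `Δ`-categories and is stable under reindexing. -/
structure IsHomotopicalFibration (T : FibredDeltaStructure q) (W : MorphismProperty X) : Prop where
  fiber (b : B) : IsHomotopicalDeltaCategory.{u} (T.fiber b)
    (W.inverseImage Functor.Fiber.fiberInclusion)
  stable : IsStableUnderReindexing q W

namespace IsHomotopicalFibration

variable {T : FibredDeltaStructure q} {W : MorphismProperty X}
  (hT : IsHomotopicalFibration.{u} T W)

include hT

theorem of_isIso {b : B} {x y : X} (f : x ⟶ y) (hf : q.IsHomLift (𝟙 b) f) [IsIso f] : W f := by
  let x' : q.Fiber b := ⟨x, isHomLift_domain hf⟩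
  let y' : q.Fiber b := ⟨y, isHomLift_codomain hf⟩
  let f' : x' ⟶ y' := ⟨f, hf⟩
  have : IsIso f' := ⟨⟨inv f, IsHomLift.lift_id_inv_isIso q b f⟩,
    Subtype.ext (IsIso.hom_inv_id f), Subtype.ext (IsIso.inv_hom_id f)⟩
  exact (hT.fiber b).homotopical.of_isIso f' this

theorem comp {b : B} {x y z : X} (f : x ⟶ y) (g : y ⟶ z) (hf : q.IsHomLift (𝟙 b) f)
    (hg : q.IsHomLift (𝟙 b) g) (h : W f) (h' : W g) : W (f ≫ g) :=
  (hT.fiber b).homotopical.comp (x := ⟨x, isHomLift_domain hf⟩)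
    (y := ⟨y, isHomLift_codomain hf⟩) (z := ⟨z, isHomLift_codomain hg⟩) ⟨f, hf⟩ ⟨g, hg⟩ h h'

theorem of_precomp {b : B} {x y z : X} (f : x ⟶ y) (g : y ⟶ z) (hf : q.IsHomLift (𝟙 b) f)
    (hg : q.IsHomLift (𝟙 b) g) (h : W f) (h' : W (f ≫ g)) : W g :=
  (hT.fiber b).homotopical.of_precomp (x := ⟨x, isHomLift_domain hf⟩)
    (y := ⟨y, isHomLift_codomain hf⟩) (z := ⟨z, isHomLift_codomain hg⟩) ⟨f, hf⟩ ⟨g, hg⟩ h h'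

theorem of_postcomp {b : B} {x y z : X} (f : x ⟶ y) (g : y ⟶ z) (hf : q.IsHomLift (𝟙 b) f)
    (hg : q.IsHomLift (𝟙 b) g) (h : W g) (h' : W (f ≫ g)) : W f :=
  (hT.fiber b).homotopical.of_postcomp (x := ⟨x, isHomLift_domain hf⟩)
    (y := ⟨y, isHomLift_codomain hf⟩) (z := ⟨z, isHomLift_codomain hg⟩) ⟨f, hf⟩ ⟨g, hg⟩ h h'

/-- The comparison of a weakly Cartesian arrow with any Cartesian arrow is in `W`. -/
theorem of_isWeaklyCartesianOver {b b' : B} {u : b' ⟶ b} {x y z : X} {f : x ⟶ y}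
    (hf : IsWeaklyCartesianOver q W u f) {w : x ⟶ z} {κ : z ⟶ y} (hw : q.IsHomLift (𝟙 b') w)
    (hκ : q.IsCartesian u κ) (h : w ≫ κ = f) : W w := by
  obtain ⟨z', w', κ', hw', hw'', hκ', h'⟩ := hf
  let t := Functor.IsCartesian.domainUniqueUpToIso q u κ κ'
  have ht : t.hom ≫ κ = κ' := by simp [t, Functor.IsCartesian.domainUniqueUpToIso]
  have ht' : q.IsHomLift (𝟙 b') t.hom := inferInstance
  have e : w = w' ≫ t.hom := by
    have : q.IsHomLift (𝟙 b') (w' ≫ t.hom) := isHomLift_comp_vertical hw'' ht'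
    refine Functor.IsCartesian.ext q u κ _ _ ?_
    rw [h, Category.assoc, ht, h']
  rw [e]
  exact hT.comp w' t.hom hw'' ht' hw' (hT.of_isIso t.hom ht')

/-- Being weakly Cartesian is invariant under weak equivalences of arrows. -/
theorem isWeaklyCartesianOver_iff {b b' : B} {u : b' ⟶ b} {x y x' y' : X} {f : x ⟶ y}
    {f' : x' ⟶ y'} {s : x ⟶ x'} {t : y ⟶ y'} (hf : q.IsHomLift u f) (hf' : q.IsHomLift u f')
    (hs : q.IsHomLift (𝟙 b') s)
    (ht : q.IsHomLift (𝟙 b) t) (hs' : W s) (ht' : W t) (h : f ≫ t = s ≫ f') :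
    IsWeaklyCartesianOver q W u f ↔ IsWeaklyCartesianOver q W u f' := by
  obtain ⟨z, κ, hκ⟩ := IsPreFibered.exists_isCartesian q (isHomLift_codomain hf) u
  obtain ⟨z', κ', hκ'⟩ := IsPreFibered.exists_isCartesian q (isHomLift_codomain hf') u
  let w := Functor.IsCartesian.map q u κ f
  let w' := Functor.IsCartesian.map q u κ' f'
  have hw : q.IsHomLift (𝟙 b') w := inferInstance
  have hw' : q.IsHomLift (𝟙 b') w' := inferInstance
  have e : w ≫ κ = f := by simp [w]
  have e' : w' ≫ κ' = f' := by simp [w']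
  have := isHomLift_comp_vertical hκ.toIsHomLift ht
  let d := Functor.IsCartesian.map q u κ' (κ ≫ t)
  have hd : q.IsHomLift (𝟙 b') d := inferInstance
  have ed : d ≫ κ' = κ ≫ t := by simp [d]
  have hdW : W d := hT.stable u κ κ' t d hκ hκ' hd ed ht'
  have sq : w ≫ d = s ≫ w' := by
    have h₁ := isHomLift_comp_vertical hw hd
    have h₂ := isHomLift_comp_vertical hs hw'
    refine Functor.IsCartesian.ext q u κ' _ _ ?_
    rw [Category.assoc, ed, reassoc_of% e, Category.assoc, e', h]
  have hwd := isHomLift_comp_vertical hw hd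
  constructor
  · intro H
    have hW := hT.of_isWeaklyCartesianOver H hw hκ e
    refine ⟨z', w', κ', ?_, hw', hκ', e'⟩
    refine hT.of_precomp s w' hs hw' hs' ?_
    rw [← sq]
    exact hT.comp w d hw hd hW hdW
  · intro H
    have hW := hT.of_isWeaklyCartesianOver H hw' hκ' e'
    refine ⟨z, w, κ, ?_, hw, hκ, e⟩
    refine hT.of_postcomp w d hw hd hdW ?_
    rw [sq]
    exact hT.comp s w' hs hw' hs' hW

theorem weq_reindexMap (τ : k' ⟶ k) {A A' : Sect k q} (φ : A ⟶ A') (hφ : Sect.weq k q W φ) :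
    Sect.weq k' q W (Sect.reindexMap τ φ) := fun x =>
  hT.stable (τ.app x) (A.reindexπ τ x) (A'.reindexπ τ x) (φ.natTrans.app x) _ inferInstance
    inferInstance ((Sect.reindexMap τ φ).vertical x) (Sect.reindexMap_π τ φ x) (hφ x)

theorem weq_reindexLift (τ : k' ⟶ k) {A : Sect k q} {Z : Sect k' q}
    (g : ∀ x, Z.functor.obj x ⟶ A.functor.obj x) (hg : ∀ x, q.IsHomLift (τ.app x) (g x))
    (hg' : ∀ ⦃x y : K⦄ (f : x ⟶ y), Z.functor.map f ≫ g y = g x ≫ A.functor.map f)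
    (h : ∀ x, IsWeaklyCartesianOver q W (τ.app x) (g x)) :
    Sect.weq k' q W (Sect.reindexLift τ g hg hg') := fun x =>
  hT.of_isWeaklyCartesianOver (h x) ((Sect.reindexLift τ g hg hg').vertical x) inferInstance
    (Sect.reindexLift_π τ g hg hg' x)

end IsHomotopicalFibration

end Reindex

/-! ### Joins of simplices -/

namespace SimplexJoin

/-- The join `[m] ⋆ [n] = [m + n + 1]` of two simplices. -/
def join (m n : SimplexCategory) : SimplexCategory := ⦋m.len + n.len + 1⦌

/-- The inclusion of the first `m + 1` elements. -/
def inl (m n : SimplexCategory) : m ⟶ join m n :=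
  SimplexCategory.mkHom
    { toFun := fun i => ⟨i, by omega⟩
      monotone' := fun _ _ h => h }

/-- The inclusion of the last `n + 1` elements. -/
def inr (m n : SimplexCategory) : n ⟶ join m n :=
  SimplexCategory.mkHom
    { toFun := fun j => ⟨m.len + 1 + j, by omega⟩
      monotone' := fun _ _ h => Nat.add_le_add_left h _ }

theorem cases {m n : SimplexCategory} (x : Fin ((join m n).len + 1)) :
    (∃ i, x = (inl m n).toOrderHom i) ∨ ∃ j, x = (inr m n).toOrderHom j := by
  have hx : (x : ℕ) < m.len + n.len + 1 + 1 := x.2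
  by_cases h : (x : ℕ) < m.len + 1
  · exact Or.inl ⟨⟨x, h⟩, rfl⟩
  · refine Or.inr ⟨⟨x - (m.len + 1), by omega⟩, Fin.ext ?_⟩
    change (x : ℕ) = m.len + 1 + (x - (m.len + 1))
    omega

theorem inl_le_inr {m n : SimplexCategory} (i : Fin (m.len + 1)) (j : Fin (n.len + 1)) :
    (inl m n).toOrderHom i ≤ (inr m n).toOrderHom j := by
  change (i : ℕ) ≤ m.len + 1 + j
  omega

theorem inr_last (m n : SimplexCategory) :
    (inr m n).toOrderHom (Fin.last _) = Fin.last _ := by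
  refine Fin.ext ?_
  change m.len + 1 + n.len = m.len + n.len + 1
  omega

theorem hom_ext {m n p : SimplexCategory} {f g : join m n ⟶ p} (h : inl m n ≫ f = inl m n ≫ g)
    (h' : inr m n ≫ f = inr m n ≫ g) : f = g := by
  refine SimplexCategory.Hom.ext _ _ (OrderHom.ext _ _ (funext fun x => ?_))
  rcases cases x with ⟨i, rfl⟩ | ⟨j, rfl⟩
  · exact congrArg (fun t => SimplexCategory.Hom.toOrderHom t i) h
  · exact congrArg (fun t => SimplexCategory.Hom.toOrderHom t j) h'

/-- The map out of a join given by its restrictions. -/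
def desc {m n p : SimplexCategory} (f : m ⟶ p) (g : n ⟶ p)
    (h : ∀ i j, f.toOrderHom i ≤ g.toOrderHom j) : join m n ⟶ p :=
  SimplexCategory.mkHom
    { toFun := fun x => if hx : (x : ℕ) < m.len + 1 then f.toOrderHom ⟨x, hx⟩
        else g.toOrderHom ⟨x - (m.len + 1), by
          have hx : (x : ℕ) < m.len + n.len + 1 + 1 := x.2
          omega⟩
      monotone' := fun x y hxy => by
        have hxy : (x : ℕ) ≤ y := hxy
        dsimp only
        split_ifs with h₁ h₂ h₂
        · exact f.toOrderHom.monotone hxy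
        · exact h _ _
        · omega
        · exact g.toOrderHom.monotone (Nat.sub_le_sub_right hxy _) }

theorem desc_inl {m n p : SimplexCategory} (f : m ⟶ p) (g : n ⟶ p)
    (h : ∀ i j, f.toOrderHom i ≤ g.toOrderHom j) (i : Fin (m.len + 1)) :
    (desc f g h).toOrderHom ((inl m n).toOrderHom i) = f.toOrderHom i :=
  dif_pos i.2

theorem desc_inr {m n p : SimplexCategory} (f : m ⟶ p) (g : n ⟶ p)
    (h : ∀ i j, f.toOrderHom i ≤ g.toOrderHom j) (j : Fin (n.len + 1)) :
    (desc f g h).toOrderHom ((inr m n).toOrderHom j) = g.toOrderHom j := by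
  have h₀ : (((inr m n).toOrderHom j : Fin _) : ℕ) = m.len + 1 + j := rfl
  refine (dif_neg (by omega)).trans (congrArg g.toOrderHom (Fin.ext ?_))
  change m.len + 1 + (j : ℕ) - (m.len + 1) = j
  omega

@[simp]
theorem inl_desc {m n p : SimplexCategory} (f : m ⟶ p) (g : n ⟶ p)
    (h : ∀ i j, f.toOrderHom i ≤ g.toOrderHom j) : inl m n ≫ desc f g h = f :=
  SimplexCategory.Hom.ext _ _ (OrderHom.ext _ _ (funext fun i => desc_inl f g h i))

@[simp]
theorem inr_desc {m n p : SimplexCategory} (f : m ⟶ p) (g : n ⟶ p)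
    (h : ∀ i j, f.toOrderHom i ≤ g.toOrderHom j) : inr m n ≫ desc f g h = g :=
  SimplexCategory.Hom.ext _ _ (OrderHom.ext _ _ (funext fun i => desc_inr f g h i))

/-- Functoriality of the join. -/
def map {m n m' n' : SimplexCategory} (f : m ⟶ m') (g : n ⟶ n') : join m n ⟶ join m' n' :=
  desc (f ≫ inl m' n') (g ≫ inr m' n') (fun _ _ => inl_le_inr _ _)

@[simp]
theorem inl_map {m n m' n' : SimplexCategory} (f : m ⟶ m') (g : n ⟶ n') :
    inl m n ≫ map f g = f ≫ inl m' n' := inl_desc _ _ _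

@[simp]
theorem inr_map {m n m' n' : SimplexCategory} (f : m ⟶ m') (g : n ⟶ n') :
    inr m n ≫ map f g = g ≫ inr m' n' := inr_desc _ _ _

@[simp]
theorem map_id (m n : SimplexCategory) : map (𝟙 m) (𝟙 n) = 𝟙 _ :=
  hom_ext (by simp) (by simp)

theorem map_comp {m n m' n' m'' n'' : SimplexCategory} (f : m ⟶ m') (g : n ⟶ n') (f' : m' ⟶ m'')
    (g' : n' ⟶ n'') : map (f ≫ f') (g ≫ g') = map f g ≫ map f' g' :=
  hom_ext (by rw [inl_map, reassoc_of% (inl_map f g), inl_map, Category.assoc])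
    (by rw [inr_map, reassoc_of% (inr_map f g), inr_map, Category.assoc])

end SimplexJoin

/-! ### Simplices over a simplex -/

section JoinSimplex

variable {C D : Type u} [SmallCategory.{u} C] [SmallCategory.{u} D] (F : D ⥤ C)

/-- For `c = (c₀ ⟶ ⋯ ⟶ cₙ)`, a simplex of dimension `k` over `c` is a sequence
`d = (d₀ ⟶ ⋯ ⟶ dₖ)` of `D` together with a sequence `y` of length `k + 1 + n` which restricts to
`F d` and to `c`. -/
@[ext]
structure JoinSimplex (c : SimplicialReplacement C) (k : SimplexCategory) where
  d : (nerve D).obj (op k)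
  y : (nerve C).obj (op (SimplexJoin.join k c.1.unop))
  inl_y : (nerve C).map (SimplexJoin.inl k c.1.unop).op y = (show ComposableArrows D _ from d) ⋙ F
  inr_y : (nerve C).map (SimplexJoin.inr k c.1.unop).op y = c.2

variable {F}

theorem nerve_map_map {n m p : SimplexCategory} (f : n ⟶ m) (g : m ⟶ p) (x : (nerve C).obj (op p)) :
    (nerve C).map f.op ((nerve C).map g.op x) = (nerve C).map (f ≫ g).op x := rfl

/-- Simplicial operators on simplices over `c`. -/
def JoinSimplex.restrict {c : SimplicialReplacement C} {k : SimplexCategory}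
    (s : JoinSimplex F c k) {l : SimplexCategory} (θ : l ⟶ k) : JoinSimplex F c l where
  d := (nerve D).map θ.op s.d
  y := (nerve C).map (SimplexJoin.map θ (𝟙 _)).op s.y
  inl_y := by
    rw [nerve_map_map, SimplexJoin.inl_map, ← nerve_map_map, s.inl_y]
    rfl
  inr_y := by
    rw [nerve_map_map, SimplexJoin.inr_map, Category.id_comp, s.inr_y]

/-- Functoriality in `c` of simplices over `c`. -/
def JoinSimplex.push {c c' : SimplicialReplacement C} {k : SimplexCategory}
    (s : JoinSimplex F c k) (f : c ⟶ c') : JoinSimplex F c' k where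
  d := s.d
  y := (nerve C).map (SimplexJoin.map (𝟙 k) f.1.unop).op s.y
  inl_y := by
    rw [nerve_map_map, SimplexJoin.inl_map, Category.id_comp, s.inl_y]
  inr_y := by
    have h : (nerve C).map f.1.unop.op c.2 = c'.2 := f.2
    rw [nerve_map_map, SimplexJoin.inr_map, ← nerve_map_map, s.inr_y, h]

theorem JoinSimplex.map_y {k l n m : SimplexCategory} {k' l' : SimplexCategory}
    (y : (nerve C).obj (op (SimplexJoin.join k n))) {f : l ⟶ k} {g : m ⟶ n} {f' : k' ⟶ l}
    {g' : l' ⟶ m} : (nerve C).map (SimplexJoin.map f' g').op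
      ((nerve C).map (SimplexJoin.map f g).op y) =
        (nerve C).map (SimplexJoin.map (f' ≫ f) (g' ≫ g)).op y := by
  rw [nerve_map_map, SimplexJoin.map_comp]

variable (F)

/-- The simplicial set of simplices over `c`. -/
def joinSSet (c : SimplicialReplacement C) : SSet.{u} where
  obj n := JoinSimplex F c n.unop
  map α := ↾fun s => s.restrict α.unop
  map_id n := by
    ext s
    · rfl
    · change (nerve C).map (SimplexJoin.map (𝟙 n.unop) (𝟙 c.1.unop)).op s.y = s.y
      rw [SimplexJoin.map_id]
      rfl
  map_comp α β := by
    ext s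
    · rfl
    · change (nerve C).map (SimplexJoin.map (β.unop ≫ α.unop) (𝟙 c.1.unop)).op s.y = _
      refine Eq.trans ?_ (JoinSimplex.map_y s.y).symm
      rw [Category.comp_id]

/-- The diagram of simplicial sets of simplices over the objects of the simplicial replacement. -/
def joinDiagram : SimplicialReplacement C ⥤ SSet.{u} where
  obj c := joinSSet F c
  map {c c'} f :=
    { app := fun n => ↾fun s => s.push f
      naturality := fun n m α => by
        ext s
        refine JoinSimplex.ext ?_ ?_
        · rfl
        · refine (JoinSimplex.map_y s.y).trans ((JoinSimplex.map_y s.y).trans ?_).symm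
          rw [Category.id_comp, Category.comp_id, Category.id_comp, Category.comp_id] }
  map_id c := by
    ext n s
    refine JoinSimplex.ext ?_ ?_
    · rfl
    · change (nerve C).map (SimplexJoin.map (𝟙 n.unop) (𝟙 c.1.unop)).op s.y = s.y
      rw [SimplexJoin.map_id]
      rfl
  map_comp {c c' c''} f g := by
    ext n s
    refine JoinSimplex.ext ?_ ?_
    · rfl
    · change (nerve C).map (SimplexJoin.map (𝟙 n.unop) (g.1.unop ≫ f.1.unop)).op s.y = _
      refine Eq.trans ?_ (JoinSimplex.map_y s.y).symm
      rw [Category.comp_id]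

namespace joinDiagram

theorem hom_w {x x' : Simplices (joinDiagram F)} (f : x ⟶ x') :
    (nerve D).map f.dim.op x.simplex.d = x'.simplex.d ∧
      (nerve C).map (SimplexJoin.map f.dim f.base.1.unop).op x.simplex.y = x'.simplex.y := by
  have h := f.w
  refine ⟨congrArg JoinSimplex.d h, ?_⟩
  have h' : (nerve C).map (SimplexJoin.map (𝟙 x'.dim) f.base.1.unop).op
    ((nerve C).map (SimplexJoin.map f.dim (𝟙 x.base.1.unop)).op x.simplex.y) =
      x'.simplex.y := congrArg JoinSimplex.y h
  rw [JoinSimplex.map_y, Category.id_comp, Category.comp_id] at h'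
  exact h'

/-- The functor `(c, d, y) ↦ y`. -/
def middle : Simplices (joinDiagram F) ⥤ SimplicialReplacement C where
  obj x := ⟨op (SimplexJoin.join x.dim x.base.1.unop), x.simplex.y⟩
  map f := CategoryOfElements.homMk _ _ (SimplexJoin.map f.dim f.base.1.unop).op (hom_w F f).2
  map_id _ := Subtype.ext (congrArg Quiver.Hom.op (SimplexJoin.map_id _ _))
  map_comp _ _ := Subtype.ext (congrArg Quiver.Hom.op (SimplexJoin.map_comp _ _ _ _))

/-- The functor `(c, d, y) ↦ d`. -/
def source : Simplices (joinDiagram F) ⥤ SimplicialReplacement D where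
  obj x := ⟨op x.dim, x.simplex.d⟩
  map f := CategoryOfElements.homMk _ _ f.dim.op (hom_w F f).1
  map_id _ := rfl
  map_comp _ _ := rfl

/-- The anchor maps `y ⟶ F d`. -/
def toSource : middle F ⟶ source F ⋙ SimplicialReplacement.map F where
  app x := CategoryOfElements.homMk _ _ (SimplexJoin.inl x.dim x.base.1.unop).op x.simplex.inl_y
  naturality _ _ _ := Subtype.ext (congrArg Quiver.Hom.op (SimplexJoin.inl_map _ _))

/-- The maps `y ⟶ c`. -/
def toBase : middle F ⟶ Simplices.proj (joinDiagram F) where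
  app x := CategoryOfElements.homMk _ _ (SimplexJoin.inr x.dim x.base.1.unop).op x.simplex.inr_y
  naturality _ _ _ := Subtype.ext (congrArg Quiver.Hom.op (SimplexJoin.inr_map _ _))

theorem isAnchor_toSource (x : Simplices (joinDiagram F)) : IsAnchor ((toSource F).app x) :=
  fun _ => rfl

end joinDiagram

/-- A functor on a simplicial replacement which sends the maps preserving the last vertex to
identities. -/
def DependsOnLast {B : Type u₂} [Category.{v₂} B] (k : SimplicialReplacement C ⥤ B) : Prop :=
  ∀ ⦃x y : SimplicialReplacement C⦄ (f : x ⟶ y),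
    f.1.unop.toOrderHom (Fin.last _) = Fin.last _ → ∃ h : k.obj x = k.obj y, k.map f = eqToHom h

theorem lastMap_eq_eqToHom_aux {J : Type u₃} [Preorder J] (G : J ⥤ C) {i j : J} (h : i ≤ j)
    (hij : i = j) {a : C} (e : a = G.obj i) :
    eqToHom e ≫ G.map (homOfLE h) = eqToHom (e.trans (congrArg G.obj hij)) := by
  subst hij
  have : homOfLE h = 𝟙 i := rfl
  rw [this, G.map_id, Category.comp_id]

variable (C) in
theorem dependsOnLast_tail : DependsOnLast (tail C) := fun x y f hf => by
  have h : y.last = x.last :=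
    (SimplicialReplacement.last_eq f).trans (congrArg x.arrows.obj hf)
  have h' : SimplicialReplacement.lastMap f = eqToHom h := lastMap_eq_eqToHom_aux _ _ hf _
  refine ⟨congrArg op h.symm, ?_⟩
  change (SimplicialReplacement.lastMap f).op = _
  rw [h', eqToHom_op]
  rfl

theorem DependsOnLast.comp_map {B : Type u₂} [Category.{v₂} B] {k : SimplicialReplacement C ⥤ B}
    (hk : DependsOnLast k) : DependsOnLast (SimplicialReplacement.map F ⋙ k) := fun _ _ f hf =>
  hk ((SimplicialReplacement.map F).map f) hf

variable {F} in
/-- The sequences `y` and `c` have the same last object, so the values of a section at `y` lie in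
the fibre required for the homotopy colimit at `c`. -/
theorem DependsOnLast.middle_comp {B : Type u₂} [Category.{v₂} B]
    {k : SimplicialReplacement C ⥤ B} (hk : DependsOnLast k) :
    joinDiagram.middle F ⋙ k = Simplices.proj (joinDiagram F) ⋙ k := by
  have h := fun x => hk ((joinDiagram.toBase F).app x) (SimplexJoin.inr_last _ _)
  choose h₁ h₂ using h
  refine CategoryTheory.Functor.ext h₁ (fun x y f => ?_)
  have h₃ := (Functor.whiskerRight (joinDiagram.toBase F) k).naturality f
  have h₄ : (joinDiagram.middle F ⋙ k).map f ≫ eqToHom (h₁ y) =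
      eqToHom (h₁ x) ≫ (Simplices.proj (joinDiagram F) ⋙ k).map f :=
    (congrArg ((joinDiagram.middle F ⋙ k).map f ≫ ·) (h₂ y).symm).trans (h₃.trans
      (congrArg (· ≫ (Simplices.proj (joinDiagram F) ⋙ k).map f) (h₂ x)))
  rw [← Category.assoc, ← h₄, Category.assoc]
  simp

end JoinSimplex

/-! ### The contraction of the category of simplices over a simplex -/

section Pushforward

variable {C : Type u₁} [Category.{v₁} C] {D : Type u₂} [Category.{v₂} D] (F : D ⥤ C)
  [IsOpfibration F] (c : C)

/-- A chosen pushforward of an object over `c` to the fibre over `c`. -/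
noncomputable def pushforwardObj (X : CostructuredArrow F c) : D :=
  (IsOpfibration.exists_lift (p := F) X.left X.hom).choose

/-- The opCartesian arrow to the pushforward. -/
noncomputable def pushforwardι (X : CostructuredArrow F c) : X.left ⟶ pushforwardObj F c X :=
  (IsOpfibration.exists_lift (p := F) X.left X.hom).choose_spec.choose

instance (X : CostructuredArrow F c) : F.IsCocartesian X.hom (pushforwardι F c X) :=
  (IsOpfibration.exists_lift (p := F) X.left X.hom).choose_spec.choose_spec

theorem obj_pushforwardObj (X : CostructuredArrow F c) : F.obj (pushforwardObj F c X) = c :=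
  isHomLift_codomain (f := X.hom) (φ := pushforwardι F c X)
    (IsOpfibration.exists_lift (p := F) X.left X.hom).choose_spec.choose_spec.toIsHomLift

theorem exists_pushforwardMap {X Y : CostructuredArrow F c} (f : X ⟶ Y) :
    ∃ g : pushforwardObj F c X ⟶ pushforwardObj F c Y, F.IsHomLift (𝟙 c) g ∧
      pushforwardι F c X ≫ g = f.left ≫ pushforwardι F c Y := by
  have h : F.IsHomLift X.hom (f.left ≫ pushforwardι F c Y) := by
    have h₁ : F.IsHomLift (F.map f.left ≫ Y.hom) (f.left ≫ pushforwardι F c Y) := by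
      have := IsHomLift.map F f.left
      infer_instance
    rwa [CostructuredArrow.w f] at h₁
  exact ⟨Functor.IsCocartesian.map F X.hom (pushforwardι F c X) (f.left ≫ pushforwardι F c Y),
    inferInstance, by simp⟩

theorem pushforward_hom_ext {X : CostructuredArrow F c} {z : D}
    {f g : pushforwardObj F c X ⟶ z} (hf : F.IsHomLift (𝟙 c) f) (hg : F.IsHomLift (𝟙 c) g)
    (h : pushforwardι F c X ≫ f = pushforwardι F c X ≫ g) : f = g :=
  Functor.IsCocartesian.ext F X.hom (pushforwardι F c X) f g h

/-- Pushing forward to the fibre over `c` the objects of `D` equipped with an arrow from their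
image to `c`. -/
noncomputable def pushforward : CostructuredArrow F c ⥤ F.Fiber c where
  obj X := ⟨pushforwardObj F c X, obj_pushforwardObj F c X⟩
  map f := ⟨(exists_pushforwardMap F c f).choose, (exists_pushforwardMap F c f).choose_spec.1⟩
  map_id X := Subtype.ext (by
    have h := (exists_pushforwardMap F c (𝟙 X)).choose_spec
    exact pushforward_hom_ext F c h.1 (IsHomLift.id (obj_pushforwardObj F c X))
      (h.2.trans ((Category.id_comp _).trans (Category.comp_id _).symm)))
  map_comp {X Y Z} f g := Subtype.ext (by
    have h := (exists_pushforwardMap F c f).choose_spec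
    have h' := (exists_pushforwardMap F c g).choose_spec
    have h'' := (exists_pushforwardMap F c (f ≫ g)).choose_spec
    refine pushforward_hom_ext F c h''.1 (isHomLift_comp_vertical h.1 h'.1) ?_
    refine h''.2.trans ((Category.assoc _ _ _).trans ((congrArg (f.left ≫ ·) h'.2.symm).trans ?_))
    exact (Category.assoc _ _ _).symm.trans ((congrArg (· ≫ _) h.2.symm).trans
      (Category.assoc _ _ _)))

/-- The opCartesian arrows to the pushforwards, as a natural transformation. -/
noncomputable def pushforwardUnit :
    CostructuredArrow.proj F c ⟶ pushforward F c ⋙ Functor.Fiber.fiberInclusion where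
  app X := pushforwardι F c X
  naturality _ _ f := (exists_pushforwardMap F c f).choose_spec.2.symm

/-- The functor `(0, X) ↦ X`, `(1, X) ↦` pushforward of `X`. -/
noncomputable def pushforwardInterval : Fin 2 × CostructuredArrow F c ⥤ D :=
  Functor.uncurry.obj (ComposableArrows.mk₁ (pushforwardUnit F c))

/-- The structure arrows to `c`, as a natural transformation. -/
def structureArrow : CostructuredArrow.proj F c ⋙ F ⟶ (Functor.const _).obj c where
  app X := X.hom
  naturality _ _ f := (CostructuredArrow.w f).trans (Category.comp_id _).symm

/-- The functor `(0, X) ↦ F X`, `(1, X) ↦ c`. -/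
def structureInterval : Fin 2 × CostructuredArrow F c ⥤ C :=
  Functor.uncurry.obj (ComposableArrows.mk₁ (structureArrow F c))

/-- Functors out of a product with the arrow `0 ⟶ 1` which are given by natural transformations
agreeing up to identifications are equal. -/
theorem uncurry_mk₁_ext {J : Type u₃} [Category.{v₃} J] {M : Type*} [Category* M] {G G' : J ⥤ M}
    (t : G ⟶ G') {H : Fin 2 × J ⥤ M} (h₀ : ∀ j, H.obj (0, j) = G.obj j)
    (h₁ : ∀ j, H.obj (1, j) = G'.obj j)
    (m₀ : ∀ {i j : J} (f : i ⟶ j), H.map (Prod.mkHom (𝟙 (0 : Fin 2)) f) ≫ eqToHom (h₀ j) =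
      eqToHom (h₀ i) ≫ G.map f)
    (m₁ : ∀ {i j : J} (f : i ⟶ j), H.map (Prod.mkHom (𝟙 (1 : Fin 2)) f) ≫ eqToHom (h₁ j) =
      eqToHom (h₁ i) ≫ G'.map f)
    (m : ∀ j, H.map (Prod.mkHom (homOfLE (Fin.zero_le 1) : (0 : Fin 2) ⟶ 1) (𝟙 j)) ≫
      eqToHom (h₁ j) =
      eqToHom (h₀ j) ≫ t.app j) : H = Functor.uncurry.obj (ComposableArrows.mk₁ t) := by
  let e : ∀ p : Fin 2 × J, H.obj p = (Functor.uncurry.obj (ComposableArrows.mk₁ t)).obj p :=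
    fun p => match p with
      | (0, j) => h₀ j
      | (1, j) => h₁ j
  have key : ∀ {p p' : Fin 2 × J} (f : p ⟶ p'), H.map f ≫ eqToHom (e p') =
      eqToHom (e p) ≫ (Functor.uncurry.obj (ComposableArrows.mk₁ t)).map f := by
    rintro ⟨a, i⟩ ⟨b, j⟩ ⟨f, g⟩
    fin_cases a <;> fin_cases b
    · obtain rfl : f = 𝟙 0 := Subsingleton.elim _ _
      exact (m₀ g).trans (congrArg (_ ≫ ·) (Category.id_comp _).symm)
    · obtain rfl : f = homOfLE (Fin.zero_le _) := Subsingleton.elim _ _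
      have e₁ : Prod.mkHom (homOfLE (Fin.zero_le 1) : (0 : Fin 2) ⟶ 1) g =
          Prod.mkHom (homOfLE (Fin.zero_le 1) : (0 : Fin 2) ⟶ 1) (𝟙 i) ≫
            Prod.mkHom (𝟙 (1 : Fin 2)) g :=
        Prod.ext (Subsingleton.elim _ _) (Category.id_comp _).symm
      refine (congrArg (fun s => H.map s ≫ eqToHom (h₁ j)) e₁).trans ?_
      refine (congrArg (· ≫ eqToHom (h₁ j)) (H.map_comp _ _)).trans ?_
      refine (Category.assoc _ _ _).trans ((congrArg (_ ≫ ·) (m₁ g)).trans ?_)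
      refine (Category.assoc _ _ _).symm.trans ((congrArg (· ≫ _) (m i)).trans ?_)
      exact Category.assoc _ _ _
    · exact absurd (leOfHom f) (show ¬(1 : Fin 2) ≤ 0 by decide)
    · obtain rfl : f = 𝟙 1 := Subsingleton.elim _ _
      exact (m₁ g).trans (congrArg (_ ≫ ·) (Category.id_comp _).symm)
  refine CategoryTheory.Functor.ext e (fun p p' f => ?_)
  have h := key f
  rw [← Category.assoc, ← h, Category.assoc]
  simp

theorem map_comp_eqToHom_of_isHomLift {F : D ⥤ C} {R S : C} {a b : D} {f : R ⟶ S} {φ : a ⟶ b}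
    (h : F.IsHomLift f φ) (hb : F.obj b = S) (ha : F.obj a = R) :
    F.map φ ≫ eqToHom hb = eqToHom ha ≫ f := by
  cases h
  simp

theorem pushforwardInterval_comp : pushforwardInterval F c ⋙ F = structureInterval F c := by
  have hX : ∀ X, F.obj (pushforwardObj F c X) = c := fun X => ((pushforward F c).obj X).2
  refine uncurry_mk₁_ext (structureArrow F c) (fun _ => rfl) hX ?_ ?_ ?_
  · intro X Y f
    refine (Category.comp_id _).trans (Eq.trans ?_ (Category.id_comp _).symm)
    exact congrArg F.map (Category.id_comp _)
  · intro X Y f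
    have h : F.IsHomLift (𝟙 c) ((pushforward F c).map f).1 := ((pushforward F c).map f).2
    have e : (pushforwardInterval F c).map (Prod.mkHom (𝟙 (1 : Fin 2)) f) =
      ((pushforward F c).map f).1 := Category.id_comp _
    refine (congrArg (fun s => F.map s ≫ eqToHom (hX Y)) e).trans ?_
    exact map_comp_eqToHom_of_isHomLift h _ (hX X)
  · intro X
    have e : (pushforwardInterval F c).map
        (Prod.mkHom (homOfLE (Fin.zero_le 1) : (0 : Fin 2) ⟶ 1) (𝟙 X)) = pushforwardι F c X :=
      (congrArg (pushforwardι F c X ≫ ·)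
        (congrArg Functor.Fiber.fiberInclusion.map ((pushforward F c).map_id X))).trans
          (Category.comp_id _)
    refine (congrArg (fun s => F.map s ≫ eqToHom (hX X)) e).trans ?_
    have h : F.IsHomLift X.hom (pushforwardι F c X) := inferInstance
    exact map_comp_eqToHom_of_isHomLift h _ rfl

/-- A functor to the category of objects over `c`, given by a functor to `D` and compatible arrows
to `c`. -/
def toCostructuredArrow {F : D ⥤ C} {c : C} {J : Type u₃} [Category.{v₃} J] (d : J ⥤ D)
    (w : ∀ j, F.obj (d.obj j) ⟶ c) (hw : ∀ {i j : J} (f : i ⟶ j), F.map (d.map f) ≫ w j = w i) :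
    J ⥤ CostructuredArrow F c where
  obj j := CostructuredArrow.mk (w j)
  map f := CostructuredArrow.homMk (d.map f) (hw f)
  map_id _ := CostructuredArrow.hom_ext _ _ (d.map_id _)
  map_comp _ _ := CostructuredArrow.hom_ext _ _ (d.map_comp _ _)

theorem toCostructuredArrow_congr {F : D ⥤ C} {c : C} {J : Type u₃} [Category.{v₃} J] {d : J ⥤ D}
    {w w' : ∀ j, F.obj (d.obj j) ⟶ c} (hw : ∀ {i j : J} (f : i ⟶ j), F.map (d.map f) ≫ w j = w i)
    (hw' : ∀ {i j : J} (f : i ⟶ j), F.map (d.map f) ≫ w' j = w' i) (h : ∀ j, w j = w' j) :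
    toCostructuredArrow d w hw = toCostructuredArrow d w' hw' := by
  obtain rfl : w = w' := funext h
  rfl

end Pushforward

section JoinContraction

theorem SimplexJoin.map_inl {m n m' n' : SimplexCategory} (f : m ⟶ m') (g : n ⟶ n')
    (i : Fin (m.len + 1)) : (SimplexJoin.map f g).toOrderHom ((SimplexJoin.inl m n).toOrderHom i) =
      (SimplexJoin.inl m' n').toOrderHom (f.toOrderHom i) :=
  SimplexJoin.desc_inl (f ≫ SimplexJoin.inl m' n') (g ≫ SimplexJoin.inr m' n')
    (fun _ _ => SimplexJoin.inl_le_inr _ _) i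

theorem SimplexJoin.map_inr {m n m' n' : SimplexCategory} (f : m ⟶ m') (g : n ⟶ n')
    (j : Fin (n.len + 1)) : (SimplexJoin.map f g).toOrderHom ((SimplexJoin.inr m n).toOrderHom j) =
      (SimplexJoin.inr m' n').toOrderHom (g.toOrderHom j) :=
  SimplexJoin.desc_inr (f ≫ SimplexJoin.inl m' n') (g ≫ SimplexJoin.inr m' n')
    (fun _ _ => SimplexJoin.inl_le_inr _ _) j

theorem map_comp_eqToHom_of_eq {I : Type u₁} [Category.{v₁} I] {M : Type u₃} [Category.{v₃} M]
    {G G' : I ⥤ M} (e : G = G') {i j : I} (f : i ⟶ j) :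
    G.map f ≫ eqToHom (congrArg (fun K => K.obj j) e) =
      eqToHom (congrArg (fun K => K.obj i) e) ≫ G'.map f := by
  subst e
  exact (Category.comp_id _).trans (Category.id_comp _).symm

theorem eqToHom_comp_cancel {M : Type u₃} [Category.{v₃} M] {a b c : M} (h : a = b) (f : a ⟶ c) :
    eqToHom h ≫ eqToHom h.symm ≫ f = f := by
  subst h
  exact (Category.id_comp _).trans (Category.id_comp _)

theorem uncurry_mk₁_whisker {J : Type u₁} [Category.{v₁} J] {J' : Type u₃} [Category.{v₃} J']
    {M : Type u₂} [Category.{v₂} M] (Q : J ⥤ J') {G G' : J' ⥤ M} (t : G ⟶ G') :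
    Functor.prod (𝟭 (Fin 2)) Q ⋙ Functor.uncurry.obj (ComposableArrows.mk₁ t) =
      Functor.uncurry.obj (ComposableArrows.mk₁ (Functor.whiskerLeft Q t)) := by
  refine uncurry_mk₁_ext (Functor.whiskerLeft Q t) (fun _ => rfl) (fun _ => rfl) ?_ ?_ ?_
  · intro i j f
    exact (Category.comp_id _).trans
      ((Category.id_comp _).trans (Category.id_comp _).symm)
  · intro i j f
    exact (Category.comp_id _).trans
      ((Category.id_comp _).trans (Category.id_comp _).symm)
  · intro j
    refine (Category.comp_id _).trans (Eq.trans ?_ (Category.id_comp _).symm)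
    exact (congrArg (t.app (Q.obj j) ≫ ·)
      ((congrArg G'.map (Q.map_id j)).trans (G'.map_id _))).trans (Category.comp_id _)

theorem map_comp_structure {I : Type u₁} [Category.{v₁} I] {J : Type u₂} [Preorder J]
    {M : Type u₃} [Category.{v₃} M] {l : I ⥤ J} {Y : J ⥤ M} {G : I ⥤ M} (e : l ⋙ Y = G) {i i' : I}
    (f : i ⟶ i') {t : J} (h : l.obj i ≤ t) (h' : l.obj i' ≤ t) {c : M} (ec : Y.obj t = c) :
    G.map f ≫ eqToHom (congrArg (fun K => K.obj i') e).symm ≫ Y.map (homOfLE h') ≫ eqToHom ec =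
      eqToHom (congrArg (fun K => K.obj i) e).symm ≫ Y.map (homOfLE h) ≫ eqToHom ec := by
  subst e ec
  simp only [eqToHom_refl, Category.comp_id]
  refine (congrArg (_ ≫ ·) (Category.id_comp _)).trans (Eq.trans ?_ (Category.id_comp _).symm)
  exact (Y.map_comp _ _).symm.trans (congrArg Y.map (Subsingleton.elim _ _))

theorem eqToHom_map_eqToHom {J : Type u₁} [Preorder J] {M : Type u₃} [Category.{v₃} M] (Y : J ⥤ M)
    {i i' t t' : J} (hi : i = i') (ht : t = t') (h : i ≤ t) (h' : i' ≤ t') {a b : M}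
    (ha : a = Y.obj i) (ha' : a = Y.obj i') (hb : Y.obj t = b) (hb' : Y.obj t' = b) :
    eqToHom ha ≫ Y.map (homOfLE h) ≫ eqToHom hb =
      eqToHom ha' ≫ Y.map (homOfLE h') ≫ eqToHom hb' := by
  subst hi ht
  rfl

theorem nerve_map_congr {C : Type u₁} [Category.{v₁} C] {n m : SimplexCategory} {f g : n ⟶ m}
    (h : f = g) (x : (nerve C).obj (op m)) : (nerve C).map f.op x = (nerve C).map g.op x := by
  rw [h]

variable {C D : Type u} [SmallCategory.{u} C] [SmallCategory.{u} D] {F : D ⥤ C}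
  {c : SimplicialReplacement C} {k : SimplexCategory}

namespace JoinSimplex

/-- The first component of a simplex over `c`, as a functor. -/
abbrev top (s : JoinSimplex F c k) : Fin (k.len + 1) ⥤ D := s.d

/-- The second component of a simplex over `c`, as a functor. -/
abbrev long (s : JoinSimplex F c k) : Fin ((SimplexJoin.join k c.1.unop).len + 1) ⥤ C := s.y

theorem long_inl (s : JoinSimplex F c k) :
    (SimplexJoin.inl k c.1.unop).toOrderHom.monotone.functor ⋙ s.long = s.top ⋙ F := s.inl_y

theorem long_inr (s : JoinSimplex F c k) :
    (SimplexJoin.inr k c.1.unop).toOrderHom.monotone.functor ⋙ s.long = c.arrows := s.inr_y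

theorem long_inr_zero (s : JoinSimplex F c k) :
    s.long.obj ((SimplexJoin.inr k c.1.unop).toOrderHom 0) = c.arrows.obj 0 :=
  congrArg (fun G => G.obj 0) s.long_inr

/-- The arrows `F dᵢ ⟶ c₀` of a simplex over `c`. -/
def toFirst (s : JoinSimplex F c k) (i : Fin (k.len + 1)) :
    F.obj (s.top.obj i) ⟶ c.arrows.obj 0 :=
  eqToHom (congrArg (fun G => G.obj i) s.long_inl).symm ≫
    s.long.map (homOfLE (SimplexJoin.inl_le_inr i 0)) ≫ eqToHom s.long_inr_zero

theorem map_toFirst (s : JoinSimplex F c k) {i j : Fin (k.len + 1)} (f : i ⟶ j) :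
    F.map (s.top.map f) ≫ s.toFirst j = s.toFirst i :=
  map_comp_structure s.long_inl f _ _ _

/-- The objects `dᵢ` of a simplex over `c`, together with the arrows `F dᵢ ⟶ c₀`. -/
def overFirst (s : JoinSimplex F c k) : Fin (k.len + 1) ⥤ CostructuredArrow F (c.arrows.obj 0) :=
  toCostructuredArrow s.top s.toFirst s.map_toFirst

theorem overFirst_restrict (s : JoinSimplex F c k) {l : SimplexCategory} (θ : l ⟶ k) :
    (s.restrict θ).overFirst = θ.toOrderHom.monotone.functor ⋙ s.overFirst := by
  refine toCostructuredArrow_congr (s.restrict θ).map_toFirst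
    (fun f => s.map_toFirst (θ.toOrderHom.monotone.functor.map f)) (fun i => ?_)
  exact eqToHom_map_eqToHom s.long (SimplexJoin.map_inl θ (𝟙 _) i) (SimplexJoin.map_inr θ (𝟙 _) 0)
    _ _ _ _ _ _

end JoinSimplex

/-- The map `(0, i) ↦ i`, `(1, i) ↦` first element of the second simplex, to a join. -/
def toggleObj (k n : SimplexCategory) (a : Fin 2) (i : Fin (k.len + 1)) :
    Fin ((SimplexJoin.join k n).len + 1) :=
  if a = 0 then (SimplexJoin.inl k n).toOrderHom i else (SimplexJoin.inr k n).toOrderHom 0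

theorem toggleObj_le {k n : SimplexCategory} {a b : Fin 2} (hab : a ≤ b) {i j : Fin (k.len + 1)}
    (hij : i ≤ j) : toggleObj k n a i ≤ toggleObj k n b j := by
  fin_cases a <;> fin_cases b
  · exact (SimplexJoin.inl k n).toOrderHom.monotone hij
  · exact SimplexJoin.inl_le_inr _ _
  · exact absurd hab (by decide)
  · exact le_rfl

theorem toggleObj_le_inr {k n : SimplexCategory} (a : Fin 2) (i : Fin (k.len + 1))
    (j : Fin (n.len + 1)) : toggleObj k n a i ≤ (SimplexJoin.inr k n).toOrderHom j := by
  fin_cases a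
  · exact SimplexJoin.inl_le_inr _ _
  · exact (SimplexJoin.inr k n).toOrderHom.monotone (Fin.zero_le _)

/-- `toggleObj` as a functor. -/
def toggleFunctor (k n : SimplexCategory) :
    Fin 2 × Fin (k.len + 1) ⥤ Fin ((SimplexJoin.join k n).len + 1) where
  obj p := toggleObj k n p.1 p.2
  map f := homOfLE (toggleObj_le (leOfHom f.1) (leOfHom f.2))

/-- The map `i ↦ toggleObj (θ i) i` to a join. -/
def toggleLeft (k n : SimplexCategory) (θ : Fin (k.len + 1) →o Fin 2) : k ⟶ SimplexJoin.join k n :=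
  SimplexCategory.mkHom
    { toFun := fun i => toggleObj k n (θ i) i
      monotone' := fun _ _ h => toggleObj_le (θ.monotone h) h }

/-- The endomorphism of a join which sends the elements `i` of the first simplex with `θ i = 1` to
the first element of the second simplex and fixes the others. -/
def toggle (k n : SimplexCategory) (θ : Fin (k.len + 1) →o Fin 2) :
    SimplexJoin.join k n ⟶ SimplexJoin.join k n :=
  SimplexJoin.desc (toggleLeft k n θ) (SimplexJoin.inr k n) (fun i j => toggleObj_le_inr (θ i) i j)

/-- The retraction of a join to the second simplex sending the first simplex to the first
element. -/
def joinCollapse (k n : SimplexCategory) : SimplexJoin.join k n ⟶ n :=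
  SimplexJoin.desc (SimplexCategory.const k n 0) (𝟙 n) (fun _ _ => Fin.zero_le _)

theorem map_toggle {k l n : SimplexCategory} (α : l ⟶ k) (θ : Fin (k.len + 1) →o Fin 2) :
    SimplexJoin.map α (𝟙 n) ≫ toggle k n θ =
      toggle l n (θ.comp α.toOrderHom) ≫ SimplexJoin.map α (𝟙 n) := by
  refine SimplexJoin.hom_ext ?_ ?_
  · refine SimplexCategory.Hom.ext _ _ (OrderHom.ext _ _ (funext fun i => ?_))
    refine (congrArg (toggle k n θ).toOrderHom (SimplexJoin.map_inl α (𝟙 n) i)).trans ?_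
    refine (SimplexJoin.desc_inl _ _ _ (α.toOrderHom i)).trans ?_
    refine Eq.trans ?_ (congrArg (SimplexJoin.map α (𝟙 n)).toOrderHom
      (SimplexJoin.desc_inl _ _ _ i).symm)
    change toggleObj k n (θ (α.toOrderHom i)) (α.toOrderHom i) =
      (SimplexJoin.map α (𝟙 n)).toOrderHom (toggleObj l n (θ (α.toOrderHom i)) i)
    unfold toggleObj
    split_ifs
    · exact (SimplexJoin.map_inl α (𝟙 n) i).symm
    · exact (SimplexJoin.map_inr α (𝟙 n) 0).symm
  · refine (Category.assoc _ _ _).symm.trans ((congrArg (· ≫ _) (SimplexJoin.inr_map _ _)).trans ?_)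
    refine Eq.trans ?_ (Category.assoc _ _ _)
    refine Eq.trans ?_ (congrArg (· ≫ SimplexJoin.map α (𝟙 n)) (SimplexJoin.inr_desc _ _ _).symm)
    refine Eq.trans ?_ (SimplexJoin.inr_map _ _).symm
    exact (Category.assoc _ _ _).trans (congrArg (𝟙 n ≫ ·) (SimplexJoin.inr_desc _ _ _))

theorem toggle_zero {k n : SimplexCategory} {θ : Fin (k.len + 1) →o Fin 2} (hθ : ∀ i, θ i = 0) :
    toggle k n θ = 𝟙 _ := by
  refine SimplexJoin.hom_ext ?_ ?_
  · refine (SimplexJoin.inl_desc _ _ _).trans (Eq.trans ?_ (Category.comp_id _).symm)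
    exact SimplexCategory.Hom.ext _ _ (OrderHom.ext _ _ (funext fun i => if_pos (hθ i)))
  · exact (SimplexJoin.inr_desc _ _ _).trans (Category.comp_id _).symm

theorem toggle_one {k n : SimplexCategory} {θ : Fin (k.len + 1) →o Fin 2} (hθ : ∀ i, θ i = 1) :
    toggle k n θ = joinCollapse k n ≫ SimplexJoin.inr k n := by
  refine SimplexJoin.hom_ext ?_ ?_
  · refine (SimplexJoin.inl_desc _ _ _).trans (Eq.trans ?_ (Category.assoc _ _ _))
    refine Eq.trans ?_ (congrArg (· ≫ SimplexJoin.inr k n) (SimplexJoin.inl_desc _ _ _).symm)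
    exact SimplexCategory.Hom.ext _ _ (OrderHom.ext _ _ (funext fun i =>
      if_neg (by rw [hθ i]; decide)))
  · refine (SimplexJoin.inr_desc _ _ _).trans (Eq.trans ?_ (Category.assoc _ _ _))
    refine Eq.trans ?_ (congrArg (· ≫ SimplexJoin.inr k n) (SimplexJoin.inr_desc _ _ _).symm)
    exact (Category.id_comp _).symm

theorem map_joinCollapse {k l n : SimplexCategory} (α : l ⟶ k) :
    SimplexJoin.map α (𝟙 n) ≫ joinCollapse k n = joinCollapse l n := by
  refine SimplexJoin.hom_ext ?_ ?_
  · refine (Category.assoc _ _ _).symm.trans ((congrArg (· ≫ _) (SimplexJoin.inl_map _ _)).trans ?_)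
    refine (Category.assoc _ _ _).trans ((congrArg (α ≫ ·) (SimplexJoin.inl_desc _ _ _)).trans ?_)
    exact Eq.trans rfl (SimplexJoin.inl_desc _ _ _).symm
  · refine (Category.assoc _ _ _).symm.trans ((congrArg (· ≫ _) (SimplexJoin.inr_map _ _)).trans ?_)
    refine (Category.assoc _ _ _).trans ((congrArg (𝟙 n ≫ ·) (SimplexJoin.inr_desc _ _ _)).trans ?_)
    exact (Category.id_comp _).trans (SimplexJoin.inr_desc _ _ _).symm

theorem inr_joinCollapse (k n : SimplexCategory) :
    SimplexJoin.inr k n ≫ joinCollapse k n = 𝟙 n := SimplexJoin.inr_desc _ _ _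

theorem joinCollapse_last (k n : SimplexCategory) :
    (joinCollapse k n).toOrderHom (Fin.last _) = Fin.last _ := by
  rw [← SimplexJoin.inr_last]
  exact SimplexJoin.desc_inr _ _ _ _

theorem toggle_last (k n : SimplexCategory) (θ : Fin (k.len + 1) →o Fin 2) :
    (toggle k n θ).toOrderHom (Fin.last _) = Fin.last _ := by
  rw [← SimplexJoin.inr_last]
  exact SimplexJoin.desc_inr _ _ _ _

variable [IsOpfibration F]

namespace JoinSimplex

theorem toggleFunctor_comp_long (s : JoinSimplex F c k) :
    toggleFunctor k c.1.unop ⋙ s.long = Functor.prod (𝟭 (Fin 2)) s.overFirst ⋙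
      structureInterval F (c.arrows.obj 0) := by
  refine Eq.trans ?_ (uncurry_mk₁_whisker s.overFirst (structureArrow F (c.arrows.obj 0))).symm
  refine uncurry_mk₁_ext (Functor.whiskerLeft s.overFirst (structureArrow F (c.arrows.obj 0)))
    (fun i => congrArg (fun G => G.obj i) s.long_inl) (fun _ => s.long_inr_zero) ?_ ?_ ?_
  · intro i j f
    exact map_comp_eqToHom_of_eq s.long_inl f
  · intro i j f
    refine Eq.trans ?_ (Category.comp_id _).symm
    exact (congrArg (· ≫ _) (s.long.map_id _)).trans (Category.id_comp _)
  · intro i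
    refine Eq.trans ?_ (eqToHom_comp_cancel (congrArg (fun G => G.obj i) s.long_inl) _).symm
    rfl

/-- The homotopy on the simplices over `c` which replaces the objects `dᵢ` with `θ i = 1` by their
pushforwards to the fibre over `c₀`. -/
noncomputable def push₁ (s : JoinSimplex F c k) (θ : Fin (k.len + 1) →o Fin 2) :
    JoinSimplex F c k where
  d := Functor.prod' θ.monotone.functor s.overFirst ⋙ pushforwardInterval F (c.arrows.obj 0)
  y := (nerve C).map (toggle k c.1.unop θ).op s.y
  inl_y := by
    have h : SimplexJoin.inl k c.1.unop ≫ toggle k c.1.unop θ = toggleLeft k c.1.unop θ :=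
      SimplexJoin.inl_desc _ _ _
    rw [nerve_map_map, h]
    have h₁ := congrArg (Functor.prod' θ.monotone.functor (𝟭 _) ⋙ ·) s.toggleFunctor_comp_long
    refine Eq.trans h₁ ?_
    exact (congrArg (Functor.prod' θ.monotone.functor s.overFirst ⋙ ·)
      (pushforwardInterval_comp F (c.arrows.obj 0))).symm
  inr_y := by
    have h : SimplexJoin.inr k c.1.unop ≫ toggle k c.1.unop θ = SimplexJoin.inr k c.1.unop :=
      SimplexJoin.inr_desc _ _ _
    rw [nerve_map_map, h, s.inr_y]

theorem restrict_push₁ (s : JoinSimplex F c k) (θ : Fin (k.len + 1) →o Fin 2) {l : SimplexCategory}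
    (α : l ⟶ k) : (s.push₁ θ).restrict α = (s.restrict α).push₁ (θ.comp α.toOrderHom) := by
  refine JoinSimplex.ext ?_ ?_
  · exact (congrArg (fun G => Functor.prod' (θ.comp α.toOrderHom).monotone.functor G ⋙
      pushforwardInterval F (c.arrows.obj 0)) (s.overFirst_restrict α)).symm
  · exact nerve_map_congr (map_toggle (n := c.1.unop) α θ) s.y

theorem push₁_zero (s : JoinSimplex F c k) {θ : Fin (k.len + 1) →o Fin 2} (hθ : ∀ i, θ i = 0) :
    s.push₁ θ = s := by
  obtain rfl : θ = OrderHom.const _ 0 := OrderHom.ext _ _ (funext hθ)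
  refine JoinSimplex.ext ?_ ?_
  · refine CategoryTheory.Functor.ext (fun _ => rfl) (fun i j f => ?_)
    exact (Category.id_comp _).trans ((Category.id_comp _).trans (Category.comp_id _)).symm
  · exact (nerve_map_congr (toggle_zero (n := c.1.unop) hθ) s.y).trans
      (Functor.map_id_apply (nerve C) _ s.y)

/-- The simplex over `c` given by a simplex of the fibre over `c₀`. -/
def ofFiber (c : SimplicialReplacement C) (e : ComposableArrows (F.Fiber (c.arrows.obj 0)) k.len) :
    JoinSimplex F c k where
  d := e ⋙ Functor.Fiber.fiberInclusion
  y := (nerve C).map (joinCollapse k c.1.unop).op c.2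
  inl_y := by
    have h : SimplexJoin.inl k c.1.unop ≫ joinCollapse k c.1.unop = SimplexCategory.const _ _ 0 :=
      SimplexJoin.inl_desc _ _ _
    rw [nerve_map_map, h]
    refine Eq.trans ?_ (congrArg (e ⋙ ·)
      (Functor.Fiber.fiberInclusion_comp_eq_const (p := F) (S := c.arrows.obj 0))).symm
    refine CategoryTheory.Functor.ext (fun _ => rfl) (fun i j f => ?_)
    refine Eq.trans ?_ ((Category.id_comp _).trans (Category.comp_id _)).symm
    exact c.arrows.map_id 0
  inr_y := by
    rw [nerve_map_map, inr_joinCollapse]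
    exact Functor.map_id_apply (nerve C) _ c.2

theorem push₁_one (s : JoinSimplex F c k) {θ : Fin (k.len + 1) →o Fin 2} (hθ : ∀ i, θ i = 1) :
    s.push₁ θ = ofFiber c (s.overFirst ⋙ pushforward F (c.arrows.obj 0)) := by
  obtain rfl : θ = OrderHom.const _ 1 := OrderHom.ext _ _ (funext hθ)
  refine JoinSimplex.ext ?_ ?_
  · refine CategoryTheory.Functor.ext (fun _ => rfl) (fun i j f => ?_)
    exact (Category.id_comp _).trans ((Category.id_comp _).trans (Category.comp_id _)).symm
  · refine (nerve_map_congr (toggle_one (n := c.1.unop) hθ) s.y).trans ?_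
    exact congrArg ((nerve C).map (joinCollapse k c.1.unop).op) s.inr_y

end JoinSimplex

end JoinContraction

section MiddleContraction

variable {C D : Type u} [SmallCategory.{u} C] [SmallCategory.{u} D]
  {B : Type u₂} [Category.{v₂} B] {X : Type u₃} [Category.{v₃} X] {q : X ⥤ B}
  {k : SimplicialReplacement C ⥤ B} (hk : DependsOnLast k)

include hk in
theorem DependsOnLast.isHomLift (A : Sect k q) {x y : SimplicialReplacement C} (f : x ⟶ y)
    (hf : f.1.unop.toOrderHom (Fin.last _) = Fin.last _) {b : B} (hb : k.obj y = b) :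
    q.IsHomLift (𝟙 b) (A.functor.map f) := by
  obtain ⟨h, h'⟩ := hk f hf
  have h₁ := A.isHomLift f
  rw [h'] at h₁
  subst hb
  exact IsHomLift.of_fac' q _ _ ((A.obj_eq x).trans h) (A.obj_eq y)
    (by rw [IsHomLift.fac' q (eqToHom h) (A.functor.map f)]; simp)

variable (F : D ⥤ C)

/-- The values `A(y)` of a section `A` on the simplices `(d, y)` over `c`. -/
def Sect.middle (A : Sect k q) : Sect (Simplices.proj (joinDiagram F) ⋙ k) q :=
  A.precomp (joinDiagram.middle F) hk.middle_comp

/-- The maps `A(y) ⟶ A(c)`. -/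
def Sect.middleToBase (A : Sect k q) :
    A.middle hk F ⟶ A.precomp (Simplices.proj (joinDiagram F)) rfl where
  natTrans := Functor.whiskerRight (joinDiagram.toBase F) A.functor
  vertical x := hk.isHomLift A ((joinDiagram.toBase F).app x) (SimplexJoin.inr_last _ _) rfl

variable {F} [IsOpfibration F] {c : SimplicialReplacement C}

namespace JoinSimplex

/-- The object `y` of the simplicial replacement. -/
abbrev mid {m : SimplexCategory} (s : JoinSimplex F c m) : SimplicialReplacement C :=
  ⟨op (SimplexJoin.join m c.1.unop), s.y⟩

/-- The map of simplices under the homotopy `push₁`. -/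
noncomputable def toPush₁ {m : SimplexCategory} (s : JoinSimplex F c m)
    (θ : Fin (m.len + 1) →o Fin 2) : s.mid ⟶ (s.push₁ θ).mid :=
  CategoryOfElements.homMk _ _ (toggle m c.1.unop θ).op rfl

/-- The degeneracy from `c` to the simplex given by a simplex of the fibre over `c₀`. -/
def toOfFiber {m : SimplexCategory} (e : ComposableArrows (F.Fiber (c.arrows.obj 0)) m.len) :
    c ⟶ (ofFiber c e).mid :=
  CategoryOfElements.homMk _ _ (joinCollapse m c.1.unop).op rfl

end JoinSimplex

/-- The simplices given by the nerve of the fibre over `c₀`. -/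
def nerveFiberToJoin (F : D ⥤ C) (c : SimplicialReplacement C) :
    nerve (F.Fiber (c.arrows.obj 0)) ⟶ joinSSet F c where
  app m := ↾fun e => JoinSimplex.ofFiber (k := m.unop) c e
  naturality m l α := by
    ext e
    refine JoinSimplex.ext ?_ ?_
    · rfl
    · exact nerve_map_congr (map_joinCollapse (n := c.1.unop) α.unop).symm c.2

/-- Pushing a simplex over `c` forward to the fibre over `c₀`. -/
noncomputable def joinToNerveFiber (F : D ⥤ C) [IsOpfibration F] (c : SimplicialReplacement C) :
    joinSSet F c ⟶ nerve (F.Fiber (c.arrows.obj 0)) where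
  app m := ↾fun s => s.overFirst ⋙ pushforward F (c.arrows.obj 0)
  naturality m l α := by
    ext s
    exact congrArg (· ⋙ pushforward F (c.arrows.obj 0))
      (JoinSimplex.overFirst_restrict s α.unop)

theorem Sect.map_comp_eq {A : Sect k q} {x y y' z : SimplicialReplacement C} {f : x ⟶ y} {g : y ⟶ z}
    {f' : x ⟶ y'} {g' : y' ⟶ z} (h : g.1.unop ≫ f.1.unop = g'.1.unop ≫ f'.1.unop) :
    A.functor.map f ≫ A.functor.map g = A.functor.map f' ≫ A.functor.map g' := by
  rw [← A.functor.map_comp, ← A.functor.map_comp]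
  exact congrArg A.functor.map (Subtype.ext (congrArg Quiver.Hom.op h))

theorem Sect.map_comp_eq_map {A : Sect k q} {x y z : SimplicialReplacement C} {f : x ⟶ y}
    {g : y ⟶ z} {f' : x ⟶ z} (h : g.1.unop ≫ f.1.unop = f'.1.unop) :
    A.functor.map f ≫ A.functor.map g = A.functor.map f' := by
  rw [← A.functor.map_comp]
  exact congrArg A.functor.map (Subtype.ext (congrArg Quiver.Hom.op h))

variable [∀ b, HasColimitsOfSize.{0, 0} (q.Fiber b)] [∀ b, HasColimitsOfSize.{0, u} (q.Fiber b)]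
  [∀ b, HasCoproducts.{u} (q.Fiber b)] [q.IsFibered]

/-- The augmentation `A(y) ⟶ A(c)` of the diagram of values of a section on the simplices over `c`
is contractible: these simplices retract, by pushforward along the arrows to `c₀`, to the nerve of
the fibre over `c₀`, on which the diagram is constant. -/
noncomputable def Sect.middleContraction (A : Sect k q)
    (hc : ContractibleSpace (SSet.toTop.obj (nerve (F.Fiber (c.arrows.obj 0))))) :
    Contraction ((A.middle hk F).fiberFunctor c) (z := ⟨A.functor.obj c, A.obj_eq c⟩)
      (fun e => ⟨augApp (A.middleToBase hk F) ((Simplices.incl (joinDiagram F) c).obj e),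
        augApp_isHomLift (A.middleToBase hk F) ((Simplices.incl (joinDiagram F) c).obj e)⟩) where
  dom := nerve (F.Fiber (c.arrows.obj 0))
  dom_contractible := hc
  i := nerveFiberToJoin F c
  γ m e := ⟨A.functor.map (JoinSimplex.toOfFiber (m := m.unop) e),
    hk.isHomLift A (JoinSimplex.toOfFiber (m := m.unop) e) (joinCollapse_last _ _)
      ((A.obj_eq _).symm.trans (((A.middle hk F).fiberFunctor c).obj (Functor.elementsMk _ m
        ((nerveFiberToJoin F c).app m e))).2)⟩
  γ_map α j e he := by
    refine Subtype.ext (Sect.map_comp_eq_map ?_)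
    refine (congrArg (fun t => SimplexJoin.map (Quiver.Hom.unop t) (𝟙 c.1.unop) ≫ _) he).trans ?_
    exact map_joinCollapse (n := c.1.unop) α.unop
  γ_a m j := Subtype.ext ((Sect.map_comp_eq_map (f := JoinSimplex.toOfFiber (m := m.unop) j)
    (g := (joinDiagram.toBase F).app ((Simplices.incl (joinDiagram F) c).obj
      (Functor.elementsMk _ m ((nerveFiberToJoin F c).app m j)))) (f' := 𝟙 c)
    (inr_joinCollapse m.unop c.1.unop)).trans (A.functor.map_id c))
  r := joinToNerveFiber F c
  par := Δ[1]
  par_contractible := inferInstance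
  h m s v := JoinSimplex.push₁ (k := m.unop) s (SSet.stdSimplex.asOrderHom v)
  h_map {m l} α s v := JoinSimplex.restrict_push₁ (k := m.unop) s (SSet.stdSimplex.asOrderHom v) α.unop
  η m s v := ⟨A.functor.map (JoinSimplex.toPush₁ (m := m.unop) s (SSet.stdSimplex.asOrderHom v)),
    hk.isHomLift A (JoinSimplex.toPush₁ (m := m.unop) s (SSet.stdSimplex.asOrderHom v))
      (toggle_last _ _ _) ((A.obj_eq _).symm.trans (((A.middle hk F).fiberFunctor c).obj
        (Functor.elementsMk _ m
          (JoinSimplex.push₁ (k := m.unop) s (SSet.stdSimplex.asOrderHom v)))).2)⟩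
  η_map α s v e e' he he' := by
    refine Subtype.ext (Sect.map_comp_eq ?_)
    refine (congrArg (fun t => _ ≫ SimplexJoin.map (Quiver.Hom.unop t) (𝟙 c.1.unop)) he).trans ?_
    refine Eq.trans ?_ (congrArg (fun t => SimplexJoin.map (Quiver.Hom.unop t) (𝟙 c.1.unop) ≫ _)
      he').symm
    exact (map_toggle (n := c.1.unop) α.unop (SSet.stdSimplex.asOrderHom v)).symm
  start := SSet.stdSimplex.const 1 0 _
  finish := SSet.stdSimplex.const 1 1 _
  h_start m s := JoinSimplex.push₁_zero (k := m.unop) s (fun _ => rfl)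
  h_finish m s := JoinSimplex.push₁_one (k := m.unop) s (fun _ => rfl)
  η_start m s e he := by
    refine Subtype.ext ((Sect.map_comp_eq_map (f' := 𝟙 (JoinSimplex.mid (m := m.unop) s)) ?_).trans
      (A.functor.map_id _))
    refine (congrArg (fun t => SimplexJoin.map (Quiver.Hom.unop t) (𝟙 c.1.unop) ≫ _) he).trans ?_
    refine (congrArg (· ≫ _) (SimplexJoin.map_id m.unop c.1.unop)).trans ?_
    exact (Category.id_comp _).trans (toggle_zero (n := c.1.unop) (fun _ => rfl))
  η_finish m s e he := by
    refine Subtype.ext (Sect.map_comp_eq ?_)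
    refine (congrArg (fun t => SimplexJoin.map (Quiver.Hom.unop t) (𝟙 c.1.unop) ≫ _) he).trans ?_
    refine (congrArg (· ≫ _) (SimplexJoin.map_id m.unop c.1.unop)).trans ?_
    exact (Category.id_comp _).trans (toggle_one (n := c.1.unop) (fun _ => rfl))

end MiddleContraction

/-! ### Functors between categories of sections -/

namespace Sect

variable {B : Type u₂} [Category.{v₂} B] {X : Type u₃} [Category.{v₃} X] {q : X ⥤ B}

/-- Precomposition of sections, as a functor. -/
def precompFunctor {K : Type*} [Category* K] {K' : Type*} [Category* K'] (Φ : K' ⥤ K) {k : K ⥤ B}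
    {k' : K' ⥤ B} (h : Φ ⋙ k = k') : Sect k q ⥤ Sect k' q where
  obj A := A.precomp Φ h
  map φ :=
    { natTrans := Functor.whiskerLeft Φ φ.natTrans
      vertical := fun x => by
        subst h
        exact φ.vertical (Φ.obj x) }

section Reindex

variable {K : Type u₁} [Category.{v₁} K] {k k' : K ⥤ B} [q.IsFibered]

/-- Reindexing of sections, as a functor. -/
noncomputable def reindexFunctor (τ : k' ⟶ k) : Sect k q ⥤ Sect k' q where
  obj A := A.reindex τ
  map φ := reindexMap τ φ
  map_id A := reindex_hom_ext (fun x => (reindexMap_π τ (𝟙 A) x).trans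
    ((Category.comp_id _).trans (Category.id_comp _).symm))
  map_comp φ ψ := reindex_hom_ext (fun x => by
    refine (reindexMap_π τ (φ ≫ ψ) x).trans ?_
    refine Eq.trans ?_ (Category.assoc _ _ _).symm
    refine Eq.trans ?_ (congrArg ((reindexMap τ φ).natTrans.app x ≫ ·)
      (reindexMap_π τ ψ x)).symm
    refine Eq.trans ?_ (Category.assoc _ _ _)
    exact (Category.assoc _ _ _).symm.trans
      (congrArg (· ≫ ψ.natTrans.app x) (reindexMap_π τ φ x)).symm)

end Reindex

variable {K : Type u₁} [Category.{v₁} K] {k : K ⥤ B} {P : K ⥤ SSet.{u}}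
  (T : FibredDeltaStructure q)
  [∀ b, HasColimitsOfSize.{0, 0} (q.Fiber b)] [∀ b, HasColimitsOfSize.{0, u} (q.Fiber b)]
  [∀ b, HasCoproducts.{u} (q.Fiber b)]
  [∀ b n, PreservesColimitsOfSize.{u, u} ((T.fiber b).tensor.obj n)] [q.IsFibered]

/-- Fibrewise homotopy colimits, as a functor. -/
noncomputable def hocolimFunctor : Sect (Simplices.proj P ⋙ k) q ⥤ Sect k q where
  obj A := A.hocolim T
  map φ := hocolimMap T φ
  map_id A := hocolim_hom_ext T (fun x => by
    refine (hocolimι_map T (𝟙 A) x).trans ?_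
    refine (congrArg (· ≫ A.hocolimι T x) ((T.tensor.obj x.dim).map_id _)).trans ?_
    exact (Category.id_comp _).trans (Category.comp_id _).symm)
  map_comp {A A' A''} φ ψ := hocolim_hom_ext T (fun x => by
    refine (hocolimι_map T (φ ≫ ψ) x).trans ?_
    refine Eq.trans ?_ (Category.assoc _ _ _)
    refine Eq.trans ?_ (congrArg (· ≫ (hocolimMap T ψ).natTrans.app x.base)
      (hocolimι_map T φ x)).symm
    refine Eq.trans ?_ (Category.assoc _ _ _).symm
    refine Eq.trans ?_ (congrArg (_ ≫ ·) (hocolimι_map T ψ x)).symm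
    refine Eq.trans ?_ (Category.assoc _ _ _)
    exact congrArg (· ≫ A''.hocolimι T x) ((T.tensor.obj x.dim).map_comp _ _))

theorem hocolimAug_natural {A A₁ : Sect (Simplices.proj P ⋙ k) q} {A' A₁' : Sect k q}
    (a : A ⟶ A'.precomp (Simplices.proj P) rfl) (a₁ : A₁ ⟶ A₁'.precomp (Simplices.proj P) rfl)
    (φ : A ⟶ A₁) (φ' : A' ⟶ A₁')
    (h : ∀ x, φ.natTrans.app x ≫ a₁.natTrans.app x =
      a.natTrans.app x ≫ φ'.natTrans.app x.base) :
    hocolimMap T φ ≫ hocolimAug T a₁ = hocolimAug T a ≫ φ' := by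
  refine hocolim_hom_ext T (fun x => ?_)
  refine (Category.assoc _ _ _).symm.trans ?_
  refine (congrArg (· ≫ (hocolimAug T a₁).natTrans.app x.base) (hocolimι_map T φ x)).trans ?_
  refine (Category.assoc _ _ _).trans ((congrArg (_ ≫ ·) (hocolimι_aug T a₁ x)).trans ?_)
  refine (Category.assoc _ _ _).symm.trans ?_
  refine Eq.trans ?_ (Category.assoc _ _ _)
  refine Eq.trans ?_ (congrArg (· ≫ φ'.natTrans.app x.base) (hocolimι_aug T a x)).symm
  refine Eq.trans ?_ (Category.assoc _ _ _).symm
  refine Eq.trans ?_ (congrArg (_ ≫ ·) (T.collapse_natural x.dim (φ'.natTrans.app x.base)))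
  refine Eq.trans ?_ (Category.assoc _ _ _)
  refine congrArg (· ≫ T.collapse x.dim _) ?_
  refine ((T.tensor.obj x.dim).map_comp _ _).symm.trans (Eq.trans ?_
    ((T.tensor.obj x.dim).map_comp _ _))
  exact congrArg (T.tensor.obj x.dim).map (h x)

end Sect

/-! ### Change of base for fibrewise homotopy colimits -/

section ChangeOfBase

variable {K : Type u₁} [Category.{v₁} K] {K' : Type w} [Category.{v} K'] {P : K ⥤ SSet.{u}}
  {P' : K' ⥤ SSet.{u}} {G : K ⥤ K'} (ρ : P ⟶ G ⋙ P')

/-- The functor between categories of simplices induced by a natural transformation. -/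
def Simplices.mapAlong : Simplices P ⥤ Simplices P' where
  obj x := ⟨G.obj x.base, x.dim, (ρ.app x.base).app _ x.simplex⟩
  map {x y} f := ⟨G.map f.base, f.dim, by
    have h₁ := NatTrans.naturality_apply (ρ.app x.base) f.dim.op x.simplex
    have h₂ := fun s => congrArg (fun t => (t.app (op y.dim)) s) (ρ.naturality f.base)
    refine Eq.trans ?_ (congrArg ((ρ.app y.base).app (op y.dim)) f.w)
    refine Eq.trans ?_ (h₂ _).symm
    exact congrArg ((P'.map (G.map f.base)).app (op y.dim)) h₁.symm⟩
  map_id x := Simplices.hom_ext (G.map_id _) rfl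
  map_comp f g := Simplices.hom_ext (G.map_comp _ _) rfl

variable {B : Type u₂} [Category.{v₂} B] {X : Type u₃} [Category.{v₃} X] {q : X ⥤ B}
  {k : K' ⥤ B} (T : FibredDeltaStructure q)
  [∀ b, HasColimitsOfSize.{0, 0} (q.Fiber b)] [∀ b, HasColimitsOfSize.{0, u} (q.Fiber b)]
  [∀ b, HasCoproducts.{u} (q.Fiber b)]
  [∀ b n, PreservesColimitsOfSize.{u, u} ((T.fiber b).tensor.obj n)] [q.IsFibered]

theorem Sect.exists_hocolimChange {A : Sect (Simplices.proj P ⋙ G ⋙ k) q}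
    {A' : Sect (Simplices.proj P' ⋙ k) q}
    (a : ∀ x, A.functor.obj x ⟶ A'.functor.obj ((Simplices.mapAlong ρ).obj x))
    (ha : ∀ x, q.IsHomLift (𝟙 (k.obj (G.obj x.base))) (a x))
    (ha' : ∀ ⦃x y⦄ (e : x ⟶ y), A.functor.map e ≫ a y =
      a x ≫ A'.functor.map ((Simplices.mapAlong ρ).map e)) :
    ∃ d : A.hocolim T ⟶ (A'.hocolim T).precomp G rfl, ∀ x,
      A.hocolimι T x ≫ d.natTrans.app x.base =
        (T.tensor.obj x.dim).map (a x) ≫ A'.hocolimι T ((Simplices.mapAlong ρ).obj x) :=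
  A.exists_hocolimDesc T ((A'.hocolim T).precomp G rfl)
    (fun x => (T.tensor.obj x.dim).map (a x) ≫ A'.hocolimι T ((Simplices.mapAlong ρ).obj x))
    (fun x => isHomLift_vertical_comp (T.isHomLift_tensor_map _ (ha x))
      (A'.hocolimι_isHomLift T ((Simplices.mapAlong ρ).obj x)))
    (fun x y e => by
      refine (Category.assoc _ _ _).symm.trans ?_
      refine (congrArg (· ≫ _) (((T.tensor.obj y.dim).map_comp _ _).symm.trans
        ((congrArg (T.tensor.obj y.dim).map (ha' e)).trans
          ((T.tensor.obj y.dim).map_comp _ _)))).trans ?_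
      refine (Category.assoc _ _ _).trans ?_
      refine (congrArg (_ ≫ ·) (A'.hocolimι_condition T ((Simplices.mapAlong ρ).map e))).trans ?_
      refine (Category.assoc _ _ _).symm.trans ?_
      refine (congrArg (· ≫ _) ((T.tensor.map e.dim).naturality (a x))).trans ?_
      refine (Category.assoc _ _ _).trans (congrArg (_ ≫ ·) ?_)
      exact (Category.assoc _ _ _).symm)

end ChangeOfBase

section IdentityResolution

/-- The nerve of a category whose hom-sets and whose set of objects have exactly one element is
contractible. -/
theorem contractibleSpace_nerve_of_unique {J : Type u} [SmallCategory.{u} J] [Nonempty J]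
    [Subsingleton J] [∀ i j : J, Subsingleton (i ⟶ j)] :
    ContractibleSpace (SSet.toTop.obj (nerve J)) := by
  let φ : nerve J ⟶ (Δ[0] : SSet.{u}) := { app := fun m => ↾fun _ => SSet.stdSimplex.const 0 0 _ }
  have h : ∀ m, IsIso (φ.app m) := fun m => by
    rw [isIso_iff_bijective]
    refine ⟨fun x y _ => ?_, fun y => ⟨(Functor.const _).obj (Classical.arbitrary J), ?_⟩⟩
    · exact CategoryTheory.Functor.ext (fun _ => Subsingleton.elim _ _)
        (fun _ _ _ => Subsingleton.elim _ _)
    · exact stdSimplex_ext (fun i => Subsingleton.elim (α := Fin 1) _ _)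
  have : IsIso φ := NatIso.isIso_of_isIso_app φ
  exact (TopCat.homeoOfIso (SSet.toTop.mapIso (asIso φ))).contractibleSpace

theorem isResolution_id (D : Type u) [SmallCategory.{u} D] : IsResolution (𝟭 D) where
  isOpfibration :=
    { exists_lift := fun x c' f => ⟨c', f, isCocartesian_id f⟩
      comp := fun {_ _ _} f g {_ _ _} φ ψ hφ hψ => by
        have := hφ.toIsHomLift
        have := hψ.toIsHomLift
        have h : (𝟭 D).IsHomLift (f ≫ g) (φ ≫ ψ) := inferInstance
        exact isCocartesian_of_isHomLift h (isCocartesian_id (φ ≫ ψ)) }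
  contractible c := by
    have : Nonempty ((𝟭 D).Fiber c) := ⟨⟨c, rfl⟩⟩
    have : Subsingleton ((𝟭 D).Fiber c) := ⟨fun x y => Subtype.ext (x.2.trans y.2.symm)⟩
    have : ∀ x y : (𝟭 D).Fiber c, Subsingleton (x ⟶ y) := fun x y => ⟨fun f g => Subtype.ext (by
      have := f.2
      have := g.2
      exact (IsHomLift.fac' (𝟭 D) (𝟙 c) f.1).trans (IsHomLift.fac' (𝟭 D) (𝟙 c) g.1).symm)⟩
    exact contractibleSpace_nerve_of_unique
where
  isCocartesian_id {a b : D} (f : a ⟶ b) : (𝟭 D).IsCocartesian f f :=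
    { toIsHomLift := IsHomLift.map (𝟭 D) f
      universal_property := fun {z} g hg => by
        obtain rfl : b = z := (isHomLift_codomain hg).symm
        have h : f = g := by simpa using IsHomLift.fac (𝟭 D) f g
        refine ⟨𝟙 b, ⟨IsHomLift.id rfl, by simp [h]⟩, fun t ht => ?_⟩
        have h' := ht.1
        simpa using (IsHomLift.fac (𝟭 D) (𝟙 b) t).symm }

end IdentityResolution

/-! ### Resolution and extension of sections -/

section Resolution

variable {C D : Type u} [SmallCategory.{u} C] [SmallCategory.{u} D]
  {B : Type u₂} [Category.{v₂} B] {X : Type u₃} [Category.{v₃} X] {q : X ⥤ B}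
  {k : SimplicialReplacement C ⥤ B} (hk : DependsOnLast k)
  (T : FibredDeltaStructure q)
  [∀ b, HasColimitsOfSize.{0, 0} (q.Fiber b)] [∀ b, HasColimitsOfSize.{0, u} (q.Fiber b)]
  [∀ b, HasCoproducts.{u} (q.Fiber b)]
  [∀ b n, PreservesColimitsOfSize.{u, u} ((T.fiber b).tensor.obj n)] [q.IsFibered]
  (F : D ⥤ C)

namespace Sect

/-- Restriction of sections along a functor. -/
abbrev restrictFunctor (k : SimplicialReplacement C ⥤ B) (q : X ⥤ B) (F : D ⥤ C) :
    Sect k q ⥤ Sect (SimplicialReplacement.map F ⋙ k) q :=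
  precompFunctor (SimplicialReplacement.map F) rfl

/-- The resolution of a section `A`: its value at `c` is the homotopy colimit of the values `A(y)`
over the simplices `(d, y)` over `c`. -/
noncomputable abbrev resolutionFunctor : Sect k q ⥤ Sect k q :=
  precompFunctor (joinDiagram.middle F) hk.middle_comp ⋙ hocolimFunctor T

/-- The comparison of the base objects of `c` and of `F d`, for a simplex `(d, y)` over `c`. -/
def baseComparison : Simplices.proj (joinDiagram F) ⋙ k ⟶
    joinDiagram.source F ⋙ SimplicialReplacement.map F ⋙ k :=
  eqToHom hk.middle_comp.symm ≫ Functor.whiskerRight (joinDiagram.toSource F) k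

/-- The extension of a section `B` along `F`: its value at `c` is the homotopy colimit, over the
simplices `(d, y)` over `c`, of the reindexings of the values `B(d)`. -/
noncomputable abbrev extensionFunctor :
    Sect (SimplicialReplacement.map F ⋙ k) q ⥤ Sect k q :=
  precompFunctor (joinDiagram.source F) rfl ⋙ reindexFunctor (baseComparison hk F) ⋙
    hocolimFunctor T

/-- The augmentation of the resolution. -/
noncomputable def resolutionAug : resolutionFunctor hk T F ⟶ 𝟭 (Sect k q) where
  app A := hocolimAug T (A.middleToBase hk F)
  naturality A A' φ := hocolimAug_natural T (A.middleToBase hk F) (A'.middleToBase hk F)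
    ((precompFunctor (joinDiagram.middle F) hk.middle_comp).map φ) φ
    (fun x => (φ.natTrans.naturality ((joinDiagram.toBase F).app x)).symm)

theorem isHomLift_eqToHom_comp {R R' S : B} {a b : X} {f : R ⟶ S} {φ : a ⟶ b}
    (h : q.IsHomLift f φ) (e : R' = R) : q.IsHomLift (eqToHom e ≫ f) φ := by
  subst e
  simpa using h

theorem isWeaklyCartesianOver_eqToHom_comp {W : MorphismProperty X} {R R' S : B} {a b : X}
    {f : R ⟶ S} {φ : a ⟶ b} (h : IsWeaklyCartesianOver q W f φ) (e : R' = R) :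
    IsWeaklyCartesianOver q W (eqToHom e ≫ f) φ := by
  subst e
  simpa using h

theorem baseComparison_app (x : Simplices (joinDiagram F)) : (baseComparison hk F).app x =
    eqToHom (congrArg (fun G => G.obj x) hk.middle_comp.symm) ≫
      k.map ((joinDiagram.toSource F).app x) :=
  congrArg (· ≫ k.map ((joinDiagram.toSource F).app x)) (eqToHom_app _ _)

theorem isHomLift_toSource (A : Sect k q) (x : Simplices (joinDiagram F)) :
    q.IsHomLift ((baseComparison hk F).app x) (A.functor.map ((joinDiagram.toSource F).app x)) := by
  rw [baseComparison_app]
  exact isHomLift_eqToHom_comp (A.isHomLift ((joinDiagram.toSource F).app x)) _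

/-- The values of a section on the maps `y ⟶ F d`, from the values on `y` to the reindexings of the
values on `F d`. -/
noncomputable def middleToSource (A : Sect k q) :
    A.middle hk F ⟶ (((restrictFunctor k q F).obj A).precomp (joinDiagram.source F) rfl).reindex
      (baseComparison hk F) :=
  reindexLift (A := ((restrictFunctor k q F).obj A).precomp (joinDiagram.source F) rfl)
    (Z := A.middle hk F) (baseComparison hk F)
    (fun x => A.functor.map ((joinDiagram.toSource F).app x))
    (fun x => isHomLift_toSource hk F A x)
    (fun _ _ f => (A.functor.map_comp _ _).symm.trans
      ((congrArg A.functor.map ((joinDiagram.toSource F).naturality f)).trans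
        (A.functor.map_comp _ _)))

theorem middleToSource_π (A : Sect k q) (x : Simplices (joinDiagram F)) :
    (A.middleToSource hk F).natTrans.app x ≫
      (((restrictFunctor k q F).obj A).precomp (joinDiagram.source F) rfl).reindexπ
        (baseComparison hk F) x = A.functor.map ((joinDiagram.toSource F).app x) :=
  reindexLift_π (A := ((restrictFunctor k q F).obj A).precomp (joinDiagram.source F) rfl)
    (Z := A.middle hk F) _ _ _ _ x

/-- The comparison of the resolution of a section with the extension of its restriction. -/
noncomputable def resolutionToExtension :
    resolutionFunctor hk T F ⟶ restrictFunctor k q F ⋙ extensionFunctor hk T F where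
  app A := (hocolimFunctor T).map (A.middleToSource hk F)
  naturality A A' φ := by
    refine ((hocolimFunctor T).map_comp _ _).symm.trans (Eq.trans (congrArg _ ?_)
      ((hocolimFunctor T).map_comp _ _))
    refine reindex_hom_ext (fun x => ?_)
    refine (Category.assoc _ _ _).trans ((congrArg (φ.natTrans.app _ ≫ ·)
      (A'.middleToSource_π hk F x)).trans ?_)
    refine Eq.trans ?_ (Category.assoc _ _ _).symm
    refine Eq.trans ?_ (congrArg ((A.middleToSource hk F).natTrans.app x ≫ ·)
      (reindexMap_π (baseComparison hk F) ((precompFunctor (joinDiagram.source F) rfl).map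
        ((restrictFunctor k q F).map φ)) x)).symm
    refine Eq.trans ?_ (Category.assoc _ _ _)
    refine Eq.trans ?_ (congrArg (· ≫ φ.natTrans.app _) (A.middleToSource_π hk F x)).symm
    exact (φ.natTrans.naturality ((joinDiagram.toSource F).app x)).symm

variable {W : MorphismProperty X} (hT : IsHomotopicalFibration.{u} T W)

include hT

/-- Only here is it used that `F` is a resolution; the section need not be derived. -/
theorem weq_resolutionAug (hF : IsResolution F) (A : Sect k q) :
    Sect.weq k q W ((resolutionAug hk T F).app A) := fun c =>
  have := hF.isOpfibration
  weq_hocolimAug T hT.fiber (A.middleToBase hk F) c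
    (A.middleContraction hk (hF.contractible (c.arrows.obj 0)))

/-- For a derived section the comparison is a weak equivalence, since the maps `y ⟶ F d` are
anchor maps. -/
theorem weq_resolutionToExtension (A : Sect k q)
    (hA : ∀ ⦃x y : SimplicialReplacement C⦄ (f : x ⟶ y), IsAnchor f →
      IsWeaklyCartesianOver q W (k.map f) (A.functor.map f)) :
    Sect.weq k q W ((resolutionToExtension hk T F).app A) := by
  refine weq_hocolimMap T hT.fiber _ ?_
  refine hT.weq_reindexLift (baseComparison hk F) _ _ _ (fun x => ?_)
  rw [baseComparison_app]
  exact isWeaklyCartesianOver_eqToHom_comp (hA _ (joinDiagram.isAnchor_toSource F x)) _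

theorem weq_extensionFunctor {A A' : Sect (SimplicialReplacement.map F ⋙ k) q} (φ : A ⟶ A')
    (hφ : Sect.weq _ q W φ) : Sect.weq k q W ((extensionFunctor hk T F).map φ) :=
  weq_hocolimMap T hT.fiber _ (hT.weq_reindexMap (baseComparison hk F) _ (fun _ => hφ _))

end Sect

/-! ### The comparison with the resolution along an identity functor -/

/-- The image under `F` of a simplex over a sequence of `D`. -/
def joinDiagramMap : joinDiagram (𝟭 D) ⟶ SimplicialReplacement.map F ⋙ joinDiagram F where
  app c :=
    { app := fun m => ↾fun s : JoinSimplex (𝟭 D) c m.unop =>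
        (show JoinSimplex F ((SimplicialReplacement.map F).obj c) m.unop from
        { d := s.d
          y := s.long ⋙ F
          inl_y := congrArg (fun G : ComposableArrows D m.unop.len => G ⋙ F) s.inl_y
          inr_y := congrArg (fun G : ComposableArrows D c.1.unop.len => G ⋙ F) s.inr_y })
      naturality := fun _ _ _ => rfl }
  naturality _ _ _ := rfl

namespace Sect

theorem exists_resolutionChange (A : Sect k q) :
    ∃ d : (resolutionFunctor (hk.comp_map F) T (𝟭 D)).obj ((restrictFunctor k q F).obj A) ⟶
      (restrictFunctor k q F).obj ((resolutionFunctor hk T F).obj A),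
      ∀ x, hocolimι T (((restrictFunctor k q F).obj A).middle (hk.comp_map F) (𝟭 D)) x ≫
        d.natTrans.app x.base = (T.tensor.obj x.dim).map (𝟙 _) ≫
          hocolimι T (A.middle hk F) ((Simplices.mapAlong (joinDiagramMap F)).obj x) :=
  exists_hocolimChange (joinDiagramMap F) T
    (A := ((restrictFunctor k q F).obj A).middle (hk.comp_map F) (𝟭 D)) (A' := A.middle hk F)
    (fun _ => 𝟙 _)
    (fun x => IsHomLift.id ((((restrictFunctor k q F).obj A).middle (hk.comp_map F)
      (𝟭 D)).obj_eq x))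
    (fun _ _ _ => (Category.comp_id _).trans (Category.id_comp _).symm)

/-- The resolution along the identity of the restriction of a section maps to the restriction of
its resolution. -/
noncomputable def resolutionChange (A : Sect k q) :
    (resolutionFunctor (hk.comp_map F) T (𝟭 D)).obj ((restrictFunctor k q F).obj A) ⟶
      (restrictFunctor k q F).obj ((resolutionFunctor hk T F).obj A) :=
  (exists_resolutionChange hk T F A).choose

theorem hocolimι_resolutionChange (A : Sect k q) (x : Simplices (joinDiagram (𝟭 D))) :
    hocolimι T (((restrictFunctor k q F).obj A).middle (hk.comp_map F) (𝟭 D)) x ≫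
      (resolutionChange hk T F A).natTrans.app x.base =
        hocolimι T (A.middle hk F) ((Simplices.mapAlong (joinDiagramMap F)).obj x) :=
  ((exists_resolutionChange hk T F A).choose_spec x).trans
    ((congrArg (· ≫ _) ((T.tensor.obj x.dim).map_id _)).trans (Category.id_comp _))

theorem resolutionChange_aug (A : Sect k q) :
    resolutionChange hk T F A ≫ (restrictFunctor k q F).map ((resolutionAug hk T F).app A) =
      (resolutionAug (hk.comp_map F) T (𝟭 D)).app ((restrictFunctor k q F).obj A) := by
  refine hocolim_hom_ext T (fun x => ?_)
  refine (Category.assoc _ _ _).symm.trans ?_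
  refine (congrArg (· ≫ _) (hocolimι_resolutionChange hk T F A x)).trans ?_
  refine (hocolimι_aug T (A.middleToBase hk F)
    ((Simplices.mapAlong (joinDiagramMap F)).obj x)).trans ?_
  exact (hocolimι_aug T (((restrictFunctor k q F).obj A).middleToBase (hk.comp_map F) (𝟭 D))
    x).symm

theorem exists_middleToReindex (A : Sect (SimplicialReplacement.map F ⋙ k) q)
    (x : Simplices (joinDiagram (𝟭 D))) :
    ∃ d : (A.middle (hk.comp_map F) (𝟭 D)).functor.obj x ⟶
      ((A.precomp (joinDiagram.source F) rfl).reindex (baseComparison hk F)).functor.obj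
        ((Simplices.mapAlong (joinDiagramMap F)).obj x),
      q.IsHomLift (𝟙 (k.obj ((SimplicialReplacement.map F).obj x.base))) d ∧
      d ≫ (A.precomp (joinDiagram.source F) rfl).reindexπ (baseComparison hk F) _ =
        A.functor.map ((joinDiagram.toSource (𝟭 D)).app x) := by
  let g : (A.middle (hk.comp_map F) (𝟭 D)).functor.obj x ⟶
      (A.precomp (joinDiagram.source F) rfl).functor.obj
        ((Simplices.mapAlong (joinDiagramMap F)).obj x) :=
    A.functor.map ((joinDiagram.toSource (𝟭 D)).app x)
  have h : q.IsHomLift ((baseComparison hk F).app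
      ((Simplices.mapAlong (joinDiagramMap F)).obj x)) g := by
    rw [baseComparison_app]
    exact isHomLift_eqToHom_comp (A.isHomLift ((joinDiagram.toSource (𝟭 D)).app x)) _
  exact (Functor.IsCartesian.universal_property (p := q)
    (f := (baseComparison hk F).app ((Simplices.mapAlong (joinDiagramMap F)).obj x))
    (φ := (A.precomp (joinDiagram.source F) rfl).reindexπ (baseComparison hk F)
      ((Simplices.mapAlong (joinDiagramMap F)).obj x)) g).exists

/-- The map from `A(y)` to the reindexing of `A(d)`, for a simplex `(d, y)` over a sequence of
`D`. -/
noncomputable def middleToReindex (A : Sect (SimplicialReplacement.map F ⋙ k) q)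
    (x : Simplices (joinDiagram (𝟭 D))) :
    (A.middle (hk.comp_map F) (𝟭 D)).functor.obj x ⟶
      ((A.precomp (joinDiagram.source F) rfl).reindex (baseComparison hk F)).functor.obj
        ((Simplices.mapAlong (joinDiagramMap F)).obj x) :=
  (exists_middleToReindex hk F A x).choose

theorem middleToReindex_isHomLift (A : Sect (SimplicialReplacement.map F ⋙ k) q)
    (x : Simplices (joinDiagram (𝟭 D))) :
    q.IsHomLift (𝟙 (k.obj ((SimplicialReplacement.map F).obj x.base)))
      (middleToReindex hk F A x) :=
  (exists_middleToReindex hk F A x).choose_spec.1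

theorem middleToReindex_π (A : Sect (SimplicialReplacement.map F ⋙ k) q)
    (x : Simplices (joinDiagram (𝟭 D))) :
    middleToReindex hk F A x ≫
      (A.precomp (joinDiagram.source F) rfl).reindexπ (baseComparison hk F) _ =
        A.functor.map ((joinDiagram.toSource (𝟭 D)).app x) :=
  (exists_middleToReindex hk F A x).choose_spec.2

theorem exists_resolutionToRestrict (A : Sect (SimplicialReplacement.map F ⋙ k) q) :
    ∃ d : (resolutionFunctor (hk.comp_map F) T (𝟭 D)).obj A ⟶
      (restrictFunctor k q F).obj ((extensionFunctor hk T F).obj A),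
      ∀ x, hocolimι T (A.middle (hk.comp_map F) (𝟭 D)) x ≫ d.natTrans.app x.base =
        (T.tensor.obj x.dim).map (middleToReindex hk F A x) ≫
          hocolimι T ((A.precomp (joinDiagram.source F) rfl).reindex (baseComparison hk F))
            ((Simplices.mapAlong (joinDiagramMap F)).obj x) :=
  exists_hocolimChange (joinDiagramMap F) T (A := A.middle (hk.comp_map F) (𝟭 D))
    (A' := (A.precomp (joinDiagram.source F) rfl).reindex (baseComparison hk F))
    (fun x => middleToReindex hk F A x) (fun x => middleToReindex_isHomLift hk F A x)
    (fun x y e => by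
      have h₁ := middleToReindex_isHomLift hk F A x
      have h₂ := middleToReindex_isHomLift hk F A y
      refine reindexπ_ext (baseComparison hk F) _
        (isHomLift_comp_vertical ((A.middle (hk.comp_map F) (𝟭 D)).isHomLift e) h₂)
        (isHomLift_vertical_comp h₁ (((A.precomp (joinDiagram.source F) rfl).reindex
          (baseComparison hk F)).isHomLift ((Simplices.mapAlong (joinDiagramMap F)).map e))) ?_
      refine (Category.assoc _ _ _).trans ((congrArg (_ ≫ ·)
        (middleToReindex_π hk F A y)).trans ?_)
      refine Eq.trans ?_ (Category.assoc _ _ _).symm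
      refine Eq.trans ?_ (congrArg (middleToReindex hk F A x ≫ ·)
        (reindexπ_naturality (baseComparison hk F) (A.precomp (joinDiagram.source F) rfl)
          ((Simplices.mapAlong (joinDiagramMap F)).map e))).symm
      refine Eq.trans ?_ (Category.assoc _ _ _)
      refine Eq.trans ?_ (congrArg (· ≫ _) (middleToReindex_π hk F A x)).symm
      exact (A.functor.map_comp _ _).symm.trans
        ((congrArg A.functor.map ((joinDiagram.toSource (𝟭 D)).naturality e)).trans
          (A.functor.map_comp _ _)))

/-- The resolution along the identity of a section maps to the restriction of its extension. -/
noncomputable def resolutionToRestrictApp (A : Sect (SimplicialReplacement.map F ⋙ k) q) :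
    (resolutionFunctor (hk.comp_map F) T (𝟭 D)).obj A ⟶
      (restrictFunctor k q F).obj ((extensionFunctor hk T F).obj A) :=
  (exists_resolutionToRestrict hk T F A).choose

theorem hocolimι_resolutionToRestrictApp (A : Sect (SimplicialReplacement.map F ⋙ k) q)
    (x : Simplices (joinDiagram (𝟭 D))) :
    hocolimι T (A.middle (hk.comp_map F) (𝟭 D)) x ≫
      (resolutionToRestrictApp hk T F A).natTrans.app x.base =
        (T.tensor.obj x.dim).map (middleToReindex hk F A x) ≫
          hocolimι T ((A.precomp (joinDiagram.source F) rfl).reindex (baseComparison hk F))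
            ((Simplices.mapAlong (joinDiagramMap F)).obj x) :=
  (exists_resolutionToRestrict hk T F A).choose_spec x

/-- The comparison of the resolution along the identity of a section with the restriction of its
extension, as a natural transformation. -/
noncomputable def resolutionToRestrict : resolutionFunctor (hk.comp_map F) T (𝟭 D) ⟶
    extensionFunctor hk T F ⋙ restrictFunctor k q F where
  app A := resolutionToRestrictApp hk T F A
  naturality A A' φ := by
    refine hocolim_hom_ext T (fun x => ?_)
    let y := (Simplices.mapAlong (joinDiagramMap F)).obj x
    let φ' := reindexMap (baseComparison hk F)
      ((precompFunctor (joinDiagram.source F) rfl).map φ)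
    let ψ := (precompFunctor (joinDiagram.middle (𝟭 D)) (hk.comp_map F).middle_comp).map φ
    refine (Category.assoc _ _ _).symm.trans ?_
    refine (congrArg (· ≫ _) (hocolimι_map T ψ x)).trans ?_
    refine (Category.assoc _ _ _).trans ((congrArg (_ ≫ ·)
      (hocolimι_resolutionToRestrictApp hk T F A' x)).trans ?_)
    refine Eq.trans ?_ (Category.assoc _ _ _)
    refine Eq.trans ?_ (congrArg (· ≫ _) (hocolimι_resolutionToRestrictApp hk T F A x)).symm
    refine Eq.trans ?_ (Category.assoc _ _ _).symm
    refine Eq.trans ?_ (congrArg (_ ≫ ·) (hocolimι_map T φ' y)).symm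
    refine (Category.assoc _ _ _).symm.trans (Eq.trans ?_ (Category.assoc _ _ _))
    refine congrArg (· ≫ _) ?_
    refine ((T.tensor.obj x.dim).map_comp _ _).symm.trans (Eq.trans ?_
      ((T.tensor.obj x.dim).map_comp _ _))
    refine congrArg (T.tensor.obj x.dim).map ?_
    refine reindexπ_ext (baseComparison hk F) (𝟙 _)
      (isHomLift_comp_vertical (ψ.vertical x) (middleToReindex_isHomLift hk F A' x))
      (isHomLift_comp_vertical (middleToReindex_isHomLift hk F A x) (φ'.vertical y)) ?_
    refine (Category.assoc _ _ _).trans ((congrArg (_ ≫ ·)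
      (middleToReindex_π hk F A' x)).trans ?_)
    refine Eq.trans ?_ (Category.assoc _ _ _).symm
    refine Eq.trans ?_ (congrArg (middleToReindex hk F A x ≫ ·)
      (reindexMap_π (baseComparison hk F) ((precompFunctor (joinDiagram.source F) rfl).map φ)
        y)).symm
    refine Eq.trans ?_ (Category.assoc _ _ _)
    refine Eq.trans ?_ (congrArg (· ≫ _) (middleToReindex_π hk F A x)).symm
    exact (φ.natTrans.naturality ((joinDiagram.toSource (𝟭 D)).app x)).symm

theorem resolutionChange_extension (A : Sect k q) :
    resolutionChange hk T F A ≫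
      (restrictFunctor k q F).map ((resolutionToExtension hk T F).app A) =
        (resolutionToRestrict hk T F).app ((restrictFunctor k q F).obj A) := by
  refine hocolim_hom_ext T (fun x => ?_)
  let y := (Simplices.mapAlong (joinDiagramMap F)).obj x
  refine (Category.assoc _ _ _).symm.trans ?_
  refine (congrArg (· ≫ _) (hocolimι_resolutionChange hk T F A x)).trans ?_
  refine (hocolimι_map T (A.middleToSource hk F) y).trans ?_
  refine Eq.trans ?_ (hocolimι_resolutionToRestrictApp hk T F
    ((restrictFunctor k q F).obj A) x).symm
  refine congrArg (fun t => (T.tensor.obj x.dim).map t ≫ _) ?_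
  refine reindexπ_ext (baseComparison hk F) (𝟙 _) ((A.middleToSource hk F).vertical y)
    (middleToReindex_isHomLift hk F _ x) ?_
  exact (A.middleToSource_π hk F y).trans
    (middleToReindex_π hk F ((restrictFunctor k q F).obj A) x).symm

end Sect

end Resolution

/-! ### Full faithfulness on localisations -/

section HomotopyExtension

variable {M : Type u₁} [Category.{v₁} M] {N : Type u₂} [Category.{v₂} N]

/-- A homotopical extension functor `E` for a functor `R : M ⥤ N`, relative to a class `P` of
objects of `M`: there are resolutions `S X ⟶ X` in `M` and `S' Y ⟶ Y` in `N`, a natural weak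
equivalence `S X ⟶ E (R X)` for `X` in `P`, and a natural map `S' Y ⟶ R (E Y)` which agrees with
it on objects `Y = R X`. -/
structure HomotopyExtension (R : M ⥤ N) (W : MorphismProperty M) (V : MorphismProperty N)
    (P : ObjectProperty M) where
  E : N ⥤ M
  S : M ⥤ M
  S' : N ⥤ N
  σ : S ⟶ 𝟭 M
  τ : S ⟶ R ⋙ E
  σ' : S' ⟶ 𝟭 N
  ν : S' ⟶ E ⋙ R
  change (X : M) : S'.obj (R.obj X) ⟶ R.obj (S.obj X)
  change_σ (X : M) : change X ≫ R.map (σ.app X) = σ'.app (R.obj X)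
  change_τ (X : M) : change X ≫ R.map (τ.app X) = ν.app (R.obj X)
  weq_σ (X : M) : W (σ.app X)
  weq_σ' (Y : N) : V (σ'.app Y)
  weq_τ (X : M) : P X → W (τ.app X)
  weq_E {Y Y' : N} (f : Y ⟶ Y') : V f → W (E.map f)

namespace HomotopyExtension

variable {R : M ⥤ N} {W : MorphismProperty M} {V : MorphismProperty N} {P : ObjectProperty M}
  {P' : ObjectProperty N} (h : HomotopyExtension R W V P)
  (hP : ∀ {X Y : M} (f : X ⟶ Y), W f → (P X ↔ P Y))
  (hP' : ∀ {X Y : N} (f : X ⟶ Y), V f → (P' X ↔ P' Y))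
  [W.IsMultiplicative] [W.HasTwoOutOfThreeProperty] [V.IsMultiplicative]
  [V.HasTwoOutOfThreeProperty]
  (hM : HomotopyPushouts W) (hN : HomotopyPushouts V)
  (hR : ∀ X : P.FullSubcategory, P' (R.obj X.obj))
  (hW : ∀ {X Y : M} (f : X ⟶ Y), W f → V (R.map f))

/-- The restriction of a functor which preserves weak equivalences to full subcategories. -/
def restrictLocalizer : LocalizerMorphism (W.inverseImage P.ι) (V.inverseImage P'.ι) where
  functor := P'.lift (P.ι ⋙ R) hR
  map _ _ _ hf := hW _ hf

include h hP hM in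
/-- The functor induced by `E`, restricted along the one induced by `R`, is isomorphic via `σ` and
`τ` to the inclusion of the localisation of `P` in that of `M`, which is faithful. -/
theorem faithful : ((restrictLocalizer hR hW).localizedFunctor (W.inverseImage P.ι).Q
    (V.inverseImage P'.ι).Q).Faithful where
  map_injective {X Y} a b hab := by
    let Φ := restrictLocalizer hR hW
    obtain ⟨X, rfl⟩ := (Localization.Construction.objEquiv _).surjective X
    obtain ⟨Y, rfl⟩ := (Localization.Construction.objEquiv _).surjective Y
    let G := (restrictLocalizer hR hW).localizedFunctor (W.inverseImage P.ι).Q (V.inverseImage P'.ι).Q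
    have hE : (V.inverseImage P'.ι).IsInvertedBy (P'.ι ⋙ h.E ⋙ W.Q) := fun _ _ f hf =>
      Localization.inverts W.Q W _ (h.weq_E _ hf)
    let E' : (V.inverseImage P'.ι).Localization ⥤ W.Localization :=
      Localization.lift (P'.ι ⋙ h.E ⋙ W.Q) hE (V.inverseImage P'.ι).Q
    let ε : (V.inverseImage P'.ι).Q ⋙ E' ≅ P'.ι ⋙ h.E ⋙ W.Q := Localization.fac _ _ _
    have h₁ : ∀ X : P.FullSubcategory, IsIso (W.Q.map (h.σ.app X.obj)) := fun X =>
      Localization.inverts W.Q W _ (h.weq_σ X.obj)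
    have h₂ : ∀ X : P.FullSubcategory, IsIso (W.Q.map (h.τ.app X.obj)) := fun X =>
      Localization.inverts W.Q W _ (h.weq_τ X.obj X.property)
    let σ : P.ι ⋙ h.S ⋙ W.Q ⟶ P.ι ⋙ W.Q :=
      { app := fun X => W.Q.map (h.σ.app X.obj)
        naturality := fun X Y f => (W.Q.map_comp _ _).symm.trans
          ((congrArg W.Q.map (h.σ.naturality f.hom)).trans (W.Q.map_comp _ _)) }
    let τ : P.ι ⋙ h.S ⋙ W.Q ⟶ (P.ι ⋙ R) ⋙ h.E ⋙ W.Q :=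
      { app := fun X => W.Q.map (h.τ.app X.obj)
        naturality := fun X Y f => (W.Q.map_comp _ _).symm.trans
          ((congrArg W.Q.map (h.τ.naturality f.hom)).trans (W.Q.map_comp _ _)) }
    have : IsIso σ := NatIso.isIso_of_isIso_app σ
    have : IsIso τ := NatIso.isIso_of_isIso_app τ
    let ε₁ : (W.inverseImage P.ι).Q ⋙ G ≅ Φ.functor ⋙ (V.inverseImage P'.ι).Q :=
      (CatCommSq.iso Φ.functor (W.inverseImage P.ι).Q (V.inverseImage P'.ι).Q G).symm
    let κ : (W.inverseImage P.ι).Q ⋙ (G ⋙ E') ≅ P.ι ⋙ W.Q :=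
      (Functor.associator _ _ _).symm ≪≫ Functor.isoWhiskerRight ε₁ E' ≪≫
        Functor.associator _ _ _ ≪≫ Functor.isoWhiskerLeft Φ.functor ε ≪≫
        (asIso τ).symm ≪≫ asIso σ
    exact hM.map_eq_of_fullSubcategory hP a b (G ⋙ E') κ (congrArg E'.map hab)

include h hP hP' hN in
/-- An arrow `R X ⟶ R Y` of the localisation is a left fraction `R X ⟶ Z ⟵ R Y` with legs `f` and
`s`. It is the image of the composite of the zigzag
`X ⟵ S X ⟶ E (R X) ⟶ E Z ⟵ E (R Y) ⟵ S Y ⟶ Y`, whose middle arrows are `E f` and `E s`. -/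
theorem full : ((restrictLocalizer hR hW).localizedFunctor (W.inverseImage P.ι).Q
    (V.inverseImage P'.ι).Q).Full where
  map_surjective {X Y} φ := by
    obtain ⟨X, rfl⟩ := (Localization.Construction.objEquiv _).surjective X
    obtain ⟨Y, rfl⟩ := (Localization.Construction.objEquiv _).surjective Y
    let Φ := restrictLocalizer hR hW
    let L := (W.inverseImage P.ι).Q
    let L' := (V.inverseImage P'.ι).Q
    let G := Φ.localizedFunctor L L'
    let ε : L ⋙ G ≅ Φ.functor ⋙ L' := (CatCommSq.iso Φ.functor L L' G).symm
    let φ₁ : L'.obj (Φ.functor.obj X) ⟶ L'.obj (Φ.functor.obj Y) :=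
      ε.inv.app X ≫ φ ≫ ε.hom.app Y
    obtain ⟨Z, f, s, hs, hφ⟩ := (hN.fullSubcategory hP').exists_fraction φ₁
    let Sₓ : P.FullSubcategory := ⟨h.S.obj X.obj, (hP _ (h.weq_σ X.obj)).2 X.property⟩
    let Sy : P.FullSubcategory := ⟨h.S.obj Y.obj, (hP _ (h.weq_σ Y.obj)).2 Y.property⟩
    let Eₓ : P.FullSubcategory :=
      ⟨h.E.obj (R.obj X.obj), (hP _ (h.weq_τ X.obj X.property)).1 Sₓ.property⟩
    let Ey : P.FullSubcategory :=
      ⟨h.E.obj (R.obj Y.obj), (hP _ (h.weq_τ Y.obj Y.property)).1 Sy.property⟩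
    let Ez : P.FullSubcategory := ⟨h.E.obj Z.obj, (hP _ (h.weq_E s.hom hs)).1 Ey.property⟩
    let σₓ : Sₓ ⟶ X := ObjectProperty.homMk (h.σ.app X.obj)
    let σy : Sy ⟶ Y := ObjectProperty.homMk (h.σ.app Y.obj)
    let τₓ : Sₓ ⟶ Eₓ := ObjectProperty.homMk (h.τ.app X.obj)
    let τy : Sy ⟶ Ey := ObjectProperty.homMk (h.τ.app Y.obj)
    let Ef : Eₓ ⟶ Ez := ObjectProperty.homMk (h.E.map f.hom)
    let Es : Ey ⟶ Ez := ObjectProperty.homMk (h.E.map s.hom)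
    let Sx' : P'.FullSubcategory :=
      ⟨h.S'.obj (R.obj X.obj), (hP' _ (h.weq_σ' (R.obj X.obj))).2 (hR X)⟩
    let Sy' : P'.FullSubcategory :=
      ⟨h.S'.obj (R.obj Y.obj), (hP' _ (h.weq_σ' (R.obj Y.obj))).2 (hR Y)⟩
    let Sz' : P'.FullSubcategory := ⟨h.S'.obj Z.obj, (hP' _ (h.weq_σ' Z.obj)).2 Z.property⟩
    let σx' : Sx' ⟶ Φ.functor.obj X := ObjectProperty.homMk (h.σ'.app (R.obj X.obj))
    let σy' : Sy' ⟶ Φ.functor.obj Y := ObjectProperty.homMk (h.σ'.app (R.obj Y.obj))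
    let σz' : Sz' ⟶ Z := ObjectProperty.homMk (h.σ'.app Z.obj)
    let lx : Sx' ⟶ Φ.functor.obj Sₓ := ObjectProperty.homMk (h.change X.obj)
    let ly : Sy' ⟶ Φ.functor.obj Sy := ObjectProperty.homMk (h.change Y.obj)
    let νx : Sx' ⟶ Φ.functor.obj Eₓ := ObjectProperty.homMk (h.ν.app (R.obj X.obj))
    let νy : Sy' ⟶ Φ.functor.obj Ey := ObjectProperty.homMk (h.ν.app (R.obj Y.obj))
    let νz : Sz' ⟶ Φ.functor.obj Ez := ObjectProperty.homMk (h.ν.app Z.obj)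
    let Sf : Sx' ⟶ Sz' := ObjectProperty.homMk (h.S'.map f.hom)
    let Ss : Sy' ⟶ Sz' := ObjectProperty.homMk (h.S'.map s.hom)
    have e₁ : lx ≫ Φ.functor.map σₓ = σx' := by ext; exact h.change_σ X.obj
    have e₂ : ly ≫ Φ.functor.map σy = σy' := by ext; exact h.change_σ Y.obj
    have e₃ : lx ≫ Φ.functor.map τₓ = νx := by ext; exact h.change_τ X.obj
    have e₄ : ly ≫ Φ.functor.map τy = νy := by ext; exact h.change_τ Y.obj
    have e₅ : νx ≫ Φ.functor.map Ef = Sf ≫ νz := by ext; exact (h.ν.naturality f.hom).symm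
    have e₆ : νy ≫ Φ.functor.map Es = Ss ≫ νz := by ext; exact (h.ν.naturality s.hom).symm
    have e₇ : Sf ≫ σz' = σx' ≫ f := by ext; exact h.σ'.naturality f.hom
    have e₈ : Ss ≫ σz' = σy' ≫ s := by ext; exact h.σ'.naturality s.hom
    have i₁ : IsIso (L.map σₓ) := Localization.inverts L (W.inverseImage P.ι) _ (h.weq_σ X.obj)
    have i₂ : IsIso (L.map (τy ≫ Es)) := Localization.inverts L (W.inverseImage P.ι) _
      (W.comp_mem _ _ (h.weq_τ Y.obj Y.property) (h.weq_E s.hom hs))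
    have i₃ : IsIso (L'.map σx') :=
      Localization.inverts L' (V.inverseImage P'.ι) _ (h.weq_σ' (R.obj X.obj))
    have i₄ : IsIso (L'.map s) := Localization.inverts L' (V.inverseImage P'.ι) _ hs
    have i₅ : IsIso (L'.map Ss) := by
      have : IsIso (L'.map σz') :=
        Localization.inverts L' (V.inverseImage P'.ι) _ (h.weq_σ' Z.obj)
      have : IsIso (L'.map σy') :=
        Localization.inverts L' (V.inverseImage P'.ι) _ (h.weq_σ' (R.obj Y.obj))
      have : IsIso (L'.map Ss ≫ L'.map σz') := by
        rw [← L'.map_comp, e₈, L'.map_comp]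
        infer_instance
      exact IsIso.of_isIso_comp_right _ (L'.map σz')
    -- `θ` is the right half of the zigzag and `ψ` the whole of it.
    let θ : L.obj Ez ⟶ L.obj Y := inv (L.map (τy ≫ Es)) ≫ L.map σy
    have hθ : L.map (τy ≫ Es) ≫ θ = L.map σy := IsIso.hom_inv_id_assoc _ _
    let ψ : L.obj X ⟶ L.obj Y := inv (L.map σₓ) ≫ L.map (τₓ ≫ Ef) ≫ θ
    have hψ : L.map σₓ ≫ ψ = L.map (τₓ ≫ Ef) ≫ θ := IsIso.hom_inv_id_assoc _ _
    let θ' : L'.obj (Φ.functor.obj Ez) ⟶ L'.obj (Φ.functor.obj Y) :=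
      ε.inv.app Ez ≫ G.map θ ≫ ε.hom.app Y
    let ψ' : L'.obj (Φ.functor.obj X) ⟶ L'.obj (Φ.functor.obj Y) :=
      ε.inv.app X ≫ G.map ψ ≫ ε.hom.app Y
    -- Conjugation by `ε` turns the defining equations of `θ` and `ψ` into equations in the target.
    have conj : ∀ {A B : P.FullSubcategory} (m : A ⟶ B) (t : L.obj B ⟶ L.obj Y),
        L'.map (Φ.functor.map m) ≫ ε.inv.app B ≫ G.map t ≫ ε.hom.app Y =
          ε.inv.app A ≫ G.map (L.map m ≫ t) ≫ ε.hom.app Y := by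
      intro A B m t
      have n : L'.map (Φ.functor.map m) ≫ ε.inv.app B = ε.inv.app A ≫ G.map (L.map m) :=
        ε.inv.naturality m
      rw [reassoc_of% n, G.map_comp, Category.assoc]
    have hθ' : L'.map (Φ.functor.map (τy ≫ Es)) ≫ θ' = L'.map (Φ.functor.map σy) := by
      have n : L'.map (Φ.functor.map σy) ≫ ε.inv.app Y = ε.inv.app Sy ≫ G.map (L.map σy) :=
        ε.inv.naturality σy
      rw [conj, hθ, ← reassoc_of% n, ε.inv_hom_id_app]
      exact Category.comp_id _
    have hψ' : L'.map (Φ.functor.map σₓ) ≫ ψ' = L'.map (Φ.functor.map (τₓ ≫ Ef)) ≫ θ' := by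
      rw [conj, conj, hψ]
    -- `S' Z ⟶ R (E Z)` need not be a weak equivalence, but `θ` inverts it up to `s`; this can be
    -- tested after precomposition with the isomorphism `S' s`.
    have claim : L'.map νz ≫ θ' ≫ L'.map s = L'.map σz' := by
      rw [← cancel_epi (L'.map Ss), ← L'.map_comp_assoc, ← e₆, ← e₄, Category.assoc,
        ← Φ.functor.map_comp, L'.map_comp, Category.assoc, reassoc_of% hθ', ← L'.map_comp,
        ← L'.map_comp, ← L'.map_comp, reassoc_of% e₂, e₈]
    have hψφ : ψ' = φ₁ := by
      rw [← cancel_mono (L'.map s), hφ, ← cancel_epi (L'.map σx'), ← L'.map_comp, ← e₇,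
        L'.map_comp, ← claim, ← e₁, L'.map_comp, Category.assoc, reassoc_of% hψ',
        Φ.functor.map_comp, L'.map_comp, Category.assoc, ← L'.map_comp_assoc, e₃,
        ← L'.map_comp_assoc, e₅, L'.map_comp, Category.assoc]
    refine ⟨ψ, ?_⟩
    have : G.map ψ = ε.hom.app X ≫ ψ' ≫ ε.inv.app Y := by simp [ψ']
    change G.map ψ = φ
    rw [this, hψφ]
    simp only [φ₁, Category.assoc, ε.hom_inv_id_app_assoc]
    exact (Category.assoc _ _ _).trans
      ((congrArg (φ ≫ ·) (ε.hom_inv_id_app Y)).trans (Category.comp_id _))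

end HomotopyExtension

end HomotopyExtension

/-! ### The transpose of a homotopical opfibration -/

section TransposeFibration

variable {C : Type u₁} [Category.{v₁} C] {E : Type u₂} [Category.{v₂} E] {p : E ⥤ C}

/-- Two arrows over the same arrow of the base are equal if their composites with an opCartesian
arrow are: as opCartesian arrows compose, both are determined by their composite with it. -/
theorem IsOpfibration.cancel [IsOpfibration p] {R S T : C} {f : R ⟶ S} {g : S ⟶ T} {a b c : E}
    {φ : a ⟶ b} (hφ : p.IsCocartesian f φ) {s t : b ⟶ c} (hs : p.IsHomLift g s)
    (ht : p.IsHomLift g t) (h : φ ≫ s = φ ≫ t) : s = t := by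
  obtain ⟨y, ψ, hψ⟩ := IsOpfibration.exists_lift' p (isHomLift_codomain hφ.toIsHomLift) g
  have := IsOpfibration.comp f g φ ψ hφ hψ
  have e : Functor.IsCocartesian.map p g ψ s = Functor.IsCocartesian.map p g ψ t :=
    Functor.IsCocartesian.ext p (f ≫ g) (φ ≫ ψ) _ _ (by simpa using h)
  rw [← Functor.IsCocartesian.fac p g ψ s, e, Functor.IsCocartesian.fac]

theorem isStronglyCartesian_of_isHomLift {R S : C} {a b : E} {f : R ⟶ S} {φ : a ⟶ b}
    (h : p.IsHomLift f φ) (h' : p.IsStronglyCartesian (p.map φ) φ) : p.IsStronglyCartesian f φ := by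
  cases h; exact h'

theorem isCartesian_of_isHomLift {R S : C} {a b : E} {f : R ⟶ S} {φ : a ⟶ b}
    (h : p.IsHomLift f φ) (h' : p.IsCartesian (p.map φ) φ) : p.IsCartesian f φ := by
  cases h; exact h'

theorem isCartesian_map_of_isCartesian {R S : C} {a b : E} {f : R ⟶ S} {φ : a ⟶ b}
    (h : p.IsCartesian f φ) : p.IsCartesian (p.map φ) φ := by
  have := h.toIsHomLift
  cases this; exact h

theorem isCartesian_iso_comp {R S : C} {a' a b : E} {f : R ⟶ S} {φ : a ⟶ b}
    (hφ : p.IsCartesian f φ) (i : a' ≅ a) (hi : p.IsHomLift (𝟙 R) i.hom) :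
    p.IsCartesian f (i.hom ≫ φ) :=
  Functor.IsCartesian.of_iso_comp p f φ i

theorem isHomLift_of_vertical_comp {R S : C} {a b c : E} {f : R ⟶ S} {φ : a ⟶ b} {ψ : b ⟶ c}
    (h : p.IsHomLift (𝟙 R) φ) (h' : p.IsHomLift f (φ ≫ ψ)) : p.IsHomLift f ψ := by
  have e := IsHomLift.fac' p f (φ ≫ ψ)
  have e' := IsHomLift.fac' p (𝟙 R) φ
  refine IsHomLift.of_fac' p _ _ (isHomLift_codomain h) (isHomLift_codomain h') ?_
  rw [p.map_comp, e'] at e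
  simp only [Category.id_comp, eqToHom_trans] at e ⊢
  rw [eqToHom_comp_iff] at e
  simpa using e

namespace Transpose

variable [IsOpfibration p]

/-- The morphism `y ⟶ a` of the transpose fibration defined by an opCartesian arrow `a ⟶ y`. -/
def ofCocartesian {a y : E} (φ : a ⟶ y) (hφ : p.IsCocartesian (p.map φ) φ) :
    (⟨y⟩ : Transpose p) ⟶ ⟨a⟩ :=
  homMk (x := ⟨y⟩) (z := ⟨a⟩) ⟨y, 𝟙 y, φ, inferInstance, hφ⟩

theorem base_ofCocartesian {a y : E} (φ : a ⟶ y) (hφ : p.IsCocartesian (p.map φ) φ) :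
    base (ofCocartesian φ hφ) = p.map φ :=
  Category.comp_id _

/-- The composite of a cospan with the morphism defined by an opCartesian arrow `φ`: the opCartesian
leg is composed with `φ`. -/
theorem homMk_comp_ofCocartesian {x : Transpose p} {a y : E} (φ : a ⟶ y)
    (hφ : p.IsCocartesian (p.map φ) φ) (c : TransposeCospan p x.obj y) :
    homMk (x := x) (z := ⟨y⟩) c ≫ ofCocartesian φ hφ = homMk (x := x) (z := ⟨a⟩)
      ⟨c.mid, c.left, φ ≫ c.right, c.left_vertical,
        isCocartesian_map (IsOpfibration.comp _ _ _ _ hφ c.right_isCocartesian)⟩ :=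
  homMk_comp_homMk (y := ⟨y⟩) (k := c.right) (e := 𝟙 c.mid)
    ⟨c.right_isCocartesian, IsHomLift.id c.obj_mid,
      (Category.comp_id _).trans (Category.id_comp _).symm, (Category.comp_id _).symm, rfl⟩

theorem exists_cocartesian_factor {x a y : E} {φ : a ⟶ y} (hφ : p.IsCocartesian (p.map φ) φ)
    (c : TransposeCospan p x a) (v : p.obj y ⟶ p.obj x) (hc : c.base = p.map φ ≫ v) :
    ∃ t : y ⟶ c.mid, p.IsCocartesian v t ∧ φ ≫ t = c.right := by
  obtain ⟨m, t, ht⟩ := IsOpfibration.exists_lift y v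
  have h₁ := IsOpfibration.comp _ _ _ _ hφ ht
  have h₂ := c.right_isCocartesian
  rw [hc] at h₂
  let i := Functor.IsCocartesian.codomainUniqueUpToIso p (p.map φ ≫ v) (φ ≫ t) c.right
  have hi : (φ ≫ t) ≫ i.hom = c.right := by
    simp [i, Functor.IsCocartesian.codomainUniqueUpToIso, -Category.assoc]
  have hi' : p.IsHomLift (𝟙 (p.obj x)) i.hom := by
    simp only [i, Functor.IsCocartesian.codomainUniqueUpToIso]
    infer_instance
  exact ⟨t ≫ i.hom, Functor.IsCocartesian.of_comp_iso p v t i,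
    (Category.assoc _ _ _).symm.trans hi⟩

/-- OpCartesian arrows are strongly Cartesian arrows of the transpose fibration. -/
theorem isStronglyCartesian_ofCocartesian {a y : E} (φ : a ⟶ y)
    (hφ : p.IsCocartesian (p.map φ) φ) :
    (proj p).IsStronglyCartesian ((proj p).map (ofCocartesian φ hφ)) (ofCocartesian φ hφ) where
  universal_property' := by
    intro x g ψ hψ
    obtain ⟨c, rfl⟩ := homMk_surj ψ
    let v : p.obj y ⟶ p.obj x.obj := g.unop
    have hc : c.base = p.map φ ≫ v := by
      have e := isHomLift_unique hψ (IsHomLift.map (proj p) (homMk c))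
      refine (congrArg Quiver.Hom.unop e).symm.trans ?_
      exact congrArg (· ≫ v) (base_ofCocartesian φ hφ)
    obtain ⟨t, ht, hi⟩ := exists_cocartesian_factor hφ c v hc
    let d : TransposeCospan p x.obj y := ⟨c.mid, c.left, t, c.left_vertical, isCocartesian_map ht⟩
    have hd : d.base = v := isHomLift_unique d.right_isHomLift ht.toIsHomLift
    refine ⟨homMk (x := x) (z := ⟨y⟩) d, ⟨?_, ?_⟩, ?_⟩
    · have := IsHomLift.map (proj p) (homMk (x := x) (z := ⟨y⟩) d)
      rwa [show (proj p).map (homMk (x := x) (z := ⟨y⟩) d) = g from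
        congrArg Quiver.Hom.op hd] at this
    · exact (homMk_comp_ofCocartesian φ hφ d).trans ((homMk_eq_iff (x := x) (z := ⟨a⟩) _ c).2
        ⟨Iso.refl _, Category.comp_id _, (Category.comp_id _).trans hi⟩)
    · rintro θ ⟨hθ, hθ'⟩
      obtain ⟨d', rfl⟩ := homMk_surj θ
      have hd' : d'.base = v :=
        (congrArg Quiver.Hom.unop (isHomLift_unique hθ
          (IsHomLift.map (proj p) (homMk (x := x) (z := ⟨y⟩) d')))).symm
      obtain ⟨j, hj, hj'⟩ := (homMk_eq_iff (x := x) (z := ⟨a⟩) _ c).1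
        ((homMk_comp_ofCocartesian φ hφ d').symm.trans hθ')
      refine (homMk_eq_iff (x := x) (z := ⟨y⟩) d' d).2 ⟨j, hj, ?_⟩
      have hv : p.IsHomLift (𝟙 (p.obj x.obj)) j.hom := vertical_of_comp d'.left_vertical (hj ▸ c.left_vertical)
      have hs : p.IsHomLift v d'.right := hd' ▸ d'.right_isHomLift
      exact IsOpfibration.cancel hφ (isHomLift_comp_vertical hs hv) ht.toIsHomLift
        (((Category.assoc _ _ _).symm.trans hj').trans hi.symm)

theorem isHomLift_ofCocartesian {a y : E} {c d : C} {u : c ⟶ d} (φ : a ⟶ y)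
    (hφ : p.IsCocartesian u φ) :
    (proj p).IsHomLift u.op (ofCocartesian φ (isCocartesian_map hφ)) := by
  have h := hφ.toIsHomLift
  refine proj_isHomLift_iff.2 ⟨isHomLift_codomain h, isHomLift_domain h, ?_⟩
  exact (base_ofCocartesian φ _).trans (IsHomLift.fac' p u φ)

theorem isStronglyCartesian_ofCocartesian' {a y : E} {c d : C} {u : c ⟶ d} (φ : a ⟶ y)
    (hφ : p.IsCocartesian u φ) :
    (proj p).IsStronglyCartesian u.op (ofCocartesian φ (isCocartesian_map hφ)) :=
  isStronglyCartesian_of_isHomLift (isHomLift_ofCocartesian φ hφ)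
    (isStronglyCartesian_ofCocartesian φ (isCocartesian_map hφ))

theorem isCartesian_ofCocartesian {a y : E} {c d : C} {u : c ⟶ d} (φ : a ⟶ y)
    (hφ : p.IsCocartesian u φ) :
    (proj p).IsCartesian u.op (ofCocartesian φ (isCocartesian_map hφ)) :=
  have := isStronglyCartesian_ofCocartesian' φ hφ
  inferInstance

instance isFibered : (proj p).IsFibered :=
  Functor.IsFibered.of_exists_isStronglyCartesian (fun a R f => by
    obtain ⟨y, φ, hφ⟩ := IsOpfibration.exists_lift a.obj f.unop
    exact ⟨⟨y⟩, ofCocartesian φ (isCocartesian_map hφ),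
      isStronglyCartesian_ofCocartesian' φ hφ⟩)

theorem isHomLift_ofVertical {c : C} {x z : E} {f : x ⟶ z} (hf : p.IsHomLift (𝟙 (p.obj x)) f)
    (hx : p.obj x = c) : (proj p).IsHomLift (𝟙 (op c)) (ofVertical f hf) := by
  subst hx
  have h := (TransposeCospan.ofVertical f hf).right_isHomLift
  refine proj_isHomLift_iff (f := 𝟙 (p.obj x)).2 ⟨rfl, isHomLift_codomain hf, ?_⟩
  refine (base_homMk (x := ⟨x⟩) (z := ⟨z⟩) (TransposeCospan.ofVertical f hf)).trans ?_
  simp [TransposeCospan.base, TransposeCospan.ofVertical]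

theorem isHomLift_of_weq {W : MorphismProperty E} {x z : Transpose p} {φ : x ⟶ z}
    (hφ : weq W φ) : (proj p).IsHomLift (𝟙 ((proj p).obj x)) φ := by
  obtain ⟨f, hf, -, rfl⟩ := hφ
  exact isHomLift_ofVertical hf rfl

/-- Fibrewise arrows commute with opCartesian arrows in the transpose if they do so in the original
category. -/
theorem ofVertical_comp_ofCocartesian {x y a b : E} {f : x ⟶ y}
    (hf : p.IsHomLift (𝟙 (p.obj x)) f) {g : a ⟶ b} (hg : p.IsHomLift (𝟙 (p.obj a)) g)
    {φ : x ⟶ a} {ψ : y ⟶ b} {c d : C} {u : c ⟶ d} (hφ : p.IsCocartesian u φ)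
    (hψ : p.IsCocartesian u ψ) (h : φ ≫ g = f ≫ ψ) :
    ofVertical g hg ≫ ofCocartesian ψ (isCocartesian_map hψ) =
      ofCocartesian φ (isCocartesian_map hφ) ≫ ofVertical f hf := by
  obtain rfl := isHomLift_domain hφ.toIsHomLift
  obtain rfl := isHomLift_codomain hφ.toIsHomLift
  have e : u = p.map φ := isHomLift_unique hφ.toIsHomLift (IsHomLift.map p φ)
  let r : TransposeCospan p a y := ⟨b, g, ψ, hg, isCocartesian_map hψ⟩
  refine (homMk_comp_ofCocartesian (x := ⟨a⟩) ψ _ (TransposeCospan.ofVertical g hg)).trans ?_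
  refine Eq.trans (b := homMk (x := ⟨a⟩) (z := ⟨y⟩) r) ((homMk_eq_iff _ _).2 ⟨Iso.refl _,
    Category.comp_id _, (Category.comp_id _).trans (Category.comp_id _)⟩) ?_
  refine (homMk_comp_homMk (x := ⟨a⟩) (y := ⟨x⟩) (z := ⟨y⟩) (r := r) (k := ψ) (e := g)
    ⟨?_, hg, h, (Category.id_comp g).symm, (Category.id_comp ψ).symm⟩).symm
  exact (congrArg (fun t => p.IsCocartesian t ψ) ((Category.comp_id (p.map φ)).trans e.symm)).mpr hψ

end Transpose

end TransposeFibration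

section HomotopicalOpfibration

variable {C : Type u} [SmallCategory.{u} C] {E : Type w} [Category.{v} E] {p : E ⥤ C}
  [IsOpfibration p] (H : HomotopicalDeltaOpfibration.{u} p)

namespace HomotopicalDeltaOpfibration

theorem weq_comp {b : Cᵒᵖ} {x y z : Transpose p} {f : x ⟶ y} {g : y ⟶ z}
    (hf : (Transpose.proj p).IsHomLift (𝟙 b) f) (hg : (Transpose.proj p).IsHomLift (𝟙 b) g)
    (hf' : Transpose.weq H.weq f) (hg' : Transpose.weq H.weq g) :
    Transpose.weq H.weq (f ≫ g) :=
  (H.fiber b.unop).homotopical.comp (x := ⟨x, isHomLift_domain hf⟩)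
    (y := ⟨y, isHomLift_codomain hf⟩) (z := ⟨z, isHomLift_codomain hg⟩) ⟨f, hf⟩ ⟨g, hg⟩ hf' hg'

theorem weq_of_iso {b : Cᵒᵖ} {x y : Transpose p} (i : x ≅ y)
    (hi : (Transpose.proj p).IsHomLift (𝟙 b) i.hom) : Transpose.weq H.weq i.hom := by
  let x' : (Transpose.proj p).Fiber b := ⟨x, isHomLift_domain hi⟩
  let y' : (Transpose.proj p).Fiber b := ⟨y, isHomLift_codomain hi⟩
  let f : x' ⟶ y' := ⟨i.hom, hi⟩
  have : IsIso f := ⟨⟨i.inv, IsHomLift.lift_id_inv _ b i⟩, Subtype.ext i.hom_inv_id,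
    Subtype.ext i.inv_hom_id⟩
  exact (H.fiber b.unop).homotopical.of_isIso f this

/-- Every Cartesian arrow of the transpose is isomorphic to an opCartesian arrow, so that the
stability of the weak equivalences under pushforward is their stability under reindexing. -/
theorem isStableUnderReindexing :
    IsStableUnderReindexing (Transpose.proj p) (Transpose.weq H.weq) := by
  rintro b b' u x y x' y' κ κ' f f' hκ hκ' hf' h ⟨f₀, hf₀, hW, rfl⟩
  have hx : p.obj x.obj = b.unop := congrArg unop (isHomLift_codomain hκ.toIsHomLift)
  have hy : p.obj y.obj = b.unop := congrArg unop (isHomLift_codomain hκ'.toIsHomLift)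
  obtain ⟨a, φ, hφ⟩ := IsOpfibration.exists_lift' p hx u.unop
  obtain ⟨a', φ', hφ'⟩ := IsOpfibration.exists_lift' p hy u.unop
  have hv : p.IsHomLift (𝟙 b.unop) f₀ := hx ▸ hf₀
  have := isHomLift_vertical_comp hv hφ'.toIsHomLift
  let g := Functor.IsCocartesian.map p u.unop φ (f₀ ≫ φ')
  have hg : p.IsHomLift (𝟙 b'.unop) g := inferInstance
  have hφg : φ ≫ g = f₀ ≫ φ' := Functor.IsCocartesian.fac p u.unop φ (f₀ ≫ φ')
  have hgW : H.weq g := H.isHomotopical.pushforward u.unop hφ hφ' hg hφg hW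
  have ha : p.obj a = b'.unop := isHomLift_codomain hφ.toIsHomLift
  have hg' : p.IsHomLift (𝟙 (p.obj a)) g := ha ▸ hg
  let κ₀ := Transpose.ofCocartesian φ (isCocartesian_map hφ)
  let κ₀' := Transpose.ofCocartesian φ' (isCocartesian_map hφ')
  have hκ₀ : (Transpose.proj p).IsCartesian u κ₀ := Transpose.isCartesian_ofCocartesian φ hφ
  have hκ₀' : (Transpose.proj p).IsCartesian u κ₀' := Transpose.isCartesian_ofCocartesian φ' hφ'
  let s := Functor.IsCartesian.domainUniqueUpToIso (Transpose.proj p) u κ₀ κ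
  let t := Functor.IsCartesian.domainUniqueUpToIso (Transpose.proj p) u κ₀' κ'
  have hs : s.hom ≫ κ₀ = κ := Functor.IsCartesian.fac (Transpose.proj p) u κ₀ κ
  have ht : t.hom ≫ κ₀' = κ' := Functor.IsCartesian.fac (Transpose.proj p) u κ₀' κ'
  have hs' : (Transpose.proj p).IsHomLift (𝟙 b') s.hom := inferInstance
  have ht' : (Transpose.proj p).IsHomLift (𝟙 b') t.hom := inferInstance
  have ht'' : (Transpose.proj p).IsHomLift (𝟙 b') t.inv := inferInstance
  have hG : (Transpose.proj p).IsHomLift (𝟙 b') (Transpose.ofVertical g hg') :=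
    Transpose.isHomLift_ofVertical hg' ha
  have e₀ : Transpose.ofVertical g hg' ≫ κ₀' = κ₀ ≫ Transpose.ofVertical f₀ hf₀ :=
    Transpose.ofVertical_comp_ofCocartesian hf₀ hg' hφ hφ' hφg
  have hl : (Transpose.proj p).IsHomLift (𝟙 b') (f' ≫ t.hom) := isHomLift_vertical_comp hf' ht'
  have hr : (Transpose.proj p).IsHomLift (𝟙 b') (s.hom ≫ Transpose.ofVertical g hg') :=
    isHomLift_vertical_comp hs' hG
  have e : f' ≫ t.hom = s.hom ≫ Transpose.ofVertical g hg' := by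
    refine Functor.IsCartesian.ext (Transpose.proj p) u κ₀' _ _ ?_
    rw [Category.assoc, Category.assoc, ht, h, e₀, reassoc_of% hs]
  have e' : f' = (s.hom ≫ Transpose.ofVertical g hg') ≫ t.inv := by
    rw [← e, Category.assoc, t.hom_inv_id, Category.comp_id]
  rw [e']
  exact H.weq_comp hr ht'' (H.weq_comp hs' hG (H.weq_of_iso s hs') ⟨g, hg', hgW, rfl⟩)
    (H.weq_of_iso t.symm ht'')

theorem isHomotopicalFibration : IsHomotopicalFibration.{u} H.delta (Transpose.weq H.weq) where
  fiber b := H.fiber b.unop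
  stable := H.isStableUnderReindexing

end HomotopicalDeltaOpfibration

namespace Transpose

theorem isWeaklyCartesian_iff {W : MorphismProperty E} {b b' : Cᵒᵖ} {u : b' ⟶ b}
    {x y : Transpose p} {φ : x ⟶ y} (hφ : (proj p).IsHomLift u φ) :
    IsWeaklyCartesian W φ ↔ IsWeaklyCartesianOver (proj p) (weq W) u φ := by
  constructor
  · rintro ⟨z, f, κ, hf, hκ, rfl⟩
    have hf' := isHomLift_of_weq hf
    obtain rfl := isHomLift_domain hφ
    obtain rfl := isHomLift_codomain hφ
    exact ⟨z, f, κ, hf, hf', isCartesian_of_isHomLift (isHomLift_of_vertical_comp hf' hφ) hκ, rfl⟩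
  · rintro ⟨z, f, κ, hf, -, hκ, rfl⟩
    exact ⟨z, f, κ, hf, isCartesian_map_of_isCartesian hκ, rfl⟩

end Transpose

end HomotopicalOpfibration

/-! ### Sections of the pulled back opfibration -/

section PullbackComparison

variable {C : Type u₁} [Category.{v₁} C] {E : Type u₂} [Category.{v₂} E]
  {D : Type u₃} [Category.{v₃} D] {F : D ⥤ C} {p : E ⥤ C} [IsOpfibration p]

namespace Pullback

theorem isHomLift_transposeToTotal {R S : D} {u : S ⟶ R} {X Z : Transpose (proj F p)} {φ : X ⟶ Z}
    (h : (Transpose.proj (proj F p)).IsHomLift u.op φ) :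
    (Transpose.proj p).IsHomLift (F.map u).op ((transposeToTotal F p).map φ) := by
  obtain ⟨hX, hZ, hφ⟩ := Transpose.proj_isHomLift_iff.1 h
  have hX : X.obj.base = R := hX
  have hZ : Z.obj.base = S := hZ
  subst hX hZ
  have hφ : Transpose.base φ = u := hφ.trans ((Category.id_comp _).trans (Category.comp_id _))
  exact Transpose.proj_isHomLift_iff.2 ⟨X.obj.w, Z.obj.w,
    (base_map φ).trans (congrArg (fun t => eqToHom Z.obj.w ≫ F.map t ≫ eqToHom X.obj.w.symm) hφ)⟩

theorem exists_transposeLift {R S : D} {u : S ⟶ R} {X Z : Transpose (proj F p)}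
    (hX : X.obj.base = R) (hZ : Z.obj.base = S)
    {ψ : (transposeToTotal F p).obj X ⟶ (transposeToTotal F p).obj Z}
    (h : (Transpose.proj p).IsHomLift (F.map u).op ψ) :
    ∃ φ : X ⟶ Z, (Transpose.proj (proj F p)).IsHomLift u.op φ ∧
      (transposeToTotal F p).map φ = ψ := by
  subst hX hZ
  obtain ⟨_, _, hψ⟩ := Transpose.proj_isHomLift_iff.1 h
  refine ⟨transposeLift (X := X.obj) (Z := Z.obj) u ψ hψ, ?_, map_transposeLift _ _ _⟩
  refine Transpose.proj_isHomLift_iff.2 ⟨rfl, rfl, (base_transposeLift _ _ _).trans ?_⟩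
  exact ((Category.id_comp _).trans (Category.comp_id _)).symm

theorem transpose_hom_ext_of_isHomLift {R S : D} {u : S ⟶ R} {X Z : Transpose (proj F p)}
    {φ φ' : X ⟶ Z} (h : (Transpose.proj (proj F p)).IsHomLift u.op φ)
    (h' : (Transpose.proj (proj F p)).IsHomLift u.op φ')
    (e : (transposeToTotal F p).map φ = (transposeToTotal F p).map φ') : φ = φ' := by
  obtain ⟨_, _, hφ⟩ := Transpose.proj_isHomLift_iff.1 h
  obtain ⟨_, _, hφ'⟩ := Transpose.proj_isHomLift_iff.1 h'
  exact transpose_hom_ext (hφ.trans hφ'.symm) e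

theorem weq_map {W : MorphismProperty E} {X Z : Transpose (proj F p)} {φ : X ⟶ Z}
    (hφ : Transpose.weq (weq F p W) φ) : Transpose.weq W ((transposeToTotal F p).map φ) := by
  obtain ⟨f, hf, hW, rfl⟩ := hφ
  have h := fib_isHomLift hf
  rw [F.map_id] at h
  exact ⟨f.fib, (cospanToTotal (TransposeCospan.ofVertical f hf)).left_vertical, hW.2, rfl⟩

theorem transposeLift_map {X Z : Transpose (proj F p)} (φ : X ⟶ Z) :
    transposeLift (X := X.obj) (Z := Z.obj) (Transpose.base φ) ((transposeToTotal F p).map φ)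
      (base_map φ) = φ :=
  transposeLift_eq rfl rfl

theorem weq_of_map {W : MorphismProperty E} {X Z : Transpose (proj F p)} {φ : X ⟶ Z} {d : Dᵒᵖ}
    (hφ : (Transpose.proj (proj F p)).IsHomLift (𝟙 d) φ)
    (h : Transpose.weq W ((transposeToTotal F p).map φ)) : Transpose.weq (weq F p W) φ := by
  obtain ⟨hX, hZ, e⟩ := Transpose.proj_isHomLift_iff (f := 𝟙 d.unop).1 hφ
  have e : Transpose.base φ = eqToHom (hZ.trans hX.symm) := e.trans (eqToHom_id_eqToHom _ _)
  exact transposeLift_map φ ▸ weq_transposeLift W (X := X.obj) (Z := Z.obj) (Transpose.base φ) _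
    (base_map φ) (hX.trans hZ.symm) e h

theorem isWeaklyCartesian_of_map {W : MorphismProperty E} {X Z : Transpose (proj F p)} {φ : X ⟶ Z}
    (h : Transpose.IsWeaklyCartesian W ((transposeToTotal F p).map φ)) :
    Transpose.IsWeaklyCartesian (weq F p W) φ := by
  exact transposeLift_map φ ▸ isWeaklyCartesian_transposeLift W (X := X.obj) (Z := Z.obj)
    (Transpose.base φ) _ (base_map φ) h

/-- A Cartesian arrow of the transpose of the pullback is isomorphic to a lift of a Cartesian arrow
of the transpose, so its image is Cartesian. -/
theorem isCartesian_map {Y Z : Transpose (proj F p)} {κ : Y ⟶ Z}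
    (hκ : (Transpose.proj (proj F p)).IsCartesian ((Transpose.proj (proj F p)).map κ) κ) :
    (Transpose.proj p).IsCartesian (F.map (Transpose.base κ)).op
      ((transposeToTotal F p).map κ) := by
  let Z₀ : Transpose p := (transposeToTotal F p).obj Z
  have hZ : (Transpose.proj p).obj Z₀ = op (F.obj Z.obj.base) := congrArg op Z.obj.w
  obtain ⟨y, κ₁, hκ₁⟩ := IsPreFibered.exists_isCartesian (Transpose.proj p) hZ
    (F.map (Transpose.base κ)).op
  have hy : p.obj y.obj = F.obj Y.obj.base := congrArg unop (isHomLift_domain hκ₁.toIsHomLift)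
  let Y' : Pullback F p := ⟨Y.obj.base, y.obj, hy⟩
  have hb := (Transpose.proj_isHomLift_iff.1 hκ₁.toIsHomLift).choose_spec.choose_spec
  have hκ₁' : (Transpose.proj p).IsCartesian ((Transpose.proj p).map κ₁) κ₁ := by
    have := hκ₁.toIsHomLift
    exact isCartesian_map_of_isCartesian hκ₁
  let κ' := transposeLift (X := Y') (Z := Z.obj) (Transpose.base κ) κ₁ hb
  have hκ' : (Transpose.proj (proj F p)).IsCartesian ((Transpose.proj (proj F p)).map κ') κ' :=
    transposeLift_isCartesian _ _ hb hκ₁'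
  have hb' : Transpose.base κ' = Transpose.base κ := base_transposeLift _ _ _
  have hκ'' : (Transpose.proj (proj F p)).IsCartesian ((Transpose.proj (proj F p)).map κ) κ' :=
    (congrArg (fun t : Z.obj.base ⟶ Y.obj.base =>
      (Transpose.proj (proj F p)).IsCartesian (R := op Y.obj.base) (S := op Z.obj.base) t.op κ')
      hb').mp hκ'
  let i := Functor.IsCartesian.domainUniqueUpToIso (Transpose.proj (proj F p))
    ((Transpose.proj (proj F p)).map κ) κ' κ
  have hi : i.hom ≫ κ' = κ :=
    Functor.IsCartesian.fac _ ((Transpose.proj (proj F p)).map κ) κ' κ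
  have hi' : (Transpose.proj (proj F p)).IsHomLift (𝟙 Y.obj.base).op i.hom :=
    Functor.IsCartesian.map_isHomLift _ ((Transpose.proj (proj F p)).map κ) κ' κ
  have hj := isHomLift_transposeToTotal hi'
  let j := (transposeToTotal F p).mapIso i
  have hj' : (Transpose.proj p).IsHomLift (𝟙 (op (F.obj Y.obj.base))) j.hom := by
    rw [F.map_id] at hj
    exact hj
  have e : j.hom ≫ κ₁ = (transposeToTotal F p).map κ := by
    refine Eq.trans ?_ (congrArg (transposeToTotal F p).map hi)
    refine Eq.trans ?_ ((transposeToTotal F p).map_comp _ _).symm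
    exact congrArg (j.hom ≫ ·) (map_transposeLift (X := Y') (Z := Z.obj) _ κ₁ hb).symm
  rw [← e]
  exact isCartesian_iso_comp hκ₁ j hj'

theorem isWeaklyCartesian_map {W : MorphismProperty E} {X Z : Transpose (proj F p)} {φ : X ⟶ Z}
    (h : Transpose.IsWeaklyCartesian (weq F p W) φ) :
    Transpose.IsWeaklyCartesian W ((transposeToTotal F p).map φ) := by
  obtain ⟨Y, f, κ, hf, hκ, rfl⟩ := h
  exact ⟨_, _, _, weq_map hf, isCartesian_map_of_isCartesian (isCartesian_map hκ),
    ((transposeToTotal F p).map_comp f κ).symm⟩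

end Pullback

namespace PSect

variable (F p)

/-- Presections of the pulled back opfibration, seen as sections of the original transpose
fibration over the simplicial replacement of `D`. -/
noncomputable def toSect : PSect (Pullback.proj F p) ⥤
    Sect (SimplicialReplacement.map F ⋙ tail C) (Transpose.proj p) where
  obj B := Sect.ofLifts (fun d => (Pullback.transposeToTotal F p).obj (B.functor.obj d))
    (fun d => congrArg op ((B.functor.obj d).obj.w.trans
      (congrArg F.obj (congrArg unop (B.obj_eq d)))))
    (fun f => (Pullback.transposeToTotal F p).map (B.functor.map f))
    (fun f => by
      have h := Pullback.isHomLift_transposeToTotal (B.isHomLift f)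
      rw [← tail_map] at h
      exact h)
    (fun d => by rw [CategoryTheory.Functor.map_id, CategoryTheory.Functor.map_id])
    (fun f g => by rw [Functor.map_comp, Functor.map_comp])
  map φ :=
    { natTrans := Functor.whiskerRight φ.natTrans (Pullback.transposeToTotal F p)
      vertical := fun d => by
        have h := Pullback.isHomLift_transposeToTotal (u := 𝟙 d.last) (φ.vertical d)
        rw [F.map_id] at h
        exact h }
  map_id B := Sect.hom_ext (fun d => (Pullback.transposeToTotal F p).map_id _)
  map_comp φ ψ := Sect.hom_ext (fun d => (Pullback.transposeToTotal F p).map_comp _ _)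

instance faithful_toSect : (toSect F p).Faithful where
  map_injective {_ _} φ ψ h := Sect.hom_ext (fun d =>
    Pullback.transpose_hom_ext_of_isHomLift (u := 𝟙 d.last) (φ.vertical d) (ψ.vertical d)
      (congrArg (fun t => t.natTrans.app d) h))

instance full_toSect : (toSect F p).Full where
  map_surjective {A B} ψ := by
    have H : ∀ d, ∃ φ : A.functor.obj d ⟶ B.functor.obj d,
        (Transpose.proj (Pullback.proj F p)).IsHomLift (𝟙 d.last).op φ ∧
          (Pullback.transposeToTotal F p).map φ = ψ.natTrans.app d := fun d =>
      Pullback.exists_transposeLift (congrArg unop (A.obj_eq d)) (congrArg unop (B.obj_eq d))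
        ((congrArg (fun t : F.obj d.last ⟶ F.obj d.last => (Transpose.proj p).IsHomLift
          (R := op (F.obj d.last)) (S := op (F.obj d.last)) t.op (ψ.natTrans.app d))
            (F.map_id d.last)).mpr (ψ.vertical d))
    choose φ hφ hφ' using H
    refine ⟨⟨{ app := φ, naturality := fun d d' f => ?_ }, fun d => hφ d⟩,
      Sect.hom_ext (fun d => hφ' d)⟩
    refine Pullback.transpose_hom_ext_of_isHomLift (u := SimplicialReplacement.lastMap f)
      (isHomLift_comp_vertical (A.isHomLift f) (hφ d'))
      (isHomLift_vertical_comp (hφ d) (B.isHomLift f)) ?_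
    rw [Functor.map_comp, Functor.map_comp, hφ', hφ']
    exact ψ.natTrans.naturality f

theorem exists_toSect_obj_eq (A : Sect (SimplicialReplacement.map F ⋙ tail C) (Transpose.proj p)) :
    ∃ B, (toSect F p).obj B = A := by
  let X : SimplicialReplacement D → Transpose (Pullback.proj F p) := fun d =>
    ⟨⟨d.last, (A.functor.obj d).obj, congrArg unop (A.obj_eq d)⟩⟩
  have H : ∀ {d d' : SimplicialReplacement D} (f : d ⟶ d'), ∃ φ : X d ⟶ X d',
      (Transpose.proj (Pullback.proj F p)).IsHomLift (SimplicialReplacement.lastMap f).op φ ∧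
        (Pullback.transposeToTotal F p).map φ = A.functor.map f := fun {d d'} f =>
    Pullback.exists_transposeLift rfl rfl (by
      rw [← tail_map]
      exact A.isHomLift f)
  choose φ hφ hφ' using @H
  refine ⟨Sect.ofLifts X (fun d => rfl) φ hφ (fun d => ?_) (fun {d d' d''} f g => ?_), ?_⟩
  · refine Pullback.transpose_hom_ext_of_isHomLift (hφ _) ?_ ?_
    · rw [SimplicialReplacement.lastMap_id]
      exact IsHomLift.id (p := Transpose.proj (Pullback.proj F p)) (R := op d.last) rfl
    · rw [hφ', CategoryTheory.Functor.map_id, CategoryTheory.Functor.map_id]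
      rfl
  · refine Pullback.transpose_hom_ext_of_isHomLift (hφ _) ?_ ?_
    · rw [SimplicialReplacement.lastMap_comp]
      exact isHomLift_comp (hφ f) (hφ g)
    · rw [hφ', Functor.map_comp, Functor.map_comp, hφ', hφ']
      rfl
  · obtain ⟨G, hG⟩ := A
    have : ∀ {G' : SimplicialReplacement D ⥤ Transpose p} (h : G' ⋙ Transpose.proj p = _),
        G' = G → (⟨G', h⟩ : Sect (SimplicialReplacement.map F ⋙ tail C) (Transpose.proj p)) =
          ⟨G, hG⟩ := by
      rintro _ _ rfl
      rfl
    exact this _ (CategoryTheory.Functor.hext (fun _ => rfl) (fun _ _ f => heq_of_eq (hφ' f)))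

/-- The pullback of presections is restriction of sections along `F`. -/
noncomputable def pullbackCompToSect : pullbackFunctor F ⋙ toSect F p ≅
    Sect.precompFunctor (SimplicialReplacement.map F) rfl :=
  NatIso.ofComponents
    (fun A =>
      { hom := ⟨{ app := fun _ => 𝟙 _
                  naturality := fun _ _ f => (Category.comp_id _).trans
                    ((A.map_pullbackMap F f).trans (Category.id_comp _).symm) },
          fun _ => IsHomLift.id (A.obj_eq _)⟩
        inv := ⟨{ app := fun _ => 𝟙 _
                  naturality := fun _ _ f => (Category.comp_id _).trans
                    ((A.map_pullbackMap F f).symm.trans (Category.id_comp _).symm) },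
          fun _ => IsHomLift.id (A.obj_eq _)⟩
        hom_inv_id := Sect.hom_ext (fun _ => Category.comp_id _)
        inv_hom_id := Sect.hom_ext (fun _ => Category.comp_id _) })
    (fun φ => Sect.hom_ext (fun d => (Category.comp_id _).trans
      ((map_pullbackApp F φ d).trans (Category.id_comp _).symm)))

end PSect

end PullbackComparison

/-! ### Pullback of derived sections along resolutions -/

section Resolutions

namespace Sect

variable {C : Type u₁} [Category.{v₁} C] {B : Type u₂} [Category.{v₂} B] {X : Type u₃}
  [Category.{v₃} X]

/-- Sections over a simplicial replacement which send anchor maps to weakly Cartesian morphisms. -/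
def isDerived (k : SimplicialReplacement C ⥤ B) (q : X ⥤ B) (W : MorphismProperty X) :
    ObjectProperty (Sect k q) := fun A =>
  ∀ ⦃x y : SimplicialReplacement C⦄ (f : x ⟶ y), IsAnchor f →
    IsWeaklyCartesianOver q W (k.map f) (A.functor.map f)

theorem isDerived_iff_of_weq {q : X ⥤ B} [q.IsFibered] {T : FibredDeltaStructure q}
    {W : MorphismProperty X} (hT : IsHomotopicalFibration.{u} T W)
    {k : SimplicialReplacement C ⥤ B} {A A' : Sect k q} (φ : A ⟶ A') (hφ : Sect.weq k q W φ) :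
    isDerived k q W A ↔ isDerived k q W A' := by
  have h : ∀ {x y : SimplicialReplacement C} (f : x ⟶ y),
      IsWeaklyCartesianOver q W (k.map f) (A.functor.map f) ↔
        IsWeaklyCartesianOver q W (k.map f) (A'.functor.map f) := fun {x y} f =>
    hT.isWeaklyCartesianOver_iff (A.isHomLift f) (A'.isHomLift f) (φ.vertical x) (φ.vertical y)
      (hφ x) (hφ y) (φ.natTrans.naturality f)
  exact ⟨fun hA x y f hf => (h f).1 (hA f hf), fun hA x y f hf => (h f).2 (hA f hf)⟩

end Sect

variable {C D : Type u} [SmallCategory.{u} C] [SmallCategory.{u} D] {E : Type w} [Category.{v} E]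
  {p : E ⥤ C} [IsOpfibration p] (H : HomotopicalDeltaOpfibration.{u} p) (F : D ⥤ C)

/-- For sections of the transpose fibration, being derived does not depend on the base arrow named
in the definition of weakly Cartesian morphisms. -/
theorem isDerivedSection_eq (W : MorphismProperty E) : IsDerivedSection p W =
    Sect.isDerived (tail C) (Transpose.proj p) (Transpose.weq W) := by
  ext A
  exact ⟨fun hA x y f hf => (Transpose.isWeaklyCartesian_iff (A.isHomLift f)).1 (hA f hf),
    fun hA x y f hf => (Transpose.isWeaklyCartesian_iff (A.isHomLift f)).2 (hA f hf)⟩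

namespace HomotopicalDeltaOpfibration

theorem hasColimits (H : HomotopicalDeltaOpfibration.{u} p) (b : Cᵒᵖ) :
    HasColimitsOfSize.{u, u} ((Transpose.proj p).Fiber b) :=
  (H.fiber b.unop).cocomplete

theorem hasColimits_zero (H : HomotopicalDeltaOpfibration.{u} p) (b : Cᵒᵖ) :
    HasColimitsOfSize.{0, 0} ((Transpose.proj p).Fiber b) :=
  have := H.hasColimits b
  hasColimitsOfSizeShrink.{0, 0, u, u} _

theorem hasElementsColimits (H : HomotopicalDeltaOpfibration.{u} p) (b : Cᵒᵖ) :
    HasColimitsOfSize.{0, u} ((Transpose.proj p).Fiber b) :=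
  have := H.hasColimits b
  hasColimitsOfSizeShrink.{0, u, u, u} _

theorem hasCoproducts (H : HomotopicalDeltaOpfibration.{u} p) (b : Cᵒᵖ) :
    HasCoproducts.{u} ((Transpose.proj p).Fiber b) :=
  have := H.hasColimits b
  fun _ => inferInstance

theorem preservesColimits (H : HomotopicalDeltaOpfibration.{u} p) (b : Cᵒᵖ)
    (n : SimplexCategory) :
    PreservesColimitsOfSize.{u, u} ((H.delta.fiber b).tensor.obj n) :=
  (H.fiber b.unop).tensor_preserves n

end HomotopicalDeltaOpfibration

/-- Extension along a resolution, for sections of the transpose fibration. -/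
noncomputable def homotopyExtension (hF : IsResolution F) :
    HomotopyExtension
      (Sect.precompFunctor (q := Transpose.proj p) (k := tail C) (SimplicialReplacement.map F) rfl)
      (Sect.weq _ _ (Transpose.weq H.weq)) (Sect.weq _ _ (Transpose.weq H.weq))
      (IsDerivedSection p H.weq) :=
  have := H.hasColimits_zero
  have := H.hasElementsColimits
  have := H.hasCoproducts
  have := H.preservesColimits
  let hk := dependsOnLast_tail C
  { E := Sect.extensionFunctor hk H.delta F
    S := Sect.resolutionFunctor hk H.delta F
    S' := Sect.resolutionFunctor (hk.comp_map F) H.delta (𝟭 D)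
    σ := Sect.resolutionAug hk H.delta F
    τ := Sect.resolutionToExtension hk H.delta F
    σ' := Sect.resolutionAug (hk.comp_map F) H.delta (𝟭 D)
    ν := Sect.resolutionToRestrict hk H.delta F
    change := Sect.resolutionChange hk H.delta F
    change_σ := Sect.resolutionChange_aug hk H.delta F
    change_τ := Sect.resolutionChange_extension hk H.delta F
    weq_σ := Sect.weq_resolutionAug hk H.delta F H.isHomotopicalFibration hF
    weq_σ' := Sect.weq_resolutionAug (hk.comp_map F) H.delta (𝟭 D) H.isHomotopicalFibration
      (isResolution_id D)
    weq_τ := fun A hA => Sect.weq_resolutionToExtension hk H.delta F H.isHomotopicalFibration A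
      ((isDerivedSection_eq (p := p) H.weq).le A hA)
    weq_E := fun φ hφ =>
      Sect.weq_extensionFunctor hk H.delta F H.isHomotopicalFibration φ hφ }

theorem isDerived_restrict {W : MorphismProperty E} (A : RSect p W) :
    Sect.isDerived (SimplicialReplacement.map F ⋙ tail C) (Transpose.proj p) (Transpose.weq W)
      ((Sect.precompFunctor (q := Transpose.proj p) (k := tail C) (SimplicialReplacement.map F)
        rfl).obj A.obj) := fun _ _ f hf =>
  (Transpose.isWeaklyCartesian_iff (p := p) (A.obj.isHomLift ((SimplicialReplacement.map F).map f))).1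
    (A.property ((SimplicialReplacement.map F).map f) hf)

/-- The weak equivalences of the derived sections over the simplicial replacement of `D` of the
transpose fibration of `p`. -/
abbrev restrictedWeq (F : D ⥤ C) (p : E ⥤ C) [IsOpfibration p] (W : MorphismProperty E) :
    MorphismProperty (Sect.isDerived (SimplicialReplacement.map F ⋙ tail C) (Transpose.proj p)
      (Transpose.weq W)).FullSubcategory :=
  (Sect.weq (SimplicialReplacement.map F ⋙ tail C) (Transpose.proj p)
    (Transpose.weq W)).inverseImage (Sect.isDerived (SimplicialReplacement.map F ⋙ tail C)
      (Transpose.proj p) (Transpose.weq W)).ι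

/-- Restriction of derived sections along `F`. -/
noncomputable abbrev restrictDerived (F : D ⥤ C) (p : E ⥤ C) [IsOpfibration p] (W : MorphismProperty E) :
    LocalizerMorphism (derivedWeq p W)
      (restrictedWeq F p W) :=
  HomotopyExtension.restrictLocalizer (R := Sect.precompFunctor (q := Transpose.proj p)
    (k := tail C) (SimplicialReplacement.map F) rfl) (W := presectionWeq p W)
    (isDerived_restrict F) (fun _ h _ => h _)

theorem full_and_faithful_restrictDerived (hF : IsResolution F) :
    ((restrictDerived F p H.weq).localizedFunctor (derivedWeq p H.weq).Q
      (restrictedWeq F p H.weq).Q).Full ∧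
    ((restrictDerived F p H.weq).localizedFunctor (derivedWeq p H.weq).Q
      (restrictedWeq F p H.weq).Q).Faithful := by
  have := H.hasColimits_zero
  have := H.hasElementsColimits
  have := H.hasCoproducts
  have := H.preservesColimits
  have hT := H.isHomotopicalFibration
  have i₁ : (Sect.weq (tail C) (Transpose.proj p) (Transpose.weq H.weq)).IsMultiplicative := Sect.weq_isMultiplicative hT.fiber
  have i₂ : (Sect.weq (tail C) (Transpose.proj p)
    (Transpose.weq H.weq)).HasTwoOutOfThreeProperty := Sect.weq_hasTwoOutOfThree hT.fiber
  have i₃ : (Sect.weq (SimplicialReplacement.map F ⋙ tail C) (Transpose.proj p)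
    (Transpose.weq H.weq)).IsMultiplicative := Sect.weq_isMultiplicative hT.fiber
  have i₄ : (Sect.weq (SimplicialReplacement.map F ⋙ tail C) (Transpose.proj p)
    (Transpose.weq H.weq)).HasTwoOutOfThreeProperty := Sect.weq_hasTwoOutOfThree hT.fiber
  have hP : ∀ {A A' : PSect p} (φ : A ⟶ A'), presectionWeq p H.weq φ →
      (IsDerivedSection p H.weq A ↔ IsDerivedSection p H.weq A') := fun φ hφ => by
    rw [isDerivedSection_eq]
    exact Sect.isDerived_iff_of_weq hT φ hφ
  exact ⟨(homotopyExtension H F hF).full hP (fun φ hφ => Sect.isDerived_iff_of_weq hT φ hφ)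
      (Sect.homotopyPushouts _ hT.fiber)
      (isDerived_restrict F) (fun _ h _ => h _),
    (homotopyExtension H F hF).faithful hP (Sect.homotopyPushouts _ hT.fiber)
      (isDerived_restrict F) (fun _ h _ => h _)⟩

/-- Derived sections of the pulled back opfibration, seen as derived sections of the original
transpose fibration over the simplicial replacement of `D`. -/
noncomputable def toDerived (F : D ⥤ C) (p : E ⥤ C) [IsOpfibration p] (W : MorphismProperty E) :
    LocalizerMorphism (derivedWeq (Pullback.proj F p) (Pullback.weq F p W))
      (restrictedWeq F p W) where
  functor := ObjectProperty.lift _ (ObjectProperty.ι _ ⋙ PSect.toSect F p) (fun A _ _ f hf =>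
    (Transpose.isWeaklyCartesian_iff (((PSect.toSect F p).obj A.obj).isHomLift f)).1
      (Pullback.isWeaklyCartesian_map (A.property f hf)))
  map _ _ _ hφ d := Pullback.weq_map (hφ d)

theorem isLocalizedEquivalence_toDerived (W : MorphismProperty E) :
    (toDerived F p W).IsLocalizedEquivalence := by
  have h₁ : (toDerived F p W).functor.Faithful :=
    Functor.Faithful.of_comp_iso (G := ObjectProperty.ι _)
      (H := ObjectProperty.ι _ ⋙ PSect.toSect F p) (Iso.refl _)
  have h₂ : (toDerived F p W).functor.Full :=
    Functor.Full.of_comp_faithful_iso (G := ObjectProperty.ι _)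
      (H := ObjectProperty.ι _ ⋙ PSect.toSect F p) (Iso.refl _)
  have h₃ : ∀ A, ∃ B, (toDerived F p W).functor.obj B = A := by
    rintro ⟨A, hA⟩
    obtain ⟨B, rfl⟩ := PSect.exists_toSect_obj_eq F p A
    exact ⟨⟨B, fun x y f hf => Pullback.isWeaklyCartesian_of_map
      ((Transpose.isWeaklyCartesian_iff (((PSect.toSect F p).obj B).isHomLift f)).2 (hA f hf))⟩, rfl⟩
  have h₄ : (toDerived F p W).functor.EssSurj :=
    ⟨fun A => ⟨(h₃ A).choose, ⟨eqToIso (h₃ A).choose_spec⟩⟩⟩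
  have h₅ : (toDerived F p W).functor.IsEquivalence := {}
  refine LocalizerMorphism.IsLocalizedEquivalence.of_equivalence _ (fun A A' f hf => ?_)
  obtain ⟨B, rfl⟩ := h₃ A
  obtain ⟨B', rfl⟩ := h₃ A'
  obtain ⟨g, rfl⟩ := (toDerived F p W).functor.map_surjective f
  exact MorphismProperty.map_mem_map _ _ _ (fun d => Pullback.weq_of_map (g.hom.vertical d) (hf d))

/-- The pullback of derived sections along `F` followed by the comparison is restriction along
`F`. -/
noncomputable def pullbackCompToDerived (W : MorphismProperty E) :
    (RSect.pullback F p W).functor ⋙ (toDerived F p W).functor ≅ (restrictDerived F p W).functor :=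
  ((ObjectProperty.fullyFaithfulι _).whiskeringRight _).preimageIso
    (Functor.isoWhiskerLeft (ObjectProperty.ι _) (PSect.pullbackCompToSect F p))

theorem HoRSect.full_and_faithful_pullback (hF : IsResolution F) :
    (HoRSect.pullback F p H.weq).Full ∧ (HoRSect.pullback F p H.weq).Faithful := by
  obtain ⟨hfull, hfaithful⟩ := full_and_faithful_restrictDerived H F hF
  have := isLocalizedEquivalence_toDerived (p := p) F H.weq
  -- Pullback followed by the faithful comparison functor `Θ` is restriction.
  let L := (derivedWeq p H.weq).Q
  let L' := (derivedWeq (Pullback.proj F p) (Pullback.weq F p H.weq)).Q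
  let G := (restrictDerived F p H.weq).localizedFunctor L (restrictedWeq F p H.weq).Q
  let Θ := (toDerived F p H.weq).localizedFunctor L' (restrictedWeq F p H.weq).Q
  have hΘ : Θ.Faithful := inferInstance
  let R := (RSect.pullback F p H.weq).localizedFunctor L L'
  let e : L ⋙ R ≅ (RSect.pullback F p H.weq).functor ⋙ L' :=
    (CatCommSq.iso (RSect.pullback F p H.weq).functor L L' (R)).symm
  let e' : L' ⋙ Θ ≅ (toDerived F p H.weq).functor ⋙ (restrictedWeq F p H.weq).Q :=
    (CatCommSq.iso (toDerived F p H.weq).functor L' (restrictedWeq F p H.weq).Q Θ).symm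
  let e'' : L ⋙ G ≅ (restrictDerived F p H.weq).functor ⋙ (restrictedWeq F p H.weq).Q :=
    (CatCommSq.iso (restrictDerived F p H.weq).functor L (restrictedWeq F p H.weq).Q G).symm
  let i : R ⋙ Θ ≅ G :=
    Localization.liftNatIso L (derivedWeq p H.weq) (L ⋙ R ⋙ Θ) (L ⋙ G)
      _ _ ((Functor.associator _ _ _).symm ≪≫ Functor.isoWhiskerRight e Θ ≪≫
        Functor.associator _ _ _ ≪≫ Functor.isoWhiskerLeft _ e' ≪≫
        (Functor.associator _ _ _).symm ≪≫
        Functor.isoWhiskerRight (pullbackCompToDerived F H.weq) _ ≪≫ e''.symm)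
  change R.Full ∧ R.Faithful
  exact ⟨Functor.Full.of_comp_faithful_iso i, Functor.Faithful.of_comp_iso i⟩

end Resolutions

end DerivedSections

theorem mainTheorem1 {C D : Type u} [SmallCategory.{u} C] [SmallCategory.{u} D]
    {E : Type w} [Category.{v} E] (p : E ⥤ C) [DerivedSections.IsOpfibration p]
    (H : DerivedSections.HomotopicalDeltaOpfibration.{u} p)
    (F : D ⥤ C) (hF : DerivedSections.IsResolution F) :
    (DerivedSections.HoRSect.pullback F p H.weq).Full ∧
      (DerivedSections.HoRSect.pullback F p H.weq).Faithful :=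
  DerivedSections.HoRSect.full_and_faithful_pullback H F hF
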